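/- **Conventions.** Knots are tame knots in $\mathbb R^3$ (represented by simple closed polygons, up to the usual elementary triangle moves). A diagram $D$ of a knot $K$ is a regular projection to the plane (finitely many multiple points, all of them transverse double points), together with over/under information, of a knot equivalent to $K$; $c(D)$ is its number of crossings. $D$ *has a bridge of length $l$* if some arc of $D$ passes consecutively through exactly $l$ crossing passes that are all overpasses or all underpasses. $D$ is *composite* if there is a simple closed curve in the plane that meets $D$ in exactly two points, transversely and away from the crossings, such that both components of its complement contain crossings of $D$; otherwise $D$ is *prime*. **Theorem.** Let $K$ be a knot and let $k,l\ge 0$ be integers. Let $D$ be a prime diagram of $K$ with $c(D)$ crossings and a bridge of length $l=c(D)-k$, and suppose that $c(D)\le c(D')$ for every diagram $D'$ of $K$ (prime or not) that has a bridge of length $c(D')-k$, with the same $k$. Then $$l\le\max(3,k-3),\qquad\text{and hence}\qquad c(D)\le k+\max(3,k-3).$$ -/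

import Mathlib

/-- The projection plane. -/
abbrev Plane : Type := ℝ × ℝ

/-- Three-space, written as plane times height: the knot is projected by `Prod.fst`,
and `Prod.snd` is the height above the plane. -/
abbrev Space : Type := Plane × ℝ

/-- A closed polygon with `n` edges. Its vertices are listed `n`-periodically along `ℤ`; the `i`-th
edge runs from `vertex i` to `vertex (i + 1)`. -/
structure ClosedPolygon (E : Type) where
  n : ℕ
  n_pos : 0 < n
  vertex : ℤ → E
  periodic : ∀ i : ℤ, vertex (i + n) = vertex i

namespace ClosedPolygon

variable {E : Type} [AddCommGroup E] [Module ℝ E]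

/-- The piecewise linear `n`-periodic parametrisation of the polygon: on `[i, i + 1]` it runs
affinely along the `i`-th edge. -/
noncomputable def path (P : ClosedPolygon E) (s : ℝ) : E :=
  AffineMap.lineMap (P.vertex ⌊s⌋) (P.vertex (⌊s⌋ + 1)) (Int.fract s)

/-- The set of points of the polygon. -/
def carrier (P : ClosedPolygon E) : Set E :=
  Set.range P.path

/-- The polygon has no self-intersections. -/
def IsSimple (P : ClosedPolygon E) : Prop :=
  Set.InjOn P.path (Set.Ico (0 : ℝ) (P.n : ℝ))

end ClosedPolygon

/-- A (tame) knot: a simple closed polygon in three-space. -/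
structure PolygonalKnot extends ClosedPolygon Space where
  simple : toClosedPolygon.IsSimple

/-- An elementary move of polygonal knots (viewed as subsets of space): the segment `AB` of the knot
is replaced by the two segments `AC` and `CB`, where the triangle `ABC` meets the knot in `AB`
only. -/
def DeltaMove (S S' : Set Space) : Prop :=
  (∃ K : PolygonalKnot, K.carrier = S) ∧ (∃ K' : PolygonalKnot, K'.carrier = S') ∧
    ∃ A B C : Space, AffineIndependent ℝ ![A, B, C] ∧
      convexHull ℝ {A, B, C} ∩ S = segment ℝ A B ∧
      S' = (S \ segment ℝ A B) ∪ (segment ℝ A C ∪ segment ℝ C B)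

/-- Equivalence of (unoriented) knots: finitely many elementary moves and their inverses lead
from one to the other. -/
def PolygonalKnot.Equivalent (K K' : PolygonalKnot) : Prop :=
  Relation.EqvGen DeltaMove K.carrier K'.carrier

namespace PolygonalKnot

/-- The crossings: the multiple points of the projection to the plane. -/
def crossings (K : PolygonalKnot) : Set Plane :=
  {x | ∃ s t : ℝ, K.path s ≠ K.path t ∧ (K.path s).1 = x ∧ (K.path t).1 = x}

/-- The knot is in regular position: its projection has finitely many multiple points, these are
double points, and no vertex of the polygon is projected to a double point.
(Consequently no edge is vertical, and the two strands at a double point cross transversely.) -/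
structure IsRegular (K : PolygonalKnot) : Prop where
  finite : K.crossings.Finite
  double : ∀ s t u : ℝ, (K.path s).1 = (K.path t).1 → (K.path t).1 = (K.path u).1 →
    K.path s = K.path t ∨ K.path t = K.path u ∨ K.path s = K.path u
  vertex_not_mem : ∀ i : ℤ, (K.vertex i).1 ∉ K.crossings

end PolygonalKnot

/-- A knot diagram, given as a polygonal knot in regular position: the diagram is its projection
together with the over/under information recorded by the height. -/
structure KnotDiagram extends PolygonalKnot where
  regular : toPolygonalKnot.IsRegular

namespace KnotDiagram

/-- `D` is a diagram of the knot `K`. -/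
def IsDiagramOf (D : KnotDiagram) (K : PolygonalKnot) : Prop :=
  D.toPolygonalKnot.Equivalent K

/-- The underlying closed plane curve of the diagram. -/
def shadow (D : KnotDiagram) : Set Plane :=
  Prod.fst '' D.carrier

/-- The number `c(D)` of crossings of the diagram. -/
noncomputable def crossingNumber (D : KnotDiagram) : ℕ :=
  D.crossings.ncard

/-- At parameter `s` the diagram passes over one of its crossings. -/
def IsOverpass (D : KnotDiagram) (s : ℝ) : Prop :=
  ∃ t : ℝ, (D.path t).1 = (D.path s).1 ∧ (D.path t).2 < (D.path s).2

/-- At parameter `s` the diagram passes under one of its crossings. -/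
def IsUnderpass (D : KnotDiagram) (s : ℝ) : Prop :=
  ∃ t : ℝ, (D.path t).1 = (D.path s).1 ∧ (D.path s).2 < (D.path t).2

/-- The diagram has a bridge of length `l`: some arc of the diagram (less than one full turn of the
parametrisation) carries exactly `l` crossing passes, and these are all overpasses or all
underpasses. That is, there are `l` consecutive overpasses or `l` consecutive underpasses. -/
def HasBridge (D : KnotDiagram) (l : ℕ) : Prop :=
  ∃ a b : ℝ, a ≤ b ∧ b < a + D.n ∧
    (((∀ s ∈ Set.Icc a b, ¬ D.IsUnderpass s) ∧
        {s | s ∈ Set.Icc a b ∧ D.IsOverpass s}.encard = l) ∨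
      ((∀ s ∈ Set.Icc a b, ¬ D.IsOverpass s) ∧
        {s | s ∈ Set.Icc a b ∧ D.IsUnderpass s}.encard = l))

/-- The diagram is composite: some simple closed curve in the plane meets it in exactly two points,
neither of them a crossing, and there are crossings of the diagram in both components of the
complement of the curve. (Since there are crossings on both sides, each of the two arcs of the
diagram between the two points lies in a different component of the complement, so that the diagram
really passes from one side of the curve to the other at the two points.) -/
def IsComposite (D : KnotDiagram) : Prop :=
  ∃ C : ClosedPolygon Plane, C.IsSimple ∧
    (∃ p q : Plane, p ≠ q ∧ C.carrier ∩ D.shadow = {p, q} ∧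
      p ∉ D.crossings ∧ q ∉ D.crossings) ∧
    ∃ x ∈ D.crossings, ∃ y ∈ D.crossings, y ∉ connectedComponentIn (C.carrier)ᶜ x

/-- The diagram is prime: it is not composite. -/
def IsPrime (D : KnotDiagram) : Prop :=
  ¬ D.IsComposite

end KnotDiagram

/-!
Suppose that `l ≥ 4` and `k ≤ l + 2`; then the diagram is composite, which is the contrapositive of
the bound (`HasBridge.isComposite_of_minimal`). Up to a reflection in the projection plane the
bridge consists of overpasses (`eqvGen_reflect`). Call the part of the shadow outside of the bridge
the *rest*. Exactly `k` crossings lie on the rest alone.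

*Rerouting.* A bridge may be replaced by any other arc with the same end points that lies above the
rest of the knot and has a simple projection: triangle moves in the vertical wall over such an arc
lift it to a horizontal plane above the knot, and there it is exchanged for a standard arc over this
plane, the sides of the cone over it serving as triangles (`eqvGen_of_over`). The new diagram again
has `k` crossings outside of the bridge. By minimality, every polygonal arc in general position from
one end of the bridge to the other meets the rest at least `l` times
(`IsOverBridge.exists_reroute_of_reach`); the predicate `Reach` records such arcs.

*Levels.* Sort the points off the rest by the least number of intersections with the rest on a path
to the right end of the bridge. The set of points of cost `j` is the `level j`; the bridge is a
shortest path, so that it runs through each level in one interval (`mem_level_iff`,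
`exists_level_gap`). The complement of the rest has at most `k + 1` components
(`compLE_compl_rest`), since each double point of the rest adds at most one component. There are
`l + 1` nonempty levels, of cost `0` to `l`. If each of the `l - 1` intermediate ones were
disconnected, there would be at least `2 (l - 1) + 2 = 2 l` components, but `2 l ≤ k + 1 ≤ l + 3`
fails for `l ≥ 4`. Hence some intermediate level is connected (`exists_level_isPreconnected`).

*A decomposing curve.* The bridge cuts a connected level into two regions, on which the winding
number of the shadow takes two successive values (`exists_regions`). The level must also be adjacent
to itself across an edge of the rest (`exists_exit`): follow the rest to its last contact with the
closure of the cheaper points, which is a crossing. If near this crossing no edge had the level on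
both sides, two opposite quadrants would belong to the level and to the same region, and a closed
polygon in this region through the crossing would separate points that are connected off the
polygon. A closed polygon with one half in each region, which crosses the bridge once inside of the
level and the rest once at such an edge, meets the shadow in two points. The two crossings at the
ends of the segment of the bridge inside of the level lie on different sides of it
(`IsOverBridge.isComposite`).

The plane topology in use is elementary: winding numbers of polygons are locally constant off the
polygon and jump by one across an edge (`ClosedPolygon.wind_jump_at`), and the removal of a
polygonal path from an open set increases the number of components by at most one for each point
where the path returns to itself or to the complement of the set (`CompLE.diff_path`).
-/

/-! ### Polygonal arcs given by their vertex lists -/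

section Arcs

variable {E : Type} [NormedAddCommGroup E] [NormedSpace ℝ E]

/-- The polygonal chain with the given list of vertices, as a set of points. -/
def chain : List E → Set E
  | [] => ∅
  | [a] => {a}
  | a :: b :: l => segment ℝ a b ∪ chain (b :: l)

/-- The list is the vertex list of a simple (non-closed) polygonal arc; a single point counts. -/
def IsArc : List E → Prop
  | [] => False
  | [_] => True
  | a :: b :: l => a ≠ b ∧ segment ℝ a b ∩ chain (b :: l) ⊆ {b} ∧ IsArc (b :: l)

theorem mem_chain_of_mem {L : List E} {a : E} (h : a ∈ L) : a ∈ chain L := by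
  induction L with
  | nil => simp at h
  | cons x l ih =>
    cases l with
    | nil => simpa [chain] using h
    | cons y l =>
      rcases List.mem_cons.1 h with rfl | h
      · exact Or.inl (left_mem_segment ℝ _ _)
      · exact Or.inr (ih h)

theorem head_mem_chain (a : E) (l : List E) : a ∈ chain (a :: l) :=
  mem_chain_of_mem (by simp)

theorem mem_chain_of_getLast? {L : List E} {p : E} (h : L.getLast? = some p) : p ∈ chain L :=
  mem_chain_of_mem (List.mem_of_getLast? h)

theorem isCompact_segment' (a b : E) : IsCompact (segment ℝ a b) := by
  rw [segment_eq_image_lineMap]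
  exact isCompact_Icc.image AffineMap.lineMap_continuous

theorem isCompact_chain (L : List E) : IsCompact (chain L) := by
  induction L with
  | nil => simp [chain]
  | cons x l ih =>
    cases l with
    | nil => simp [chain]
    | cons y l => exact (isCompact_segment' x y).union ih

theorem isPreconnected_chain (L : List E) : IsPreconnected (chain L) := by
  induction L with
  | nil => simpa [chain] using isPreconnected_empty
  | cons x l ih =>
    cases l with
    | nil => simpa [chain] using isPreconnected_singleton
    | cons y l =>
      exact (convex_segment x y).isPreconnected.union y (right_mem_segment ℝ _ _)
        (head_mem_chain _ _) ih

theorem chain_append (l₁ : List E) (x : E) (l₂ : List E) :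
    chain (l₁ ++ x :: l₂) = chain (l₁ ++ [x]) ∪ chain (x :: l₂) := by
  induction l₁ with
  | nil =>
    have : {x} ⊆ chain (x :: l₂) := by simpa using head_mem_chain x l₂
    simp [chain, Set.insert_eq_of_mem (head_mem_chain x l₂)]
  | cons a l ih =>
    cases l with
    | nil =>
      simp only [List.cons_append, List.nil_append, chain, Set.union_assoc]
      congr 1
    | cons c l =>
      simp only [List.cons_append, chain, Set.union_assoc] at ih ⊢
      rw [ih]

theorem isArc_append_iff (l₁ : List E) (x : E) (l₂ : List E) :
    IsArc (l₁ ++ x :: l₂) ↔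
      IsArc (l₁ ++ [x]) ∧ IsArc (x :: l₂) ∧ chain (l₁ ++ [x]) ∩ chain (x :: l₂) ⊆ {x} := by
  induction l₁ with
  | nil => simp [chain, IsArc]
  | cons a l ih =>
    cases l with
    | nil =>
      simp only [List.cons_append, List.nil_append, IsArc, chain]
      constructor
      · rintro ⟨h1, h2, h3⟩
        refine ⟨⟨h1, by simp, trivial⟩, h3, ?_⟩
        rintro y ⟨hy | hy, hy'⟩
        · exact h2 ⟨hy, hy'⟩
        · exact hy
      · rintro ⟨⟨h1, _, _⟩, h3, h4⟩
        exact ⟨h1, fun y hy => h4 ⟨Or.inl hy.1, hy.2⟩, h3⟩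
    | cons c l =>
      simp only [List.cons_append] at ih ⊢
      simp only [IsArc]
      rw [ih]
      have e : chain (c :: (l ++ x :: l₂)) = chain (c :: (l ++ [x])) ∪ chain (x :: l₂) := by
        simpa using chain_append (c :: l) x l₂
      rw [e]
      simp only [chain]
      constructor
      · rintro ⟨h1, h2, h3, h4, h5⟩
        refine ⟨⟨h1, fun y hy => h2 ⟨hy.1, Or.inl hy.2⟩, h3⟩, h4, ?_⟩
        rintro y ⟨hy | hy, hy'⟩
        · have : y = c := h2 ⟨hy, Or.inr hy'⟩
          subst this
          exact h5 ⟨head_mem_chain _ _, hy'⟩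
        · exact h5 ⟨hy, hy'⟩
      · rintro ⟨⟨h1, h2, h3⟩, h4, h5⟩
        refine ⟨h1, ?_, h3, h4, fun y hy => h5 ⟨Or.inr hy.1, hy.2⟩⟩
        rintro y ⟨hy, hy' | hy'⟩
        · exact h2 ⟨hy, hy'⟩
        · have : y = x := h5 ⟨Or.inl hy, hy'⟩
          subst this
          exact h2 ⟨hy, mem_chain_of_mem (by simp)⟩

theorem chain_reverse (L : List E) : chain L.reverse = chain L := by
  induction L with
  | nil => rfl
  | cons x l ih =>
    cases l with
    | nil => rfl
    | cons y l =>
      have : (x :: y :: l).reverse = l.reverse ++ y :: [x] := by simp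
      rw [this, chain_append]
      have e : l.reverse ++ [y] = (y :: l).reverse := by simp
      rw [e, ih]
      simp only [chain]
      have hx : {x} ⊆ segment ℝ y x := by simpa using right_mem_segment ℝ y x
      rw [Set.union_eq_self_of_subset_right hx, segment_symm, Set.union_comm]

theorem IsArc.reverse {L : List E} (h : IsArc L) : IsArc L.reverse := by
  induction L with
  | nil => exact h
  | cons x l ih =>
    cases l with
    | nil => trivial
    | cons y l =>
      have e1 : (x :: y :: l).reverse = l.reverse ++ y :: [x] := by simp
      have e : l.reverse ++ [y] = (y :: l).reverse := by simp
      obtain ⟨h1, h2, h3⟩ := h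
      rw [e1, isArc_append_iff, e, chain_reverse]
      refine ⟨ih h3, ⟨h1.symm, by simp [chain], trivial⟩, ?_⟩
      rintro z ⟨hz, hz' | hz'⟩
      · rw [segment_symm] at hz'
        exact h2 ⟨hz', hz⟩
      · have : z = x := hz'
        subst this
        exact h2 ⟨left_mem_segment ℝ _ _, hz⟩

/-- The head of an arc does not lie on the remaining part. -/
theorem IsArc.head_notMem {x y : E} {l : List E} (h : IsArc (x :: y :: l)) :
    x ∉ chain (y :: l) :=
  fun hx => h.1 (h.2.1 ⟨left_mem_segment ℝ _ _, hx⟩)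

theorem segment_subset_left {a b y : E} (hy : y ∈ segment ℝ a b) :
    segment ℝ y b ⊆ segment ℝ a b :=
  (convex_segment a b).segment_subset hy (right_mem_segment ℝ _ _)

theorem segment_subset_right {a b y : E} (hy : y ∈ segment ℝ a b) :
    segment ℝ a y ⊆ segment ℝ a b :=
  (convex_segment a b).segment_subset (left_mem_segment ℝ _ _) hy

/-- A simple arc can be cut at any of its points. -/
theorem IsArc.truncate {L : List E} (h : IsArc L) {p y : E} (hp : L.getLast? = some p)
    (hy : y ∈ chain L) :
    ∃ L', IsArc (y :: L') ∧ (y :: L').getLast? = some p ∧ chain (y :: L') ⊆ chain L ∧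
      ∀ v ∈ L', v ∈ L := by
  induction L with
  | nil => exact h.elim
  | cons a l ih =>
    cases l with
    | nil =>
      have : y = a := hy
      subst this
      exact ⟨[], trivial, hp, subset_rfl, by simp⟩
    | cons b l =>
      have hp' : (b :: l).getLast? = some p := by simpa using hp
      rcases hy with hy | hy
      · by_cases hyb : y = b
        · subst hyb
          exact ⟨l, h.2.2, hp', Set.subset_union_right, by simp +contextual⟩
        · refine ⟨b :: l, ⟨hyb, fun z hz => h.2.1 ⟨segment_subset_left hy hz.1, hz.2⟩, h.2.2⟩,
            by simpa using hp', ?_, by simp +contextual⟩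
          exact Set.union_subset_union_left _ (segment_subset_left hy)
      · obtain ⟨L', h1, h2, h3, h4⟩ := ih h.2.2 hp' hy
        exact ⟨L', h1, h2, h3.trans Set.subset_union_right,
          fun v hv => List.mem_cons_of_mem _ (h4 v hv)⟩

/-- A segment attached to the head of a simple arc gives, after erasing loops, a simple arc. -/
theorem IsArc.erase_loop {u : E} {L : List E} (h : IsArc (u :: L)) {p : E}
    (hp : (u :: L).getLast? = some p) (w : E) :
    ∃ L', IsArc (w :: L') ∧ (w :: L').getLast? = some p ∧
      chain (w :: L') ⊆ chain (u :: L) ∪ segment ℝ u w ∧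
      (∀ v ∈ L', v ∈ u :: L ∨ v ∈ chain (u :: L) ∩ segment ℝ u w) ∧
      (w ∉ chain (u :: L) → ∃ y L'', L' = y :: L'' ∧ y ∈ segment ℝ u w ∧
        chain (y :: L'') ⊆ chain (u :: L)) := by
  by_cases hw : w ∈ chain (u :: L)
  · obtain ⟨L', h1, h2, h3, h4⟩ := h.truncate hp hw
    exact ⟨L', h1, h2, h3.trans Set.subset_union_left, fun v hv => Or.inl (h4 v hv),
      fun h => absurd hw h⟩
  · have hK : IsCompact (chain (u :: L) ∩ segment ℝ u w) :=
      (isCompact_chain _).inter (isCompact_segment' _ _)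
    obtain ⟨y, hy, hmin⟩ := hK.exists_isMinOn
      ⟨u, head_mem_chain _ _, left_mem_segment ℝ _ _⟩
      (f := fun z => dist z w) (by fun_prop)
    obtain ⟨L', h1, h2, h3, h4⟩ := h.truncate hp hy.1
    have hyw : w ≠ y := fun e => hw (e ▸ hy.1)
    refine ⟨y :: L', ⟨hyw, ?_, h1⟩, by simpa using h2, ?_, ?_, fun _ => ⟨y, L', rfl, hy.2, h3⟩⟩
    · rintro z ⟨hz, hz'⟩
      have hz1 : z ∈ segment ℝ u w := by
        rw [segment_symm] at hz
        exact segment_subset_left hy.2 hz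
      have := hmin (show z ∈ chain (u :: L) ∩ segment ℝ u w from ⟨h3 hz', hz1⟩)
      simp only [Set.mem_ofPred_eq] at this
      rw [segment_eq_image_lineMap] at hz
      obtain ⟨t, ht, rfl⟩ := hz
      rw [dist_lineMap_left, dist_comm w y, Real.norm_eq_abs, abs_of_nonneg ht.1] at this
      have hd : 0 < dist y w := dist_pos.2 hyw.symm
      have : t = 1 := le_antisymm ht.2 (by nlinarith)
      simp [this]
    · rintro z (hz | hz)
      · rw [segment_symm] at hz
        exact Or.inr (segment_subset_left hy.2 hz)
      · exact Or.inl (h3 hz)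
    · intro v hv
      rcases List.mem_cons.1 hv with rfl | hv
      · exact Or.inr hy
      · exact Or.inl (h4 v hv)

/-- A vertex may be inserted in the first edge of an arc. -/
theorem IsArc.insert {p y m : E} {L : List E} (h : IsArc (p :: y :: L))
    (hm : m ∈ openSegment ℝ p y) :
    IsArc (p :: m :: y :: L) ∧ chain (p :: m :: y :: L) = chain (p :: y :: L) := by
  have hms := openSegment_subset_segment ℝ _ _ hm
  rw [openSegment_eq_image_lineMap] at hm
  obtain ⟨t, ht, rfl⟩ := hm
  have hpy : p ≠ y := h.1
  have h0 : segment ℝ p (AffineMap.lineMap p y t) ∪ segment ℝ (AffineMap.lineMap p y t) y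
      = segment ℝ p y := by
    apply Set.Subset.antisymm
    · exact Set.union_subset (segment_subset_right hms) (segment_subset_left hms)
    · intro z hz
      rw [segment_eq_image_lineMap] at hz
      obtain ⟨s, hs, rfl⟩ := hz
      rcases le_total s t with hst | hst
      · left
        rw [segment_eq_image_lineMap]
        refine ⟨s / t, ⟨div_nonneg hs.1 ht.1.le, (div_le_one ht.1).2 hst⟩, ?_⟩
        rw [AffineMap.lineMap_lineMap_right]
        congr 1
        field_simp [ht.1.ne']
      · right
        rw [segment_symm, segment_eq_image_lineMap]
        have h1t : 0 < 1 - t := by linarith [ht.2]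
        refine ⟨(1 - s) / (1 - t), ⟨div_nonneg (by linarith [hs.2]) h1t.le,
          (div_le_one h1t).2 (by linarith)⟩, ?_⟩
        simp only [AffineMap.lineMap_apply_module']
        have : (1 - s) / (1 - t) * (1 - t) = 1 - s := by field_simp
        match_scalars
        · linear_combination -this
        · linear_combination this
  have hinj := AffineMap.lineMap_injective ℝ hpy
  refine ⟨⟨?_, ?_, ?_, ?_, h.2.2⟩, ?_⟩
  · intro e
    have := hinj ((AffineMap.lineMap_apply_zero p y).trans e)
    exact ht.1.ne this
  · rintro z ⟨hz, hz' | hz'⟩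
    · rw [segment_eq_image_lineMap] at hz hz'
      obtain ⟨s, hs, rfl⟩ := hz
      obtain ⟨s', hs', e⟩ := hz'
      rw [AffineMap.lineMap_lineMap_right] at e
      rw [AffineMap.lineMap_lineMap_right]
      rw [AffineMap.lineMap_lineMap_left] at e
      have := hinj e
      have h2 : s * t = t := by
        apply le_antisymm
        · nlinarith [hs.2, ht.1]
        · nlinarith [hs'.1, ht.2]
      rw [h2]; rfl
    · have : z = y := h.2.1 ⟨segment_subset_right hms hz, hz'⟩
      subst this
      rw [segment_eq_image_lineMap] at hz
      obtain ⟨s, hs, e⟩ := hz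
      rw [AffineMap.lineMap_lineMap_right] at e
      have := hinj (e.trans (AffineMap.lineMap_apply_one p z).symm)
      nlinarith [hs.2, ht.2, ht.1]
  · intro e
    have := hinj (e.trans (AffineMap.lineMap_apply_one p y).symm)
    exact ht.2.ne this
  · exact fun z hz => h.2.1 ⟨segment_subset_left hms hz.1, hz.2⟩
  · simp only [chain]
    rw [← Set.union_assoc, h0]

/-- The point `x` is joined to `p` by a simple polygonal arc inside `Y` with vertices in `V`. -/
def ArcTo (p : E) (Y V : Set E) (x : E) : Prop :=
  ∃ L, IsArc (x :: L) ∧ (x :: L).getLast? = some p ∧ chain (x :: L) ⊆ Y ∧ ∀ v ∈ x :: L, v ∈ V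

theorem ArcTo.mono {p x : E} {Y V Y' V' : Set E} (h : ArcTo p Y V x) (hY : Y ⊆ Y')
    (hV : V ⊆ V') : ArcTo p Y' V' x := by
  obtain ⟨L, h1, h2, h3, h4⟩ := h
  exact ⟨L, h1, h2, h3.trans hY, fun v hv => hV (h4 v hv)⟩

theorem ArcTo.step {p x w : E} {Y V : Set E} (h : ArcTo p Y V x) (hw : w ∈ V)
    (hs : segment ℝ x w ∩ Y ⊆ V) : ArcTo p (Y ∪ segment ℝ x w) V w := by
  obtain ⟨L, h1, h2, h3, h4⟩ := h
  obtain ⟨L', g1, g2, g3, g4, -⟩ := h1.erase_loop h2 w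
  refine ⟨L', g1, g2, g3.trans (Set.union_subset_union_left _ h3), ?_⟩
  intro v hv
  rcases List.mem_cons.1 hv with rfl | hv
  · exact hw
  · rcases g4 v hv with hv | hv
    · exact h4 v hv
    · exact hs ⟨hv.2, h3 hv.1⟩

/-- In an open set, two points of a connected subset have the same polygonal accessibility. -/
theorem ArcTo.of_isPreconnected {p : E} {Y V U s : Set E} (hU : IsOpen U) (hs : IsPreconnected s)
    (hsU : s ⊆ U) (hUY : U ⊆ Y) (hUV : U ⊆ V) {x y : E} (hx : x ∈ s) (hy : y ∈ s)
    (h : ArcTo p Y V x) : ArcTo p Y V y := by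
  have key : ∀ x ∈ U, ∃ r > 0, ∀ y ∈ Metric.ball x r, ∀ z ∈ Metric.ball x r,
      ArcTo p Y V y → ArcTo p Y V z := by
    intro x hx
    obtain ⟨r, hr, hb⟩ := Metric.isOpen_iff.1 hU x hx
    refine ⟨r, hr, fun y hy z hz h => ?_⟩
    have hsub : segment ℝ y z ⊆ U := ((convex_ball x r).segment_subset hy hz).trans hb
    exact (h.step (hUV (hb hz)) (fun w hw => hUV (hsub hw.1))).mono
      (Set.union_subset subset_rfl (hsub.trans hUY)) subset_rfl
  refine (hs.induction₂ (fun x y => ArcTo p Y V x ↔ ArcTo p Y V y) ?_ ?_ ?_ hx hy).1 h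
  · intro x hx
    obtain ⟨r, hr, hb⟩ := key x (hsU hx)
    filter_upwards [mem_nhdsWithin_of_mem_nhds (Metric.ball_mem_nhds x hr)] with y hy
    exact ⟨hb x (Metric.mem_ball_self hr) y hy, hb y hy x (Metric.mem_ball_self hr)⟩
  · intro x y z _ _ _ h1 h2
    exact h1.trans h2
  · intro x y _ _ h1
    exact h1.symm

end Arcs

/-! ### Closed polygons and polygonal arcs -/

namespace ClosedPolygon

theorem n_pos' {E : Type} (P : ClosedPolygon E) : (0 : ℝ) < P.n := by exact_mod_cast P.n_pos

theorem exists_mem_Ico {E : Type} (P : ClosedPolygon E) (s c : ℝ) :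
    ∃ k : ℤ, s + k * P.n ∈ Set.Ico c (c + P.n) := by
  refine ⟨-toIcoDiv P.n_pos' c s, ?_⟩
  have := toIcoMod_mem_Ico P.n_pos' c s
  rw [toIcoMod] at this
  simpa [sub_eq_add_neg] using this

/-- The closed polygon with the given cyclic list of vertices. -/
def ofList {E : Type} [Zero E] (L : List E) (h : L ≠ []) : ClosedPolygon E where
  n := L.length
  n_pos := List.length_pos_iff.2 h
  vertex i := L.getD (i % L.length).toNat 0
  periodic i := by simp

theorem ofList_vertex {E : Type} [Zero E] (L : List E) (h : L ≠ []) {k : ℕ} (hk : k < L.length) :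
    (ofList L h).vertex k = L[k] := by
  have : ((k : ℤ) % L.length).toNat = k := by
    rw [Int.emod_eq_of_lt (by positivity) (by exact_mod_cast hk)]
    simp
  simp [ofList, this, hk]

theorem ofList_vertex_mem {E : Type} [Zero E] (L : List E) (h : L ≠ []) (i : ℤ) :
    (ofList L h).vertex i ∈ L := by
  have hl : (0 : ℤ) < L.length := by exact_mod_cast List.length_pos_iff.2 h
  have h0 := Int.emod_nonneg i hl.ne'
  have h1 := Int.emod_lt_of_pos i hl
  have : (i % L.length).toNat < L.length := by omega
  simp only [ofList, List.getD_eq_getElem _ _ this]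
  exact List.getElem_mem _

end ClosedPolygon

section Polygons

variable {E : Type} [NormedAddCommGroup E] [NormedSpace ℝ E]

namespace ClosedPolygon

theorem path_intCast (P : ClosedPolygon E) (i : ℤ) : P.path i = P.vertex i := by
  simp [path]

theorem path_of_mem (P : ClosedPolygon E) (i : ℤ) {s : ℝ} (h : s ∈ Set.Icc (i : ℝ) (i + 1)) :
    P.path s = AffineMap.lineMap (P.vertex i) (P.vertex (i + 1)) (s - i) := by
  rcases h.2.lt_or_eq with h2 | h2
  · have : ⌊s⌋ = i := Int.floor_eq_iff.2 ⟨h.1, h2⟩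
    simp [path, Int.fract, this]
  · have : s = ((i + 1 : ℤ) : ℝ) := by simpa using h2
    rw [this, path_intCast]
    simp

theorem path_add (P : ClosedPolygon E) (s : ℝ) : P.path (s + P.n) = P.path s := by
  have h := P.periodic (⌊s⌋ + 1)
  rw [add_right_comm] at h
  simp only [path, Int.floor_add_natCast, Int.fract_add_natCast, P.periodic, h]

theorem path_add_mul (P : ClosedPolygon E) (s : ℝ) (k : ℤ) : P.path (s + k * P.n) = P.path s := by
  have hp : Function.Periodic P.path (P.n : ℝ) := P.path_add
  have := hp.int_mul k s
  simpa using this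

theorem path_image_Icc (P : ClosedPolygon E) (i : ℤ) :
    P.path '' Set.Icc (i : ℝ) (i + 1) = segment ℝ (P.vertex i) (P.vertex (i + 1)) := by
  rw [segment_eq_image_lineMap]
  ext x
  constructor
  · rintro ⟨s, hs, rfl⟩
    exact ⟨s - i, ⟨by linarith [hs.1], by linarith [hs.2]⟩, (P.path_of_mem i hs).symm⟩
  · rintro ⟨t, ht, rfl⟩
    refine ⟨i + t, ⟨by linarith [ht.1], by linarith [ht.2]⟩, ?_⟩
    rw [P.path_of_mem i ⟨by linarith [ht.1], by linarith [ht.2]⟩]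
    simp

theorem carrier_eq_image (P : ClosedPolygon E) (c : ℝ) :
    P.carrier = P.path '' Set.Ico c (c + P.n) := by
  ext x
  constructor
  · rintro ⟨s, rfl⟩
    obtain ⟨k, hk⟩ := P.exists_mem_Ico s c
    exact ⟨_, hk, P.path_add_mul s k⟩
  · rintro ⟨s, -, rfl⟩
    exact ⟨s, rfl⟩

theorem carrier_eq_image_Icc (P : ClosedPolygon E) (c : ℝ) :
    P.carrier = P.path '' Set.Icc c (c + P.n) := by
  apply Set.Subset.antisymm
  · rw [P.carrier_eq_image c]
    exact Set.image_mono Set.Ico_subset_Icc_self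
  · rintro _ ⟨s, -, rfl⟩
    exact ⟨s, rfl⟩

theorem carrier_eq_iUnion (P : ClosedPolygon E) :
    P.carrier = ⋃ i ∈ Finset.range P.n, segment ℝ (P.vertex i) (P.vertex (i + 1)) := by
  ext x
  simp only [Set.mem_iUnion, Finset.mem_range, exists_prop]
  constructor
  · rw [P.carrier_eq_image 0]
    rintro ⟨s, hs, rfl⟩
    have h0 : 0 ≤ ⌊s⌋ := Int.floor_nonneg.2 hs.1
    refine ⟨⌊s⌋.toNat, ?_, ?_⟩
    · have : ⌊s⌋ < P.n := Int.floor_lt.2 (by simpa using hs.2)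
      omega
    · rw [Int.toNat_of_nonneg h0, ← P.path_image_Icc]
      exact ⟨s, ⟨Int.floor_le s, (Int.lt_floor_add_one s).le⟩, rfl⟩
  · rintro ⟨i, -, hx⟩
    rw [← P.path_image_Icc] at hx
    obtain ⟨s, -, rfl⟩ := hx
    exact ⟨s, rfl⟩

theorem isCompact_carrier (P : ClosedPolygon E) : IsCompact P.carrier := by
  rw [P.carrier_eq_iUnion]
  exact (Finset.range P.n).isCompact_biUnion fun i _ => isCompact_segment' _ _

/-- Two parameters of the same point of a simple closed polygon differ by full turns. -/
theorem IsSimple.eq_add {P : ClosedPolygon E} (h : P.IsSimple) {s t : ℝ}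
    (e : P.path s = P.path t) : ∃ k : ℤ, s = t + k * P.n := by
  have key : ∀ s : ℝ, ∃ k : ℤ, s + k * P.n ∈ Set.Ico (0 : ℝ) P.n := by
    simpa using fun s => P.exists_mem_Ico s 0
  obtain ⟨k, hk⟩ := key s
  obtain ⟨k', hk'⟩ := key t
  have := h hk hk' (by rw [path_add_mul, path_add_mul, e])
  refine ⟨k' - k, ?_⟩
  push_cast
  linarith

theorem IsSimple.eq_of_abs_lt {P : ClosedPolygon E} (h : P.IsSimple) {s t : ℝ}
    (e : P.path s = P.path t) (hst : |s - t| < P.n) : s = t := by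
  obtain ⟨k, hk⟩ := h.eq_add e
  have hn := P.n_pos'
  have : |(k : ℝ)| < 1 := by
    rw [hk, add_sub_cancel_left, abs_mul, abs_of_pos hn] at hst
    by_contra hc
    push Not at hc
    nlinarith
  have hk0 : k = 0 := by
    have : |k| < 1 := by exact_mod_cast this
    exact Int.abs_lt_one_iff.1 this
  simpa [hk0] using hk

theorem continuous_path (P : ClosedPolygon E) : Continuous P.path := by
  have hlf : LocallyFinite fun i : ℤ => Set.Icc (i : ℝ) (i + 1) := by
    intro x
    refine ⟨Metric.ball x 1, Metric.ball_mem_nhds x one_pos, ?_⟩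
    refine (Set.finite_Icc (⌊x⌋ - 2) (⌊x⌋ + 2)).subset ?_
    rintro i ⟨y, hy, hy'⟩
    rw [Metric.mem_ball, Real.dist_eq, abs_lt] at hy'
    have h1 := Int.floor_le x
    have h2 := Int.lt_floor_add_one x
    constructor
    · have : ((⌊x⌋ - 2 : ℤ) : ℝ) < i + 1 := by push_cast; linarith [hy.2]
      have : (⌊x⌋ - 2 : ℤ) < i + 1 := by exact_mod_cast this
      omega
    · have : (i : ℝ) < ((⌊x⌋ + 2 : ℤ) : ℝ) := by push_cast; linarith [hy.1]
      have : i < (⌊x⌋ + 2 : ℤ) := by exact_mod_cast this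
      omega
  refine hlf.continuous ?_ (fun i => isClosed_Icc) ?_
  · ext x
    simp only [Set.mem_iUnion, Set.mem_univ, iff_true]
    exact ⟨⌊x⌋, Int.floor_le x, (Int.lt_floor_add_one x).le⟩
  · intro i
    refine ContinuousOn.congr (f := fun s : ℝ =>
      AffineMap.lineMap (P.vertex i) (P.vertex (i + 1)) (s - i)) ?_ fun s hs => P.path_of_mem i hs
    exact (AffineMap.lineMap_continuous.comp (by fun_prop)).continuousOn

/-- A piece of a simple closed polygon, shorter than a full turn, is a polygonal arc. -/
theorem IsSimple.exists_arc {P : ClosedPolygon E} (h : P.IsSimple) {s t : ℝ} (hst : s < t)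
    (ht : t < s + P.n) :
    ∃ L, IsArc (P.path s :: L) ∧ (P.path s :: L).getLast? = some (P.path t) ∧
      chain (P.path s :: L) = P.path '' Set.Icc s t ∧
      ∀ v ∈ P.path s :: L, v = P.path s ∨ v = P.path t ∨ v ∈ Set.range P.vertex := by
  have main : ∀ (m : ℕ) (s : ℝ), s < t → t < s + P.n → t ≤ ⌊s⌋ + m + 1 →
    ∃ L, IsArc (P.path s :: L) ∧ (P.path s :: L).getLast? = some (P.path t) ∧
      chain (P.path s :: L) = P.path '' Set.Icc s t ∧
      ∀ v ∈ P.path s :: L, v = P.path s ∨ v = P.path t ∨ v ∈ Set.range P.vertex := by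
    have hseg : ∀ s t : ℝ, s ≤ t → t ≤ ⌊s⌋ + 1 →
        segment ℝ (P.path s) (P.path t) = P.path '' Set.Icc s t := by
      intro s t hst ht
      have hs := Int.floor_le s
      rw [P.path_of_mem ⌊s⌋ ⟨hs, hst.trans ht⟩, P.path_of_mem ⌊s⌋ ⟨hs.trans hst, ht⟩,
        ← image_segment, segment_eq_Icc (by linarith)]
      ext x
      constructor
      · rintro ⟨r, hr, rfl⟩
        refine ⟨r + ⌊s⌋, ⟨by linarith [hr.1], by linarith [hr.2]⟩, ?_⟩
        rw [P.path_of_mem ⌊s⌋ ⟨by linarith [hr.1], by linarith [hr.2]⟩]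
        simp
      · rintro ⟨r, hr, rfl⟩
        refine ⟨r - ⌊s⌋, ⟨by linarith [hr.1], by linarith [hr.2]⟩, ?_⟩
        rw [P.path_of_mem ⌊s⌋ ⟨by linarith [hr.1], by linarith [hr.2]⟩]
    have hinj : ∀ s t : ℝ, s < t → t < s + P.n → P.path s ≠ P.path t := by
      intro s t hst ht e
      refine hst.ne (h.eq_of_abs_lt e ?_)
      rw [abs_lt]
      constructor <;> linarith
    intro m
    induction m with
    | zero =>
      intro s hst ht hm
      refine ⟨[P.path t], ⟨hinj s t hst ht, by simp [chain], trivial⟩, by simp, ?_,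
        by simp +contextual⟩
      have h2 : {P.path t} ⊆ segment ℝ (P.path s) (P.path t) := by
        simpa using right_mem_segment ℝ _ _
      simp only [chain, Set.union_eq_self_of_subset_right h2]
      exact hseg s t hst.le (by simpa using hm)
    | succ m ih =>
      intro s hst ht hm
      rcases le_or_gt t (⌊s⌋ + 1) with hc | hc
      · refine ⟨[P.path t], ⟨hinj s t hst ht, by simp [chain], trivial⟩, by simp, ?_,
          by simp +contextual⟩
        have h2 : {P.path t} ⊆ segment ℝ (P.path s) (P.path t) := by
          simpa using right_mem_segment ℝ _ _
        simp only [chain, Set.union_eq_self_of_subset_right h2]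
        exact hseg s t hst.le hc
      · set r : ℝ := ⌊s⌋ + 1 with hr
        have hsr : s < r := Int.lt_floor_add_one s
        have hfr : ⌊r⌋ = ⌊s⌋ + 1 := by simp [hr]
        obtain ⟨L, h1, h2, h3, h4⟩ := ih r hc (by linarith) (by
          rw [hfr]; push_cast at hm ⊢; linarith)
        refine ⟨P.path r :: L, ⟨hinj s r hsr (by linarith), ?_, h1⟩, by simpa using h2, ?_, ?_⟩
        · rw [h3, hseg s r hsr.le hr.le]
          rintro _ ⟨⟨x, hx, rfl⟩, y, hy, e⟩
          rcases (hx.2.trans hy.1).lt_or_eq with hlt | heq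
          · exact absurd e.symm (hinj x y hlt (by linarith [hx.1, hy.2]))
          · have : x = r := le_antisymm hx.2 (heq ▸ hy.1)
            rw [this]; rfl
        · simp only [chain]
          rw [h3, hseg s r hsr.le hr.le, ← Set.image_union, Set.Icc_union_Icc_eq_Icc hsr.le hc.le]
        · intro v hv
          rcases List.mem_cons.1 hv with rfl | hv
          · exact Or.inl rfl
          · rcases h4 v hv with rfl | hv | hv
            · right; right
              refine ⟨⌊s⌋ + 1, ?_⟩
              rw [← P.path_intCast]; simp [hr]
            · exact Or.inr (Or.inl hv)
            · exact Or.inr (Or.inr hv)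
  refine main (⌈t - s⌉).toNat s hst ht ?_
  have h1 : t - s ≤ (⌈t - s⌉.toNat : ℝ) := by
    have h2 : (⌈t - s⌉ : ℝ) ≤ (⌈t - s⌉.toNat : ℝ) := by exact_mod_cast Int.self_le_toNat _
    exact (Int.le_ceil _).trans h2
  linarith [Int.lt_floor_add_one s]

/-- If consecutive vertices of a closed polygon form a simple arc, then the parametrisation is
injective on the corresponding interval and traverses the arc. -/
theorem injOn_of_isArc (P : ClosedPolygon E) {L : List E} (hL : IsArc L) (i : ℤ)
    (hv : ∀ k (hk : k < L.length), P.vertex (i + k) = L[k]) :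
    Set.InjOn P.path (Set.Icc (i : ℝ) (i + (L.length - 1))) ∧
      P.path '' Set.Icc (i : ℝ) (i + (L.length - 1)) = chain L := by
  induction L generalizing i with
  | nil => exact hL.elim
  | cons a l ih =>
    have ha : P.vertex i = a := by
        have := hv 0 (by simp)
        rw [Nat.cast_zero, add_zero] at this
        exact this
    cases l with
    | nil => simp [chain, path_intCast, ha]
    | cons b l =>
      have hb : P.vertex (i + 1) = b := by
        have := hv 1 (by simp)
        rw [Nat.cast_one] at this
        exact this
      obtain ⟨h1, h2⟩ := ih hL.2.2 (i + 1) (fun k hk => by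
        have := hv (k + 1) (by simpa using hk)
        push_cast at this
        rw [add_assoc, add_comm 1 (k : ℤ)]
        simpa using this)
      have hlen : ((i + 1 : ℤ) : ℝ) + ((b :: l).length - 1) = i + ((a :: b :: l).length - 1) := by
        push_cast [List.length_cons]; ring
      rw [hlen] at h1 h2
      push_cast at h1 h2
      set T : ℝ := i + ((a :: b :: l).length - 1) with hT
      have hT1 : (i : ℝ) + 1 ≤ T := by
        rw [hT]; push_cast [List.length_cons]
        have : (0 : ℝ) ≤ l.length := by positivity
        linarith
      have hseg := P.path_image_Icc i
      rw [ha, hb] at hseg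
      have hpb : P.path (i + 1) = b := by
        have := P.path_intCast (i + 1); push_cast at this; rw [this, hb]
      have hinj0 : ∀ s ∈ Set.Icc (i : ℝ) (i + 1), ∀ t ∈ Set.Icc (i : ℝ) (i + 1),
          P.path s = P.path t → s = t := by
        intro s hs t ht e
        rw [P.path_of_mem i hs, P.path_of_mem i ht, ha, hb] at e
        have := AffineMap.lineMap_injective ℝ hL.1 e
        linarith
      have hmix : ∀ s ∈ Set.Icc (i : ℝ) (i + 1), ∀ t ∈ Set.Icc (i + 1 : ℝ) T,
          P.path s = P.path t → s = t := by
        intro s hs t ht e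
        have hx : P.path s = b := hL.2.1 ⟨hseg ▸ ⟨s, hs, rfl⟩, h2 ▸ ⟨t, ht, e.symm⟩⟩
        have e1 : s = i + 1 := hinj0 s hs _ ⟨by linarith, le_rfl⟩ (by rw [hx, hpb])
        have e2 : t = i + 1 := h1 ht ⟨le_rfl, hT1⟩ (by rw [← e, hx, hpb])
        rw [e1, e2]
      constructor
      · intro s hs t ht e
        rcases le_total s (i + 1) with hs1 | hs1 <;> rcases le_total t (i + 1) with ht1 | ht1
        · exact hinj0 s ⟨hs.1, hs1⟩ t ⟨ht.1, ht1⟩ e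
        · exact hmix s ⟨hs.1, hs1⟩ t ⟨ht1, ht.2⟩ e
        · exact (hmix t ⟨ht.1, ht1⟩ s ⟨hs1, hs.2⟩ e.symm).symm
        · exact h1 ⟨hs1, hs.2⟩ ⟨ht1, ht.2⟩ e
      · rw [← Set.Icc_union_Icc_eq_Icc (b := (i : ℝ) + 1) (by linarith) hT1, Set.image_union,
          hseg, h2]
        rfl

end ClosedPolygon

/-- Two simple arcs that share exactly their end points form a simple closed polygon, whose
parametrisation starts with the first arc. -/
theorem exists_polygon {h t : E} {K M : List E} (h1 : IsArc (h :: K))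
    (ht : (h :: K).getLast? = some t) (h2 : IsArc (t :: (M ++ [h])))
    (hint : chain (h :: K) ∩ chain (t :: (M ++ [h])) ⊆ {h, t}) :
    ∃ P : ClosedPolygon E, P.IsSimple ∧
      P.carrier = chain (h :: K) ∪ chain (t :: (M ++ [h])) ∧
      (∀ i, P.vertex i ∈ h :: K ++ M) ∧
      P.n = (h :: K ++ M).length ∧ (∀ k (hk : k < (h :: K ++ M).length),
        P.vertex k = (h :: K ++ M)[k]) ∧
      P.path '' Set.Icc (0 : ℝ) K.length = chain (h :: K) ∧
      P.path '' Set.Icc (K.length : ℝ) P.n = chain (t :: (M ++ [h])) := by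
  set P := ClosedPolygon.ofList (h :: K ++ M) (by simp) with hP
  have hn : P.n = (h :: K ++ M).length := rfl
  have hv : ∀ k (hk : k < (h :: K ++ M).length), P.vertex k = (h :: K ++ M)[k] :=
    fun k hk => ClosedPolygon.ofList_vertex _ _ hk
  obtain ⟨a1, a2⟩ := P.injOn_of_isArc h1 0 (fun k hk => by
    rw [zero_add, hv k (by simp at hk ⊢; omega), List.getElem_append_left hk])
  have hKt : (h :: K)[K.length]'(by simp) = t := by
    rw [List.getLast?_eq_getElem?] at ht
    simpa using ht
  obtain ⟨b1, b2⟩ := P.injOn_of_isArc h2 K.length (fun k hk => by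
    rcases k with _ | k
    · rw [Nat.cast_zero, add_zero, hv K.length (by simp),
        List.getElem_append_left (by simp), hKt]
      rfl
    · have e : ((K.length : ℤ) + ((k + 1 : ℕ) : ℤ)) = ((K.length + (k + 1) : ℕ) : ℤ) := by
        push_cast; ring
      rw [e]
      by_cases hkM : k < M.length
      · rw [hv _ (by simp; omega), List.getElem_append_right (by simp)]
        simp only [List.length_cons, List.getElem_cons_succ]
        rw [List.getElem_append_left hkM]
        congr 1
        omega
      · have hkM' : k = M.length := by simp at hk; omega
        have : ((K.length + (k + 1) : ℕ) : ℤ) = (0 : ℤ) + P.n := by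
          rw [hn, hkM']; push_cast [List.length_append, List.length_cons]; ring
        rw [this, P.periodic]
        have := hv 0 (by simp)
        simp only [Nat.cast_zero] at this
        rw [this]
        simp [hkM'])
  simp only [Int.cast_zero, zero_add, List.length_cons, Nat.cast_add, Nat.cast_one,
    add_sub_cancel_right, Int.cast_natCast, List.length_append, List.length_nil] at a1 a2 b1 b2
  have hn' : (P.n : ℝ) = K.length + (M.length + 1) := by
    rw [hn]; push_cast [List.length_append, List.length_cons]; ring
  rw [← hn'] at b1 b2
  have hKn : (K.length : ℝ) ≤ P.n := by rw [hn']; have : (0 : ℝ) ≤ M.length := by positivity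
                                        linarith
  have hK0 : (0 : ℝ) ≤ K.length := by positivity
  have p0 : P.path 0 = h := by
    have := P.path_intCast 0
    simp only [Int.cast_zero] at this
    rw [this]
    simpa using hv 0 (by simp)
  have pn : P.path P.n = h := by rw [← p0, ← P.path_add 0, zero_add]
  have pk : P.path K.length = t := by
    have := P.path_intCast K.length
    simp only [Int.cast_natCast] at this
    rw [this, hv K.length (by simp), List.getElem_append_left (by simp), hKt]
  refine ⟨P, ?_, ?_, fun i => ClosedPolygon.ofList_vertex_mem _ _ i, hn, hv, a2, b2⟩
  · have hmix : ∀ x ∈ Set.Icc (0 : ℝ) K.length, ∀ y ∈ Set.Ico (K.length : ℝ) P.n,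
        P.path x = P.path y → x = y := by
      intro x hx y hy e
      have hx1 : P.path x ∈ chain (h :: K) := a2.subset ⟨x, hx, rfl⟩
      have hx2 : P.path x ∈ chain (t :: (M ++ [h])) :=
        b2.subset ⟨y, ⟨hy.1, hy.2.le⟩, e.symm⟩
      rcases hint ⟨hx1, hx2⟩ with hh | hh
      · have : y = P.n := b1 ⟨hy.1, hy.2.le⟩ ⟨hKn, le_rfl⟩ (by rw [← e, hh, pn])
        exact absurd this hy.2.ne
      · have e1 : x = K.length := a1 hx ⟨hK0, le_rfl⟩ (by rw [hh, pk])
        have e2 : y = K.length := b1 ⟨hy.1, hy.2.le⟩ ⟨le_rfl, hKn⟩ (by rw [← e, hh, pk])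
        rw [e1, e2]
    intro x hx y hy e
    rcases le_total x K.length with hx1 | hx1 <;> rcases le_total y K.length with hy1 | hy1
    · exact a1 ⟨hx.1, hx1⟩ ⟨hy.1, hy1⟩ e
    · exact hmix x ⟨hx.1, hx1⟩ y ⟨hy1, hy.2⟩ e
    · exact (hmix y ⟨hy.1, hy1⟩ x ⟨hx1, hx.2⟩ e.symm).symm
    · exact b1 ⟨hx1, hx.2.le⟩ ⟨hy1, hy.2.le⟩ e
  · rw [P.carrier_eq_image_Icc 0, zero_add, ← a2, ← b2, ← Set.image_union,
      Set.Icc_union_Icc_eq_Icc hK0 hKn]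

end Polygons

/-! ### The winding number of a closed plane polygon -/

section Winding

/-- A point of the plane as a complex number. -/
def toC (x : Plane) : ℂ := ⟨x.1, x.2⟩

/-- The two-dimensional cross product. -/
def cross (d y : Plane) : ℝ := d.1 * y.2 - d.2 * y.1

theorem continuous_toC : Continuous toC := by
  have : toC = fun x : Plane => (x.1 : ℂ) + x.2 * Complex.I := by
    funext x; apply Complex.ext <;> simp [toC]
  rw [this]
  fun_prop

theorem toC_injective : Function.Injective toC := by
  intro x y h
  have h1 := congrArg Complex.re h
  have h2 := congrArg Complex.im h
  exact Prod.ext h1 h2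

theorem mem_slitPlane_of_notMem_segment {u w x : Plane} (hx : x ∉ segment ℝ u w) :
    (toC w - toC x) / (toC u - toC x) ∈ Complex.slitPlane := by
  rw [Complex.mem_slitPlane_iff]
  by_contra hc
  push Not at hc
  obtain ⟨h1, h2⟩ := hc
  have hux : toC u - toC x ≠ 0 := by
    rw [sub_ne_zero]
    intro e
    exact hx (toC_injective e ▸ left_mem_segment ℝ _ _)
  set r := ((toC w - toC x) / (toC u - toC x)).re with hr
  have e : toC w - toC x = (r : ℂ) * (toC u - toC x) := by
    have : (toC w - toC x) / (toC u - toC x) = (r : ℂ) := by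
      apply Complex.ext
      · simp [hr]
      · simp [h2]
    rw [← this, div_mul_cancel₀ _ hux]
  have e1 : w.1 - x.1 = r * (u.1 - x.1) := by simpa [toC] using congrArg Complex.re e
  have e2 : w.2 - x.2 = r * (u.2 - x.2) := by simpa [toC] using congrArg Complex.im e
  have h1r : 0 < 1 - r := by linarith
  apply hx
  refine ⟨-r / (1 - r), 1 / (1 - r), div_nonneg (by linarith) h1r.le, by positivity, ?_, ?_⟩
  · field_simp; ring
  · apply Prod.ext
    · simp only [Prod.fst_add, Prod.smul_fst, smul_eq_mul]
      field_simp; linarith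
    · simp only [Prod.snd_add, Prod.smul_snd, smul_eq_mul]
      field_simp; linarith

/-- The angle in `(-π, π]` under which the oriented segment `uw` is seen from `x`. -/
noncomputable def viewAngle (u w x : Plane) : ℝ :=
  Complex.arg ((toC w - toC x) / (toC u - toC x))

theorem continuousAt_ratio {u w x : Plane} (hx : x ≠ u) :
    ContinuousAt (fun y => (toC w - toC y) / (toC u - toC y)) x := by
  refine ContinuousAt.div ?_ ?_ ?_
  · exact (continuous_const.sub continuous_toC).continuousAt
  · exact (continuous_const.sub continuous_toC).continuousAt
  · rw [sub_ne_zero]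
    exact fun e => hx (toC_injective e).symm

theorem continuousAt_viewAngle {u w x : Plane} (hx : x ∉ segment ℝ u w) :
    ContinuousAt (viewAngle u w) x := by
  have hxu : x ≠ u := fun e => hx (e ▸ left_mem_segment ℝ _ _)
  exact ContinuousAt.comp (f := fun y => (toC w - toC y) / (toC u - toC y))
    (Complex.continuousAt_arg (mem_slitPlane_of_notMem_segment hx)) (continuousAt_ratio hxu)

namespace ClosedPolygon

/-- The total angle under which a closed polygon is seen from `x`. -/
noncomputable def angleSum (P : ClosedPolygon Plane) (x : Plane) : ℝ :=
  ∑ i ∈ Finset.range P.n, viewAngle (P.vertex i) (P.vertex (i + 1)) x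

/-- The winding number of a closed polygon around a point; meaningful off the polygon only. -/
noncomputable def wind (P : ClosedPolygon Plane) (x : Plane) : ℤ :=
  round (P.angleSum x / (2 * Real.pi))

theorem notMem_segment_of_notMem_carrier {P : ClosedPolygon Plane} {x : Plane}
    (hx : x ∉ P.carrier) {i : ℕ} (hi : i < P.n) :
    x ∉ segment ℝ (P.vertex i) (P.vertex (i + 1)) := by
  rw [carrier_eq_iUnion] at hx
  simp only [Set.mem_iUnion, Finset.mem_range, not_exists] at hx
  exact hx i hi

theorem angleSum_eq {P : ClosedPolygon Plane} {x : Plane} (hx : x ∉ P.carrier) :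
    P.angleSum x = 2 * Real.pi * P.wind x := by
  have hne : ∀ i : ℕ, toC (P.vertex i) - toC x ≠ 0 := by
    intro i
    rw [sub_ne_zero]
    intro e
    apply hx
    rw [← toC_injective e, ← path_intCast]
    exact ⟨_, rfl⟩
  have hprod : ∀ m : ℕ, ∏ i ∈ Finset.range m,
      (toC (P.vertex (i + 1)) - toC x) / (toC (P.vertex i) - toC x) =
      (toC (P.vertex m) - toC x) / (toC (P.vertex 0) - toC x) := by
    intro m
    induction m with
    | zero => simpa using (div_self (by simpa using hne 0)).symm
    | succ m ih =>
      rw [Finset.prod_range_succ, ih]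
      have h1 := hne m
      have h2 := hne 0
      push_cast at h2 ⊢
      field_simp
  have h1 : ∏ i ∈ Finset.range P.n,
      (toC (P.vertex (i + 1)) - toC x) / (toC (P.vertex i) - toC x) = 1 := by
    rw [hprod]
    have := P.periodic 0
    rw [zero_add] at this
    rw [this]
    exact div_self (by simpa using hne 0)
  have h2 : Complex.exp (∑ i ∈ Finset.range P.n,
      Complex.log ((toC (P.vertex (i + 1)) - toC x) / (toC (P.vertex i) - toC x))) = 1 := by
    rw [Complex.exp_sum, ← h1]
    refine Finset.prod_congr rfl fun i _ => Complex.exp_log ?_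
    have := hne (i + 1)
    push_cast at this
    exact div_ne_zero this (hne i)
  obtain ⟨k, hk⟩ := Complex.exp_eq_one_iff.1 h2
  have h3 : P.angleSum x = 2 * Real.pi * k := by
    have := congrArg Complex.im hk
    rw [Complex.im_sum] at this
    simp only [Complex.log_im] at this
    rw [angleSum]
    simp only [viewAngle]
    rw [this]
    simp
    ring
  rw [wind, h3, mul_div_cancel_left₀ _ (by positivity), round_intCast]

theorem continuousAt_angleSum {P : ClosedPolygon Plane} {x : Plane} (hx : x ∉ P.carrier) :
    ContinuousAt P.angleSum x := by
  unfold angleSum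
  refine tendsto_finsetSum _ fun i hi => ?_
  exact continuousAt_viewAngle (notMem_segment_of_notMem_carrier hx (Finset.mem_range.1 hi))

/-- The winding number is constant on connected sets off the polygon. -/
theorem wind_eq_of_isPreconnected {P : ClosedPolygon Plane} {V : Set Plane}
    (hV : IsPreconnected V) (hd : ∀ x ∈ V, x ∉ P.carrier) {x y : Plane} (hx : x ∈ V)
    (hy : y ∈ V) : P.wind x = P.wind y := by
  have hc : ContinuousOn (fun x => P.angleSum x / (2 * Real.pi)) V := fun x hx =>
    ((continuousAt_angleSum (hd x hx)).div_const _).continuousWithinAt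
  have he : ∀ x ∈ V, P.angleSum x / (2 * Real.pi) = P.wind x := by
    intro x hx
    rw [angleSum_eq (hd x hx), mul_div_cancel_left₀ _ (by positivity)]
  have key : ∀ x ∈ V, ∀ y ∈ V, ¬ P.wind x < P.wind y := by
    intro x hx y hy hlt
    have hlt' : (P.wind x : ℝ) + 1 ≤ P.wind y := by exact_mod_cast hlt
    have hmem : (P.wind x : ℝ) + 1 / 2 ∈ Set.Icc (P.angleSum x / (2 * Real.pi))
        (P.angleSum y / (2 * Real.pi)) := by
      rw [he x hx, he y hy]
      constructor <;> linarith
    obtain ⟨z, hz, hz'⟩ := hV.intermediate_value hx hy hc hmem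
    simp only [he z hz] at hz'
    have h2 : (2 * P.wind z : ℝ) = 2 * P.wind x + 1 := by linarith
    have h3 : 2 * P.wind z = 2 * P.wind x + 1 := by exact_mod_cast h2
    omega
  exact le_antisymm (not_lt.1 (key y hy x hx)) (not_lt.1 (key x hx y hy))

/-- The winding number jumps by one across an interior point of a single edge. -/
theorem wind_jump (P : ClosedPolygon Plane) {i : ℕ} (hi : i < P.n) {m : Plane}
    (hm : m ∈ openSegment ℝ (P.vertex i) (P.vertex (i + 1)))
    (hne : P.vertex i ≠ P.vertex (i + 1))
    (hother : ∀ j < P.n, j ≠ i → m ∉ segment ℝ (P.vertex j) (P.vertex (j + 1))) :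
    ∃ r > 0, ∀ y ∈ Metric.ball m r, ∀ y' ∈ Metric.ball m r,
      0 < cross (P.vertex (i + 1) - P.vertex i) (y - m) →
      cross (P.vertex (i + 1) - P.vertex i) (y' - m) < 0 →
      y ∉ P.carrier ∧ y' ∉ P.carrier ∧ P.wind y = P.wind y' + 1 := by
  set u := P.vertex i with hu
  set w := P.vertex (i + 1) with hw
  obtain ⟨a, b, ha, hb, hab, rfl⟩ := hm
  set m := a • u + b • w with hmdef
  have hd : u.1 ≠ w.1 ∨ u.2 ≠ w.2 := by
    by_contra hc
    push Not at hc
    exact hne (Prod.ext hc.1 hc.2)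
  set N := (w.1 - u.1) ^ 2 + (w.2 - u.2) ^ 2 with hN
  have hNpos : 0 < N := by
    rcases hd with h | h
    · have := sub_ne_zero.2 h.symm
      positivity
    · have := sub_ne_zero.2 h.symm
      positivity
  have ea : a = 1 - b := by linarith
  have hm1 : m.1 = a * u.1 + b * w.1 := by simp [hmdef]
  have hm2 : m.2 = a * u.2 + b * w.2 := by simp [hmdef]
  have hmu : m ≠ u := by
    intro e
    have e1 : b * (w.1 - u.1) = 0 := by
      have := congrArg Prod.fst e; rw [hm1, ea] at this; linarith
    have e2 : b * (w.2 - u.2) = 0 := by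
      have := congrArg Prod.snd e; rw [hm2, ea] at this; linarith
    have e1' := (mul_eq_zero.1 e1).resolve_left hb.ne'
    have e2' := (mul_eq_zero.1 e2).resolve_left hb.ne'
    rw [hN, e1', e2'] at hNpos
    simp at hNpos
  -- the ratio at `m` is the negative real number `-a / b`
  have hratio : (toC w - toC m) / (toC u - toC m) = ((-(a / b) : ℝ) : ℂ) := by
    have hne' : toC u - toC m ≠ 0 := by
      rw [sub_ne_zero]; exact fun e => hmu (toC_injective e).symm
    rw [div_eq_iff hne']
    apply Complex.ext
    · simp only [toC, Complex.sub_re, Complex.re_ofReal_mul, hm1]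
      rw [ea]; field_simp; ring
    · simp only [toC, Complex.sub_im, Complex.im_ofReal_mul, hm2]
      rw [ea]; field_simp; ring
  have him : ∀ y : Plane, y ≠ u → ∃ c > 0, ((toC w - toC y) / (toC u - toC y)).im
      = c * cross (w - u) (y - m) := by
    intro y hy
    have hne' : toC u - toC y ≠ 0 := by
      rw [sub_ne_zero]; exact fun e => hy (toC_injective e).symm
    refine ⟨(Complex.normSq (toC u - toC y))⁻¹, by
      have := Complex.normSq_pos.2 hne'; positivity, ?_⟩
    rw [Complex.div_im]
    simp only [toC, Complex.sub_re, Complex.sub_im, cross, Prod.fst_sub, Prod.snd_sub, hm1, hm2, ea]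
    ring
  have hre : (((-(a / b) : ℝ) : ℂ)).re < 0 := by
    rw [Complex.ofReal_re, neg_lt_zero]; positivity
  have him0 : (((-(a / b) : ℝ) : ℂ)).im = 0 := Complex.ofReal_im _
  have hcont := continuousAt_ratio (w := w) hmu
  rw [ContinuousAt, hratio] at hcont
  have hyu : ∀ᶠ y in nhds m, y ≠ u := isOpen_ne.mem_nhds hmu
  have t1 : Filter.Tendsto (viewAngle u w) (nhdsWithin m {y | 0 < cross (w - u) (y - m)})
      (nhds Real.pi) := by
    refine (Complex.tendsto_arg_nhdsWithin_im_nonneg_of_re_neg_of_im_zero hre him0).comp ?_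
    refine tendsto_nhdsWithin_iff.2 ⟨hcont.mono_left nhdsWithin_le_nhds, ?_⟩
    filter_upwards [self_mem_nhdsWithin, nhdsWithin_le_nhds hyu] with y hy hy'
    obtain ⟨c, hc, e⟩ := him y hy'
    rw [e]
    exact (mul_pos hc hy).le
  have t2 : Filter.Tendsto (viewAngle u w) (nhdsWithin m {y | cross (w - u) (y - m) < 0})
      (nhds (-Real.pi)) := by
    refine (Complex.tendsto_arg_nhdsWithin_im_neg_of_re_neg_of_im_zero hre him0).comp ?_
    refine tendsto_nhdsWithin_iff.2 ⟨hcont.mono_left nhdsWithin_le_nhds, ?_⟩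
    filter_upwards [self_mem_nhdsWithin, nhdsWithin_le_nhds hyu] with y hy hy'
    obtain ⟨c, hc, e⟩ := him y hy'
    rw [e]
    exact mul_neg_of_pos_of_neg hc hy
  set R : Plane → ℝ := fun y => ∑ j ∈ (Finset.range P.n).erase i,
    viewAngle (P.vertex j) (P.vertex (j + 1)) y with hR
  have hRc : ContinuousAt R m := by
    refine tendsto_finsetSum _ fun j hj => ?_
    rw [Finset.mem_erase, Finset.mem_range] at hj
    exact continuousAt_viewAngle (hother j hj.2 hj.1)
  have hsum : ∀ y, P.angleSum y = viewAngle u w y + R y := by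
    intro y
    rw [angleSum, ← Finset.add_sum_erase _ _ (Finset.mem_range.2 hi)]
  have hoff : ∀ᶠ y in nhds m, ∀ j < P.n, j ≠ i →
      y ∉ segment ℝ (P.vertex j) (P.vertex (j + 1)) := by
    have := (Filter.eventually_all_finset ((Finset.range P.n).erase i) (l := nhds m)
      (p := fun j y => y ∉ segment ℝ (P.vertex j) (P.vertex (j + 1)))).2 (by
        intro j hj
        rw [Finset.mem_erase, Finset.mem_range] at hj
        exact (isCompact_segment' _ _).isClosed.isOpen_compl.mem_nhds (hother j hj.2 hj.1))
    filter_upwards [this] with y hy j hj hji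
    exact hy j (Finset.mem_erase.2 ⟨hji, Finset.mem_range.2 hj⟩)
  have hcar : ∀ y, (∀ j < P.n, j ≠ i → y ∉ segment ℝ (P.vertex j) (P.vertex (j + 1))) →
      cross (w - u) (y - m) ≠ 0 → y ∉ P.carrier := by
    intro y hy hcr hmem
    rw [carrier_eq_iUnion] at hmem
    simp only [Set.mem_iUnion, Finset.mem_range, exists_prop] at hmem
    obtain ⟨j, hj, hyj⟩ := hmem
    by_cases hji : j = i
    · subst hji
      obtain ⟨a', b', -, -, hab', rfl⟩ := hyj
      apply hcr
      have ea' : a' = 1 - b' := by linarith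
      simp only [cross, Prod.fst_sub, Prod.snd_sub, hm1, hm2, ea, ea', Prod.fst_add, Prod.snd_add,
        Prod.smul_fst, Prod.smul_snd, smul_eq_mul, ← hu, ← hw]
      ring
    · exact hy j hj hji hyj
  have s1 := (t1.add (hRc.tendsto.mono_left nhdsWithin_le_nhds)).eventually
    (Metric.ball_mem_nhds _ one_pos)
  have s2 := (t2.add (hRc.tendsto.mono_left nhdsWithin_le_nhds)).eventually
    (Metric.ball_mem_nhds _ one_pos)
  rw [eventually_nhdsWithin_iff] at s1 s2
  obtain ⟨r, hr, hball⟩ := Metric.eventually_nhds_iff_ball.1 (s1.and (s2.and hoff))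
  refine ⟨r, hr, fun y hy y' hy' hcy hcy' => ?_⟩
  obtain ⟨b1, -, b3⟩ := hball y hy
  obtain ⟨-, b2, b3'⟩ := hball y' hy'
  have c1 := hcar y b3 hcy.ne'
  have c2 := hcar y' b3' hcy'.ne
  refine ⟨c1, c2, ?_⟩
  have d1 := b1 hcy
  have d2 := b2 hcy'
  rw [Real.dist_eq, ← hsum, angleSum_eq c1, abs_lt] at d1
  rw [Real.dist_eq, ← hsum, angleSum_eq c2, abs_lt] at d2
  have hpi := Real.pi_gt_three
  have f1 : (P.wind y : ℝ) - P.wind y' < 2 := by nlinarith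
  have f2 : 0 < (P.wind y : ℝ) - P.wind y' := by nlinarith
  have g1 : P.wind y - P.wind y' < 2 := by exact_mod_cast f1
  have g2 : 0 < P.wind y - P.wind y' := by exact_mod_cast f2
  omega

end ClosedPolygon

end Winding

/-! ### Counting complementary components -/

section Components

open Set Topology

/-- The set `U` is a union of at most `n` connected subsets, that is, it has at most `n` connected
components. -/
def CompLE {X : Type*} [TopologicalSpace X] (U : Set X) (n : ℕ) : Prop :=
  ∃ F : Finset (Set X), F.card ≤ n ∧ (∀ V ∈ F, IsPreconnected V ∧ V ⊆ U) ∧ U ⊆ ⋃ V ∈ F, V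

theorem CompLE.mono {X : Type*} [TopologicalSpace X] {U : Set X} {n m : ℕ} (h : CompLE U n)
    (hnm : n ≤ m) : CompLE U m := by
  obtain ⟨F, h1, h2⟩ := h
  exact ⟨F, h1.trans hnm, h2⟩

/-- Removing a connected set `S` from an open set `U` replaces the component that contains `S`
by at most as many components as there are connected sets `N` that surround `S`. -/
theorem CompLE.diff {X : Type*} [TopologicalSpace X] [LocallyConnectedSpace X] {U S : Set X}
    {n : ℕ} (hU : IsOpen U) (hUS : IsOpen (U \ S)) (hSU : S ⊆ U) (hS : IsConnected S)
    (𝒩 : Finset (Set X)) (hN : ∀ N ∈ 𝒩, IsPreconnected N ∧ N ⊆ U \ S ∧ N.Nonempty)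
    (hnhds : ∀ x ∈ S, S ∪ ⋃ N ∈ 𝒩, N ∈ 𝓝 x) (h : CompLE U (n + 1)) :
    CompLE (U \ S) (n + 𝒩.card) := by
  classical
  obtain ⟨F, hF1, hF2, hF3⟩ := h
  obtain ⟨s₀, hs₀⟩ := hS.nonempty
  obtain ⟨V₀, hV₀, hsV₀⟩ : ∃ V ∈ F, s₀ ∈ V := by simpa using hF3 (hSU hs₀)
  set C₀ := connectedComponentIn U s₀ with hC₀
  have hSC : S ⊆ C₀ := hS.isPreconnected.subset_connectedComponentIn hs₀ hSU
  set pt : Set X → X := fun N => if h : N.Nonempty then h.some else s₀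
  refine ⟨((F.erase V₀).filter fun V => Disjoint V C₀) ∪
    𝒩.image (fun N => connectedComponentIn (U \ S) (pt N)), ?_, ?_, ?_⟩
  · refine (Finset.card_union_le _ _).trans ?_
    refine add_le_add ((Finset.card_filter_le _ _).trans ?_) Finset.card_image_le
    rw [Finset.card_erase_of_mem hV₀]
    omega
  · intro V hV
    rcases Finset.mem_union.1 hV with hV | hV
    · rw [Finset.mem_filter, Finset.mem_erase] at hV
      obtain ⟨h1, h2⟩ := hF2 V hV.1.2
      exact ⟨h1, fun x hx => ⟨h2 hx, fun hxS => Set.disjoint_left.1 hV.2 hx (hSC hxS)⟩⟩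
    · obtain ⟨N, hN', rfl⟩ := Finset.mem_image.1 hV
      exact ⟨isPreconnected_connectedComponentIn, connectedComponentIn_subset _ _⟩
  · intro x hx
    simp only [mem_iUnion, exists_prop]
    by_cases hxC : x ∈ C₀
    · by_contra hcon
      have hnot : ∀ N ∈ 𝒩, x ∉ connectedComponentIn (U \ S) (pt N) := fun N hN' hx' =>
        hcon ⟨_, Finset.mem_union_right _ (Finset.mem_image_of_mem _ hN'), hx'⟩
      set O := connectedComponentIn (U \ S) x with hO
      have hOopen : IsOpen O := hUS.connectedComponentIn
      have hdisj : ∀ N ∈ 𝒩, ∀ y ∈ N, y ∉ O := by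
        intro N hN' y hy hyO
        obtain ⟨h1, h2, h3⟩ := hN N hN'
        have hp : pt N ∈ N := by simp only [pt, h3, dif_pos]; exact h3.some_mem
        have h4 := h1.subset_connectedComponentIn hp h2 hy
        have e1 := connectedComponentIn_eq h4
        have e2 := connectedComponentIn_eq hyO
        apply hnot N hN'
        rw [e1, ← e2]
        exact mem_connectedComponentIn hx
      have hC₀O : IsOpen (C₀ \ O) := by
        rw [isOpen_iff_mem_nhds]
        rintro y ⟨hy, hyO⟩
        have hC₀n : C₀ ∈ 𝓝 y := hU.connectedComponentIn.mem_nhds hy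
        by_cases hyS : y ∈ S
        · filter_upwards [hC₀n, hnhds y hyS] with z hz hz'
          refine ⟨hz, fun hzO => ?_⟩
          rcases hz' with hz' | hz'
          · exact (connectedComponentIn_subset _ _ hzO).2 hz'
          · simp only [mem_iUnion, exists_prop] at hz'
            obtain ⟨N, hN', hzN⟩ := hz'
            exact hdisj N hN' z hzN hzO
        · have hyU : y ∈ U \ S := ⟨connectedComponentIn_subset _ _ hy, hyS⟩
          filter_upwards [hC₀n, hUS.connectedComponentIn.mem_nhds (mem_connectedComponentIn hyU)]
            with z hz hz'
          refine ⟨hz, fun hzO => hyO ?_⟩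
          have e1 := connectedComponentIn_eq hz'
          have e2 := connectedComponentIn_eq hzO
          rw [hO, e2, ← e1]
          exact mem_connectedComponentIn hyU
      have hpre : IsPreconnected C₀ := isPreconnected_connectedComponentIn
      obtain ⟨z, -, hz1, hz2⟩ := hpre O (C₀ \ O) hOopen hC₀O
        (fun z hz => by by_cases h : z ∈ O <;> simp [h, hz])
        ⟨x, hxC, mem_connectedComponentIn hx⟩
        ⟨s₀, hSC hs₀, hSC hs₀, fun h => (connectedComponentIn_subset _ _ h).2 hs₀⟩
      exact hz2.2 hz1
    · obtain ⟨V, hV, hxV⟩ : ∃ V ∈ F, x ∈ V := by simpa using hF3 hx.1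
      have hVC : Disjoint V C₀ := by
        rw [Set.disjoint_left]
        intro y hy hyC
        apply hxC
        obtain ⟨h1, h2⟩ := hF2 V hV
        have h4 := h1.subset_connectedComponentIn hy h2 hxV
        rwa [hC₀, connectedComponentIn_eq hyC]
      refine ⟨V, Finset.mem_union_left _ ?_, hxV⟩
      rw [Finset.mem_filter, Finset.mem_erase]
      refine ⟨⟨?_, hV⟩, hVC⟩
      rintro rfl
      exact Set.disjoint_left.1 hVC hsV₀ (hSC hs₀)

theorem cross_add (d x y : Plane) : cross d (x + y) = cross d x + cross d y := by
  simp [cross]; ring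

theorem cross_smul (d : Plane) (c : ℝ) (x : Plane) : cross d (c • x) = c * cross d x := by
  simp [cross]; ring

theorem cross_smul_left (d : Plane) (c : ℝ) (x : Plane) : cross (c • x) d = c * cross x d := by
  simp [cross]; ring

theorem cross_same (d : Plane) : cross d d = 0 := by simp [cross]; ring

theorem cross_comm (d x : Plane) : cross d x = -cross x d := by simp [cross]; ring

theorem continuous_cross (d : Plane) : Continuous (cross d) := by
  unfold cross; fun_prop

theorem convex_cross_pos (d m : Plane) : Convex ℝ {y | 0 < cross d (y - m)} := by
  intro x hx y hy a b ha hb hab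
  have e : cross d (a • x + b • y - m) = a * cross d (x - m) + b * cross d (y - m) := by
    have ea : a = 1 - b := by linarith
    simp only [cross, Prod.fst_sub, Prod.snd_sub, Prod.fst_add, Prod.snd_add, Prod.smul_fst,
      Prod.smul_snd, smul_eq_mul, ea]
    ring
  have hx' : 0 < cross d (x - m) := hx
  have hy' : 0 < cross d (y - m) := hy
  rw [mem_ofPred_eq, e]
  rcases ha.lt_or_eq with ha | ha
  · have := mul_pos ha hx'
    have := mul_nonneg hb hy'.le
    linarith
  · have : b = 1 := by linarith
    rw [← ha, this]
    simpa using hy'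

theorem cross_neg_left (d x : Plane) : cross (-d) x = -cross d x := by simp [cross]; ring

theorem convex_cross_neg (d m : Plane) : Convex ℝ {y | cross d (y - m) < 0} := by
  have := convex_cross_pos (-d) m
  simpa [cross_neg_left] using this

/-- The vector `d` rotated by a right angle. -/
def rot (d : Plane) : Plane := (-d.2, d.1)

/-- The squared Euclidean length. -/
def sqLen (d : Plane) : ℝ := d.1 ^ 2 + d.2 ^ 2

theorem sqLen_pos {d : Plane} (h : d ≠ 0) : 0 < sqLen d := by
  have : d.1 ≠ 0 ∨ d.2 ≠ 0 := by
    by_contra hc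
    push Not at hc
    exact h (Prod.ext hc.1 hc.2)
  unfold sqLen
  rcases this with h | h <;> positivity

theorem cross_rot (d : Plane) : cross d (rot d) = sqLen d := by simp [cross, rot, sqLen]; ring

theorem rot_ne_zero {d : Plane} (h : d ≠ 0) : rot d ≠ 0 := by
  intro e
  apply h
  have h1 := congrArg Prod.fst e
  have h2 := congrArg Prod.snd e
  simp [rot] at h1 h2
  exact Prod.ext h2 h1

/-- Coordinates with respect to `d` and `rot d`. -/
theorem eq_add_rot {d : Plane} (h : d ≠ 0) (y : Plane) :
    y = (-(cross (rot d) y) / sqLen d) • d + (cross d y / sqLen d) • rot d := by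
  have := (sqLen_pos h).ne'
  apply Prod.ext
  · simp only [cross, rot, Prod.fst_add, Prod.smul_fst, smul_eq_mul]
    field_simp
    simp only [sqLen]; ring
  · simp only [cross, rot, Prod.snd_add, Prod.smul_snd, smul_eq_mul]
    field_simp
    simp only [sqLen]; ring

/-- The one-sided neighbourhood of the open segment from `u` to `u + d`, of width `ρ`, on the side of
the vector `v`. -/
def strip (u d v : Plane) (ρ : ℝ → ℝ) : Set Plane :=
  (fun p : ℝ × ℝ => u + p.1 • d + (p.2 * ρ p.1) • v) '' (Ioo (0 : ℝ) 1 ×ˢ Ioo (0 : ℝ) 1)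

theorem isPreconnected_strip (u d v : Plane) {ρ : ℝ → ℝ} (hρ : Continuous ρ) :
    IsPreconnected (strip u d v ρ) := by
  refine IsPreconnected.image ?_ _ (by fun_prop)
  exact isPreconnected_Ioo.prod isPreconnected_Ioo

/-- A disc minus a radius is connected. -/
theorem isPreconnected_ball_diff_ray {v d : Plane} (hd : d ≠ 0) {r : ℝ} (hr : 0 < r) :
    IsPreconnected (Metric.ball v r \ {y | ∃ c : ℝ, 0 ≤ c ∧ y = v + c • d}) := by
  have hs := sqLen_pos hd
  set H1 := Metric.ball v r ∩ {y | 0 < cross d (y - v)}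
  set H2 := Metric.ball v r ∩ {y | cross d (y - v) < 0}
  set H3 := Metric.ball v r ∩ {y | 0 < cross (rot d) (y - v)}
  have c1 : IsPreconnected H1 := ((convex_ball v r).inter (convex_cross_pos d v)).isPreconnected
  have c2 : IsPreconnected H2 := ((convex_ball v r).inter (convex_cross_neg d v)).isPreconnected
  have c3 : IsPreconnected H3 :=
    ((convex_ball v r).inter (convex_cross_pos (rot d) v)).isPreconnected
  have heq : Metric.ball v r \ {y | ∃ c : ℝ, 0 ≤ c ∧ y = v + c • d} = (H1 ∪ H3) ∪ H2 := by
    ext y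
    constructor
    · rintro ⟨hy, hy'⟩
      rcases lt_trichotomy (cross d (y - v)) 0 with h | h | h
      · exact Or.inr ⟨hy, h⟩
      · refine Or.inl (Or.inr ⟨hy, ?_⟩)
        by_contra hc
        apply hy'
        refine ⟨-(cross (rot d) (y - v)) / sqLen d,
          div_nonneg (by simpa using hc) hs.le, ?_⟩
        have := eq_add_rot hd (y - v)
        rw [h] at this
        simp only [zero_div, zero_smul, add_zero] at this
        rw [← this]
        abel
      · exact Or.inl (Or.inl ⟨hy, h⟩)
    · have hc : ∀ c : ℝ, cross d (v + c • d - v) = 0 := fun c => by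
        rw [add_sub_cancel_left, cross_smul, cross_same, mul_zero]
      rintro ((⟨hy, h⟩ | ⟨hy, h⟩) | ⟨hy, h⟩)
      · exact ⟨hy, fun ⟨c, _, e⟩ => by rw [e, mem_ofPred_eq, hc] at h; exact h.false⟩
      · refine ⟨hy, fun ⟨c, h0, e⟩ => ?_⟩
        rw [e, mem_ofPred_eq, add_sub_cancel_left, cross_smul, cross_comm, cross_rot] at h
        nlinarith
      · exact ⟨hy, fun ⟨c, _, e⟩ => by rw [e, mem_ofPred_eq, hc] at h; exact h.false⟩
  have hmeet : ∀ w : Plane, ∃ ε > 0, v + (ε : ℝ) • w ∈ Metric.ball v r := by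
    intro w
    refine ⟨r / (‖w‖ + 1), by positivity, ?_⟩
    rw [mem_ball_iff_norm, add_sub_cancel_left, norm_smul, Real.norm_eq_abs,
      abs_of_pos (by positivity), div_mul_eq_mul_div, div_lt_iff₀ (by positivity)]
    nlinarith [norm_nonneg w]
  rw [heq]
  obtain ⟨ε, hε, hb⟩ := hmeet (rot d - d)
  obtain ⟨ε', hε', hb'⟩ := hmeet (-rot d - d)
  have e1 : cross d (rot d - d) = sqLen d := by simp [cross, rot, sqLen]; ring
  have e2 : cross (rot d) (rot d - d) = sqLen d := by simp [cross, rot, sqLen]; ring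
  have e3 : cross d (-rot d - d) = -sqLen d := by simp [cross, rot, sqLen]; ring
  have e4 : cross (rot d) (-rot d - d) = sqLen d := by simp [cross, rot, sqLen]; ring
  refine IsPreconnected.union (v + ε' • (-rot d - d)) (Or.inr ⟨hb', ?_⟩) ⟨hb', ?_⟩
    (IsPreconnected.union (v + ε • (rot d - d)) ⟨hb, ?_⟩ ⟨hb, ?_⟩ c1 c3) c2
  · simp only [mem_ofPred_eq, add_sub_cancel_left, cross_smul, e4]; positivity
  · simp only [mem_ofPred_eq, add_sub_cancel_left, cross_smul, e3]; nlinarith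
  · simp only [mem_ofPred_eq, add_sub_cancel_left, cross_smul, e1]; positivity
  · simp only [mem_ofPred_eq, add_sub_cancel_left, cross_smul, e2]; positivity

theorem strip_subset {U : Set Plane} {u d v : Plane} {ρ : ℝ → ℝ} (hv : cross d v ≠ 0)
    (hρ : ∀ t ∈ Ioo (0 : ℝ) 1, 0 < ρ t ∧ ∀ r : ℝ, |r| < ρ t → u + t • d + r • v ∈ U) :
    strip u d v ρ ⊆ U ∧ ∀ t : ℝ, u + t • d ∉ strip u d v ρ := by
  constructor
  · rintro _ ⟨⟨t, s⟩, ⟨ht, hs⟩, rfl⟩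
    obtain ⟨h1, h2⟩ := hρ t ht
    apply h2
    rw [abs_mul, abs_of_pos hs.1, abs_of_pos h1]
    nlinarith [hs.2]
  · rintro t ⟨⟨t', s⟩, ⟨ht, hs⟩, e⟩
    obtain ⟨h1, -⟩ := hρ t' ht
    have := congrArg (fun y => cross d (y - u)) e
    simp only [add_assoc, add_sub_cancel_left, cross_add, cross_smul, cross_same, mul_zero,
      zero_add] at this
    exact (mul_ne_zero (mul_pos hs.1 h1).ne' hv) this

theorem strip_nonempty (u d v : Plane) (ρ : ℝ → ℝ) : (strip u d v ρ).Nonempty :=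
  ⟨_, (1 / 2, 1 / 2), ⟨by norm_num, by norm_num⟩, rfl⟩

theorem nhds_strip {u d : Plane} (hd : d ≠ 0) {ρ : ℝ → ℝ} (hc : Continuous ρ)
    (hρ : ∀ t ∈ Ioo (0 : ℝ) 1, 0 < ρ t) {t : ℝ} (ht : t ∈ Ioo (0 : ℝ) 1) :
    (fun t : ℝ => u + t • d) '' Ioo 0 1 ∪ (strip u d (rot d) ρ ∪ strip u d (-rot d) ρ) ∈
      𝓝 (u + t • d) := by
  have hs := sqLen_pos hd
  set τ : Plane → ℝ := fun y => -(cross (rot d) (y - u)) / sqLen d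
  set σ : Plane → ℝ := fun y => cross d (y - u) / sqLen d
  have hτ : Continuous τ :=
    ((continuous_cross _).comp (continuous_id.sub continuous_const)).neg.div_const _
  have hσ : Continuous σ :=
    ((continuous_cross _).comp (continuous_id.sub continuous_const)).div_const _
  have hτ0 : τ (u + t • d) = t := by
    simp only [τ, add_sub_cancel_left, cross_smul]
    rw [cross_comm, cross_rot]; field_simp
  have hσ0 : σ (u + t • d) = 0 := by
    simp only [σ, add_sub_cancel_left, cross_smul, cross_same, mul_zero, zero_div]
  have ho : IsOpen {y | 0 < τ y ∧ τ y < 1 ∧ |σ y| < ρ (τ y)} :=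
    (isOpen_lt continuous_const hτ).inter ((isOpen_lt hτ continuous_const).inter
      (isOpen_lt hσ.abs (hc.comp hτ)))
  filter_upwards [ho.mem_nhds (show u + t • d ∈ {y | 0 < τ y ∧ τ y < 1 ∧ |σ y| < ρ (τ y)} by
    simp only [mem_ofPred_eq, hτ0, hσ0, abs_zero]; exact ⟨ht.1, ht.2, hρ t ht⟩)] with y hy
  obtain ⟨h1, h2, h3⟩ := hy
  have hρy := hρ _ ⟨h1, h2⟩
  have hy : y = u + τ y • d + σ y • rot d := by
    have := eq_add_rot hd (y - u)
    rw [add_assoc, ← this]; abel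
  rcases lt_trichotomy (σ y) 0 with h | h | h
  · refine Or.inr (Or.inr ⟨(τ y, -σ y / ρ (τ y)), ⟨⟨h1, h2⟩, div_pos (by linarith) hρy, ?_⟩, ?_⟩)
    · rw [div_lt_one hρy]; rwa [abs_of_neg h] at h3
    · simp only [div_mul_cancel₀ _ hρy.ne']
      rw [smul_neg, neg_smul, neg_neg, ← hy]
  · refine Or.inl ⟨τ y, ⟨h1, h2⟩, ?_⟩
    rw [h, zero_smul, add_zero] at hy
    exact hy.symm
  · refine Or.inr (Or.inl ⟨(τ y, σ y / ρ (τ y)), ⟨⟨h1, h2⟩, div_pos h hρy, ?_⟩, ?_⟩)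
    · rw [div_lt_one hρy]; rwa [abs_of_pos h] at h3
    · simp only [div_mul_cancel₀ _ hρy.ne']
      exact hy.symm

/-- A width function for thin strips inside an open set. -/
theorem exists_width {U : Set Plane} (hU : IsOpen U) (hUc : Uᶜ.Nonempty) (u d v : Plane) :
    ∃ ρ : ℝ → ℝ, Continuous ρ ∧ ∀ t, u + t • d ∈ U →
      0 < ρ t ∧ ∀ r : ℝ, |r| < ρ t → u + t • d + r • v ∈ U := by
  refine ⟨fun t => Metric.infDist (u + t • d) Uᶜ / (‖v‖ + 1), ?_, ?_⟩
  · exact ((Metric.continuous_infDist_pt _).comp (by fun_prop)).div_const _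
  · intro t ht
    have h0 : 0 < Metric.infDist (u + t • d) Uᶜ :=
      (hU.isClosed_compl.notMem_iff_infDist_pos hUc).1 (fun h => h ht)
    refine ⟨by positivity, fun r hr => ?_⟩
    have : dist (u + t • d) (u + t • d + r • v) < Metric.infDist (u + t • d) Uᶜ := by
      rw [dist_self_add_right, norm_smul, Real.norm_eq_abs]
      rw [lt_div_iff₀ (by positivity)] at hr
      nlinarith [norm_nonneg v, abs_nonneg r]
    have h2 := Metric.notMem_of_dist_lt_infDist this
    simpa using h2

theorem segment_eq_image_add (u d : Plane) :
    segment ℝ u (u + d) = (fun t : ℝ => u + t • d) '' Icc 0 1 := by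
  rw [segment_eq_image']
  simp

/-- Cutting along a segment that enters the open set from its complement and ends inside it does
not increase the number of components. -/
theorem CompLE.diff_segment_tip {U : Set Plane} (hU : IsOpen U) {u d : Plane} (hd : d ≠ 0)
    (hu : u ∉ U) (hseg : ∀ t ∈ Ioc (0 : ℝ) 1, u + t • d ∈ U) {n : ℕ} (h : CompLE U (n + 1)) :
    CompLE (U \ segment ℝ u (u + d)) (n + 1) := by
  classical
  set S : Set Plane := (fun t : ℝ => u + t • d) '' Ioc 0 1 with hS
  have hUS : U \ segment ℝ u (u + d) = U \ S := by
    rw [segment_eq_image_add]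
    ext x
    simp only [mem_sdiff, hS, mem_image, not_exists, not_and]
    refine and_congr_right fun hx => ⟨fun h t ht => h t ⟨ht.1.le, ht.2⟩, fun h t ht e => ?_⟩
    rcases ht.1.lt_or_eq with h0 | h0
    · exact h t ⟨h0, ht.2⟩ e
    · apply hu; rw [← h0] at e; simp only [zero_smul, add_zero] at e; rwa [e]
  have hcl : IsOpen (U \ S) := by
    rw [← hUS]; exact hU.sdiff (isCompact_segment' _ _).isClosed
  obtain ⟨ρ, hρc, hρ⟩ := exists_width hU ⟨u, hu⟩ u d (rot d)
  have hrd := (sqLen_pos hd).ne'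
  have hSU : S ⊆ U := by rintro _ ⟨t, ht, rfl⟩; exact hseg t ht
  have hw : u + d ∈ U := by simpa using hseg 1 ⟨one_pos, le_rfl⟩
  obtain ⟨r₀, hr₀, hb₀⟩ := Metric.isOpen_iff.1 hU _ hw
  set r := min r₀ ‖d‖ with hr
  have hdn : 0 < ‖d‖ := norm_pos_iff.2 hd
  have hrp : 0 < r := lt_min hr₀ hdn
  have hb : Metric.ball (u + d) r ⊆ U := (Metric.ball_subset_ball (min_le_left _ _)).trans hb₀
  set cap := Metric.ball (u + d) r \ {y | ∃ c : ℝ, 0 ≤ c ∧ y = (u + d) + c • (-d)} with hcap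
  have hcapc : IsPreconnected cap := isPreconnected_ball_diff_ray (neg_ne_zero.2 hd) hrp
  have hρ1 : ∀ t ∈ Ioo (0 : ℝ) 1, 0 < ρ t ∧ ∀ r : ℝ, |r| < ρ t → u + t • d + r • rot d ∈ U :=
    fun t ht => hρ t (hseg t ⟨ht.1, ht.2.le⟩)
  have hρ2 : ∀ t ∈ Ioo (0 : ℝ) 1, 0 < ρ t ∧ ∀ r : ℝ, |r| < ρ t → u + t • d + r • (-rot d) ∈ U := by
    intro t ht
    refine ⟨(hρ1 t ht).1, fun r hr => ?_⟩
    have := (hρ1 t ht).2 (-r) (by rwa [abs_neg])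
    simpa using this
  have hv1 : cross d (rot d) ≠ 0 := by rw [cross_rot]; exact hrd
  have hv2 : cross d (-rot d) ≠ 0 := by
    have : cross d (-rot d) = - sqLen d := by simp [cross, rot, sqLen]; ring
    rw [this]; exact neg_ne_zero.2 hrd
  obtain ⟨sub1, dis1⟩ := strip_subset hv1 hρ1
  obtain ⟨sub2, dis2⟩ := strip_subset hv2 hρ2
  have hρw := hρ 1 (hseg 1 ⟨one_pos, le_rfl⟩)
  -- each strip meets the cap, near the tip
  have hmeet : ∀ v : Plane, cross d v ≠ 0 → (strip u d v ρ ∩ cap).Nonempty := by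
    intro v hv
    set K : Plane → Prop := fun y => y ∈ Metric.ball (u + d) r
    have hcont : Filter.Tendsto (fun t : ℝ => u + t • d + ((1 - t) * ρ t) • v) (𝓝[<] 1)
        (𝓝 (u + d)) := by
      have hc : Continuous (fun t : ℝ => u + t • d + ((1 - t) * ρ t) • v) := by fun_prop
      have := hc.tendsto 1
      simp only [one_smul, sub_self, zero_mul, zero_smul, add_zero] at this
      exact this.mono_left nhdsWithin_le_nhds
    have h1 := hcont.eventually (Metric.ball_mem_nhds _ hrp)
    have h2 : ∀ᶠ t : ℝ in 𝓝[<] 1, t ∈ Ioo (0 : ℝ) 1 := Ioo_mem_nhdsLT one_pos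
    obtain ⟨t, ht1, ht2⟩ := (h1.and h2).exists
    refine ⟨_, ⟨(t, 1 - t), ⟨ht2, by linarith [ht2.2], by linarith [ht2.1]⟩, rfl⟩, ht1, ?_⟩
    rintro ⟨c, -, e⟩
    have := congrArg (fun y => cross d (y - u)) e
    simp only [add_assoc, add_sub_cancel_left, cross_add, cross_smul, cross_same, mul_zero,
      zero_add] at this
    have e0 : cross d (-d) = 0 := by simp [cross]; ring
    rw [e0, mul_zero] at this
    have hp := (hρ1 t ht2).1
    exact mul_ne_zero (mul_pos (by linarith [ht2.2]) hp).ne' hv this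
  set N := strip u d (rot d) ρ ∪ cap ∪ strip u d (-rot d) ρ with hN
  have hNc : IsPreconnected N := by
    obtain ⟨x, hx1, hx2⟩ := hmeet _ hv1
    obtain ⟨y, hy1, hy2⟩ := hmeet _ hv2
    exact ((isPreconnected_strip u d (rot d) hρc).union x hx1 hx2 hcapc).union y (Or.inr hy2) hy1
      (isPreconnected_strip u d (-rot d) hρc)
  have hNsub : N ⊆ U \ S := by
    rintro x ((hx | hx) | hx)
    · exact ⟨sub1 hx, by rintro ⟨t, -, rfl⟩; exact dis1 t hx⟩
    · refine ⟨hb hx.1, ?_⟩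
      rintro ⟨t, ht, rfl⟩
      exact hx.2 ⟨1 - t, by linarith [ht.2], by module⟩
    · exact ⟨sub2 hx, by rintro ⟨t, -, rfl⟩; exact dis2 t hx⟩
  have hSc : IsConnected S := (isConnected_Ioc one_pos).image _ (by fun_prop)
  rw [hUS]
  have := CompLE.diff hU hcl hSU hSc {N} (by
    intro N' hN'
    rw [Finset.mem_singleton] at hN'
    subst hN'
    exact ⟨hNc, hNsub, ((strip_nonempty u d (rot d) ρ).mono
      (subset_union_left.trans subset_union_left))⟩) ?_ h
  · simpa using this
  · rintro _ ⟨t, ht, rfl⟩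
    simp only [Finset.mem_singleton, iUnion_iUnion_eq_left]
    rcases ht.2.lt_or_eq with h1 | h1
    · filter_upwards [nhds_strip (u := u) hd hρc (fun t ht => (hρ1 t ht).1) ⟨ht.1, h1⟩] with y hy
      rcases hy with ⟨t', ht', rfl⟩ | hy | hy
      · exact Or.inl ⟨t', ⟨ht'.1, ht'.2.le⟩, rfl⟩
      · exact Or.inr (Or.inl (Or.inl hy))
      · exact Or.inr (Or.inr hy)
    · subst h1
      rw [one_smul]
      filter_upwards [Metric.ball_mem_nhds (u + d) hrp] with y hy
      by_cases hray : ∃ c : ℝ, 0 ≤ c ∧ y = (u + d) + c • (-d)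
      · obtain ⟨c, hc, rfl⟩ := hray
        refine Or.inl ⟨1 - c, ⟨?_, by linarith⟩, by module⟩
        rw [mem_ball_iff_norm, add_sub_cancel_left, norm_smul, norm_neg, Real.norm_eq_abs,
          abs_of_nonneg hc] at hy
        have : c * ‖d‖ < ‖d‖ := hy.trans_le (min_le_right _ _)
        nlinarith
      · exact Or.inr (Or.inl (Or.inr ⟨hy, hray⟩))

/-- Cutting along a segment with both ends outside the open set and all other points inside it
creates at most one new component. -/
theorem CompLE.diff_segment_cross {U : Set Plane} (hU : IsOpen U) {u d : Plane} (hd : d ≠ 0)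
    (hu : u ∉ U) (hw : u + d ∉ U) (hseg : ∀ t ∈ Ioo (0 : ℝ) 1, u + t • d ∈ U) {n : ℕ}
    (h : CompLE U (n + 1)) : CompLE (U \ segment ℝ u (u + d)) (n + 2) := by
  classical
  set S : Set Plane := (fun t : ℝ => u + t • d) '' Ioo 0 1 with hS
  have hUS : U \ segment ℝ u (u + d) = U \ S := by
    rw [segment_eq_image_add]
    ext x
    simp only [mem_sdiff, hS, mem_image, not_exists, not_and]
    refine and_congr_right fun hx => ⟨fun h t ht => h t ⟨ht.1.le, ht.2.le⟩, fun h t ht e => ?_⟩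
    rcases ht.1.lt_or_eq with h0 | h0
    · rcases ht.2.lt_or_eq with h1 | h1
      · exact h t ⟨h0, h1⟩ e
      · apply hw; rw [h1] at e; simp only [one_smul] at e; rwa [e]
    · apply hu; rw [← h0] at e; simp only [zero_smul, add_zero] at e; rwa [e]
  have hcl : IsOpen (U \ S) := by
    rw [← hUS]; exact hU.sdiff (isCompact_segment' _ _).isClosed
  obtain ⟨ρ, hρc, hρ⟩ := exists_width hU ⟨u, hu⟩ u d (rot d)
  have hrd := (sqLen_pos hd).ne'
  have hSU : S ⊆ U := by rintro _ ⟨t, ht, rfl⟩; exact hseg t ht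
  have hρ1 : ∀ t ∈ Ioo (0 : ℝ) 1, 0 < ρ t ∧ ∀ r : ℝ, |r| < ρ t → u + t • d + r • rot d ∈ U :=
    fun t ht => hρ t (hseg t ht)
  have hρ2 : ∀ t ∈ Ioo (0 : ℝ) 1, 0 < ρ t ∧ ∀ r : ℝ, |r| < ρ t → u + t • d + r • (-rot d) ∈ U := by
    intro t ht
    refine ⟨(hρ1 t ht).1, fun r hr => ?_⟩
    have := (hρ1 t ht).2 (-r) (by rwa [abs_neg])
    simpa using this
  have hv1 : cross d (rot d) ≠ 0 := by rw [cross_rot]; exact hrd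
  have hv2 : cross d (-rot d) ≠ 0 := by
    have : cross d (-rot d) = - sqLen d := by simp [cross, rot, sqLen]; ring
    rw [this]; exact neg_ne_zero.2 hrd
  obtain ⟨sub1, dis1⟩ := strip_subset hv1 hρ1
  obtain ⟨sub2, dis2⟩ := strip_subset hv2 hρ2
  have hSc : IsConnected S := (isConnected_Ioo one_pos).image _ (by fun_prop)
  rw [hUS]
  have := CompLE.diff hU hcl hSU hSc {strip u d (rot d) ρ, strip u d (-rot d) ρ} (by
    intro N' hN'
    rw [Finset.mem_insert, Finset.mem_singleton] at hN'
    rcases hN' with rfl | rfl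
    · exact ⟨isPreconnected_strip _ _ _ hρc,
        fun x hx => ⟨sub1 hx, by rintro ⟨t, -, rfl⟩; exact dis1 t hx⟩, strip_nonempty _ _ _ _⟩
    · exact ⟨isPreconnected_strip _ _ _ hρc,
        fun x hx => ⟨sub2 hx, by rintro ⟨t, -, rfl⟩; exact dis2 t hx⟩, strip_nonempty _ _ _ _⟩)
    ?_ h
  · exact this.mono (Nat.add_le_add_left Finset.card_le_two _)
  · rintro _ ⟨t, ht, rfl⟩
    simp only [Finset.mem_insert, Finset.mem_singleton, iUnion_iUnion_eq_or_left,
      iUnion_iUnion_eq_left]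
    exact nhds_strip hd hρc (fun t ht => (hρ1 t ht).1) ht

theorem segment_add_smul {u d : Plane} {τ : ℝ} (hτ : 0 ≤ τ) :
    segment ℝ u (u + τ • d) = (fun t : ℝ => u + t • d) '' Icc 0 τ := by
  rw [segment_eq_image_add]
  ext x
  constructor
  · rintro ⟨t, ht, rfl⟩
    exact ⟨t * τ, ⟨mul_nonneg ht.1 hτ, by nlinarith [ht.2]⟩, by simp [smul_smul]⟩
  · rintro ⟨t, ht, rfl⟩
    rcases hτ.lt_or_eq with h | h
    · refine ⟨t / τ, ⟨div_nonneg ht.1 hτ, (div_le_one h).2 ht.2⟩, ?_⟩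
      simp [smul_smul, div_mul_cancel₀ _ h.ne']
    · rw [← h] at ht
      have : t = 0 := le_antisymm ht.2 ht.1
      exact ⟨0, by simp, by simp [this]⟩

/-- Cutting an open set along a segment creates at most as many new components as there are points
of the segment, other than its starting point, outside the open set. -/
theorem CompLE.diff_segment (E : Finset Plane) {U : Set Plane} (hU : IsOpen U) {u d : Plane}
    (hd : d ≠ 0) (hu : u ∉ U) (hseg : ∀ t ∈ Ioc (0 : ℝ) 1, u + t • d ∈ U ∨ u + t • d ∈ E) {n : ℕ}
    (h : CompLE U (n + 1)) : CompLE (U \ segment ℝ u (u + d)) (n + 1 + E.card) := by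
  classical
  induction hE : E.card generalizing E U u d n with
  | zero =>
    rw [Finset.card_eq_zero] at hE
    exact h.diff_segment_tip hU hd hu fun t ht => by simpa [hE] using hseg t ht
  | succ m ih =>
    by_cases hall : ∀ t ∈ Ioc (0 : ℝ) 1, u + t • d ∈ U
    · exact (h.diff_segment_tip hU hd hu hall).mono (by omega)
    push Not at hall
    have hinj : Function.Injective fun t : ℝ => u + t • d := fun s t e =>
      smul_left_injective ℝ hd (add_left_cancel e)
    set B : Set ℝ := {t | t ∈ Ioc (0 : ℝ) 1 ∧ u + t • d ∉ U} with hB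
    have hBf : B.Finite := by
      refine (E.finite_toSet.preimage hinj.injOn).subset ?_
      rintro t ⟨ht, htU⟩
      exact (hseg t ht).resolve_left htU
    obtain ⟨τ, hτ, hmin⟩ := hBf.exists_minimalFor id B (by
      obtain ⟨t, ht, htU⟩ := hall; exact ⟨t, ht, htU⟩)
    have hlow : ∀ t, 0 < t → t < τ → u + t • d ∈ U := by
      intro t h0 h1
      by_contra hc
      have := hmin (show t ∈ B from ⟨⟨h0, h1.le.trans hτ.1.2⟩, hc⟩) h1.le
      exact absurd h1 (not_lt.2 this)
    have hτ0 := hτ.1.1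
    have hcut := h.diff_segment_cross hU (d := τ • d) (smul_ne_zero hτ0.ne' hd) hu hτ.2
      (fun t ht => by
        rw [smul_smul]
        exact hlow _ (mul_pos ht.1 hτ0) (by nlinarith [ht.2]))
    rcases hτ.1.2.lt_or_eq with hτ1 | hτ1
    · set U' := U \ segment ℝ u (u + τ • d) with hU'
      have hU'o : IsOpen U' := hU.sdiff (isCompact_segment' _ _).isClosed
      have hEτ : u + τ • d ∈ E := (hseg τ hτ.1).resolve_left hτ.2
      have := ih (E.erase (u + τ • d)) hU'o (u := u + τ • d) (d := (1 - τ) • d)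
        (smul_ne_zero (by linarith) hd) (fun hx => hτ.2 hx.1) (fun t ht => by
          have e : u + τ • d + t • (1 - τ) • d = u + (τ + t * (1 - τ)) • d := by module
          have hpos : 0 < t * (1 - τ) := mul_pos ht.1 (by linarith)
          rw [e]
          rcases hseg (τ + t * (1 - τ)) ⟨by linarith, by nlinarith [ht.2]⟩ with h1 | h1
          · refine Or.inl ⟨h1, ?_⟩
            rw [segment_add_smul hτ0.le]
            rintro ⟨s, hs, e2⟩
            have := hinj e2
            linarith [hs.2]
          · refine Or.inr (Finset.mem_erase.2 ⟨fun e2 => ?_, h1⟩)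
            have := hinj e2
            linarith) hcut (by rw [Finset.card_erase_of_mem hEτ, hE]; rfl)
      have heq : U \ segment ℝ u (u + d) =
          U' \ segment ℝ (u + τ • d) (u + τ • d + (1 - τ) • d) := by
        have e2 : u + τ • d + (1 - τ) • d = u + d := by module
        rw [hU', Set.sdiff_sdiff, e2]
        have hms : u + τ • d ∈ segment ℝ u (u + d) := by
          rw [segment_eq_image_add]; exact ⟨τ, ⟨hτ0.le, hτ1.le⟩, rfl⟩
        congr 1
        apply Subset.antisymm
        · rw [segment_eq_image_add]
          rintro _ ⟨t, ht, rfl⟩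
          rcases le_total t τ with h1 | h1
          · left; rw [segment_add_smul hτ0.le]; exact ⟨t, ⟨ht.1, h1⟩, rfl⟩
          · right
            rw [← e2, segment_eq_image_add]
            refine ⟨(t - τ) / (1 - τ), ⟨div_nonneg (by linarith) (by linarith),
              (div_le_one (by linarith)).2 (by linarith [ht.2])⟩, ?_⟩
            simp only [smul_smul, div_mul_cancel₀ _ (show (1 - τ) ≠ 0 by linarith)]
            module
        · exact union_subset (segment_subset_right hms) (segment_subset_left hms)
      rw [heq]
      exact this.mono (by omega)
    · rw [hτ1, one_smul] at hcut
      exact hcut.mono (by omega)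

/-- Cutting an open set along a path of a polygon creates at most as many new components as there
are points where the path runs into the complement of the open set or into its own past. -/
theorem CompLE.diff_path (P : ClosedPolygon Plane) (hv : ∀ i, P.vertex i ≠ P.vertex (i + 1))
    {U : Set Plane} (hU : IsOpen U) {t₀ T : ℝ} (hT : t₀ ≤ T) (h0 : P.path t₀ ∉ U) {n : ℕ}
    (h : CompLE U (n + 1)) {B : Set ℝ}
    (hB : ∀ s ∈ Ioc t₀ T, P.path s ∉ U ∨ (∃ s' ∈ Ico t₀ s, P.path s' = P.path s) → s ∈ B)
    (hBT : B ⊆ Ioc t₀ T) (hBinj : InjOn P.path B) (hBf : B.Finite) :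
    CompLE (U \ P.path '' Icc t₀ T) (n + 1 + B.ncard) := by
  classical
  have hclosed : ∀ t, IsOpen (U \ P.path '' Icc t₀ t) := fun t =>
    hU.sdiff (isCompact_Icc.image P.continuous_path).isClosed
  have key : ∀ (m : ℕ) (t : ℝ), t₀ ≤ t → t ≤ T → t ≤ ⌊t₀⌋ + m + 1 →
      CompLE (U \ P.path '' Icc t₀ t) (n + 1 + (B ∩ Iic t).ncard) := by
    have step : ∀ (i : ℤ) (t t' : ℝ), t₀ ≤ t → t < t' → t' ≤ T → (i : ℝ) ≤ t → t' ≤ i + 1 →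
        CompLE (U \ P.path '' Icc t₀ t) (n + 1 + (B ∩ Iic t).ncard) →
        CompLE (U \ P.path '' Icc t₀ t') (n + 1 + (B ∩ Iic t').ncard) := by
      intro i t t' ht htt' ht' hit hit' hc
      have haff : ∀ s ∈ Icc (0 : ℝ) 1,
          P.path t + s • (P.path t' - P.path t) = P.path (t + s * (t' - t)) := by
        intro s hs
        rw [P.path_of_mem i ⟨hit, by linarith⟩, P.path_of_mem i ⟨by linarith, hit'⟩,
          P.path_of_mem i ⟨by nlinarith [hs.1], by nlinarith [hs.2]⟩]
        simp only [AffineMap.lineMap_apply_module']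
        module
      have hne : P.path t' - P.path t ≠ 0 := by
        rw [sub_ne_zero]
        intro e
        rw [P.path_of_mem i ⟨hit, by linarith⟩, P.path_of_mem i ⟨by linarith, hit'⟩] at e
        have := AffineMap.lineMap_injective ℝ (hv i) e
        linarith
      have hf1 : (B ∩ Iic t).Finite := hBf.subset inter_subset_left
      have hf2 : (B ∩ Ioc t t').Finite := hBf.subset inter_subset_left
      set E : Finset Plane := hf2.toFinset.image P.path with hE
      have := CompLE.diff_segment E (hclosed t) hne (fun hx => hx.2 ⟨t, ⟨ht, le_rfl⟩, rfl⟩)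
        (fun s hs => by
          rw [haff s ⟨hs.1.le, hs.2⟩]
          set r := t + s * (t' - t)
          have hr1 : t < r := by have := mul_pos hs.1 (sub_pos.2 htt'); linarith
          have hr2 : r ≤ t' := by nlinarith [hs.2]
          by_cases hrB : r ∈ B
          · refine Or.inr (Finset.mem_image_of_mem _ ?_)
            rw [Set.Finite.mem_toFinset]
            exact ⟨hrB, hr1, hr2⟩
          · refine Or.inl ⟨?_, ?_⟩
            · by_contra hc
              exact hrB (hB r ⟨by linarith, by linarith⟩ (Or.inl hc))
            · rintro ⟨s', hs', e⟩
              exact hrB (hB r ⟨by linarith, by linarith⟩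
                (Or.inr ⟨s', ⟨hs'.1, by linarith [hs'.2]⟩, e⟩))) (n := n + (B ∩ Iic t).ncard)
        (hc.mono (by omega))
      have hset : U \ P.path '' Icc t₀ t' =
          (U \ P.path '' Icc t₀ t) \
            segment ℝ (P.path t) (P.path t + (P.path t' - P.path t)) := by
        have e : segment ℝ (P.path t) (P.path t + (P.path t' - P.path t)) =
            P.path '' Icc t t' := by
          rw [segment_eq_image_add]
          ext x
          constructor
          · rintro ⟨s, hs, rfl⟩
            refine ⟨t + s * (t' - t), ⟨by nlinarith [hs.1], by nlinarith [hs.2]⟩, ?_⟩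
            exact (haff s hs).symm
          · rintro ⟨r, hr, rfl⟩
            have hpos : 0 < t' - t := by linarith
            have hs : (r - t) / (t' - t) ∈ Icc (0 : ℝ) 1 :=
              ⟨div_nonneg (by linarith [hr.1]) hpos.le,
                (div_le_one hpos).2 (by linarith [hr.2])⟩
            refine ⟨(r - t) / (t' - t), hs, ?_⟩
            simp only
            rw [haff _ hs, div_mul_cancel₀ _ hpos.ne']
            congr 1; ring
        rw [e, Set.sdiff_sdiff]
        congr 1
        rw [← image_union, Icc_union_Icc_eq_Icc ht htt'.le]
      have hcard : (B ∩ Iic t').ncard = (B ∩ Iic t).ncard + E.card := by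
        have e1 : B ∩ Iic t' = (B ∩ Iic t) ∪ (B ∩ Ioc t t') := by
          rw [← inter_union_distrib_left, Iic_union_Ioc_eq_Iic htt'.le]
        rw [e1, ncard_union_eq ?_ hf1 hf2, hE, Finset.card_image_of_injOn,
          ncard_eq_toFinset_card _ hf2]
        · intro x hx y hy e
          simp only [Finite.coe_toFinset] at hx hy
          exact hBinj hx.1 hy.1 e
        · rw [Set.disjoint_left]
          rintro x ⟨_, hx⟩ ⟨_, hx'⟩
          exact absurd hx'.1 (not_lt.2 hx)
      rw [hset, hcard]
      exact this.mono (by omega)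
    have base : CompLE (U \ P.path '' Icc t₀ t₀) (n + 1 + (B ∩ Iic t₀).ncard) := by
      have e : U \ P.path '' Icc t₀ t₀ = U := by
        rw [Icc_self, image_singleton]
        exact sdiff_singleton_eq_self h0
      rw [e]
      exact h.mono (by omega)
    intro m
    induction m with
    | zero =>
      intro t ht htT hm
      rcases ht.lt_or_eq with hlt | rfl
      · exact step ⌊t₀⌋ t₀ t le_rfl hlt htT (Int.floor_le _) (by simpa using hm) base
      · exact base
    | succ m ih =>
      intro t ht htT hm
      rcases le_or_gt t (⌊t₀⌋ + m + 1) with hc | hc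
      · exact ih t ht htT hc
      · have h1 : t₀ ≤ ⌊t₀⌋ + m + 1 := by
          have := Int.lt_floor_add_one t₀
          have : (0 : ℝ) ≤ m := by positivity
          linarith
        refine step (⌊t₀⌋ + m + 1) (⌊t₀⌋ + m + 1) t h1 hc htT ?_ ?_
          (ih _ h1 (hc.le.trans htT) le_rfl)
        · push_cast; exact le_rfl
        · push_cast at hm ⊢; linarith
  have := key ⌈T - t₀⌉.toNat T hT le_rfl (by
    have h2 : (⌈T - t₀⌉ : ℝ) ≤ (⌈T - t₀⌉.toNat : ℝ) := by exact_mod_cast Int.self_le_toNat _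
    have := Int.le_ceil (T - t₀)
    linarith [Int.lt_floor_add_one t₀])
  rwa [inter_eq_left.2 (show B ⊆ Iic T from fun x hx => (hBT hx).2)] at this

end Components

/-! ### Sliding an arc that lies above the rest of a knot -/

section Delta

open Set

theorem IsArc.join {E : Type} [NormedAddCommGroup E] [NormedSpace ℝ E] {x q p : E} {L K : List E}
    (h1 : IsArc (x :: L)) (hq : (x :: L).getLast? = some q) (h2 : IsArc (q :: K))
    (hp : (q :: K).getLast? = some p) (hint : chain (x :: L) ∩ chain (q :: K) ⊆ {q}) :
    IsArc (x :: (L ++ K)) ∧ (x :: (L ++ K)).getLast? = some p ∧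
      chain (x :: (L ++ K)) = chain (x :: L) ∪ chain (q :: K) := by
  obtain ⟨l, hl⟩ := List.getLast?_eq_some_iff.1 hq
  have e : x :: (L ++ K) = l ++ q :: K := by
    rw [← List.cons_append, hl]; simp
  rw [e, isArc_append_iff, chain_append l q K, ← hl]
  refine ⟨⟨h1, h2, hint⟩, ?_, rfl⟩
  rw [List.getLast?_append, hp]
  rfl

theorem chain_concat {E : Type} [NormedAddCommGroup E] [NormedSpace ℝ E] {x p c : E} {L : List E}
    (hp : (x :: L).getLast? = some p) (hpc : p ≠ c) (h1 : IsArc (x :: L))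
    (hint : chain (x :: L) ∩ segment ℝ p c ⊆ {p}) :
    IsArc (x :: (L ++ [c])) ∧ (x :: (L ++ [c])).getLast? = some c ∧
      chain (x :: (L ++ [c])) = chain (x :: L) ∪ segment ℝ p c := by
  have e : chain [p, c] = segment ℝ p c := by
    simp [chain, right_mem_segment]
  obtain ⟨h2, h3, h4⟩ := h1.join hp (K := [c]) (p := c) ⟨hpc, by simp [chain], trivial⟩ (by simp)
    (by rwa [e])
  exact ⟨h2, h3, by rw [h4, e]⟩

/-- Raise or lower a point to the height `H`. -/
def flat (H : ℝ) (z : Space) : Space := (z.1, H)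

theorem image_fst_segment (a b : Space) :
    Prod.fst '' segment ℝ a b = segment ℝ a.1 b.1 :=
  image_segment ℝ (LinearMap.fst ℝ Plane ℝ).toAffineMap a b

theorem chain_map_fst (L : List Space) : chain (L.map Prod.fst) = Prod.fst '' chain L := by
  induction L with
  | nil => simp [chain]
  | cons a l ih =>
    cases l with
    | nil => simp [chain]
    | cons b l =>
      simp only [List.map_cons] at ih
      simp only [List.map_cons, chain, image_union, image_fst_segment, ih]

theorem eq_of_fst_eq_segment {a b z z' : Space} (hab : a.1 ≠ b.1) (hz : z ∈ segment ℝ a b)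
    (hz' : z' ∈ segment ℝ a b) (e : z.1 = z'.1) : z = z' := by
  rw [segment_eq_image_lineMap] at hz hz'
  obtain ⟨s, -, rfl⟩ := hz
  obtain ⟨t, -, rfl⟩ := hz'
  have : AffineMap.lineMap a.1 b.1 s = (AffineMap.lineMap a.1 b.1 t : Plane) := by
    simpa [AffineMap.lineMap_apply_module] using e
  rw [AffineMap.lineMap_injective ℝ hab this]

/-- A chain in space whose projection is a simple arc projects injectively. -/
theorem injOn_fst_chain {L : List Space} (h : IsArc (L.map Prod.fst)) :
    InjOn Prod.fst (chain L) := by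
  induction L with
  | nil => simp [chain]
  | cons a l ih =>
    cases l with
    | nil => simp [chain]
    | cons b l =>
      simp only [List.map_cons] at ih h
      obtain ⟨h1, h2, h3⟩ := h
      have ih := ih h3
      have e := chain_map_fst (b :: l)
      simp only [List.map_cons] at e
      have mix : ∀ z ∈ segment ℝ a b, ∀ z' ∈ chain (b :: l), z.1 = z'.1 → z = z' := by
        intro z hz z' hz' ez
        have hzb : z.1 = b.1 := by
          refine h2 ⟨?_, ?_⟩
          · rw [← image_fst_segment]; exact ⟨z, hz, rfl⟩
          · rw [e]; exact ⟨z', hz', ez.symm⟩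
        rw [eq_of_fst_eq_segment h1 hz (right_mem_segment ℝ _ _) hzb]
        exact ih (head_mem_chain _ _) hz' (hzb.symm.trans ez)
      rintro z (hz | hz) z' (hz' | hz') ez
      · exact eq_of_fst_eq_segment h1 hz hz' ez
      · exact mix z hz z' hz' ez
      · exact (mix z' hz' z hz ez.symm).symm
      · exact ih hz hz' ez

theorem isArc_of_map_fst {L : List Space} (h : IsArc (L.map Prod.fst)) : IsArc L := by
  induction L with
  | nil => exact h
  | cons a l ih =>
    cases l with
    | nil => trivial
    | cons b l =>
      have hinj := injOn_fst_chain h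
      simp only [List.map_cons] at ih h
      obtain ⟨h1, h2, h3⟩ := h
      have e := chain_map_fst (b :: l)
      simp only [List.map_cons] at e
      refine ⟨fun h => h1 (congrArg _ h), ?_, ih h3⟩
      rintro z ⟨hz, hz'⟩
      have hzb : z.1 = b.1 := by
        refine h2 ⟨?_, ?_⟩
        · rw [← image_fst_segment]; exact ⟨z, hz, rfl⟩
        · rw [e]; exact ⟨z, hz', rfl⟩
      exact hinj (Or.inl hz) (Or.inr (head_mem_chain _ _)) hzb

theorem not_collinear_of_vertical {A B C : Space} (h1 : A.1 = B.1) (h2 : A.2 ≠ B.2)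
    (h3 : A.1 ≠ C.1) : ¬ Collinear ℝ {A, B, C} := by
  intro h
  obtain ⟨v, hv⟩ := (collinear_iff_of_mem (p₀ := A) (by simp)).1 h
  obtain ⟨r, hr⟩ := hv B (by simp)
  obtain ⟨s, hs⟩ := hv C (by simp)
  have r1 := congrArg Prod.fst hr
  have r2 := congrArg Prod.snd hr
  have s1 := congrArg Prod.fst hs
  simp only [vadd_eq_add, Prod.fst_add, Prod.snd_add, Prod.smul_fst, Prod.smul_snd,
    smul_eq_mul] at r1 r2 s1
  have hr0 : r ≠ 0 := by rintro rfl; simp at r2; exact h2 r2.symm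
  rw [← h1] at r1
  have hv0 : v.1 = 0 := by
    have : r • v.1 = 0 := by simpa using r1.symm
    exact (smul_eq_zero.1 this).resolve_left hr0
  rw [hv0] at s1
  simp at s1
  exact h3 s1.symm

theorem not_collinear_of_horizontal {A B C : Space} (h1 : A.2 = B.2) (h2 : A ≠ B)
    (h3 : A.2 ≠ C.2) : ¬ Collinear ℝ {A, B, C} := by
  intro h
  obtain ⟨v, hv⟩ := (collinear_iff_of_mem (p₀ := A) (by simp)).1 h
  obtain ⟨r, hr⟩ := hv B (by simp)
  obtain ⟨s, hs⟩ := hv C (by simp)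
  have r2 := congrArg Prod.snd hr
  have s2 := congrArg Prod.snd hs
  simp only [vadd_eq_add, Prod.snd_add, Prod.smul_snd, smul_eq_mul] at r2 s2
  have hr0 : r ≠ 0 := by rintro rfl; simp at hr; exact h2 hr.symm
  rw [← h1] at r2
  have hv0 : v.2 = 0 := by
    have : r * v.2 = 0 := by linarith
    exact (mul_eq_zero.1 this).resolve_left hr0
  rw [hv0] at s2
  simp at s2
  exact h3 s2.symm

/-- An elementary move described by the unchanged part of the knot, an arc from `Y` to `X`. -/
theorem deltaMove_of_arc {X Y C : Space} {K : List Space} (hR : IsArc (Y :: K))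
    (hX : (Y :: K).getLast? = some X) (hind : ¬ Collinear ℝ {X, Y, C})
    (htri : ∀ z ∈ convexHull ℝ {X, Y, C}, z ∈ chain (Y :: K) → z = X ∨ z = Y) :
    DeltaMove (chain (Y :: K) ∪ segment ℝ X Y)
      (chain (Y :: K) ∪ (segment ℝ X C ∪ segment ℝ C Y)) := by
  have hXY : X ≠ Y := by
    rintro rfl; apply hind; simp [collinear_pair]
  have hXC : X ≠ C := by
    rintro rfl; apply hind
    rw [insert_comm]; simp [collinear_pair]
  have hCY : C ≠ Y := by
    rintro rfl; apply hind; simp [collinear_pair]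
  have hsXY : segment ℝ X Y ⊆ convexHull ℝ {X, Y, C} := segment_subset_convexHull (by simp) (by simp)
  have hsXC : segment ℝ X C ⊆ convexHull ℝ {X, Y, C} := segment_subset_convexHull (by simp) (by simp)
  have hsCY : segment ℝ C Y ⊆ convexHull ℝ {X, Y, C} := segment_subset_convexHull (by simp) (by simp)
  have hXm : X ∈ chain (Y :: K) := mem_chain_of_getLast? hX
  have hYm : Y ∈ chain (Y :: K) := head_mem_chain _ _
  have e1 : chain [X, Y] = segment ℝ X Y := by simp [chain, right_mem_segment]
  have e2 : chain [X, C, Y] = segment ℝ X C ∪ segment ℝ C Y := by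
    simp [chain, right_mem_segment]
  obtain ⟨P, hP1, hP2, -⟩ := exists_polygon (M := []) hR hX
    (show IsArc [X, Y] from ⟨hXY, by simp [chain], trivial⟩) (by
      rintro z ⟨hz, hz'⟩
      simp only [List.nil_append] at hz'
      rw [e1] at hz'
      rcases htri z (hsXY hz') hz with rfl | rfl <;> simp)
  obtain ⟨P', hP1', hP2', -⟩ := exists_polygon (M := [C]) hR hX
    (show IsArc [X, C, Y] from ⟨hXC, by
      rintro z ⟨hz, hz'⟩
      simp only [chain, union_singleton, insert_eq_of_mem (right_mem_segment ℝ C Y)] at hz'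
      rw [segment_symm, segment_eq_image'] at hz
      rw [segment_eq_image'] at hz'
      obtain ⟨s, hs, rfl⟩ := hz
      obtain ⟨t, ht, e⟩ := hz'
      simp only at e
      by_cases hs0 : s = 0
      · simp [hs0]
      · exfalso
        apply hind
        rw [collinear_iff_of_mem (p₀ := C) (by simp)]
        refine ⟨Y - C, ?_⟩
        rintro p (rfl | rfl | rfl)
        · refine ⟨t / s, ?_⟩
          have e' : s • (p - C) = t • (Y - C) := (add_left_cancel e).symm
          rw [vadd_eq_add, ← sub_eq_iff_eq_add, div_eq_inv_mul, mul_smul, ← e', smul_smul,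
            inv_mul_cancel₀ hs0, one_smul]
        · exact ⟨1, by simp⟩
        · exact ⟨0, by simp⟩, hCY, by simp [chain], trivial⟩) (by
      rintro z ⟨hz, hz'⟩
      simp only [List.cons_append, List.nil_append] at hz'
      rw [e2] at hz'
      rcases hz' with hz' | hz'
      · rcases htri z (hsXC hz') hz with rfl | rfl <;> simp
      · rcases htri z (hsCY hz') hz with rfl | rfl <;> simp)
  simp only [List.cons_append, List.nil_append] at hP2 hP2'
  rw [e1] at hP2
  rw [e2] at hP2'
  refine ⟨⟨⟨P, hP1⟩, hP2⟩, ⟨⟨P', hP1'⟩, hP2'⟩, X, Y, C,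
    affineIndependent_iff_not_collinear_set.2 hind, ?_, ?_⟩
  · ext z
    constructor
    · rintro ⟨hz, hz' | hz'⟩
      · rcases htri z hz hz' with rfl | rfl
        · exact left_mem_segment ℝ _ _
        · exact right_mem_segment ℝ _ _
      · exact hz'
    · exact fun hz => ⟨hsXY hz, Or.inr hz⟩
  · ext z
    constructor
    · rintro (hz | hz)
      · by_cases hzs : z ∈ segment ℝ X Y
        · rcases htri z (hsXY hzs) hz with rfl | rfl
          · exact Or.inr (Or.inl (left_mem_segment ℝ _ _))
          · exact Or.inr (Or.inr (right_mem_segment ℝ _ _))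
        · exact Or.inl ⟨Or.inl hz, hzs⟩
      · exact Or.inr hz
    · rintro (⟨hz | hz, hz'⟩ | hz)
      · exact Or.inl hz
      · exact absurd hz hz'
      · exact Or.inr hz

/-- The vertical wall between the segment `bb'` and the plane of height `H`. -/
def wall (H : ℝ) (b b' : Space) : Set Space :=
  {z | z.2 ≤ H ∧ ∃ y ∈ segment ℝ b b', z.1 = y.1 ∧ y.2 ≤ z.2}

theorem convex_wall (H : ℝ) (b b' : Space) : Convex ℝ (wall H b b') := by
  rintro x ⟨hx, y, hy, e, hxy⟩ x' ⟨hx', y', hy', e', hxy'⟩ s t hs ht hst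
  refine ⟨?_, s • y + t • y', convex_segment _ _ hy hy' hs ht hst, ?_, ?_⟩
  · simp only [Prod.snd_add, Prod.smul_snd, smul_eq_mul]
    have et : t = 1 - s := by linarith
    rw [et] at ht ⊢
    nlinarith
  · simp [e, e']
  · simp only [Prod.snd_add, Prod.smul_snd, smul_eq_mul]
    nlinarith

theorem mem_wall_self {H : ℝ} {b b' z : Space} (hz : z ∈ segment ℝ b b') (h : z.2 ≤ H) :
    z ∈ wall H b b' := ⟨h, z, hz, rfl, le_rfl⟩

theorem flat_mem_wall {H : ℝ} {b b' z : Space} (hz : z ∈ segment ℝ b b') (h : z.2 ≤ H) :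
    flat H z ∈ wall H b b' := ⟨le_rfl, z, hz, rfl, h⟩

theorem convexHull_subset_wall {H : ℝ} {b b' X Y C : Space} (hX : X ∈ wall H b b')
    (hY : Y ∈ wall H b b') (hC : C ∈ wall H b b') : convexHull ℝ {X, Y, C} ⊆ wall H b b' := by
  refine convexHull_min ?_ (convex_wall H b b')
  rintro z (rfl | rfl | rfl) <;> assumption

theorem wall_flat_subset {H : ℝ} {b b' : Space} (hb : b.2 ≤ H) :
    wall H (flat H b) b' ⊆ wall H b b' := by
  rintro z ⟨hz, y, ⟨s, t, hs, ht, hst, rfl⟩, e, hy⟩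
  refine ⟨hz, s • b + t • b', ⟨s, t, hs, ht, hst, rfl⟩, ?_, le_trans ?_ hy⟩
  · simpa [flat] using e
  · simp only [flat, Prod.snd_add, Prod.smul_snd, smul_eq_mul]
    nlinarith

end Delta

/-! ### Lifting an arc to a horizontal plane -/

section Lift

open Set

/-- Pushing an arc, which lies above the remaining knot, up to the plane of height `H`, starting
with the arc `K` from `q` to the lifted starting point of the edge `bb'`. -/
theorem eqvGen_lift_step (H : ℝ) (B : List Space) : ∀ (b b' q : Space) (K : List Space),
    IsArc ((b :: b' :: B).map Prod.fst) → (b' :: B).getLast? = some q →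
    (∀ z ∈ chain (b :: b' :: B), z.2 < H) → IsArc (q :: K) →
    (q :: K).getLast? = some (flat H b) →
    (∀ z ∈ chain (q :: K), ∀ y ∈ chain (b :: b' :: B), z.1 = y.1 → y.2 ≤ z.2 →
      z.1 = b.1 ∨ z = q) →
    Relation.EqvGen DeltaMove (chain (q :: K) ∪ segment ℝ (flat H b) b' ∪ chain (b' :: B))
      (chain (q :: K) ∪ chain ((b :: b' :: B).map (flat H)) ∪ segment ℝ (flat H q) q) := by
  induction B with
  | nil =>
    intro b b' q K hB hq hH hK hKl hcond
    obtain rfl : b' = q := by simpa using hq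
    have hne : b.1 ≠ b'.1 := hB.1
    have hb : b.2 < H := hH _ (head_mem_chain _ _)
    have hb' : b'.2 < H := hH _ (mem_chain_of_mem (by simp))
    have hmove := deltaMove_of_arc (C := flat H b') hK hKl (by
      rw [insert_comm, pair_comm]
      refine not_collinear_of_vertical rfl hb'.ne ?_
      exact hne.symm) (by
      intro z hz hzK
      have hz1 := convexHull_subset_wall (H := H) (b := flat H b) (b' := b')
        (mem_wall_self (left_mem_segment ℝ _ _) le_rfl)
        (mem_wall_self (right_mem_segment ℝ _ _) hb'.le)
        (flat_mem_wall (right_mem_segment ℝ _ _) hb'.le) hz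
      obtain ⟨-, y, hy, e, hyz⟩ := wall_flat_subset hb.le hz1
      rcases hcond z hzK y (Or.inl hy) e hyz with h | h
      · left
        obtain ⟨hzH, y, hy, e, hyz⟩ := hz1
        have : y = flat H b := eq_of_fst_eq_segment (a := flat H b) (b := b') hne hy
          (left_mem_segment ℝ _ _) (e.symm.trans h)
        subst this
        exact Prod.ext h (le_antisymm hzH hyz)
      · exact Or.inr h)
    have e1 : chain (b' :: K) ∪ segment ℝ (flat H b) b' ∪ chain [b'] =
        chain (b' :: K) ∪ segment ℝ (flat H b) b' := by
      rw [union_eq_left]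
      simp only [chain, singleton_subset_iff]
      exact Or.inr (right_mem_segment ℝ _ _)
    have e2 : chain (b' :: K) ∪ chain ([b, b'].map (flat H)) ∪ segment ℝ (flat H b') b' =
        chain (b' :: K) ∪ (segment ℝ (flat H b) (flat H b') ∪ segment ℝ (flat H b') b') := by
      simp only [List.map_cons, List.map_nil, chain, union_singleton,
        insert_eq_of_mem (right_mem_segment ℝ _ _), union_assoc]
    rw [e1, e2]
    exact .rel _ _ hmove
  | cons b'' B ih =>
    intro b b' q K hB hq hH hK hKl hcond
    have hne : b.1 ≠ b'.1 := hB.1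
    have hne' : b'.1 ≠ b''.1 := hB.2.2.1
    have hb : b.2 < H := hH _ (head_mem_chain _ _)
    have hb' : b'.2 < H := hH _ (mem_chain_of_mem (by simp))
    have hb'' : b''.2 < H := hH _ (mem_chain_of_mem (by simp))
    have hinj := injOn_fst_chain hB
    have hmapt := chain_map_fst (b' :: b'' :: B)
    have hmapt2 := chain_map_fst (b'' :: B)
    have htail : IsArc ((b' :: b'' :: B).map Prod.fst) := hB.2.2
    have hqt : q ∈ chain (b'' :: B) := mem_chain_of_getLast? (by simpa using hq)
    have hqt' : q ∈ chain (b' :: b'' :: B) := Or.inr hqt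
    -- points of the tail do not lie over `b`, points of the second tail not over `b'`
    have hnb : ∀ z ∈ chain (b' :: b'' :: B), z.1 ≠ b.1 := by
      intro z hz e
      exact hB.head_notMem (by rw [← e]; exact hmapt.symm.subset ⟨z, hz, rfl⟩)
    have hnb' : ∀ z ∈ chain (b'' :: B), z.1 ≠ b'.1 := by
      intro z hz e
      exact htail.head_notMem (by rw [← e]; exact hmapt2.symm.subset ⟨z, hz, rfl⟩)
    have hover : ∀ z y : Space, z ∈ segment ℝ b b' → y ∈ chain (b' :: b'' :: B) → z.1 = y.1 →
        y = b' := by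
      intro z y hz hy e
      have : z.1 = b'.1 := hB.2.1 ⟨by rw [← image_fst_segment]; exact ⟨z, hz, rfl⟩,
        by rw [e]; exact hmapt.symm.subset ⟨y, hy, rfl⟩⟩
      exact hinj (Or.inr hy) (Or.inr (head_mem_chain _ _)) (e.symm.trans this)
    have hover' : ∀ z y : Space, z ∈ segment ℝ b' b'' → y ∈ chain (b'' :: B) → z.1 = y.1 →
        y = b'' := by
      intro z y hz hy e
      have : z.1 = b''.1 := htail.2.1 ⟨by rw [← image_fst_segment]; exact ⟨z, hz, rfl⟩,
        by rw [e]; exact hmapt2.symm.subset ⟨y, hy, rfl⟩⟩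
      exact hinj (Or.inr (Or.inr hy)) (Or.inr (Or.inr (head_mem_chain _ _))) (e.symm.trans this)
    -- the unchanged part for the first move
    obtain ⟨r1, r2, r3⟩ := (isArc_of_map_fst htail).join hq hK hKl (by
      rintro z ⟨hz, hzK⟩
      rcases hcond z hzK z (Or.inr hz) rfl le_rfl with h | h
      · exact absurd h (hnb z hz)
      · exact h)
    have hmove1 := deltaMove_of_arc (C := flat H b') r1 r2 (by
      rw [insert_comm, pair_comm]
      exact not_collinear_of_vertical rfl hb'.ne hne.symm) (by
      intro z hz hzR
      have hz1 := convexHull_subset_wall (H := H) (b := flat H b) (b' := b')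
        (mem_wall_self (left_mem_segment ℝ _ _) le_rfl)
        (mem_wall_self (right_mem_segment ℝ _ _) hb'.le)
        (flat_mem_wall (right_mem_segment ℝ _ _) hb'.le) hz
      obtain ⟨-, y, hy, e, hyz⟩ := wall_flat_subset hb.le hz1
      rw [r3] at hzR
      rcases hzR with hzB | hzK
      · exact Or.inr (hover y z hy hzB e.symm)
      · rcases hcond z hzK y (Or.inl hy) e hyz with h | h
        · left
          obtain ⟨hzH, y, hy, e, hyz⟩ := hz1
          have : y = flat H b := eq_of_fst_eq_segment (a := flat H b) (b := b') hne hy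
            (left_mem_segment ℝ _ _) (e.symm.trans h)
          subst this
          exact Prod.ext h (le_antisymm hzH hyz)
        · subst h
          exact Or.inr (hover y z hy hqt' e.symm))
    -- the arc `K` prolonged by the lifted edge
    obtain ⟨k1, k2, k3⟩ := chain_concat (c := flat H b') hKl
      (fun e => hne (congrArg Prod.fst e : (flat H b).1 = _)) hK (by
        rintro z ⟨hzK, hz⟩
        have hzH : z.2 = H := by
          obtain ⟨s, t, hs, ht, hst, rfl⟩ := hz
          simp only [flat, Prod.snd_add, Prod.smul_snd, smul_eq_mul]
          rw [← add_mul, hst, one_mul]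
        have hz1 : z.1 ∈ segment ℝ b.1 b'.1 := by
          have := image_fst_segment (flat H b) (flat H b')
          exact this.subset ⟨z, hz, rfl⟩
        rw [← image_fst_segment] at hz1
        obtain ⟨y, hy, e⟩ := hz1
        rcases hcond z hzK y (Or.inl hy) e.symm (by
          rw [hzH]; exact (hH y (Or.inl hy)).le) with h | h
        · exact Prod.ext h hzH
        · subst h
          exact absurd hzH (hH z (Or.inr hqt')).ne)
    have hcond' : ∀ z ∈ chain (q :: (K ++ [flat H b'])), ∀ y ∈ chain (b' :: b'' :: B),
        z.1 = y.1 → y.2 ≤ z.2 → z.1 = b'.1 ∨ z = q := by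
      intro z hz y hy e hyz
      rw [k3] at hz
      rcases hz with hz | hz
      · rcases hcond z hz y (Or.inr hy) e hyz with h | h
        · exact absurd (e.symm.trans h) (hnb y hy)
        · exact Or.inr h
      · left
        have hz1 : z.1 ∈ segment ℝ b.1 b'.1 := by
          have := image_fst_segment (flat H b) (flat H b')
          exact this.subset ⟨z, hz, rfl⟩
        rw [← image_fst_segment] at hz1
        obtain ⟨x, hx, ex⟩ := hz1
        rw [e, hover x y hx hy (ex.trans e)]
    -- the unchanged part for the second move
    have hq'' : (b'' :: B).getLast? = some q := by simpa using hq
    obtain ⟨s1, s2, s3⟩ := (isArc_of_map_fst (L := b'' :: B) htail.2.2).join hq'' k1 k2 (by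
      rintro z ⟨hz, hzK⟩
      rcases hcond' z hzK z (Or.inr hz) rfl le_rfl with h | h
      · exact absurd h (hnb' z hz)
      · exact h)
    have hmove2 := deltaMove_of_arc (C := b') s1 s2 (by
      rw [pair_comm]
      exact not_collinear_of_vertical rfl hb'.ne' hne') (by
      intro z hz hzR
      have hz1 := convexHull_subset_wall (H := H) (b := b') (b' := b'')
        (flat_mem_wall (left_mem_segment ℝ _ _) hb'.le)
        (mem_wall_self (right_mem_segment ℝ _ _) hb''.le)
        (mem_wall_self (left_mem_segment ℝ _ _) hb'.le) hz
      obtain ⟨hzH, y, hy, e, hyz⟩ := hz1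
      rw [s3] at hzR
      rcases hzR with hzB | hzK
      · exact Or.inr (hover' y z hy hzB e.symm)
      · rcases hcond' z hzK y (Or.inl hy) e hyz with h | h
        · left
          rw [k3] at hzK
          rcases hzK with hzK | hzK
          · exfalso
            have hyb : y = b' := hinj (Or.inr (Or.inl hy)) (Or.inr (head_mem_chain _ _))
              (e.symm.trans h)
            rcases hcond z hzK y (Or.inr (Or.inl hy)) e hyz with h' | h'
            · exact hne (h'.symm.trans h)
            · subst h'
              exact hnb' z hqt h
          · refine Prod.ext h ?_
            obtain ⟨s, t, hs, ht, hst, rfl⟩ := hzK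
            simp only [flat, Prod.snd_add, Prod.smul_snd, smul_eq_mul]
            rw [← add_mul, hst, one_mul]
        · subst h
          exact Or.inr (hover' y z hy hqt e.symm))
    have hrec := ih b' b'' q (K ++ [flat H b']) htail hq'' (fun z hz => hH z (Or.inr hz)) k1 k2
      hcond'
    have e1 : chain (q :: K) ∪ segment ℝ (flat H b) b' ∪ chain (b' :: b'' :: B) =
        chain (b' :: (b'' :: B ++ K)) ∪ segment ℝ (flat H b) b' := by
      rw [r3, union_right_comm, union_comm (chain (q :: K))]
    have e2 : chain (b' :: (b'' :: B ++ K)) ∪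
        (segment ℝ (flat H b) (flat H b') ∪ segment ℝ (flat H b') b') =
        chain (b'' :: (B ++ (K ++ [flat H b']))) ∪
          (segment ℝ (flat H b') b' ∪ segment ℝ b' b'') := by
      rw [r3, s3, k3]
      simp only [chain]
      ext z
      simp only [mem_union]
      tauto
    have e3 : chain (b'' :: (B ++ (K ++ [flat H b']))) ∪ segment ℝ (flat H b') b'' =
        chain (q :: (K ++ [flat H b'])) ∪ segment ℝ (flat H b') b'' ∪ chain (b'' :: B) := by
      rw [s3]
      ext z
      simp only [mem_union]
      tauto
    have e4 : chain (q :: (K ++ [flat H b'])) ∪ chain ((b' :: b'' :: B).map (flat H)) ∪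
          segment ℝ (flat H q) q =
        chain (q :: K) ∪ chain ((b :: b' :: b'' :: B).map (flat H)) ∪ segment ℝ (flat H q) q := by
      rw [k3]
      simp only [List.map_cons, chain]
      ext z
      simp only [mem_union]
      tauto
    rw [e1, ← e4]
    refine .trans _ _ _ (.rel _ _ hmove1) ?_
    rw [e2]
    refine .trans _ _ _ (.symm _ _ (.rel _ _ hmove2)) ?_
    rw [e3]
    exact hrec


theorem exists_lineMap_of_mem_cone {H : ℝ} {x y T z : Space} (hx : x.2 = H) (hy : y.2 = H)
    (hT : T.2 = H + 1) (hz : z ∈ convexHull ℝ {T, x, y}) :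
    ∃ w ∈ segment ℝ x y, w.2 = H ∧ z = AffineMap.lineMap w T (z.2 - H) ∧ H ≤ z.2 := by
  rw [convexHull_insert (by simp), convexHull_pair, mem_convexJoin] at hz
  obtain ⟨t, ht, w, hw, hz⟩ := hz
  obtain rfl : t = T := ht
  have hwH : w.2 = H := by
    obtain ⟨s, r, hs, hr, hsr, rfl⟩ := hw
    simp only [Prod.snd_add, Prod.smul_snd, smul_eq_mul, hx, hy]
    rw [← add_mul, hsr, one_mul]
  rw [segment_symm, segment_eq_image_lineMap] at hz
  obtain ⟨s, hs, rfl⟩ := hz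
  have e : (AffineMap.lineMap w t s : Space).2 = H + s := by
    simp [AffineMap.lineMap_apply_module, hwH, hT]; ring
  refine ⟨w, hw, hwH, ?_, ?_⟩
  · rw [e]; simp
  · rw [e]; linarith [hs.1]

theorem segment_cone {H : ℝ} {e T z : Space} (he : e.2 = H) (hT : T.2 = H + 1)
    (hz : z ∈ segment ℝ e T) : z = AffineMap.lineMap e T (z.2 - H) ∧ H ≤ z.2 := by
  obtain ⟨w, hw, -, h⟩ := exists_lineMap_of_mem_cone he he hT
    (segment_subset_convexHull (s := {T, e, e}) (by simp) (by simp) hz)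
  rw [segment_same] at hw
  obtain rfl : w = e := hw
  exact h

theorem lineMap_apex_inj {w e T : Space} {s : ℝ} (hs : s ≠ 1)
    (h : (AffineMap.lineMap w T s : Space) = AffineMap.lineMap e T s) : w = e := by
  simp only [AffineMap.lineMap_apply_module] at h
  have := add_right_cancel h
  exact smul_right_injective _ (sub_ne_zero.2 hs.symm) this

/-- Contracting a flat arc at height `H`, above the remaining knot, towards an apex: the arc is
replaced by the two segments that join its ends to the apex. -/
theorem eqvGen_cone_step {H : ℝ} {f e T : Space} {G : List Space} (hF : IsArc (f :: G))
    (hFe : (f :: G).getLast? = some e) (hFH : ∀ z ∈ chain (f :: G), z.2 ≤ H) (he : e.2 = H)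
    (hFH' : ∀ z ∈ chain (f :: G), z.2 = H → z = f ∨ z = e) (hT : T.2 = H + 1) :
    ∀ (C : List Space) (x : Space), IsArc (x :: C) → (x :: C).getLast? = some f →
      (∀ z ∈ chain (x :: C), z.2 = H) → e ∉ chain (x :: C) →
      Relation.EqvGen DeltaMove
        (chain (f :: G) ∪ segment ℝ e T ∪ (segment ℝ T x ∪ chain (x :: C)))
        (chain (f :: G) ∪ segment ℝ e T ∪ segment ℝ T f) := by
  have heF : e ∈ chain (f :: G) := mem_chain_of_getLast? hFe
  intro C
  induction C with
  | nil =>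
    intro x hx hxf hxH hex
    obtain rfl : x = f := by simpa using hxf
    simp only [chain, union_singleton, insert_eq_of_mem (right_mem_segment ℝ T x)]
    exact .refl _
  | cons y C ih =>
    intro x hx hxf hxH hex
    have hyf : (y :: C).getLast? = some f := by simpa using hxf
    have hyH : ∀ z ∈ chain (y :: C), z.2 = H := fun z hz => hxH z (Or.inr hz)
    have hey : e ∉ chain (y :: C) := fun h => hex (Or.inr h)
    have hx0 : x.2 = H := hxH x (head_mem_chain _ _)
    have hy0 : y.2 = H := hyH y (head_mem_chain _ _)
    obtain ⟨r1, r2, r3⟩ := hx.2.2.join hyf hF hFe (by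
      rintro z ⟨hz, hzF⟩
      rcases hFH' z hzF (hyH z hz) with h | h
      · exact h
      · exact absurd (h ▸ hz) hey)
    obtain ⟨k1, k2, k3⟩ := chain_concat (c := T) r2 (fun h => by
      rw [h, hT] at he; linarith) r1 (by
      rintro z ⟨hz, hzT⟩
      obtain ⟨h1, h2⟩ := segment_cone he hT hzT
      have hz2 : z.2 = H := by
        rw [r3] at hz
        rcases hz with hz | hz
        · exact hyH z hz
        · exact le_antisymm (hFH z hz) h2
      rw [hz2, sub_self, AffineMap.lineMap_apply_zero] at h1
      exact h1)
    have hmove := deltaMove_of_arc (C := x) k1 k2 (by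
      rw [insert_comm, pair_comm]
      exact not_collinear_of_horizontal (hy0.trans hx0.symm) hx.1.symm
        (by rw [hy0, hT]; linarith)) (by
      intro z hz hzR
      obtain ⟨w, hw, hw2, hzw, hzH⟩ := exists_lineMap_of_mem_cone hy0 hx0 hT hz
      rw [segment_symm] at hw
      rw [k3, r3] at hzR
      have hflat : z.2 = H → z ∈ segment ℝ x y := by
        intro h
        rw [h, sub_self, AffineMap.lineMap_apply_zero] at hzw
        rwa [hzw]
      rcases hzR with (hzC | hzF) | hzT
      · exact Or.inr (hx.2.1 ⟨hflat (hyH z hzC), hzC⟩)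
      · have hz2 : z.2 = H := le_antisymm (hFH z hzF) hzH
        rcases hFH' z hzF hz2 with h | h
        · exact Or.inr (hx.2.1 ⟨hflat hz2, h ▸ mem_chain_of_getLast? hyf⟩)
        · exact absurd (Or.inl (h ▸ hflat hz2)) hex
      · obtain ⟨h1, -⟩ := segment_cone he hT hzT
        by_cases hs : z.2 - H = 1
        · left; rw [h1, hs, AffineMap.lineMap_apply_one]
        · have := lineMap_apex_inj hs (hzw.symm.trans h1)
          exact absurd (Or.inl (this ▸ hw)) hex)
    have hrec := ih y hx.2.2 hyf hyH hey
    have e1 : chain (f :: G) ∪ segment ℝ e T ∪ (segment ℝ T x ∪ chain (x :: y :: C)) =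
        chain (y :: (C ++ G ++ [T])) ∪ (segment ℝ T x ∪ segment ℝ x y) := by
      rw [k3, r3]
      simp only [chain]
      ext z
      simp only [mem_union]
      tauto
    have e2 : chain (y :: (C ++ G ++ [T])) ∪ segment ℝ T y =
        chain (f :: G) ∪ segment ℝ e T ∪ (segment ℝ T y ∪ chain (y :: C)) := by
      rw [k3, r3]
      ext z
      simp only [mem_union]
      tauto
    rw [e1]
    refine .trans _ _ _ (.symm _ _ (.rel _ _ hmove)) ?_
    rw [e2]
    exact hrec

theorem eqvGen_cone {H : ℝ} {f e T c : Space} {G C : List Space} (hF : IsArc (f :: G))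
    (hFe : (f :: G).getLast? = some e) (hFH : ∀ z ∈ chain (f :: G), z.2 ≤ H)
    (hFH' : ∀ z ∈ chain (f :: G), z.2 = H → z = f ∨ z = e) (hT : T.2 = H + 1)
    (hC : IsArc (e :: c :: C)) (hCf : (c :: C).getLast? = some f)
    (hCH : ∀ z ∈ chain (e :: c :: C), z.2 = H) :
    Relation.EqvGen DeltaMove (chain (f :: G) ∪ chain (e :: c :: C))
      (chain (f :: G) ∪ segment ℝ e T ∪ segment ℝ T f) := by
  have he : e.2 = H := hCH e (head_mem_chain _ _)
  have hec := hC.head_notMem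
  have hcH : ∀ z ∈ chain (c :: C), z.2 = H := fun z hz => hCH z (Or.inr hz)
  have hc0 : c.2 = H := hcH c (head_mem_chain _ _)
  have hstep := eqvGen_cone_step hF hFe hFH he hFH' hT C c hC.2.2 hCf hcH hec
  obtain ⟨r1, r2, r3⟩ := hC.2.2.join hCf hF hFe (by
    rintro z ⟨hz, hzF⟩
    rcases hFH' z hzF (hcH z hz) with h | h
    · exact h
    · exact absurd (h ▸ hz) hec)
  have hmove := deltaMove_of_arc (C := T) r1 r2
    (not_collinear_of_horizontal (he.trans hc0.symm) hC.1 (by rw [he, hT]; linarith)) (by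
    intro z hz hzR
    have hset : ({e, c, T} : Set Space) = {T, e, c} := by
      ext; simp only [mem_insert_iff, mem_singleton_iff]; tauto
    rw [hset] at hz
    obtain ⟨w, hw, hw2, hzw, hzH⟩ := exists_lineMap_of_mem_cone he hc0 hT hz
    have hflat : z.2 = H → z ∈ segment ℝ e c := by
      intro h
      rw [h, sub_self, AffineMap.lineMap_apply_zero] at hzw
      rwa [hzw]
    rw [r3] at hzR
    rcases hzR with hzC | hzF
    · exact Or.inr (hC.2.1 ⟨hflat (hcH z hzC), hzC⟩)
    · have hz2 : z.2 = H := le_antisymm (hFH z hzF) hzH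
      rcases hFH' z hzF hz2 with h | h
      · exact Or.inr (hC.2.1 ⟨hflat hz2, h ▸ mem_chain_of_getLast? hCf⟩)
      · exact Or.inl h)
  have e1 : chain (f :: G) ∪ chain (e :: c :: C) = chain (c :: (C ++ G)) ∪ segment ℝ e c := by
    rw [r3]
    simp only [chain]
    ext z
    simp only [mem_union]
    tauto
  have e2 : chain (c :: (C ++ G)) ∪ (segment ℝ e T ∪ segment ℝ T c) =
      chain (f :: G) ∪ segment ℝ e T ∪ (segment ℝ T c ∪ chain (c :: C)) := by
    rw [r3]
    ext z
    simp only [mem_union]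
    tauto
  rw [e1]
  refine .trans _ _ _ (.rel _ _ hmove) ?_
  rw [e2]
  exact hstep

/-- An arc that lies above the rest `q :: K` of the knot is equivalent to a standard arc, which
depends on its end points only. -/
theorem eqvGen_standard (H : ℝ) {b b' q T : Space} {B K : List Space}
    (hB : IsArc ((b :: b' :: B).map Prod.fst)) (hq : (b' :: B).getLast? = some q)
    (hH : ∀ z ∈ chain (b :: b' :: B), z.2 < H) (hK : IsArc (q :: K))
    (hKb : (q :: K).getLast? = some b) (hKH : ∀ z ∈ chain (q :: K), z.2 < H)
    (hcond : ∀ z ∈ chain (q :: K), ∀ y ∈ chain (b :: b' :: B), z.1 = y.1 → y.2 ≤ z.2 →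
      z = b ∨ z = q) (hT : T.2 = H + 1) :
    Relation.EqvGen DeltaMove (chain (q :: K) ∪ chain (b :: b' :: B))
      (chain (q :: K) ∪ segment ℝ b (flat H b) ∪ segment ℝ (flat H b) T ∪
        segment ℝ T (flat H q) ∪ segment ℝ (flat H q) q) := by
  have hne : b.1 ≠ b'.1 := hB.1
  have hb : b.2 < H := hH _ (head_mem_chain _ _)
  have hb' : b'.2 < H := hH _ (mem_chain_of_mem (by simp))
  have hinj := injOn_fst_chain hB
  have hmapt := chain_map_fst (b' :: B)
  have htail : IsArc ((b' :: B).map Prod.fst) := hB.2.2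
  have hqt : q ∈ chain (b' :: B) := mem_chain_of_getLast? hq
  have hnb : ∀ z ∈ chain (b' :: B), z.1 ≠ b.1 := by
    intro z hz e
    exact hB.head_notMem (by rw [← e]; exact hmapt.symm.subset ⟨z, hz, rfl⟩)
  have hqb : q.1 ≠ b.1 := hnb q hqt
  have hover : ∀ z y : Space, z ∈ segment ℝ b b' → y ∈ chain (b' :: B) → z.1 = y.1 →
      y = b' := by
    intro z y hz hy e
    have : z.1 = b'.1 := hB.2.1 ⟨by rw [← image_fst_segment]; exact ⟨z, hz, rfl⟩,
      by rw [e]; exact hmapt.symm.subset ⟨y, hy, rfl⟩⟩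
    exact hinj (Or.inr hy) (Or.inr (head_mem_chain _ _)) (e.symm.trans this)
  have hvert : ∀ a z : Space, z ∈ segment ℝ a (flat H a) → z.1 = a.1 := by
    rintro a z ⟨s, t, hs, ht, hst, rfl⟩
    simp only [flat, Prod.fst_add, Prod.smul_fst]
    rw [← add_smul, hst, one_smul]
  have hvert2 : ∀ a z : Space, a.2 < H → z ∈ segment ℝ a (flat H a) → a.2 ≤ z.2 ∧ z.2 ≤ H := by
    rintro a z ha ⟨s, t, hs, ht, hst, rfl⟩
    simp only [flat, Prod.snd_add, Prod.smul_snd, smul_eq_mul]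
    have es : s = 1 - t := by linarith
    rw [es] at hs ⊢
    constructor <;> nlinarith
  -- raising the starting point
  obtain ⟨r1, r2, r3⟩ := (isArc_of_map_fst htail).join hq hK hKb (by
    rintro z ⟨hz, hzK⟩
    rcases hcond z hzK z (Or.inr hz) rfl le_rfl with h | h
    · exact absurd (congrArg Prod.fst h) (hnb z hz)
    · exact h)
  have hmove := deltaMove_of_arc (C := flat H b) r1 r2 (by
    rw [pair_comm]
    exact not_collinear_of_vertical rfl hb.ne hne) (by
    intro z hz hzR
    obtain ⟨-, y, hy, e, hyz⟩ := convexHull_subset_wall (H := H) (b := b) (b' := b')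
      (mem_wall_self (left_mem_segment ℝ _ _) hb.le)
      (mem_wall_self (right_mem_segment ℝ _ _) hb'.le)
      (flat_mem_wall (left_mem_segment ℝ _ _) hb.le) hz
    rw [r3] at hzR
    rcases hzR with hzB | hzK
    · exact Or.inr (hover y z hy hzB e.symm)
    · rcases hcond z hzK y (Or.inl hy) e hyz with h | h
      · exact Or.inl h
      · subst h
        exact Or.inr (hover y z hy hqt e.symm))
  obtain ⟨k1, k2, k3⟩ := chain_concat (c := flat H b) hKb
    (fun e => hb.ne (congrArg Prod.snd e)) hK (by
      rintro z ⟨hzK, hz⟩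
      rcases hcond z hzK b (head_mem_chain _ _) (hvert b z hz) (hvert2 b z hb hz).1 with h | h
      · exact h
      · exact absurd (h ▸ hvert b z hz) hqb)
  have hlift := eqvGen_lift_step H B b b' q (K ++ [flat H b]) hB hq hH k1 k2 (by
    intro z hz y hy e hyz
    rw [k3] at hz
    rcases hz with hz | hz
    · rcases hcond z hz y hy e hyz with h | h
      · exact Or.inl (congrArg Prod.fst h)
      · exact Or.inr h
    · exact Or.inl (hvert b z hz))
  -- contracting the flat arc
  have hqH : q.2 < H := hKH q (head_mem_chain _ _)
  have hF : IsArc (flat H q :: q :: (K ++ [flat H b])) := by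
    refine ⟨fun e => hqH.ne (congrArg Prod.snd e).symm, ?_, k1⟩
    rintro z ⟨hz, hzK⟩
    rw [segment_symm] at hz
    rw [k3] at hzK
    rcases hzK with hzK | hzK
    · rcases hcond z hzK q (Or.inr hqt) (hvert q z hz) (hvert2 q z hqH hz).1 with h | h
      · exact absurd ((hvert q z hz).symm.trans (congrArg Prod.fst h)) hqb
      · exact h
    · exact absurd ((hvert q z hz).symm.trans (hvert b z hzK)) hqb
  have hFc : chain (flat H q :: q :: (K ++ [flat H b])) =
      segment ℝ (flat H q) q ∪ (chain (q :: K) ∪ segment ℝ b (flat H b)) := by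
    rw [← k3]; rfl
  have hmap : (flat H b :: flat H b' :: B.map (flat H)) = (b :: b' :: B).map (flat H) := rfl
  have hmm : ∀ L : List Space, (L.map (flat H)).map Prod.fst = L.map Prod.fst := by
    intro L; rw [List.map_map]; rfl
  have hflatH : ∀ L : List Space, ∀ z ∈ chain (L.map (flat H)), z.2 = H := by
    intro L
    induction L with
    | nil => simp [chain]
    | cons a l ih =>
      cases l with
      | nil => simp [chain, flat]
      | cons c l =>
        rintro z (⟨s, t, hs, ht, hst, rfl⟩ | hz)
        · simp only [flat, Prod.snd_add, Prod.smul_snd, smul_eq_mul]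
          rw [← add_mul, hst, one_mul]
        · exact ih z hz
  have hcone := eqvGen_cone (H := H) (T := T) hF (e := flat H b) (by simpa using k2) (by
      intro z hz
      rw [hFc] at hz
      rcases hz with hz | hz | hz
      · rw [segment_symm] at hz; exact (hvert2 q z hqH hz).2
      · exact (hKH z hz).le
      · exact (hvert2 b z hb hz).2) (by
      intro z hz hzH
      rw [hFc] at hz
      rcases hz with hz | hz | hz
      · rw [segment_symm] at hz; exact Or.inl (Prod.ext (hvert q z hz) hzH)
      · exact absurd hzH (hKH z hz).ne
      · exact Or.inr (Prod.ext (hvert b z hz) hzH)) hT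
    (c := flat H b') (C := B.map (flat H)) (by
      rw [hmap]; exact isArc_of_map_fst (by rw [hmm]; exact hB)) (by
      have : (flat H b' :: B.map (flat H)) = (b' :: B).map (flat H) := rfl
      rw [this, List.getLast?_map, hq]; rfl) (by rw [hmap]; exact hflatH _)
  have e1 : chain (q :: K) ∪ chain (b :: b' :: B) = chain (b' :: (B ++ K)) ∪ segment ℝ b b' := by
    rw [r3]
    simp only [chain]
    ext z
    simp only [mem_union]
    tauto
  have e2 : chain (b' :: (B ++ K)) ∪ (segment ℝ b (flat H b) ∪ segment ℝ (flat H b) b') =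
      chain (q :: (K ++ [flat H b])) ∪ segment ℝ (flat H b) b' ∪ chain (b' :: B) := by
    rw [r3, k3]
    ext z
    simp only [mem_union]
    tauto
  have e3 : chain (q :: (K ++ [flat H b])) ∪ chain ((b :: b' :: B).map (flat H)) ∪
      segment ℝ (flat H q) q = chain (flat H q :: q :: (K ++ [flat H b])) ∪
        chain (flat H b :: flat H b' :: B.map (flat H)) := by
    rw [hFc, k3, hmap]
    ext z
    simp only [mem_union]
    tauto
  have e4 : chain (flat H q :: q :: (K ++ [flat H b])) ∪ segment ℝ (flat H b) T ∪
      segment ℝ T (flat H q) = chain (q :: K) ∪ segment ℝ b (flat H b) ∪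
        segment ℝ (flat H b) T ∪ segment ℝ T (flat H q) ∪ segment ℝ (flat H q) q := by
    rw [hFc]
    ext z
    simp only [mem_union]
    tauto
  rw [e1, ← e4]
  refine .trans _ _ _ (.rel _ _ hmove) ?_
  rw [e2]
  refine .trans _ _ _ hlift ?_
  rw [e3]
  exact hcone

/-- Two arcs with the same end points that both lie above the rest of the knot can be exchanged. -/
theorem eqvGen_of_over {b q b₁ b₂ : Space} {B₁ B₂ K : List Space}
    (hB₁ : IsArc ((b :: b₁ :: B₁).map Prod.fst)) (hq₁ : (b₁ :: B₁).getLast? = some q)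
    (hB₂ : IsArc ((b :: b₂ :: B₂).map Prod.fst)) (hq₂ : (b₂ :: B₂).getLast? = some q)
    (hK : IsArc (q :: K)) (hKb : (q :: K).getLast? = some b)
    (hcond₁ : ∀ z ∈ chain (q :: K), ∀ y ∈ chain (b :: b₁ :: B₁), z.1 = y.1 → y.2 ≤ z.2 →
      z = b ∨ z = q)
    (hcond₂ : ∀ z ∈ chain (q :: K), ∀ y ∈ chain (b :: b₂ :: B₂), z.1 = y.1 → y.2 ≤ z.2 →
      z = b ∨ z = q) :
    Relation.EqvGen DeltaMove (chain (q :: K) ∪ chain (b :: b₁ :: B₁))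
      (chain (q :: K) ∪ chain (b :: b₂ :: B₂)) := by
  have hcpt : IsCompact (chain (q :: K) ∪ (chain (b :: b₁ :: B₁) ∪ chain (b :: b₂ :: B₂))) :=
    (isCompact_chain _).union ((isCompact_chain _).union (isCompact_chain _))
  obtain ⟨H₀, hH₀⟩ := (hcpt.image continuous_snd).bddAbove
  have hlt : ∀ z ∈ chain (q :: K) ∪ (chain (b :: b₁ :: B₁) ∪ chain (b :: b₂ :: B₂)),
      z.2 < H₀ + 1 := fun z hz => by
    have := hH₀ ⟨z, hz, rfl⟩
    linarith
  have h1 := eqvGen_standard (H₀ + 1) (T := (0, H₀ + 1 + 1)) hB₁ hq₁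
    (fun z hz => hlt z (Or.inr (Or.inl hz))) hK hKb (fun z hz => hlt z (Or.inl hz)) hcond₁ rfl
  have h2 := eqvGen_standard (H₀ + 1) (T := (0, H₀ + 1 + 1)) hB₂ hq₂
    (fun z hz => hlt z (Or.inr (Or.inr hz))) hK hKb (fun z hz => hlt z (Or.inl hz)) hcond₂ rfl
  exact h1.trans _ _ _ (h2.symm _ _)

end Lift

/-! ### Local structure of a plane polygon -/

section Local

open Set Topology Filter

/-- The closed ray from `v` in direction `d`. -/
def ray (v d : Plane) : Set Plane := {y | ∃ c : ℝ, 0 ≤ c ∧ y = v + c • d}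

namespace ClosedPolygon

/-- The velocity of the parametrisation just after the time `t`. -/
noncomputable def dirR (P : ClosedPolygon Plane) (t : ℝ) : Plane := P.vertex (⌊t⌋ + 1) - P.vertex ⌊t⌋

/-- The velocity, backwards in time, just before the time `t`. -/
noncomputable def dirL (P : ClosedPolygon Plane) (t : ℝ) : Plane := P.vertex (⌈t⌉ - 1) - P.vertex ⌈t⌉

theorem path_add_right (P : ClosedPolygon Plane) {t s : ℝ} (h0 : 0 ≤ s) (h1 : s ≤ ⌊t⌋ + 1 - t) :
    P.path (t + s) = P.path t + s • P.dirR t := by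
  have ht := Int.floor_le t
  rw [P.path_of_mem ⌊t⌋ ⟨by linarith, by linarith⟩, P.path_of_mem ⌊t⌋ ⟨ht, by linarith⟩]
  simp only [AffineMap.lineMap_apply_module', dirR]
  module

theorem path_sub_left (P : ClosedPolygon Plane) {t s : ℝ} (h0 : 0 ≤ s) (h1 : s ≤ t - ⌈t⌉ + 1) :
    P.path (t - s) = P.path t + s • P.dirL t := by
  have ht := Int.le_ceil t
  rw [P.path_of_mem (⌈t⌉ - 1) ⟨by push_cast; linarith, by push_cast; linarith⟩,
    P.path_of_mem (⌈t⌉ - 1) ⟨by push_cast; linarith, by push_cast; linarith⟩]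
  simp only [AffineMap.lineMap_apply_module', dirL, sub_add_cancel]
  module

theorem dirL_eq_neg (P : ClosedPolygon Plane) {t : ℝ} (h : Int.fract t ≠ 0) :
    P.dirL t = -P.dirR t := by
  have : ⌈t⌉ = ⌊t⌋ + 1 := by
    rw [Int.ceil_eq_iff]
    push_cast
    have := Int.fract_pos.2 (fun e => h (by rw [Int.fract, sub_eq_zero]; exact e))
    rw [Int.fract] at this
    constructor
    · linarith
    · exact (Int.lt_floor_add_one t).le
  simp [dirL, dirR, this]

variable {P : ClosedPolygon Plane} (hv : ∀ i, P.vertex i ≠ P.vertex (i + 1))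

include hv in
theorem dirR_ne_zero (t : ℝ) : P.dirR t ≠ 0 := sub_ne_zero.2 (hv _).symm

include hv in
theorem dirL_ne_zero (t : ℝ) : P.dirL t ≠ 0 := by
  have := hv (⌈t⌉ - 1)
  rw [sub_add_cancel] at this
  exact sub_ne_zero.2 this

include hv in
/-- Near one of its points `v`, a path of a polygon consists of the rays along which it leaves and
enters `v`. -/
theorem exists_ball_rays {c e : ℝ} {v : Plane}
    (hfin : {t | t ∈ Icc c e ∧ P.path t = v}.Finite) :
    ∃ R > 0, ∀ r ≤ R, ∀ y ∈ Metric.ball v r, y ≠ v → (y ∈ P.path '' Icc c e ↔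
      ∃ t ∈ Icc c e, P.path t = v ∧
        ((t < e ∧ y ∈ ray v (P.dirR t)) ∨ (c < t ∧ y ∈ ray v (P.dirL t)))) := by
  set Z := {t | t ∈ Icc c e ∧ P.path t = v} with hZ
  have hpos : ∀ {x : ℝ}, 0 < x → ∀ᶠ δ in 𝓝[>] (0 : ℝ), δ ≤ x := fun hx => by
    filter_upwards [mem_nhdsWithin_of_mem_nhds (Iio_mem_nhds hx)] with y hy using le_of_lt hy
  have h1 : ∀ᶠ δ in 𝓝[>] (0 : ℝ), ∀ t ∈ Z, δ ≤ ⌊t⌋ + 1 - t ∧ δ ≤ t - ⌈t⌉ + 1 ∧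
      (t < e → δ ≤ e - t) ∧ (c < t → δ ≤ t - c) := by
    refine (eventually_all_finite hfin).2 fun t _ => ?_
    refine (hpos (by linarith [Int.lt_floor_add_one t])).and
      ((hpos (by linarith [Int.ceil_lt_add_one t])).and (Filter.Eventually.and ?_ ?_))
    · by_cases h : t < e
      · exact (hpos (sub_pos.2 h)).mono fun δ hδ _ => hδ
      · exact Eventually.of_forall fun δ h' => absurd h' h
    · by_cases h : c < t
      · exact (hpos (sub_pos.2 h)).mono fun δ hδ _ => hδ
      · exact Eventually.of_forall fun δ h' => absurd h' h
  obtain ⟨δ, hδ, hδ0⟩ := (h1.and self_mem_nhdsWithin).exists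
  replace hδ0 : 0 < δ := hδ0
  -- times far from `Z` give points far from `v`
  have hK : IsCompact (Icc c e \ ⋃ t ∈ Z, Ioo (t - δ) (t + δ)) :=
    isCompact_Icc.diff (isOpen_biUnion fun _ _ => isOpen_Ioo)
  have hK' := (hK.image P.continuous_path).isClosed
  have hvK : v ∉ P.path '' (Icc c e \ ⋃ t ∈ Z, Ioo (t - δ) (t + δ)) := by
    rintro ⟨t, ⟨ht, hn⟩, e⟩
    apply hn
    simp only [mem_iUnion]
    exact ⟨t, ⟨ht, e⟩, by linarith, by linarith⟩
  obtain ⟨r₁, hr₁, hb⟩ := Metric.isOpen_iff.1 hK'.isOpen_compl v hvK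
  have h2 : ∀ᶠ r in 𝓝[>] (0 : ℝ), ∀ t ∈ Z, r ≤ δ * ‖P.dirR t‖ ∧ r ≤ δ * ‖P.dirL t‖ := by
    refine (eventually_all_finite hfin).2 fun t _ => ?_
    exact (hpos (mul_pos hδ0 (norm_pos_iff.2 (dirR_ne_zero hv t)))).and
      (hpos (mul_pos hδ0 (norm_pos_iff.2 (dirL_ne_zero hv t))))
  obtain ⟨R, ⟨hR, hRr⟩, hR0⟩ := ((h2.and (hpos hr₁)).and self_mem_nhdsWithin).exists
  replace hR0 : 0 < R := hR0
  refine ⟨R, hR0, fun r hr y hy hyv => ⟨?_, ?_⟩⟩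
  · rintro ⟨s, hs, rfl⟩
    have : s ∈ ⋃ t ∈ Z, Ioo (t - δ) (t + δ) := by
      by_contra hn
      exact hb (Metric.ball_subset_ball (hr.trans hRr) hy) ⟨s, ⟨hs, hn⟩, rfl⟩
    simp only [mem_iUnion] at this
    obtain ⟨t, ht, hst⟩ := this
    obtain ⟨d1, d2, d3, d4⟩ := hδ t ht
    refine ⟨t, ht.1, ht.2, ?_⟩
    rcases lt_trichotomy t s with h | h | h
    · left
      refine ⟨h.trans_le hs.2, s - t, by linarith, ?_⟩
      rw [← ht.2, ← P.path_add_right (by linarith) (by linarith [hst.2]), add_sub_cancel]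
    · exact absurd (h ▸ ht.2) hyv
    · right
      refine ⟨hs.1.trans_lt h, t - s, by linarith, ?_⟩
      rw [← ht.2, ← P.path_sub_left (by linarith) (by linarith [hst.1]), sub_sub_cancel]
  · rintro ⟨t, ht, htv, h⟩
    obtain ⟨d1, d2, d3, d4⟩ := hδ t ⟨ht, htv⟩
    obtain ⟨R1, R2⟩ := hR t ⟨ht, htv⟩
    have key : ∀ d : Plane, d ≠ 0 → R ≤ δ * ‖d‖ → ∀ s : ℝ, 0 ≤ s → y = v + s • d → s < δ := by
      intro d hd hRd s hs e
      rw [mem_ball_iff_norm, e, add_sub_cancel_left, norm_smul, Real.norm_eq_abs,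
        abs_of_nonneg hs] at hy
      have : s * ‖d‖ < δ * ‖d‖ := hy.trans_le (hr.trans hRd)
      exact lt_of_mul_lt_mul_right this (norm_nonneg d)
    rcases h with ⟨hte, s, hs, e⟩ | ⟨hct, s, hs, e⟩
    · have hsδ := key _ (dirR_ne_zero hv t) R1 s hs e
      refine ⟨t + s, ⟨by linarith [ht.1], by linarith [d3 hte]⟩, ?_⟩
      rw [P.path_add_right hs (by linarith), htv, e]
    · have hsδ := key _ (dirL_ne_zero hv t) R2 s hs e
      refine ⟨t - s, ⟨by linarith [d4 hct], by linarith [ht.2]⟩, ?_⟩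
      rw [P.path_sub_left hs (by linarith), htv, e]

end ClosedPolygon

/-- Near `m`, the set `X` is the line through `m` in direction `d`. -/
def LocLine (X : Set Plane) (m d : Plane) (r : ℝ) : Prop :=
  d ≠ 0 ∧ 0 < r ∧ ∀ y ∈ Metric.ball m r, y ∈ X ↔ cross d (y - m) = 0

theorem exists_smul_of_cross_eq_zero {d y : Plane} (hd : d ≠ 0) (h : cross d y = 0) :
    ∃ c : ℝ, y = c • d := by
  have := eq_add_rot hd y
  rw [h, zero_div, zero_smul, add_zero] at this
  exact ⟨_, this⟩

theorem mem_rays_iff {v d y : Plane} (hd : d ≠ 0) :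
    y ∈ ray v d ∨ y ∈ ray v (-d) ↔ cross d (y - v) = 0 := by
  constructor
  · rintro (⟨c, -, rfl⟩ | ⟨c, -, rfl⟩)
    · rw [add_sub_cancel_left, cross_smul, cross_same, mul_zero]
    · rw [add_sub_cancel_left, cross_smul, cross_comm, cross_neg_left, cross_same]; simp
  · intro h
    obtain ⟨c, hc⟩ := exists_smul_of_cross_eq_zero hd h
    rw [sub_eq_iff_eq_add'] at hc
    rcases le_total 0 c with h0 | h0
    · exact Or.inl ⟨c, h0, hc⟩
    · exact Or.inr ⟨-c, by linarith, by rw [hc]; simp⟩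

/-- Two rays in different directions from `v` cut a small disc into two connected parts, each of
which accumulates at both rays. -/
theorem exists_preconnected_of_two_rays {X : Set Plane} {v d₁ d₂ : Plane} {r : ℝ} (hr : 0 < r)
    (h₁ : d₁ ≠ 0) (h₂ : d₂ ≠ 0) (hdir : ∀ c : ℝ, 0 < c → d₁ ≠ c • d₂)
    (hX : ∀ y ∈ Metric.ball v r, y ∈ X ↔ y ∈ ray v d₁ ∨ y ∈ ray v d₂) {y : Plane}
    (hy : y ∈ Metric.ball v r) (hyX : y ∉ X) :
    ∃ V : Set Plane, IsPreconnected V ∧ V ⊆ Metric.ball v r \ X ∧ y ∈ V ∧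
      ∀ s : ℝ, 0 < s → v + s • d₂ ∈ Metric.ball v r → v + s • d₂ ∈ closure V := by
  have hyr := (hX y hy).not.1 hyX
  push Not at hyr
  -- a criterion for being in the closure of an open piece of the disc
  have hclos : ∀ (V : Set Plane) (s : ℝ) (w : Plane), v + s • d₂ ∈ Metric.ball v r →
      (∀ ε : ℝ, 0 < ε → v + s • d₂ + ε • w ∈ Metric.ball v r → v + s • d₂ + ε • w ∈ V) →
      v + s • d₂ ∈ closure V := by
    intro V s w hs hV
    have ht : Tendsto (fun ε : ℝ => v + s • d₂ + ε • w) (𝓝[>] 0) (𝓝 (v + s • d₂)) := by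
      have hc : Continuous (fun ε : ℝ => v + s • d₂ + ε • w) := by fun_prop
      have := hc.tendsto 0
      simp only [zero_smul, add_zero] at this
      exact this.mono_left nhdsWithin_le_nhds
    refine mem_closure_of_tendsto ht ?_
    filter_upwards [ht (Metric.isOpen_ball.mem_nhds hs), self_mem_nhdsWithin] with ε h1 h2
    exact hV ε h2 h1
  have hball : ∀ w : Plane, ∃ ε > 0, v + (ε : ℝ) • w ∈ Metric.ball v r := by
    intro w
    refine ⟨r / (‖w‖ + 1), by positivity, ?_⟩
    rw [mem_ball_iff_norm, add_sub_cancel_left, norm_smul, Real.norm_eq_abs,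
      abs_of_pos (by positivity), div_mul_eq_mul_div, div_lt_iff₀ (by positivity)]
    nlinarith [norm_nonneg w]
  have c11 : cross d₁ d₁ = 0 := cross_same d₁
  have c22 : cross d₂ d₂ = 0 := cross_same d₂
  by_cases hc0 : cross d₁ d₂ = 0
  · -- opposite rays: half discs
    obtain ⟨c, hc⟩ := exists_smul_of_cross_eq_zero (y := d₁) h₂ (by
      rw [cross_comm, hc0, neg_zero])
    have hcneg : c < 0 := by
      rcases lt_trichotomy c 0 with h | h | h
      · exact h
      · rw [h, zero_smul] at hc; exact absurd hc h₁
      · exact absurd hc (hdir c h)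
    have hne : cross d₂ (y - v) ≠ 0 := by
      intro h
      rcases (mem_rays_iff h₂).2 h with h | ⟨e, he, h⟩
      · exact hyr.2 h
      · refine hyr.1 ⟨e / (-c), div_nonneg he (by linarith), ?_⟩
        rw [h, hc, smul_smul]
        congr 1
        have : e / -c * c = -e := by have hcne := hcneg.ne; field_simp
        rw [this]; simp
    have hoff : ∀ z ∈ Metric.ball v r, cross d₂ (z - v) ≠ 0 → z ∉ X := by
      intro z hz hzc hzX
      rcases (hX z hz).1 hzX with ⟨e, he, rfl⟩ | ⟨e, he, rfl⟩
      · rw [add_sub_cancel_left, hc, cross_smul, cross_smul, c22] at hzc; simp at hzc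
      · rw [add_sub_cancel_left, cross_smul, c22] at hzc; simp at hzc
    rcases hne.lt_or_gt with h | h
    · refine ⟨Metric.ball v r ∩ {z | cross d₂ (z - v) < 0},
        ((convex_ball v r).inter (convex_cross_neg d₂ v)).isPreconnected,
        fun z hz => ⟨hz.1, hoff z hz.1 hz.2.ne⟩, ⟨hy, h⟩, fun s hs hsb => ?_⟩
      refine hclos _ s (-rot d₂) hsb fun ε hε hb => ⟨hb, ?_⟩
      have : v + s • d₂ + ε • -rot d₂ - v = s • d₂ + (-ε) • rot d₂ := by module
      rw [mem_ofPred_eq, this, cross_add, cross_smul, cross_smul, c22, cross_rot]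
      nlinarith [sqLen_pos h₂]
    · refine ⟨Metric.ball v r ∩ {z | 0 < cross d₂ (z - v)},
        ((convex_ball v r).inter (convex_cross_pos d₂ v)).isPreconnected,
        fun z hz => ⟨hz.1, hoff z hz.1 hz.2.ne'⟩, ⟨hy, h⟩, fun s hs hsb => ?_⟩
      refine hclos _ s (rot d₂) hsb fun ε hε hb => ⟨hb, ?_⟩
      have : v + s • d₂ + ε • rot d₂ - v = s • d₂ + ε • rot d₂ := by module
      rw [mem_ofPred_eq, this, cross_add, cross_smul, cross_smul, c22, cross_rot]
      nlinarith [sqLen_pos h₂]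
  · -- a convex sector and its complement; `σ` is the orientation of the two rays
    obtain ⟨σ, hσ, hσc⟩ : ∃ σ : ℝ, σ ≠ 0 ∧ 0 < σ * cross d₁ d₂ := by
      exact ⟨cross d₁ d₂, hc0, mul_self_pos.2 hc0⟩
    have c21 : cross d₂ d₁ = -cross d₁ d₂ := cross_comm _ _
    have hp : ∀ z : Plane, σ * cross d₁ (z - v) = cross (σ • d₁) (z - v) :=
      fun z => (cross_smul_left _ _ _).symm
    have hq : ∀ z : Plane, σ * cross d₂ (z - v) = cross (σ • d₂) (z - v) :=
      fun z => (cross_smul_left _ _ _).symm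
    by_cases hsec : 0 < σ * cross d₁ (y - v) ∧ σ * cross d₂ (y - v) < 0
    · refine ⟨Metric.ball v r ∩ ({z | 0 < cross (σ • d₁) (z - v)} ∩
        {z | cross (σ • d₂) (z - v) < 0}), ((convex_ball v r).inter
          ((convex_cross_pos _ v).inter (convex_cross_neg _ v))).isPreconnected, ?_,
        ⟨hy, by rw [mem_ofPred_eq, ← hp]; exact hsec.1, by rw [mem_ofPred_eq, ← hq]; exact hsec.2⟩,
        ?_⟩
      · rintro z ⟨hz, hz1, hz2⟩
        rw [mem_ofPred_eq, ← hp] at hz1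
        rw [mem_ofPred_eq, ← hq] at hz2
        refine ⟨hz, fun hzX => ?_⟩
        rcases (hX z hz).1 hzX with ⟨e, he, rfl⟩ | ⟨e, he, rfl⟩
        · rw [add_sub_cancel_left, cross_smul, c11] at hz1; simp at hz1
        · rw [add_sub_cancel_left, cross_smul, c22] at hz2; simp at hz2
      · intro s hs hsb
        refine hclos _ s d₁ hsb fun ε hε hb => ⟨hb, ?_, ?_⟩
        · have : v + s • d₂ + ε • d₁ - v = s • d₂ + ε • d₁ := by module
          rw [mem_ofPred_eq, ← hp, this, cross_add, cross_smul, cross_smul, c11]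
          nlinarith
        · have : v + s • d₂ + ε • d₁ - v = s • d₂ + ε • d₁ := by module
          rw [mem_ofPred_eq, ← hq, this, cross_add, cross_smul, cross_smul, c22, c21]
          nlinarith
    · have hcase : σ * cross d₁ (y - v) < 0 ∨ 0 < σ * cross d₂ (y - v) := by
        by_contra hcon
        push Not at hcon
        rcases hcon.1.lt_or_eq with h1 | h1
        · rcases hcon.2.lt_or_eq with h2 | h2
          · exact hsec ⟨h1, h2⟩
          · obtain ⟨c, hc⟩ := exists_smul_of_cross_eq_zero h₂
              ((mul_eq_zero.1 h2).resolve_left hσ)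
            rw [hc, cross_smul] at h1
            have : 0 < c := by
              by_contra hc'
              push Not at hc'
              nlinarith
            exact hyr.2 ⟨c, this.le, by rw [← hc]; abel⟩
        · obtain ⟨c, hc⟩ := exists_smul_of_cross_eq_zero h₁
            ((mul_eq_zero.1 h1.symm).resolve_left hσ)
          have h2 := hcon.2
          rw [hc, cross_smul, c21] at h2
          have : 0 ≤ c := by
            by_contra hc'
            push Not at hc'
            nlinarith
          exact hyr.1 ⟨c, this, by rw [← hc]; abel⟩
      obtain ⟨ε, hε, hεb⟩ := hball (-d₁ - d₂)
      refine ⟨Metric.ball v r ∩ {z | cross (σ • d₁) (z - v) < 0} ∪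
        Metric.ball v r ∩ {z | 0 < cross (σ • d₂) (z - v)}, ?_, ?_, ?_, ?_⟩
      · refine IsPreconnected.union (v + ε • (-d₁ - d₂)) ⟨hεb, ?_⟩ ⟨hεb, ?_⟩
          ((convex_ball v r).inter (convex_cross_neg _ v)).isPreconnected
          ((convex_ball v r).inter (convex_cross_pos _ v)).isPreconnected
        · have : v + ε • (-d₁ - d₂) - v = (-ε) • d₁ + (-ε) • d₂ := by module
          rw [mem_ofPred_eq, ← hp, this, cross_add, cross_smul, cross_smul, c11]
          nlinarith
        · have : v + ε • (-d₁ - d₂) - v = (-ε) • d₁ + (-ε) • d₂ := by module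
          rw [mem_ofPred_eq, ← hq, this, cross_add, cross_smul, cross_smul, c22, c21]
          nlinarith
      · rintro z (⟨hz, hz1⟩ | ⟨hz, hz1⟩)
        · rw [mem_ofPred_eq, ← hp] at hz1
          refine ⟨hz, fun hzX => ?_⟩
          rcases (hX z hz).1 hzX with ⟨e, he, rfl⟩ | ⟨e, he, rfl⟩
          · rw [add_sub_cancel_left, cross_smul, c11] at hz1; simp at hz1
          · rw [add_sub_cancel_left, cross_smul] at hz1; nlinarith
        · rw [mem_ofPred_eq, ← hq] at hz1
          refine ⟨hz, fun hzX => ?_⟩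
          rcases (hX z hz).1 hzX with ⟨e, he, rfl⟩ | ⟨e, he, rfl⟩
          · rw [add_sub_cancel_left, cross_smul, c21] at hz1; nlinarith
          · rw [add_sub_cancel_left, cross_smul, c22] at hz1; simp at hz1
      · rcases hcase with h | h
        · exact Or.inl ⟨hy, by rw [mem_ofPred_eq, ← hp]; exact h⟩
        · exact Or.inr ⟨hy, by rw [mem_ofPred_eq, ← hq]; exact h⟩
      · intro s hs hsb
        refine hclos _ s (-d₁) hsb fun ε hε hb => Or.inr ⟨hb, ?_⟩
        have : v + s • d₂ + ε • -d₁ - v = s • d₂ + (-ε) • d₁ := by module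
        rw [mem_ofPred_eq, ← hq, this, cross_add, cross_smul, cross_smul, c22, c21]
        nlinarith

end Local

/-! ### Diagrams and bridges -/

section Diagram

open Set Topology Filter

namespace KnotDiagram

/-- The projection of a diagram as a closed polygon in the plane. -/
def plane (D : KnotDiagram) : ClosedPolygon Plane where
  n := D.n
  n_pos := D.n_pos
  vertex i := (D.vertex i).1
  periodic i := by rw [D.periodic]

theorem plane_path (D : KnotDiagram) (s : ℝ) : D.plane.path s = (D.path s).1 := by
  simp [ClosedPolygon.path, plane, AffineMap.lineMap_apply_module]

theorem plane_carrier (D : KnotDiagram) : D.plane.carrier = D.shadow := by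
  ext x
  constructor
  · rintro ⟨s, rfl⟩
    exact ⟨_, ⟨s, rfl⟩, (D.plane_path s).symm⟩
  · rintro ⟨_, ⟨s, rfl⟩, rfl⟩
    exact ⟨s, D.plane_path s⟩

variable {D : KnotDiagram}

theorem path_ne {s t : ℝ} (hst : s ≠ t) (h : |s - t| < D.n) : D.path s ≠ D.path t :=
  fun e => hst (D.simple.eq_of_abs_lt e h)

theorem mem_crossings {s t : ℝ} (hst : s ≠ t) (h : |s - t| < D.n)
    (e : D.plane.path s = D.plane.path t) : D.plane.path s ∈ D.crossings :=
  ⟨s, t, path_ne hst h, (D.plane_path s).symm, by rw [e, plane_path]⟩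

theorem no_three {s t u : ℝ} (h1 : |s - t| < D.n) (h2 : |t - u| < D.n) (h3 : |s - u| < D.n)
    (e1 : D.plane.path s = D.plane.path t) (e2 : D.plane.path t = D.plane.path u) :
    s = t ∨ t = u ∨ s = u := by
  simp only [plane_path] at e1 e2
  rcases D.regular.double s t u e1 e2 with h | h | h
  · exact Or.inl (D.simple.eq_of_abs_lt h h1)
  · exact Or.inr (Or.inl (D.simple.eq_of_abs_lt h h2))
  · exact Or.inr (Or.inr (D.simple.eq_of_abs_lt h h3))

theorem exists_other {s : ℝ} (h : D.plane.path s ∈ D.crossings) (c : ℝ) :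
    ∃ u ∈ Ico c (c + D.n), D.plane.path u = D.plane.path s ∧ D.path u ≠ D.path s := by
  obtain ⟨s', t', hne, h1, h2⟩ := h
  have : ∃ u, D.plane.path u = D.plane.path s ∧ D.path u ≠ D.path s := by
    by_cases hs : D.path s' = D.path s
    · exact ⟨t', by rw [plane_path, h2], fun e => hne (hs.trans e.symm)⟩
    · exact ⟨s', by rw [plane_path, h1], hs⟩
  obtain ⟨u, hu1, hu2⟩ := this
  obtain ⟨k, hk⟩ := D.plane.exists_mem_Ico u c
  refine ⟨_, hk, by rw [D.plane.path_add_mul, hu1], ?_⟩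
  have := D.path_add_mul u k
  change D.path (u + k * D.n) ≠ _
  rwa [this]

theorem fract_ne_zero {s : ℝ} (h : D.plane.path s ∈ D.crossings) : Int.fract s ≠ 0 := by
  intro hf
  have hs : s = (⌊s⌋ : ℝ) := by rw [Int.fract, sub_eq_zero] at hf; exact hf
  rw [hs, plane_path, D.path_intCast] at h
  exact D.regular.vertex_not_mem _ h

/-- The strands of a diagram nowhere run over each other along an interval. -/
theorem no_overlap {f g : ℝ → ℝ} {δ : ℝ} (hδ : 0 < δ)
    (hne : ∀ s ∈ Ioo 0 δ, f s ≠ g s ∧ |f s - g s| < D.n)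
    (he : ∀ s ∈ Ioo 0 δ, D.plane.path (f s) = D.plane.path (g s))
    (hinj : InjOn (fun s => D.plane.path (f s)) (Ioo 0 δ)) : False := by
  have : ((fun s => D.plane.path (f s)) '' Ioo 0 δ).Infinite := (Ioo_infinite hδ).image hinj
  refine this (D.regular.finite.subset ?_)
  rintro _ ⟨s, hs, rfl⟩
  exact mem_crossings (hne s hs).1 (hne s hs).2 (he s hs)

theorem plane_vertex_ne (D : KnotDiagram) (i : ℤ) :
    D.plane.vertex i ≠ D.plane.vertex (i + 1) := by
  intro e
  have hn1 : 1 < D.n := by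
    by_contra hn
    have hn1 : D.n = 1 := le_antisymm (not_lt.1 hn) D.n_pos
    have hp : D.path (1 / 2) = D.path 0 := by
      have hv := D.periodic 0
      rw [hn1] at hv
      rw [D.path_of_mem 0 ⟨by norm_num, by norm_num⟩, D.path_of_mem 0 ⟨by norm_num, by norm_num⟩]
      have hv' : D.vertex (0 + 1) = D.vertex 0 := by simpa using hv
      rw [hv', AffineMap.lineMap_same_apply, AffineMap.lineMap_same_apply]
    have := D.simple ⟨by norm_num, by rw [hn1]; norm_num⟩ ⟨le_rfl, by rw [hn1]; norm_num⟩ hp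
    norm_num at this
  have hn : (2 : ℝ) ≤ D.n := by exact_mod_cast hn1
  have hconst : ∀ s ∈ Icc (0 : ℝ) 1, D.plane.path (i + s) = D.plane.vertex i := by
    intro s hs
    rw [D.plane.path_of_mem i ⟨by linarith [hs.1], by linarith [hs.2]⟩, ← e,
      AffineMap.lineMap_same_apply]
  have h0 := hconst 0 ⟨le_rfl, zero_le_one⟩
  have h1 := hconst (1 / 2) ⟨by norm_num, by norm_num⟩
  have h2 := hconst 1 ⟨zero_le_one, le_rfl⟩
  rcases no_three (D := D) (s := i + 0) (t := i + 1 / 2) (u := i + 1)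
    (by rw [abs_lt]; constructor <;> linarith) (by rw [abs_lt]; constructor <;> linarith)
    (by rw [abs_lt]; constructor <;> linarith) (h0.trans h1.symm) (h1.trans h2.symm)
    with h | h | h <;> linarith

theorem finite_range_plane_vertex (D : KnotDiagram) : (range D.plane.vertex).Finite := by
  refine ((Set.finite_Ico (0 : ℤ) D.n).image D.plane.vertex).subset ?_
  rintro _ ⟨i, rfl⟩
  have hn : (0 : ℤ) < D.n := by exact_mod_cast D.n_pos
  refine ⟨i % D.n, ⟨Int.emod_nonneg _ hn.ne', Int.emod_lt_of_pos _ hn⟩, ?_⟩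
  have hp : Function.Periodic D.plane.vertex (D.n : ℤ) := D.plane.periodic
  have := hp.int_mul (i / D.n) (i % D.n)
  have e : i % D.n + i / D.n * D.n = i := by rw [mul_comm]; exact Int.emod_add_mul_ediv i D.n
  simp only [Int.cast_id] at this
  rw [e] at this
  exact this.symm

/-- On a short interval after (before) a time, the projection is injective. -/
theorem injOn_smul_dir {v d : Plane} (hd : d ≠ 0) {a : ℝ} (ha : a ≠ 0) (s : Set ℝ) :
    InjOn (fun s : ℝ => v + (a * s) • d) s := by
  intro x _ y _ e
  have := smul_left_injective ℝ hd (add_left_cancel e)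
  exact mul_left_cancel₀ ha this

/-- The projection does not turn back at a vertex. -/
theorem dirL_ne_smul_dirR (D : KnotDiagram) (t : ℝ) {c : ℝ} (hc : 0 < c) :
    D.plane.dirL t ≠ c • D.plane.dirR t := by
  intro e
  have h1 := Int.lt_floor_add_one t
  have h2 := Int.ceil_lt_add_one t
  have hn : (0 : ℝ) < D.n := D.n_pos'
  set δ := min (min ((⌊t⌋ + 1 - t) / c) (t - ⌈t⌉ + 1)) (D.n / (c + 1)) with hδ
  have hδ0 : 0 < δ := lt_min (lt_min (div_pos (by linarith) hc) (by linarith)) (by positivity)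
  have hb : ∀ s ∈ Ioo 0 δ, c * s ≤ ⌊t⌋ + 1 - t ∧ s ≤ t - ⌈t⌉ + 1 ∧ s * (c + 1) < D.n := by
    intro s hs
    refine ⟨?_, (hs.2.trans_le ((min_le_left _ _).trans (min_le_right _ _))).le, ?_⟩
    · have := (hs.2.trans_le ((min_le_left _ _).trans (min_le_left _ _))).le
      rw [le_div_iff₀ hc] at this
      linarith
    · have := hs.2.trans_le (min_le_right _ _)
      rwa [lt_div_iff₀ (by linarith)] at this
  have hR : ∀ s ∈ Ioo 0 δ, D.plane.path (t + c * s) =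
      D.plane.path t + (c * s) • D.plane.dirR t := fun s hs =>
    D.plane.path_add_right (mul_pos hc hs.1).le (hb s hs).1
  refine no_overlap (D := D) (f := fun s => t + c * s) (g := fun s => t - s) hδ0 ?_ ?_ ?_
  · intro s hs
    have h3 : 0 < s * (c + 1) := mul_pos hs.1 (by linarith)
    have h4 := (hb s hs).2.2
    constructor
    · intro e; nlinarith
    · rw [abs_lt]; constructor <;> nlinarith
  · intro s hs
    rw [hR s hs, D.plane.path_sub_left hs.1.le (hb s hs).2.1, e, smul_smul, mul_comm]
  · intro x hx y hy exy
    simp only [hR x hx, hR y hy] at exy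
    exact injOn_smul_dir (D.plane.dirR_ne_zero D.plane_vertex_ne t) hc.ne' (Ioo 0 δ) hx hy exy

/-- The two strands at a crossing are transverse. -/
theorem cross_dirR_ne_zero {t u : ℝ} (htu : t ≠ u) (h : |t - u| < D.n)
    (e : D.plane.path t = D.plane.path u) :
    cross (D.plane.dirR t) (D.plane.dirR u) ≠ 0 := by
  intro h0
  have ht : Int.fract t ≠ 0 := fract_ne_zero (mem_crossings htu h e)
  have hu : Int.fract u ≠ 0 := fract_ne_zero (e ▸ mem_crossings htu h e)
  have hnt := D.plane.dirR_ne_zero D.plane_vertex_ne t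
  have hnu := D.plane.dirR_ne_zero D.plane_vertex_ne u
  obtain ⟨c, hc⟩ := exists_smul_of_cross_eq_zero hnt h0
  have hc0 : c ≠ 0 := by rintro rfl; rw [zero_smul] at hc; exact hnu hc
  have hu1 := Int.lt_floor_add_one u
  have ht1 := Int.lt_floor_add_one t
  have hut : 0 < |t - u| := abs_pos.2 (sub_ne_zero.2 htu)
  have ht2 := Int.ceil_lt_add_one t
  -- run along the first strand with speed `|c|`, in the direction given by the sign of `c`
  set f : ℝ → ℝ := fun s => t + c * s with hf
  set g : ℝ → ℝ := fun s => u + s with hg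
  have hcont : Tendsto (fun s : ℝ => |c * s - s|) (𝓝[>] 0) (𝓝 0) := by
    have hcc : Continuous (fun s : ℝ => |c * s - s|) := by fun_prop
    have := hcc.tendsto 0
    simp only [mul_zero, sub_self, abs_zero] at this
    exact this.mono_left nhdsWithin_le_nhds
  have hcont2 : Tendsto (fun s : ℝ => |c * s|) (𝓝[>] 0) (𝓝 0) := by
    have hcc : Continuous (fun s : ℝ => |c * s|) := by fun_prop
    have := hcc.tendsto 0
    simp only [mul_zero, abs_zero] at this
    exact this.mono_left nhdsWithin_le_nhds
  have hcont3 : Tendsto (fun s : ℝ => s) (𝓝[>] 0) (𝓝 0) := nhdsWithin_le_nhds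
  have hev : ∀ᶠ s in 𝓝[>] (0 : ℝ), |c * s - s| < |t - u| ∧ |c * s - s| < D.n - |t - u| ∧
      |c * s| < ⌊t⌋ + 1 - t ∧ |c * s| < t - ⌈t⌉ + 1 ∧ s < ⌊u⌋ + 1 - u :=
    (hcont.eventually (gt_mem_nhds hut)).and ((hcont.eventually (gt_mem_nhds (by linarith))).and
      ((hcont2.eventually (gt_mem_nhds (by linarith))).and
        ((hcont2.eventually (gt_mem_nhds (by linarith))).and
          (hcont3.eventually (gt_mem_nhds (by linarith))))))
  obtain ⟨δ, hδ0, hδ⟩ := mem_nhdsGT_iff_exists_Ioo_subset.1 hev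
  have hft : ∀ s ∈ Ioo 0 δ, D.plane.path (f s) = D.plane.path t + (c * s) • D.plane.dirR t := by
    intro s hs
    obtain ⟨-, -, a3, a4, -⟩ := hδ hs
    rcases hc0.lt_or_gt with hneg | hpos
    · have hcs : c * s < 0 := mul_neg_of_neg_of_pos hneg hs.1
      rw [abs_of_neg hcs] at a4
      have := D.plane.path_sub_left (t := t) (s := -(c * s)) (by linarith) a4.le
      rw [sub_neg_eq_add] at this
      rw [hf, this, D.plane.dirL_eq_neg ht]
      simp
    · have hcs : 0 < c * s := mul_pos hpos hs.1
      rw [abs_of_pos hcs] at a3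
      exact D.plane.path_add_right hcs.le a3.le
  refine no_overlap (D := D) (f := f) (g := g) hδ0 ?_ ?_ ?_
  · intro s hs
    obtain ⟨a1, a2, -⟩ := hδ hs
    have e' : f s - g s = (t - u) + (c * s - s) := by simp only [hf, hg]; ring
    constructor
    · intro e2
      have : t - u = -(c * s - s) := by linarith
      rw [this, abs_neg] at a1
      exact a1.false
    · rw [e']
      exact (abs_add_le _ _).trans_lt (by linarith)
  · intro s hs
    obtain ⟨-, -, -, -, a5⟩ := hδ hs
    rw [hft s hs, hg, D.plane.path_add_right hs.1.le a5.le, hc, e, smul_smul, mul_comm]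
  · intro x hx y hy exy
    simp only [hft x hx, hft y hy] at exy
    exact injOn_smul_dir hnt hc0 (Ioo 0 δ) hx hy exy

/-- The arc of the diagram over the parameter interval `[a, b]` is a bridge that consists of
overpasses, `l` in number; its ends are neither vertices nor crossings. -/
structure IsOverBridge (D : KnotDiagram) (a b : ℝ) (l : ℕ) : Prop where
  lt : a < b
  lt_add : b < a + D.n
  left_notMem : D.plane.path a ∉ D.crossings
  right_notMem : D.plane.path b ∉ D.crossings
  fract_left : Int.fract a ≠ 0
  fract_right : Int.fract b ≠ 0
  notUnder : ∀ s ∈ Icc a b, ¬ D.IsUnderpass s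
  encard_eq : {s | s ∈ Icc a b ∧ D.IsOverpass s}.encard = l

/-- The projection of the part of the diagram outside of the bridge. -/
def rest (D : KnotDiagram) (a b : ℝ) : Set Plane := D.plane.path '' Icc b (a + D.n)

/-- The parameters at which the bridge passes over a crossing. -/
def passes (D : KnotDiagram) (a b : ℝ) : Set ℝ := {s | s ∈ Ioo a b ∧ D.plane.path s ∈ D.rest a b}

/-- The crossings between strands outside of the bridge. -/
def restCrossings (D : KnotDiagram) (a b : ℝ) : Set Plane :=
  {x | ∃ s ∈ Icc b (a + D.n), ∃ t ∈ Icc b (a + D.n), s ≠ t ∧ D.plane.path s = x ∧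
    D.plane.path t = x}

namespace IsOverBridge

variable {a b : ℝ} {l : ℕ} (h : D.IsOverBridge a b l)

include h

theorem injOn : InjOn D.plane.path (Icc a b) := by
  intro s hs t ht e
  by_contra hne
  have hp : D.path s ≠ D.path t := path_ne hne (by
    rw [abs_lt]; constructor <;> linarith [hs.1, hs.2, ht.1, ht.2, h.lt_add])
  rw [plane_path, plane_path] at e
  have h2 : (D.path s).2 ≠ (D.path t).2 := fun e2 => hp (Prod.ext e e2)
  rcases h2.lt_or_gt with h2 | h2
  · exact h.notUnder s hs ⟨t, e.symm, h2⟩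
  · exact h.notUnder t ht ⟨s, e, h2⟩

theorem abs_sub_lt {s t : ℝ} (hs : s ∈ Icc b (a + D.n)) (ht : t ∈ Icc b (a + D.n)) :
    |s - t| < D.n := by
  rw [abs_lt]; constructor <;> linarith [hs.1, hs.2, ht.1, ht.2, h.lt]

theorem path_add_n (s : ℝ) : D.plane.path (s + D.n) = D.plane.path s := D.plane.path_add s

theorem exists_rest_of_crossing {s : ℝ} (hs : s ∈ Icc a b) (hc : D.plane.path s ∈ D.crossings) :
    ∃ t ∈ Ioo b (a + D.n), D.plane.path t = D.plane.path s ∧ (D.path t).2 < (D.path s).2 := by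
  obtain ⟨u, hu, e, hne⟩ := exists_other hc a
  refine ⟨u, ⟨?_, hu.2⟩, e, ?_⟩
  · by_contra hub
    push Not at hub
    exact hne (by rw [h.injOn ⟨hu.1, hub⟩ hs e])
  · by_contra hlt
    push Not at hlt
    rw [plane_path, plane_path] at e
    rcases hlt.lt_or_eq with h2 | h2
    · exact h.notUnder s hs ⟨u, e, h2⟩
    · exact hne (Prod.ext e h2.symm)

theorem crossing_of_rest {s : ℝ} (hs : s ∈ Ioo a b) (hr : D.plane.path s ∈ D.rest a b) :
    D.plane.path s ∈ D.crossings := by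
  obtain ⟨t, ht, e⟩ := hr
  have hta : t ≠ a + D.n := by
    rintro rfl
    rw [h.path_add_n] at e
    have := h.injOn ⟨le_rfl, h.lt.le⟩ (Ioo_subset_Icc_self hs) e
    linarith [hs.1]
  refine mem_crossings (s := s) (t := t) (by linarith [hs.2, ht.1] : s < t).ne ?_ e.symm
  have := lt_of_le_of_ne ht.2 hta
  rw [abs_lt]; constructor <;> linarith [hs.1, hs.2, ht.1]

theorem mem_passes_iff {s : ℝ} : s ∈ D.passes a b ↔ s ∈ Icc a b ∧ D.plane.path s ∈ D.crossings := by
  constructor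
  · rintro ⟨hs, hr⟩
    exact ⟨Ioo_subset_Icc_self hs, h.crossing_of_rest hs hr⟩
  · rintro ⟨hs, hc⟩
    obtain ⟨t, ht, e, -⟩ := h.exists_rest_of_crossing hs hc
    refine ⟨⟨lt_of_le_of_ne hs.1 ?_, lt_of_le_of_ne hs.2 ?_⟩, t, Ioo_subset_Icc_self ht, e⟩
    · rintro rfl; exact h.left_notMem hc
    · rintro rfl; exact h.right_notMem hc

theorem passes_eq : D.passes a b = {s | s ∈ Icc a b ∧ D.IsOverpass s} := by
  ext s
  rw [h.mem_passes_iff]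
  refine and_congr_right fun hs => ⟨fun hc => ?_, ?_⟩
  · obtain ⟨t, -, e, hlt⟩ := h.exists_rest_of_crossing hs hc
    exact ⟨t, by rw [plane_path, plane_path] at e; exact e, hlt⟩
  · rintro ⟨t, e, hlt⟩
    exact ⟨s, t, fun e' => hlt.ne (by rw [e']), (D.plane_path s).symm, by rw [e, plane_path]⟩

theorem finite_passes : (D.passes a b).Finite := by
  rw [h.passes_eq]
  exact finite_of_encard_eq_coe h.encard_eq

theorem ncard_passes : (D.passes a b).ncard = l := by
  rw [h.passes_eq, ncard, h.encard_eq]; rfl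

theorem injOn_passes : InjOn D.plane.path (D.passes a b) :=
  h.injOn.mono fun _ hs => Ioo_subset_Icc_self hs.1

theorem restCrossings_subset : D.restCrossings a b ⊆ D.crossings := by
  rintro x ⟨s, hs, t, ht, hst, rfl, e⟩
  exact mem_crossings hst (h.abs_sub_lt hs ht) e.symm

theorem crossings_eq : D.crossings = D.restCrossings a b ∪ D.plane.path '' D.passes a b := by
  apply Subset.antisymm
  · intro x hx
    obtain ⟨s', t', hne', hs', ht'⟩ := hx
    obtain ⟨k, hk⟩ := D.plane.exists_mem_Ico s' a
    set s := s' + k * D.plane.n with hs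
    have hsx : D.plane.path s = x := by rw [hs, D.plane.path_add_mul, plane_path, hs']
    have hc : D.plane.path s ∈ D.crossings := by rw [hsx]; exact ⟨s', t', hne', hs', ht'⟩
    rcases le_total s b with hsb | hsb
    · exact Or.inr ⟨s, h.mem_passes_iff.2 ⟨⟨hk.1, hsb⟩, hc⟩, hsx⟩
    · obtain ⟨u, hu, e, hne⟩ := exists_other hc a
      rcases le_total u b with hub | hub
      · exact Or.inr ⟨u, h.mem_passes_iff.2 ⟨⟨hu.1, hub⟩, e ▸ hc⟩, by rw [e, hsx]⟩
      · refine Or.inl ⟨s, ⟨hsb, hk.2.le⟩, u, ⟨hub, hu.2.le⟩, ?_, hsx, by rw [e, hsx]⟩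
        rintro rfl; exact hne rfl
  · apply union_subset h.restCrossings_subset
    rintro _ ⟨s, hs, rfl⟩
    exact (h.mem_passes_iff.1 hs).2

theorem existsUnique_rest {s : ℝ} (hs : s ∈ D.passes a b) {t u : ℝ} (ht : t ∈ Icc b (a + D.n))
    (hu : u ∈ Icc b (a + D.n)) (et : D.plane.path t = D.plane.path s)
    (eu : D.plane.path u = D.plane.path s) : t = u := by
  have hn : ∀ t ∈ Icc b (a + D.n), D.plane.path t = D.plane.path s → |t - s| < D.n := by
    intro t ht e
    have : t ≠ a + D.n := by
      rintro rfl
      rw [h.path_add_n] at e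
      exact h.left_notMem (e ▸ (h.mem_passes_iff.1 hs).2)
    have := lt_of_le_of_ne ht.2 this
    rw [abs_lt]; constructor <;> linarith [ht.1, hs.1.1, hs.1.2]
  rcases no_three (hn t ht et) (by rw [abs_sub_comm]; exact hn u hu eu) (h.abs_sub_lt ht hu) et
    eu.symm with e | e | e
  · linarith [ht.1, hs.1.2]
  · linarith [hu.1, hs.1.2]
  · exact e

theorem disjoint_crossings : Disjoint (D.restCrossings a b) (D.plane.path '' D.passes a b) := by
  rw [Set.disjoint_left]
  rintro _ ⟨t, ht, u, hu, htu, et, eu⟩ ⟨s, hs, rfl⟩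
  exact htu (h.existsUnique_rest hs ht hu et eu)

theorem crossingNumber_eq : D.crossingNumber = (D.restCrossings a b).ncard + l := by
  rw [crossingNumber, h.crossings_eq, ncard_union_eq h.disjoint_crossings
    (D.regular.finite.subset h.restCrossings_subset)
    (h.finite_passes.image _), h.injOn_passes.ncard_image, h.ncard_passes]

theorem isCompact_rest : IsCompact (D.rest a b) := isCompact_Icc.image D.plane.continuous_path

theorem isOpen_compl_rest : IsOpen (D.rest a b)ᶜ := h.isCompact_rest.isClosed.isOpen_compl

theorem right_mem_rest : D.plane.path b ∈ D.rest a b :=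
  ⟨b, ⟨le_rfl, h.lt_add.le⟩, rfl⟩

theorem left_mem_rest : D.plane.path a ∈ D.rest a b :=
  ⟨a + D.n, ⟨h.lt_add.le, le_rfl⟩, h.path_add_n a⟩

theorem rest_inter_bridge {s : ℝ} (hs : s ∈ Icc a b) (hr : D.plane.path s ∈ D.rest a b) :
    s = a ∨ s = b ∨ s ∈ D.passes a b := by
  rcases hs.1.lt_or_eq with h1 | h1
  · rcases hs.2.lt_or_eq with h2 | h2
    · exact Or.inr (Or.inr ⟨⟨h1, h2⟩, hr⟩)
    · exact Or.inr (Or.inl h2)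
  · exact Or.inl h1.symm

theorem shadow_eq : D.shadow = D.rest a b ∪ D.plane.path '' Icc a b := by
  rw [← plane_carrier, D.plane.carrier_eq_image_Icc a]
  change D.plane.path '' Icc a (a + D.n) = _
  rw [← Icc_union_Icc_eq_Icc h.lt.le h.lt_add.le, image_union, union_comm]
  rfl

/-- The end points of the rest are simple points of it. -/
theorem eq_right_of_path_eq {t : ℝ} (ht : t ∈ Icc b (a + D.n))
    (e : D.plane.path t = D.plane.path b) : t = b := by
  by_contra hne
  exact h.right_notMem (e ▸ mem_crossings hne (h.abs_sub_lt ht ⟨le_rfl, h.lt_add.le⟩) e)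

theorem eq_left_of_path_eq {t : ℝ} (ht : t ∈ Icc b (a + D.n))
    (e : D.plane.path t = D.plane.path a) : t = a + D.n := by
  by_contra hne
  have e' : D.plane.path t = D.plane.path (a + D.n) := by rw [h.path_add_n, e]
  exact h.left_notMem (e ▸ mem_crossings hne (h.abs_sub_lt ht ⟨h.lt_add.le, le_rfl⟩) e')

theorem path_left_ne_right : D.plane.path a ≠ D.plane.path b := fun e =>
  h.lt.ne (h.injOn ⟨le_rfl, h.lt.le⟩ ⟨h.lt.le, le_rfl⟩ e)

/-- The complement of the rest of the diagram has at most one more component than the rest has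
crossings. -/
theorem compLE_compl_rest : CompLE (D.rest a b)ᶜ ((D.restCrossings a b).ncard + 1) := by
  set B : Set ℝ := {s | s ∈ Ioc b (a + D.n) ∧ ∃ s' ∈ Ico b s, D.plane.path s' = D.plane.path s}
    with hB
  have hmem : ∀ s ∈ B, s ∈ Icc b (a + D.n) := fun s hs => Ioc_subset_Icc_self hs.1
  have hinj : InjOn D.plane.path B := by
    have key : ∀ s ∈ B, ∀ t ∈ B, s < t → D.plane.path s ≠ D.plane.path t := by
      intro s hs t ht hst e
      obtain ⟨s', hs', e'⟩ := hs.2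
      have hs'm : s' ∈ Icc b (a + D.n) := ⟨hs'.1, (hs'.2.le.trans hs.1.2)⟩
      rcases no_three (h.abs_sub_lt hs'm (hmem s hs)) (h.abs_sub_lt (hmem s hs) (hmem t ht))
        (h.abs_sub_lt hs'm (hmem t ht)) e' e with h | h | h
      · linarith [hs'.2]
      · linarith
      · linarith [hs'.2]
    intro s hs t ht e
    rcases lt_trichotomy s t with hst | hst | hst
    · exact absurd e (key s hs t ht hst)
    · exact hst
    · exact absurd e.symm (key t ht s hs hst)
  have himg : D.plane.path '' B = D.restCrossings a b := by
    ext x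
    constructor
    · rintro ⟨s, hs, rfl⟩
      obtain ⟨s', hs', e'⟩ := hs.2
      exact ⟨s', ⟨hs'.1, hs'.2.le.trans hs.1.2⟩, s, hmem s hs, hs'.2.ne, e', rfl⟩
    · have key : ∀ s ∈ Icc b (a + D.n), ∀ t ∈ Icc b (a + D.n), s < t →
          D.plane.path s = D.plane.path t → t ∈ B := fun s hs t ht hst e =>
        ⟨⟨hs.1.trans_lt hst, ht.2⟩, s, ⟨hs.1, hst⟩, e⟩
      rintro ⟨s, hs, t, ht, hst, rfl, e⟩
      rcases hst.lt_or_gt with hst | hst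
      · exact ⟨t, key s hs t ht hst e.symm, e⟩
      · exact ⟨s, key t ht s hs hst e, rfl⟩
  have hfin : B.Finite := by
    refine Set.Finite.of_finite_image ?_ hinj
    rw [himg]
    exact D.regular.finite.subset h.restCrossings_subset
  have hU : IsOpen ({D.plane.path b}ᶜ : Set Plane) := isOpen_compl_singleton
  have hconn : CompLE ({D.plane.path b}ᶜ : Set Plane) (0 + 1) := by
    refine ⟨{{D.plane.path b}ᶜ}, by simp, ?_, by simp⟩
    intro V hV
    rw [Finset.mem_singleton] at hV
    subst hV
    refine ⟨(isConnected_compl_singleton_of_one_lt_rank ?_ _).isPreconnected, subset_rfl⟩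
    rw [← Module.finrank_eq_rank]
    have : Module.finrank ℝ Plane = 2 := by simp [Plane]
    rw [this]
    norm_num
  have := CompLE.diff_path D.plane D.plane_vertex_ne hU h.lt_add.le (by simp) hconn (B := B) (by
    rintro s hs (hp | ⟨s', hs', e⟩)
    · exact ⟨hs, b, ⟨le_rfl, hs.1⟩, by simpa using Eq.symm (by simpa using hp)⟩
    · exact ⟨hs, s', hs', e⟩) (fun s hs => hs.1) hinj hfin
  have e : ({D.plane.path b}ᶜ : Set Plane) \ D.plane.path '' Icc b (a + D.n) = (D.rest a b)ᶜ := by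
    ext x
    simp only [Set.mem_sdiff, mem_compl_iff, mem_singleton_iff]
    refine ⟨fun hx => hx.2, fun hx => ⟨?_, hx⟩⟩
    rintro rfl
    exact hx h.right_mem_rest
  rw [e, ← hinj.ncard_image, himg] at this
  exact this.mono (by omega)

end IsOverBridge

end KnotDiagram

end Diagram

/-! ### Local structure of the rest of the diagram -/

section LocalStructure

open Set Topology Filter

namespace KnotDiagram.IsOverBridge

variable {D : KnotDiagram} {a b : ℝ} {l : ℕ} (h : D.IsOverBridge a b l)

include h

theorem finite_times (v : Plane) : {t | t ∈ Icc b (a + D.n) ∧ D.plane.path t = v}.Finite := by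
  by_cases h1 : ∃ t, t ∈ Icc b (a + D.n) ∧ D.plane.path t = v
  swap
  · convert Set.finite_empty
    ext t
    exact ⟨fun ht => h1 ⟨t, ht⟩, fun ht => ht.elim⟩
  obtain ⟨t, ht, et⟩ := h1
  by_cases h2 : ∃ u, (u ∈ Icc b (a + D.n) ∧ D.plane.path u = v) ∧ u ≠ t
  · obtain ⟨u, ⟨hu, eu⟩, hut⟩ := h2
    refine (Set.toFinite {t, u}).subset ?_
    rintro w ⟨hw, ew⟩
    rcases no_three (h.abs_sub_lt hw ht) (h.abs_sub_lt ht hu) (h.abs_sub_lt hw hu)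
      (ew.trans et.symm) (et.trans eu.symm) with e | e | e
    · exact Or.inl e
    · exact absurd e.symm hut
    · exact Or.inr e
  · push Not at h2
    refine (Set.finite_singleton t).subset ?_
    intro w hw
    exact h2 w hw

/-- Near a point passed only once, the rest of the diagram consists of at most two rays. -/
theorem exists_ball_of_unique {t : ℝ} (ht : t ∈ Icc b (a + D.n))
    (hu : ∀ u ∈ Icc b (a + D.n), D.plane.path u = D.plane.path t → u = t) :
    ∃ r > 0, ∀ y ∈ Metric.ball (D.plane.path t) r, y ∈ D.rest a b ↔
      (t < a + D.n ∧ y ∈ ray (D.plane.path t) (D.plane.dirR t)) ∨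
        (b < t ∧ y ∈ ray (D.plane.path t) (D.plane.dirL t)) := by
  obtain ⟨R, hR, hb⟩ := ClosedPolygon.exists_ball_rays D.plane_vertex_ne
    (h.finite_times (D.plane.path t))
  refine ⟨R, hR, fun y hy => ?_⟩
  by_cases hyv : y = D.plane.path t
  · subst hyv
    refine iff_of_true ⟨t, ht, rfl⟩ ?_
    have hray : ∀ d, D.plane.path t ∈ ray (D.plane.path t) d := fun d => ⟨0, le_rfl, by simp⟩
    rcases ht.2.lt_or_eq with h1 | h1
    · exact Or.inl ⟨h1, hray _⟩
    · exact Or.inr ⟨h1 ▸ h.lt_add, hray _⟩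
  · have := hb R le_rfl y hy hyv
    rw [rest, this]
    constructor
    · rintro ⟨u, hu', e, h1⟩
      rw [hu u hu' e] at h1
      exact h1
    · exact fun h1 => ⟨t, ht, rfl, h1⟩

theorem exists_locLine {t : ℝ} (ht : t ∈ Ioo b (a + D.n)) (hf : Int.fract t ≠ 0)
    (hu : ∀ u ∈ Icc b (a + D.n), D.plane.path u = D.plane.path t → u = t) :
    ∃ r, LocLine (D.rest a b) (D.plane.path t) (D.plane.dirR t) r := by
  obtain ⟨r, hr, hb⟩ := h.exists_ball_of_unique (Ioo_subset_Icc_self ht) hu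
  have hd := D.plane.dirR_ne_zero D.plane_vertex_ne t
  refine ⟨r, hd, hr, fun y hy => ?_⟩
  rw [hb y hy, D.plane.dirL_eq_neg hf, ← mem_rays_iff hd]
  simp [ht.1, ht.2]

theorem exists_ball_right : ∃ r > 0, ∀ y ∈ Metric.ball (D.plane.path b) r, y ∈ D.rest a b ↔
    y ∈ ray (D.plane.path b) (D.plane.dirR b) := by
  obtain ⟨r, hr, hb⟩ := h.exists_ball_of_unique ⟨le_rfl, h.lt_add.le⟩
    (fun u hu e => h.eq_right_of_path_eq hu e)
  refine ⟨r, hr, fun y hy => ?_⟩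
  rw [hb y hy]
  simp [h.lt_add]

theorem dirL_add_n : D.plane.dirL (a + D.n) = D.plane.dirL a := by
  have e : ⌈a + (D.n : ℝ)⌉ = ⌈a⌉ + D.n := by exact_mod_cast Int.ceil_add_natCast a D.n
  have hp := D.plane.periodic
  simp only [ClosedPolygon.dirL, e]
  rw [show ⌈a⌉ + (D.n : ℤ) - 1 = ⌈a⌉ - 1 + (D.plane.n : ℤ) by rw [show D.plane.n = D.n from rfl]; ring]
  rw [hp, show (D.n : ℤ) = (D.plane.n : ℤ) from rfl, hp]

theorem exists_ball_left : ∃ r > 0, ∀ y ∈ Metric.ball (D.plane.path a) r, y ∈ D.rest a b ↔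
    y ∈ ray (D.plane.path a) (D.plane.dirL a) := by
  obtain ⟨r, hr, hb⟩ := h.exists_ball_of_unique (t := a + D.n) ⟨h.lt_add.le, le_rfl⟩
    (fun u hu e => h.eq_left_of_path_eq hu (by rw [e, h.path_add_n]))
  rw [h.path_add_n] at hb
  refine ⟨r, hr, fun y hy => ?_⟩
  rw [hb y hy, h.dirL_add_n]
  simp [h.lt_add]

theorem mem_Ioo_of_eq {t u : ℝ} (ht : t ∈ Icc b (a + D.n)) (hu : u ∈ Icc b (a + D.n))
    (htu : t ≠ u) (e : D.plane.path t = D.plane.path u) : t ∈ Ioo b (a + D.n) := by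
  refine ⟨lt_of_le_of_ne ht.1 ?_, lt_of_le_of_ne ht.2 ?_⟩
  · rintro rfl
    exact htu (h.eq_right_of_path_eq hu e.symm).symm
  · rintro rfl
    rw [h.path_add_n] at e
    exact htu (h.eq_left_of_path_eq hu e.symm).symm

/-- Near a crossing of two of its strands, the rest of the diagram consists of two lines. -/
theorem exists_ball_of_crossing {t u : ℝ} (ht : t ∈ Icc b (a + D.n)) (hu : u ∈ Icc b (a + D.n))
    (htu : t ≠ u) (e : D.plane.path t = D.plane.path u) :
    cross (D.plane.dirR t) (D.plane.dirR u) ≠ 0 ∧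
    ∃ r > 0, ∀ y ∈ Metric.ball (D.plane.path t) r, y ∈ D.rest a b ↔
      cross (D.plane.dirR t) (y - D.plane.path t) = 0 ∨
        cross (D.plane.dirR u) (y - D.plane.path t) = 0 := by
  have hc := mem_crossings htu (h.abs_sub_lt ht hu) e
  refine ⟨cross_dirR_ne_zero htu (h.abs_sub_lt ht hu) e, ?_⟩
  have htI := h.mem_Ioo_of_eq ht hu htu e
  have huI := h.mem_Ioo_of_eq hu ht htu.symm e.symm
  obtain ⟨R, hR, hb⟩ := ClosedPolygon.exists_ball_rays D.plane_vertex_ne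
    (h.finite_times (D.plane.path t))
  refine ⟨R, hR, fun y hy => ?_⟩
  rw [← mem_rays_iff (D.plane.dirR_ne_zero D.plane_vertex_ne t),
    ← mem_rays_iff (D.plane.dirR_ne_zero D.plane_vertex_ne u),
    ← D.plane.dirL_eq_neg (fract_ne_zero hc), ← D.plane.dirL_eq_neg (fract_ne_zero (e ▸ hc))]
  by_cases hyv : y = D.plane.path t
  · subst hyv
    exact iff_of_true ⟨t, ht, rfl⟩ (Or.inl (Or.inl ⟨0, le_rfl, by simp⟩))
  · rw [rest, hb R le_rfl y hy hyv]
    constructor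
    · rintro ⟨w, hw, ew, h1⟩
      rcases no_three (h.abs_sub_lt hw ht) (h.abs_sub_lt ht hu) (h.abs_sub_lt hw hu) ew e with
        e1 | e1 | e1
      · subst e1
        exact Or.inl (h1.imp And.right And.right)
      · exact absurd e1 htu
      · subst e1
        exact Or.inr (h1.imp And.right And.right)
    · rintro (h1 | h1)
      · exact ⟨t, ht, rfl, h1.imp (fun h2 => ⟨htI.2, h2⟩) (fun h2 => ⟨htI.1, h2⟩)⟩
      · exact ⟨u, hu, e.symm, h1.imp (fun h2 => ⟨huI.2, h2⟩) (fun h2 => ⟨huI.1, h2⟩)⟩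

/-- Near a crossing with the bridge, the rest of the diagram is a line transverse to the bridge. -/
theorem exists_locLine_of_mem_passes {s : ℝ} (hs : s ∈ D.passes a b) :
    ∃ d r, cross d (D.plane.dirR s) ≠ 0 ∧ LocLine (D.rest a b) (D.plane.path s) d r := by
  obtain ⟨hsI, hc⟩ := h.mem_passes_iff.1 hs
  obtain ⟨t, ht, e, -⟩ := h.exists_rest_of_crossing hsI hc
  have htc : D.plane.path t ∈ D.crossings := e ▸ hc
  obtain ⟨r, hr⟩ := h.exists_locLine ht (fract_ne_zero htc) (fun u hu eu =>
    h.existsUnique_rest hs hu (Ioo_subset_Icc_self ht) (eu.trans e) e)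
  rw [e] at hr
  refine ⟨_, r, ?_, hr⟩
  refine cross_dirR_ne_zero (by linarith [ht.1, hs.1.2] : s < t).ne' ?_ e
  rw [abs_lt]; constructor <;> linarith [hs.1.1, hs.1.2, ht.1, ht.2]

end KnotDiagram.IsOverBridge

end LocalStructure

/-! ### Polygonal access across the rest of the diagram -/

section Access

open Set Topology Filter

theorem ArcTo.congr_of_isPreconnected {p : Plane} {X : Set Plane} (hX : IsClosed X)
    (M : Finset Plane) {s : Set Plane} (hs : IsPreconnected s) (hsX : s ⊆ Xᶜ) {x y : Plane}
    (hx : x ∈ s) (hy : y ∈ s) (h : ArcTo p (Xᶜ ∪ {p} ∪ M) (Xᶜ ∪ {p}) x) :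
    ArcTo p (Xᶜ ∪ {p} ∪ M) (Xᶜ ∪ {p}) y :=
  h.of_isPreconnected hX.isOpen_compl hs hsX (fun _ hz => Or.inl (Or.inl hz))
    (fun _ hz => Or.inl hz) hx hy

/-- The point `x` is joined to `p` by a simple polygonal arc which, apart from its end point, meets
`X` in at most `i` points, none of which is a vertex of the arc or belongs to `F`. -/
def Reach (X : Set Plane) (p : Plane) (F : Set Plane) (i : ℕ) (x : Plane) : Prop :=
  ∃ M : Finset Plane, M.card ≤ i ∧ (∀ m ∈ M, m ∈ X ∧ m ∉ F) ∧
    ArcTo p (Xᶜ ∪ {p} ∪ M) (Xᶜ ∪ {p}) x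

namespace Reach

variable {X : Set Plane} {p : Plane} {F : Set Plane} {i : ℕ} {x y : Plane}

theorem mono (h : Reach X p F i x) {j : ℕ} (hij : i ≤ j) : Reach X p F j x := by
  obtain ⟨M, h1, h2⟩ := h
  exact ⟨M, h1.trans hij, h2⟩

theorem congr (hX : IsClosed X) {s : Set Plane} (hs : IsPreconnected s) (hsX : s ⊆ Xᶜ)
    (hx : x ∈ s) (hy : y ∈ s) (h : Reach X p F i x) : Reach X p F i y := by
  obtain ⟨M, h1, h2, h3⟩ := h
  exact ⟨M, h1, h2, h3.congr_of_isPreconnected hX M hs hsX hx hy⟩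

theorem base (hxp : x ≠ p) (h : segment ℝ x p ⊆ Xᶜ ∪ {p}) : Reach X p F 0 x := by
  refine ⟨∅, le_rfl, by simp, [p], ⟨hxp, by simp [chain], trivial⟩, by simp, ?_, ?_⟩
  · simp only [Finset.coe_empty, union_empty]
    refine union_subset h ?_
    intro z hz
    exact Or.inr hz
  · intro v hv
    rcases List.mem_cons.1 hv with rfl | hv
    · exact h (left_mem_segment ℝ _ _)
    · exact Or.inr (by simpa using hv)

/-- Crossing `X` once, at a place where it is a line, costs one more intersection point. -/
theorem cross_line (hX : IsClosed X) (hF : F.Finite) {m₀ d : Plane} {r : ℝ}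
    (hl : LocLine X m₀ d r) (hx : x ∈ Metric.ball m₀ r) (hxX : x ∉ X) (hy : y ∈ Metric.ball m₀ r)
    (hyX : y ∉ X) (h : Reach X p F i x) : Reach X p F (i + 1) y := by
  classical
  obtain ⟨hd, hr, hb⟩ := hl
  -- the two sides of the line
  set H : ℝ → Set Plane := fun σ => Metric.ball m₀ r ∩ {z | 0 < cross (σ • d) (z - m₀)} with hH
  have hHp : ∀ σ, IsPreconnected (H σ) := fun σ =>
    ((convex_ball _ _).inter (convex_cross_pos (σ • d) m₀)).isPreconnected
  have hHX : ∀ σ, H σ ⊆ Xᶜ := by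
    intro σ z hz hzX
    have := hz.2
    simp only [Set.mem_ofPred_eq, cross_smul_left, (hb z hz.1).1 hzX, mul_zero, lt_irrefl] at this
  have hside : ∀ z ∈ Metric.ball m₀ r, z ∉ X → ∃ σ : ℝ, (σ = 1 ∨ σ = -1) ∧ z ∈ H σ := by
    intro z hz hzX
    have : cross d (z - m₀) ≠ 0 := fun e => hzX ((hb z hz).2 e)
    rcases this.lt_or_gt with h1 | h1
    · exact ⟨-1, Or.inr rfl, hz, by simp only [Set.mem_ofPred_eq, cross_smul_left]; linarith⟩
    · exact ⟨1, Or.inl rfl, hz, by simp only [Set.mem_ofPred_eq, cross_smul_left]; linarith⟩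
  obtain ⟨σ, hσ, hxσ⟩ := hside x hx hxX
  obtain ⟨τ, hτ, hyτ⟩ := hside y hy hyX
  by_cases hστ : σ = τ
  · subst hστ
    exact (h.congr hX (hHp σ) (hHX σ) hxσ hyτ).mono (Nat.le_succ i)
  have hτσ : τ = -σ := by
    rcases hσ with rfl | rfl <;> rcases hτ with rfl | rfl <;> simp at hστ ⊢
  have hσ2 : σ * σ = 1 := by rcases hσ with rfl | rfl <;> norm_num
  obtain ⟨M, h1, h2, h3⟩ := h
  -- a point of the line to cross at
  obtain ⟨m, hmb, hmX, hmFM⟩ : ∃ m ∈ Metric.ball m₀ r, m ∈ X ∧ m ∉ F ∪ M := by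
    by_contra hcon
    push Not at hcon
    have hc : Tendsto (fun c : ℝ => m₀ + c • d) (𝓝 0) (𝓝 m₀) := by
      have hcc : Continuous (fun c : ℝ => m₀ + c • d) := by fun_prop
      simpa using hcc.tendsto 0
    have hev := hc.eventually (Metric.ball_mem_nhds m₀ hr)
    obtain ⟨δ, hδ, hball⟩ := Metric.eventually_nhds_iff_ball.1 hev
    have hinf : ((fun c : ℝ => m₀ + c • d) '' Ioo 0 δ).Infinite :=
      (Ioo_infinite hδ).image fun c _ c' _ e =>
        smul_left_injective ℝ hd (add_left_cancel e)
    refine hinf ((hF.union M.finite_toSet).subset ?_)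
    rintro _ ⟨c, hc, rfl⟩
    have hcb : m₀ + c • d ∈ Metric.ball m₀ r := by
      refine hball c ?_
      rw [Metric.mem_ball, Real.dist_eq, sub_zero, abs_lt]
      constructor <;> linarith [hc.1, hc.2]
    refine hcon _ hcb ((hb _ hcb).2 ?_)
    rw [add_sub_cancel_left, cross_smul, cross_same, mul_zero]
  have hcm : cross d (m - m₀) = 0 := (hb m hmb).1 hmX
  have hev : ∀ᶠ ε in 𝓝[>] (0 : ℝ), 0 < ε ∧ m + (ε * σ) • rot d ∈ Metric.ball m₀ r ∧
      m + (-(ε * σ)) • rot d ∈ Metric.ball m₀ r := by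
    have hc : ∀ c : ℝ, ∀ᶠ ε in 𝓝[>] (0 : ℝ), m + (ε * c) • rot d ∈ Metric.ball m₀ r := by
      intro c
      have hcc : Continuous (fun ε : ℝ => m + (ε * c) • rot d) := by fun_prop
      have h0 := hcc.tendsto 0
      simp only [zero_mul, zero_smul, add_zero] at h0
      exact (h0.mono_left nhdsWithin_le_nhds).eventually (Metric.isOpen_ball.mem_nhds hmb)
    filter_upwards [self_mem_nhdsWithin, hc σ, hc (-σ)] with ε h1 h2 h3
    exact ⟨h1, h2, by rwa [← mul_neg]⟩
  obtain ⟨ε, hε, hb1, hb2⟩ := hev.exists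
  set x' := m + (ε * σ) • rot d with hx'
  set w := m + (-(ε * σ)) • rot d with hw
  have hsq := sqLen_pos hd
  have hcr : ∀ c : ℝ, cross d (m + c • rot d - m₀) = c * sqLen d := by
    intro c
    rw [show m + c • rot d - m₀ = (m - m₀) + c • rot d by abel, cross_add, hcm, cross_smul,
      cross_rot, zero_add]
  have hx'σ : x' ∈ H σ := by
    refine ⟨hb1, ?_⟩
    simp only [Set.mem_ofPred_eq, cross_smul_left, hx', hcr]
    nlinarith [mul_pos hε hsq]
  have hwτ : w ∈ H τ := by
    refine ⟨hb2, ?_⟩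
    simp only [Set.mem_ofPred_eq, cross_smul_left, hw, hcr, hτσ]
    nlinarith [mul_pos hε hsq]
  have h4 := h3.congr_of_isPreconnected hX M (hHp σ) (hHX σ) hxσ hx'σ
  -- on the short segment from one side to the other, `X` contains only the point `m`
  have hseg : ∀ z ∈ segment ℝ x' w, z ∈ X → z = m := by
    intro z hz hzX
    have hzb := (convex_ball m₀ r).segment_subset hb1 hb2 hz
    rw [segment_eq_image_lineMap] at hz
    obtain ⟨t, -, rfl⟩ := hz
    have e : AffineMap.lineMap x' w t = m + (ε * σ * (1 - 2 * t)) • rot d := by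
      rw [AffineMap.lineMap_apply_module', hx', hw]
      module
    rw [e] at hzb hzX ⊢
    have := (hb _ hzb).1 hzX
    rw [hcr] at this
    rw [(mul_eq_zero.1 this).resolve_right hsq.ne', zero_smul, add_zero]
  have hmF : m ∉ F := fun hm => hmFM (Or.inl hm)
  have hmM : m ∉ M := fun hm => hmFM (Or.inr hm)
  have hwX : w ∈ Xᶜ := hHX τ hwτ
  have h5 : ArcTo p (Xᶜ ∪ {p} ∪ M ∪ segment ℝ x' w) (Xᶜ ∪ {p}) w := by
    refine h4.step (Or.inl hwX) ?_
    rintro z ⟨hz, hz' | hz'⟩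
    · exact hz'
    · have := hseg z hz (h2 z hz').1
      subst this
      exact absurd hz' hmM
  refine Reach.congr hX (hHp τ) (hHX τ) hwτ hyτ ⟨insert m M, ?_, ?_, h5.mono ?_ subset_rfl⟩
  · exact (Finset.card_insert_le _ _).trans (Nat.succ_le_succ h1)
  · intro z hz
    rcases Finset.mem_insert.1 hz with rfl | hz
    · exact ⟨hmX, hmF⟩
    · exact h2 z hz
  · rw [Finset.coe_insert]
    refine union_subset (union_subset_union_right _ (subset_insert _ _)) ?_
    intro z hz
    by_cases hzX : z ∈ X
    · exact Or.inr (Or.inl (hseg z hz hzX))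
    · exact Or.inl (Or.inl hzX)

/-- The points of an arc that gives access have themselves access. -/
theorem of_mem_chain {M : Finset Plane} (hM : M.card ≤ i) (hMX : ∀ m ∈ M, m ∈ X ∧ m ∉ F)
    {L : List Plane} (h1 : IsArc L) (h2 : L.getLast? = some p)
    (h3 : chain L ⊆ Xᶜ ∪ {p} ∪ M) (h4 : ∀ v ∈ L, v ∈ Xᶜ ∪ {p}) {z : Plane}
    (hz : z ∈ chain L) (hzX : z ∉ X) : Reach X p F i z := by
  obtain ⟨L', g1, g2, g3, g4⟩ := h1.truncate h2 hz
  refine ⟨M, hM, hMX, L', g1, g2, g3.trans h3, ?_⟩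
  intro v hv
  rcases List.mem_cons.1 hv with rfl | hv
  · exact Or.inl hzX
  · exact h4 v (g4 v hv)

end Reach


namespace KnotDiagram.IsOverBridge

variable {D : KnotDiagram} {a b : ℝ} {l : ℕ} (h : D.IsOverBridge a b l)

include h

theorem bridge_notMem_rest {s : ℝ} (hs : s ∈ Ioo a b) (hp : s ∉ D.passes a b) :
    D.plane.path s ∉ D.rest a b := fun hr => hp ⟨hs, hr⟩

theorem bridge_subset_compl_rest {s s' : ℝ} (hs : a < s) (hs' : s' < b)
    (hp : D.passes a b ∩ Icc s s' = ∅) : D.plane.path '' Icc s s' ⊆ (D.rest a b)ᶜ := by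
  rintro _ ⟨u, hu, rfl⟩
  refine h.bridge_notMem_rest ⟨hs.trans_le hu.1, hu.2.trans_lt hs'⟩ fun hm => ?_
  exact (Set.eq_empty_iff_forall_notMem.1 hp u) ⟨hm, hu⟩

theorem isPreconnected_bridge (s s' : ℝ) : IsPreconnected (D.plane.path '' Icc s s') :=
  isPreconnected_Icc.image _ D.plane.continuous_path.continuousOn

/-- Walking along the bridge towards its left end, access costs one more intersection point for
each crossing passed. -/
theorem reach_left {F : Set Plane} (hF : F.Finite) {p : Plane} {i : ℕ} {s s' : ℝ} (hs : a < s)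
    (hss : s ≤ s') (hs' : s' < b) (hps : s ∉ D.passes a b) (hps' : s' ∉ D.passes a b)
    (hr : Reach (D.rest a b) p F i (D.plane.path s')) :
    Reach (D.rest a b) p F (i + (D.passes a b ∩ Icc s s').ncard) (D.plane.path s) := by
  induction hn : (D.passes a b ∩ Icc s s').ncard using Nat.strong_induction_on
    generalizing i s s' with
  | _ n ih =>
  have hfin : ∀ c e, (D.passes a b ∩ Icc c e).Finite := fun c e => h.finite_passes.inter_of_left _
  rcases Set.eq_empty_or_nonempty (D.passes a b ∩ Icc s s') with h0 | ⟨τ, hτ, hτI⟩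
  · refine (hr.congr h.isCompact_rest.isClosed (h.isPreconnected_bridge s s')
      (h.bridge_subset_compl_rest hs hs' h0) ⟨s', ⟨hss, le_rfl⟩, rfl⟩
      ⟨s, ⟨le_rfl, hss⟩, rfl⟩).mono (Nat.le_add_right _ _)
  have hτ1 : s < τ := lt_of_le_of_ne hτI.1 (fun e => hps (e ▸ hτ))
  have hτ2 : τ < s' := lt_of_le_of_ne hτI.2 (fun e => hps' (e ▸ hτ))
  obtain ⟨d, r, -, hl⟩ := h.exists_locLine_of_mem_passes hτ
  have hball := D.plane.continuous_path.continuousAt.preimage_mem_nhds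
    (Metric.ball_mem_nhds (D.plane.path τ) hl.2.1)
  have hother : (D.passes a b \ {τ})ᶜ ∈ 𝓝 τ :=
    (h.finite_passes.subset sdiff_subset).isClosed.isOpen_compl.mem_nhds (by simp)
  obtain ⟨δ, hδ, hsub⟩ := Metric.mem_nhds_iff.1
    (Filter.inter_mem (Filter.inter_mem hball hother) (Ioo_mem_nhds hτ1 hτ2))
  have hmem : ∀ u, |u - τ| < δ → u ≠ τ → D.plane.path u ∈ Metric.ball (D.plane.path τ) r ∧
      u ∉ D.passes a b ∧ u ∈ Ioo s s' := by
    intro u hu hne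
    obtain ⟨⟨m1, m2⟩, m3⟩ := hsub (Metric.mem_ball.2 (by rwa [Real.dist_eq]))
    exact ⟨m1, fun hm => m2 ⟨hm, hne⟩, m3⟩
  obtain ⟨b1, c1, e1⟩ := hmem (τ - δ / 2) (by rw [abs_lt]; constructor <;> linarith) (by linarith)
  obtain ⟨b2, c2, e2⟩ := hmem (τ + δ / 2) (by rw [abs_lt]; constructor <;> linarith) (by linarith)
  set n₁ := (D.passes a b ∩ Icc (τ + δ / 2) s').ncard with hn1
  set n₂ := (D.passes a b ∩ Icc s (τ - δ / 2)).ncard with hn2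
  have hsum : n₁ + 1 + n₂ ≤ n := by
    have hd1 : Disjoint (D.passes a b ∩ Icc (τ + δ / 2) s') {τ} := by
      rw [Set.disjoint_singleton_right]
      exact fun hm => by linarith [hm.2.1]
    have hd2 : Disjoint (D.passes a b ∩ Icc (τ + δ / 2) s' ∪ {τ})
        (D.passes a b ∩ Icc s (τ - δ / 2)) := by
      rw [Set.disjoint_left]
      rintro u (hu | rfl) hu'
      · linarith [hu.2.1, hu'.2.2]
      · linarith [hu'.2.2]
    have e : n₁ + 1 + n₂ = (D.passes a b ∩ Icc (τ + δ / 2) s' ∪ {τ} ∪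
        D.passes a b ∩ Icc s (τ - δ / 2)).ncard := by
      rw [ncard_union_eq hd2 ((hfin _ _).union (finite_singleton _)) (hfin _ _),
        ncard_union_eq hd1 (hfin _ _) (finite_singleton _), ncard_singleton]
    rw [e, ← hn]
    refine ncard_le_ncard ?_ (hfin _ _)
    rintro u ((hu | rfl) | hu)
    · exact ⟨hu.1, e2.1.le.trans hu.2.1, hu.2.2⟩
    · exact ⟨hτ, hτI⟩
    · exact ⟨hu.1, hu.2.1, hu.2.2.trans e1.2.le⟩
  have r1 := ih n₁ (by omega) (hs.trans e2.1) e2.2.le hs' c2 hps' hr rfl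
  have r2 := r1.cross_line h.isCompact_rest.isClosed hF hl b2
    (h.bridge_notMem_rest ⟨hs.trans e2.1, e2.2.trans hs'⟩ c2) b1
    (h.bridge_notMem_rest ⟨hs.trans e1.1, e1.2.trans hs'⟩ c1)
  exact (ih n₂ (by omega) hs e1.1.le (e1.2.trans hs') hps c1 r2 rfl).mono (by omega)

/-- The points of the bridge near its right end have access without intersections. -/
theorem reach_right (F : Set Plane) : ∃ s₀ ∈ Ioo a b, ∀ s ∈ Ioo s₀ b,
    s ∉ D.passes a b ∧ Reach (D.rest a b) (D.plane.path b) F 0 (D.plane.path s) := by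
  obtain ⟨r, hr, hb⟩ := h.exists_ball_right
  set p := D.plane.path b with hp
  set d := D.plane.dirR b with hd
  have hd0 : d ≠ 0 := D.plane.dirR_ne_zero D.plane_vertex_ne b
  have hball := D.plane.continuous_path.continuousAt.preimage_mem_nhds
    (Metric.ball_mem_nhds (D.plane.path b) hr)
  obtain ⟨δ, hδ, hsub⟩ := Metric.mem_nhds_iff.1 (Filter.inter_mem hball (Ioi_mem_nhds h.lt))
  have hceil : 0 < b - ⌈b⌉ + 1 := by linarith [Int.ceil_lt_add_one b]
  set δ' := min δ (b - ⌈b⌉ + 1) with hδ'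
  have hδ'0 : 0 < δ' := lt_min hδ hceil
  -- near its right end, the bridge is opposite to the single ray of the rest
  have hline : ∀ s ∈ Ioo (b - δ') b, D.plane.path s = p + (-(b - s)) • d := by
    intro s hs
    have := D.plane.path_sub_left (t := b) (s := b - s) (by linarith [hs.2])
      (by linarith [hs.1, min_le_right δ (b - ⌈b⌉ + 1)])
    rw [sub_sub_cancel, D.plane.dirL_eq_neg h.fract_right] at this
    rw [this, hp, hd, smul_neg, neg_smul]
  have hin : ∀ s ∈ Ioo (b - δ') b, D.plane.path s ∈ Metric.ball p r ∧ a < s := by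
    intro s hs
    refine hsub ?_
    rw [Metric.mem_ball, Real.dist_eq, abs_lt]
    constructor <;> linarith [hs.1, hs.2, min_le_left δ (b - ⌈b⌉ + 1)]
  have hray : ∀ c : ℝ, c < 0 → p + c • d ∉ ray p d := by
    rintro c hc ⟨c', hc', e⟩
    have := smul_left_injective ℝ hd0 (add_left_cancel e)
    linarith
  refine ⟨max (b - δ') ((a + b) / 2), ⟨lt_max_of_lt_right (by linarith [h.lt]),
    max_lt (by linarith) (by linarith [h.lt])⟩, ?_⟩
  intro s hs
  have hs' : s ∈ Ioo (b - δ') b := ⟨(le_max_left _ _).trans_lt hs.1, hs.2⟩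
  refine ⟨fun hm => ?_, ?_⟩
  · refine hray (-(b - s)) (by linarith [hs.2]) ?_
    have := (hb _ (hin s hs').1).1 hm.2
    rwa [hline s hs'] at this
  · refine Reach.base ?_ ?_
    · intro e
      have := h.injOn ⟨(hin s hs').2.le, hs.2.le⟩ ⟨h.lt.le, le_rfl⟩ e
      linarith [hs.2]
    · intro z hz
      have hzb : z ∈ Metric.ball p r :=
        (convex_ball p r).segment_subset (hin s hs').1 (Metric.mem_ball_self hr) hz
      by_cases hzp : z = p
      · exact Or.inr hzp
      · left
        intro hzr
        rw [segment_symm, segment_eq_image_lineMap] at hz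
        obtain ⟨t, ht, rfl⟩ := hz
        have e : AffineMap.lineMap p (D.plane.path s) t = p + (t * -(b - s)) • d := by
          rw [hline s hs', AffineMap.lineMap_apply_module']
          module
        rw [e] at hzb hzr hzp
        have ht0 : 0 < t := lt_of_le_of_ne ht.1 (by rintro rfl; simp at hzp)
        exact hray _ (by nlinarith [hs.2]) ((hb _ hzb).1 hzr)

/-- Near the left end of the bridge, the segment from a point of the bridge to that end meets the
rest of the diagram in this end only. -/
theorem segment_left : ∃ s₀ ∈ Ioo a b, ∀ s ∈ Ioo a s₀, s ∉ D.passes a b ∧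
    segment ℝ (D.plane.path s) (D.plane.path a) ∩ D.rest a b ⊆ {D.plane.path a} := by
  obtain ⟨r, hr, hb⟩ := h.exists_ball_left
  set q := D.plane.path a with hq
  set d := D.plane.dirR a with hd
  have hd0 : d ≠ 0 := D.plane.dirR_ne_zero D.plane_vertex_ne a
  rw [D.plane.dirL_eq_neg h.fract_left] at hb
  have hball := D.plane.continuous_path.continuousAt.preimage_mem_nhds
    (Metric.ball_mem_nhds (D.plane.path a) hr)
  obtain ⟨δ, hδ, hsub⟩ := Metric.mem_nhds_iff.1 (Filter.inter_mem hball (Iio_mem_nhds h.lt))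
  have hfl : 0 < ⌊a⌋ + 1 - a := by linarith [Int.lt_floor_add_one a]
  set δ' := min δ (⌊a⌋ + 1 - a) with hδ'
  have hδ'0 : 0 < δ' := lt_min hδ hfl
  have hline : ∀ s ∈ Ioo a (a + δ'), D.plane.path s = q + (s - a) • d := by
    intro s hs
    have := D.plane.path_add_right (t := a) (s := s - a) (by linarith [hs.1])
      (by linarith [hs.2, min_le_right δ (⌊a⌋ + 1 - a)])
    rwa [add_sub_cancel] at this
  have hin : ∀ s ∈ Ioo a (a + δ'), D.plane.path s ∈ Metric.ball q r ∧ s < b := by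
    intro s hs
    refine hsub ?_
    rw [Metric.mem_ball, Real.dist_eq, abs_lt]
    constructor <;> linarith [hs.1, hs.2, min_le_left δ (⌊a⌋ + 1 - a)]
  have hray : ∀ c : ℝ, 0 < c → q + c • d ∉ ray q (-d) := by
    rintro c hc ⟨c', hc', e⟩
    rw [smul_neg, ← neg_smul] at e
    have := smul_left_injective ℝ hd0 (add_left_cancel e)
    linarith
  refine ⟨min (a + δ') ((a + b) / 2), ⟨lt_min (by linarith) (by linarith [h.lt]),
    min_lt_of_right_lt (by linarith [h.lt])⟩, ?_⟩
  intro s hs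
  have hs' : s ∈ Ioo a (a + δ') := ⟨hs.1, hs.2.trans_le (min_le_left _ _)⟩
  refine ⟨fun hm => ?_, ?_⟩
  · refine hray (s - a) (by linarith [hs.1]) ?_
    have := (hb _ (hin s hs').1).1 hm.2
    rwa [hline s hs'] at this
  · rintro z ⟨hz, hzr⟩
    have hzb : z ∈ Metric.ball q r :=
      (convex_ball q r).segment_subset (hin s hs').1 (Metric.mem_ball_self hr) hz
    by_contra hzq
    rw [segment_symm, segment_eq_image_lineMap] at hz
    obtain ⟨t, ht, rfl⟩ := hz
    have e : AffineMap.lineMap q (D.plane.path s) t = q + (t * (s - a)) • d := by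
      rw [hline s hs', AffineMap.lineMap_apply_module']
      module
    rw [e] at hzb hzr hzq
    have ht0 : 0 < t := lt_of_le_of_ne ht.1 (by rintro rfl; simp at hzq)
    exact hray _ (by nlinarith [hs.1]) ((hb _ hzb).1 hzr)

end KnotDiagram.IsOverBridge

end Access

/-! ### Rerouting the bridge -/

section Reroute

open Set Topology Filter

theorem isArc_map_fst {L : List Space} (h : IsArc L) (hinj : InjOn Prod.fst (chain L)) :
    IsArc (L.map Prod.fst) := by
  induction L with
  | nil => exact h
  | cons u L ih =>
    cases L with
    | nil => trivial
    | cons v L =>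
      have hsub : chain (v :: L) ⊆ chain (u :: v :: L) := subset_union_right
      have hseg : segment ℝ u v ⊆ chain (u :: v :: L) := subset_union_left
      refine ⟨fun e => h.1 (hinj (mem_chain_of_mem (by simp)) (mem_chain_of_mem (by simp)) e), ?_,
        ih h.2.2 (hinj.mono hsub)⟩
      rintro z ⟨hz, hz'⟩
      rw [← image_fst_segment] at hz
      have e : chain (v.1 :: L.map Prod.fst) = Prod.fst '' chain (v :: L) :=
        chain_map_fst (v :: L)
      change z ∈ chain (v.1 :: L.map Prod.fst) at hz'
      rw [e] at hz'
      obtain ⟨y, hy, rfl⟩ := hz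
      obtain ⟨y', hy', e'⟩ := hz'
      have := hinj (hsub hy') (hseg hy) e'
      subst this
      rw [h.2.1 ⟨hy, hy'⟩]
      rfl

open Classical in
/-- A plane point is lifted to the height `H`, except for two points `p` and `q`, whose heights are
prescribed. -/
noncomputable def lift (p q : Plane) (hp hq H : ℝ) (z : Plane) : Space :=
  (z, if z = q then hq else if z = p then hp else H)

theorem map_fst_map_lift (p q : Plane) (hp hq H : ℝ) (L : List Plane) :
    (L.map (lift p q hp hq H)).map Prod.fst = L := by
  simp [lift, Function.comp_def]

section Height

variable {p q : Plane} {hp hq : ℝ}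

theorem lift_snd_special {u : Plane} (hu : u = p ∨ u = q) :
    ∃ c, ∀ H, (lift p q hp hq H u).2 = c := by
  by_cases h : u = q
  · exact ⟨hq, fun H => by simp [lift, h]⟩
  · obtain rfl := hu.resolve_right h
    exact ⟨hp, fun H => by simp [lift, h]⟩

theorem lift_snd_other {u : Plane} (hu : ¬ (u = p ∨ u = q)) (H : ℝ) :
    (lift p q hp hq H u).2 = H := by
  push Not at hu
  simp [lift, hu.1, hu.2]

/-- A lifted edge, not both ends of which have prescribed heights, lies arbitrarily high over a
given point if the lifting height is large. -/
theorem eventually_lt_segment {u v m : Plane} (huv : u ≠ v)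
    (hs : ¬ ((u = p ∨ u = q) ∧ (v = p ∨ v = q))) (hm : ¬ (m = p ∨ m = q)) (C : ℝ) :
    ∀ᶠ H in atTop, ∀ y ∈ segment ℝ (lift p q hp hq H u) (lift p q hp hq H v),
      y.1 = m → C < y.2 := by
  by_cases hmem : m ∈ segment ℝ u v
  swap
  · refine Eventually.of_forall fun H y hy e => absurd ?_ hmem
    have := (image_fst_segment _ _).subset ⟨y, hy, rfl⟩
    rwa [e] at this
  rw [segment_eq_image_lineMap] at hmem
  obtain ⟨t, ht, rfl⟩ := hmem
  have key : ∃ A c : ℝ, 0 < c ∧ ∀ H, (1 - t) * (lift p q hp hq H u).2 +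
      t * (lift p q hp hq H v).2 = A + c * H := by
    by_cases hu : u = p ∨ u = q
    · have hv : ¬ (v = p ∨ v = q) := fun hv => hs ⟨hu, hv⟩
      obtain ⟨c, hc⟩ := lift_snd_special (hp := hp) (hq := hq) hu
      refine ⟨(1 - t) * c, t, lt_of_le_of_ne ht.1 ?_, fun H => by rw [hc, lift_snd_other hv]⟩
      rintro rfl
      exact hm (by simpa using hu)
    · by_cases hv : v = p ∨ v = q
      · obtain ⟨c, hc⟩ := lift_snd_special (hp := hp) (hq := hq) hv
        refine ⟨t * c, 1 - t, lt_of_le_of_ne (by linarith [ht.2]) ?_,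
          fun H => by rw [hc, lift_snd_other hu]; ring⟩
        intro e
        have : t = 1 := by linarith
        subst this
        exact hm (by simpa using hv)
      · exact ⟨0, 1, one_pos, fun H => by rw [lift_snd_other hu, lift_snd_other hv]; ring⟩
  obtain ⟨A, c, hc, hA⟩ := key
  filter_upwards [eventually_gt_atTop ((C - A) / c)] with H hH y hy e
  rw [segment_eq_image_lineMap] at hy
  obtain ⟨t', -, rfl⟩ := hy
  have e1 : t' = t := by
    refine AffineMap.lineMap_injective ℝ huv ?_
    rw [← e]
    simp [AffineMap.lineMap_apply_module, lift]
  subst e1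
  have e2 : (AffineMap.lineMap (lift p q hp hq H u) (lift p q hp hq H v) t' : Space).2 =
      A + c * H := by
    rw [← hA]
    simp [AffineMap.lineMap_apply_module]
  rw [e2]
  rw [div_lt_iff₀ hc] at hH
  linarith

theorem eventually_lt_chain {L : List Plane} (hL : IsArc L) (hqL : q ∉ L)
    (hlen : 2 ≤ L.length) {m : Plane} (hm : ¬ (m = p ∨ m = q)) (C : ℝ) :
    ∀ᶠ H in atTop, ∀ y ∈ chain (L.map (lift p q hp hq H)), y.1 = m → C < y.2 := by
  induction L with
  | nil => exact hL.elim
  | cons u L ih =>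
    cases L with
    | nil => simp at hlen
    | cons v L =>
      have h1 := eventually_lt_segment (p := p) (q := q) (hp := hp) (hq := hq) (m := m) hL.1 (by
        rintro ⟨h1 | h1, h2 | h2⟩
        · exact hL.1 (h1.trans h2.symm)
        · exact hqL (by simp [h2])
        · exact hqL (by simp [h1])
        · exact hqL (by simp [h1])) hm C
      cases L with
      | nil =>
        filter_upwards [h1] with H h1 y hy e
        rcases hy with hy | hy
        · exact h1 y hy e
        · rw [show y = _ from hy] at e ⊢
          exact h1 _ (right_mem_segment ℝ _ _) e
      | cons w L =>
        have h2 := ih hL.2.2 (fun hm => hqL (List.mem_cons_of_mem _ hm)) (by simp)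
        filter_upwards [h1, h2] with H h1 h2 y hy e
        rcases hy with hy | hy
        · exact h1 y hy e
        · exact h2 y hy e

end Height

theorem PolygonalKnot.crossings_eq_carrier (K : PolygonalKnot) :
    K.crossings = {x | ∃ z ∈ K.carrier, ∃ z' ∈ K.carrier, z ≠ z' ∧ z.1 = x ∧ z'.1 = x} := by
  ext x
  constructor
  · rintro ⟨s, t, h1, h2, h3⟩
    exact ⟨_, ⟨s, rfl⟩, _, ⟨t, rfl⟩, h1, h2, h3⟩
  · rintro ⟨_, ⟨s, rfl⟩, _, ⟨t, rfl⟩, h1, h2, h3⟩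
    exact ⟨s, t, h1, h2, h3⟩

/-- The last entry of a nonempty list, displayed. -/
theorem exists_eq_append_of_getLast? {E : Type} {x y : E} {L : List E}
    (h : (x :: L).getLast? = some y) (hxy : x ≠ y) : ∃ M, L = M ++ [y] := by
  cases L with
  | nil => simp at h; exact absurd h hxy
  | cons z L =>
    have : (z :: L).getLast? = some y := by simpa using h
    obtain ⟨M, hM⟩ := List.getLast?_eq_some_iff.1 this
    exact ⟨M, hM⟩

namespace KnotDiagram.IsOverBridge

variable {D : KnotDiagram} {a b : ℝ} {l : ℕ} (h : D.IsOverBridge a b l)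

include h

/-- The part of the diagram outside of the bridge in space. -/
theorem exists_rest_list : ∃ N : List Space, IsArc (D.path a :: (N ++ [D.path b])) ∧
    chain (D.path a :: (N ++ [D.path b])) = D.path '' Icc b (a + D.n) ∧
    ∀ v ∈ N, v = D.path a ∨ v = D.path b ∨ v ∈ range D.vertex := by
  obtain ⟨L, h1, h2, h3, h4⟩ := D.simple.exists_arc h.lt_add (t := a + D.n) (by linarith [h.lt])
  have ha : D.path (a + D.n) = D.path a := D.path_add a
  rw [ha] at h2 h4
  have hne : D.path b ≠ D.path a := path_ne h.lt.ne' (by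
    rw [abs_lt]; constructor <;> linarith [h.lt, h.lt_add])
  obtain ⟨M, rfl⟩ := exists_eq_append_of_getLast? h2 hne
  have e : (D.path b :: (M ++ [D.path a])).reverse = D.path a :: (M.reverse ++ [D.path b]) := by
    simp
  refine ⟨M.reverse, e ▸ h1.reverse, by rw [← e, chain_reverse, h3], ?_⟩
  intro v hv
  rcases h4 v (by simp at hv ⊢; tauto) with h5 | h5 | h5
  · exact Or.inr (Or.inl h5)
  · exact Or.inl h5
  · exact Or.inr (Or.inr h5)

/-- The bridge in space, run through from its right to its left end. -/
theorem exists_bridge_list : ∃ N : List Space, IsArc ((D.path b :: (N ++ [D.path a])).map Prod.fst) ∧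
    chain (D.path b :: (N ++ [D.path a])) = D.path '' Icc a b := by
  obtain ⟨L, h1, h2, h3, -⟩ := D.simple.exists_arc h.lt h.lt_add
  have hne : D.path a ≠ D.path b := path_ne h.lt.ne (by
    rw [abs_lt]; constructor <;> linarith [h.lt, h.lt_add])
  obtain ⟨M, rfl⟩ := exists_eq_append_of_getLast? h2 hne
  have e : (D.path a :: (M ++ [D.path b])).reverse = D.path b :: (M.reverse ++ [D.path a]) := by
    simp
  have hc : chain (D.path b :: (M.reverse ++ [D.path a])) = D.path '' Icc a b := by
    rw [← e, chain_reverse, h3]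
  refine ⟨M.reverse, isArc_map_fst (e ▸ h1.reverse) ?_, hc⟩
  rw [hc]
  rintro _ ⟨s, hs, rfl⟩ _ ⟨t, ht, rfl⟩ est
  rw [h.injOn hs ht (by rw [plane_path, plane_path, est])]

theorem path_fst_mem_rest {z : Space} (hz : z ∈ D.path '' Icc b (a + D.n)) :
    z.1 ∈ D.rest a b := by
  obtain ⟨s, hs, rfl⟩ := hz
  exact ⟨s, hs, D.plane_path s⟩

theorem eq_right_of_fst_eq {z : Space} (hz : z ∈ D.path '' Icc b (a + D.n))
    (e : z.1 = D.plane.path b) : z = D.path b := by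
  obtain ⟨s, hs, rfl⟩ := hz
  rw [h.eq_right_of_path_eq hs (by rw [plane_path, e])]

theorem eq_left_of_fst_eq {z : Space} (hz : z ∈ D.path '' Icc b (a + D.n))
    (e : z.1 = D.plane.path a) : z = D.path a := by
  obtain ⟨s, hs, rfl⟩ := hz
  rw [h.eq_left_of_path_eq hs (by rw [plane_path, e])]
  exact D.path_add a

theorem carrier_eq : D.carrier = D.path '' Icc b (a + D.n) ∪ D.path '' Icc a b := by
  rw [D.carrier_eq_image_Icc a, ← Icc_union_Icc_eq_Icc h.lt.le h.lt_add.le, image_union, union_comm]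

theorem isCompact_rest_space : IsCompact (D.path '' Icc b (a + D.n)) :=
  isCompact_Icc.image D.continuous_path

/-- The bridge may be replaced by any other arc in the plane between its ends; the new arc is
lifted above everything else. -/
theorem exists_reroute {L : List Plane} (hL : IsArc (D.plane.path a :: L))
    (hLb : (D.plane.path a :: L).getLast? = some (D.plane.path b)) {M : Finset Plane}
    (hLM : ∀ z ∈ chain (D.plane.path a :: L), z ∈ D.rest a b →
      z = D.plane.path b ∨ z = D.plane.path a ∨ z ∈ M)
    (hM : ∀ m ∈ M, m ∉ D.crossings ∧ m ∉ range D.plane.vertex ∧ m ≠ D.plane.path b ∧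
      m ≠ D.plane.path a)
    (hV : ∀ v ∈ L, v ∈ D.rest a b → v = D.plane.path b ∨ v = D.plane.path a) :
    ∃ (D' : KnotDiagram) (l' : ℕ), Relation.EqvGen DeltaMove D.carrier D'.carrier ∧
      D'.HasBridge l' ∧ D'.crossingNumber = (D.restCrossings a b).ncard + l' ∧ l' ≤ M.card := by
  classical
  set p := D.plane.path b with hp
  set q := D.plane.path a with hq
  have hpq : q ≠ p := h.path_left_ne_right
  have hp1 : (D.path b).1 = p := (D.plane_path b).symm
  have hq1 : (D.path a).1 = q := (D.plane_path a).symm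
  -- insert a vertex in the first edge, so that no edge joins the two ends
  obtain ⟨L, m₀, hL, hLb, hLM, hV, hm₀p⟩ : ∃ (L₁ : List Plane) (m₀ : Plane),
      IsArc (q :: m₀ :: L₁) ∧ (q :: m₀ :: L₁).getLast? = some p ∧
      (∀ z ∈ chain (q :: m₀ :: L₁), z ∈ D.rest a b → z = p ∨ z = q ∨ z ∈ M) ∧
      (∀ v ∈ m₀ :: L₁, v ∈ D.rest a b → v = p ∨ v = q) ∧ m₀ ≠ p := by
    cases L with
    | nil => simp at hLb; exact absurd hLb hpq
    | cons y L =>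
      obtain ⟨m₀, hm₀, hm₀M⟩ : ∃ m₀ ∈ openSegment ℝ q y, m₀ ∉ insert p (insert q M) := by
        have hinf : (openSegment ℝ q y).Infinite := by
          rw [openSegment_eq_image_lineMap]
          exact (Ioo_infinite one_pos).image (AffineMap.lineMap_injective ℝ hL.1).injOn
        exact hinf.exists_notMem_finset _
      obtain ⟨g1, g2⟩ := hL.insert hm₀
      simp only [Finset.mem_insert, not_or] at hm₀M
      refine ⟨y :: L, m₀, g1, by simpa using hLb, fun z hz => hLM z (g2 ▸ hz), ?_, hm₀M.1⟩
      intro v hv hvr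
      rcases List.mem_cons.1 hv with rfl | hv
      · have := hLM v (g2 ▸ mem_chain_of_mem (by simp)) hvr
        tauto
      · exact hV v hv hvr
  set R : Set Space := D.path '' Icc b (a + D.n) with hR
  -- choose the height
  obtain ⟨C, hC⟩ : ∃ C, ∀ z ∈ R, z.2 < C := by
    obtain ⟨C, hC⟩ := (h.isCompact_rest_space.image continuous_snd).bddAbove
    exact ⟨C + 1, fun z hz => (hC ⟨z, hz, rfl⟩).trans_lt (by linarith)⟩
  have hqL : q ∉ m₀ :: L := by
    intro hm
    exact hL.head_notMem (mem_chain_of_mem hm)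
  have hLlen : 2 ≤ (m₀ :: L).length := by
    cases L with
    | nil => simp at hLb; exact absurd hLb hm₀p
    | cons => simp
  obtain ⟨H, hH⟩ : ∃ H, ∀ m ∈ M, ∀ y ∈ chain ((q :: m₀ :: L).map
      (lift p q (D.path b).2 (D.path a).2 H)), y.1 = m → C < y.2 := by
    have : ∀ᶠ H in atTop, ∀ m ∈ M, ∀ y ∈ chain ((q :: m₀ :: L).map
        (lift p q (D.path b).2 (D.path a).2 H)), y.1 = m → C < y.2 := by
      rw [Filter.eventually_all_finset]
      intro m hm
      have hmpq : ¬ (m = p ∨ m = q) := fun e => e.elim (hM m hm).2.2.1 (hM m hm).2.2.2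
      filter_upwards [eventually_lt_segment (p := p) (q := q) (hp := (D.path b).2)
        (hq := (D.path a).2) hL.1 (fun e => e.2.elim hm₀p (fun e => hL.1 e.symm)) hmpq C,
        eventually_lt_chain (p := p) (q := q) (hp := (D.path b).2)
        (hq := (D.path a).2) hL.2.2 hqL hLlen hmpq C] with H h1 h2 y hy e
      rcases hy with hy | hy
      · exact h1 y hy e
      · exact h2 y hy e
    exact this.exists
  -- the lifted arc, run through from right to left
  set σ := lift p q (D.path b).2 (D.path a).2 H with hσ
  have hσp : σ p = D.path b := by
    apply Prod.ext
    · simp [hσ, lift, hp1]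
    · simp [hσ, lift, hpq.symm]
  have hσq : σ q = D.path a := by
    apply Prod.ext
    · simp [hσ, lift, hq1]
    · simp [hσ, lift]
  obtain ⟨N, hN⟩ := exists_eq_append_of_getLast? hLb hpq
  have hNne : N ≠ [] := by
    rintro rfl
    simp at hN
    exact hm₀p hN.1
  have hmaprev : ((q :: m₀ :: L).map σ).reverse =
      D.path b :: ((N.map σ).reverse ++ [D.path a]) := by
    rw [hN]; simp [hσp, hσq]
  set B := (N.map σ).reverse with hB
  set O : Set Space := chain (D.path b :: (B ++ [D.path a])) with hO
  have hOe : O = chain ((q :: m₀ :: L).map σ) := by rw [hO, ← hmaprev, chain_reverse]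
  have hOfst : IsArc ((D.path b :: (B ++ [D.path a])).map Prod.fst) := by
    rw [← hmaprev, List.map_reverse, map_fst_map_lift]
    exact hL.reverse
  have hOinj : InjOn Prod.fst O := injOn_fst_chain hOfst
  have hOimg : Prod.fst '' O = chain (q :: m₀ :: L) := by
    rw [hOe, ← chain_map_fst, map_fst_map_lift]
  have hOb : D.path b ∈ O := mem_chain_of_mem (by simp)
  have hOa : D.path a ∈ O := mem_chain_of_mem (by simp)
  have hOver : ∀ y ∈ O, ∀ z ∈ R, z.1 = y.1 →
      (y = D.path b ∧ z = D.path b) ∨ (y = D.path a ∧ z = D.path a) ∨ (y.1 ∈ M ∧ z.2 < y.2) := by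
    intro y hy z hz e
    have hzr := h.path_fst_mem_rest hz
    rcases hLM y.1 (hOimg.subset ⟨y, hy, rfl⟩) (e ▸ hzr) with e1 | e1 | e1
    · exact Or.inl ⟨hOinj hy hOb (e1.trans hp1.symm), h.eq_right_of_fst_eq hz (e.trans e1)⟩
    · exact Or.inr (Or.inl ⟨hOinj hy hOa (e1.trans hq1.symm), h.eq_left_of_fst_eq hz (e.trans e1)⟩)
    · exact Or.inr (Or.inr ⟨e1, (hC z hz).trans (hH _ e1 y (hOe ▸ hy) rfl)⟩)
  obtain ⟨N₁, hR1, hR2, hR3⟩ := h.exists_rest_list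
  obtain ⟨P, hPs, hPc, hPv, hPn, -, hP1, hP2⟩ := exists_polygon (h := D.path b) (t := D.path a)
    (K := B ++ [D.path a]) (M := N₁) (isArc_of_map_fst hOfst) (by rw [← List.cons_append, List.getLast?_concat]) hR1 (by
      rw [hR2]
      rintro y ⟨hy, hy'⟩
      rcases hOver y hy y hy' rfl with e | e | e
      · exact Or.inl e.1
      · exact Or.inr e.1
      · exact absurd e.2 (lt_irrefl _))
  rw [hR2] at hPc hP2
  -- the crossings of the new diagram
  set M' : Set Plane := {x | x ∈ M ∧ x ∈ chain (q :: m₀ :: L) ∧ x ∈ D.rest a b} with hM'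
  have hM'fin : M'.Finite := M.finite_toSet.subset fun x hx => hx.1
  let K' : PolygonalKnot := ⟨P, hPs⟩
  have hK'c : K'.carrier = O ∪ R := hPc
  have hRR : ∀ z ∈ R, ∀ z' ∈ R, z ≠ z' → z.1 = z'.1 → z.1 ∈ D.restCrossings a b := by
    rintro _ ⟨s, hs, rfl⟩ _ ⟨t, ht, rfl⟩ hne e
    exact ⟨s, hs, t, ht, fun e => hne (by rw [e]), D.plane_path s, by rw [plane_path, e]⟩
  have hcr : K'.crossings = D.restCrossings a b ∪ M' := by
    rw [PolygonalKnot.crossings_eq_carrier, hK'c]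
    have hOR : ∀ y ∈ O, ∀ z ∈ R, z ≠ y → z.1 = y.1 → y.1 ∈ M' := by
      intro y hy z hz hne e
      rcases hOver y hy z hz e with e1 | e1 | e1
      · exact absurd (e1.2.trans e1.1.symm) hne
      · exact absurd (e1.2.trans e1.1.symm) hne
      · exact ⟨e1.1, hOimg.subset ⟨y, hy, rfl⟩, e ▸ h.path_fst_mem_rest hz⟩
    ext x
    constructor
    · rintro ⟨z, hz | hz, z', hz' | hz', hne, rfl, e⟩
      · exact absurd (hOinj hz hz' e.symm) hne
      · exact Or.inr (hOR z hz z' hz' hne.symm e)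
      · exact Or.inr (e ▸ hOR z' hz' z hz hne e.symm)
      · exact Or.inl (hRR z hz z' hz' hne e.symm)
    · rintro (⟨s, hs, t, ht, hst, rfl, e⟩ | ⟨hxM, hxL, hxr⟩)
      · exact ⟨D.path s, Or.inr ⟨s, hs, rfl⟩, D.path t, Or.inr ⟨t, ht, rfl⟩,
          path_ne hst (h.abs_sub_lt hs ht), (D.plane_path s).symm, by rw [← plane_path, e]⟩
      · obtain ⟨s, hs, rfl⟩ := hxr
        obtain ⟨y, hy, e⟩ := hOimg.superset hxL
        have e' : (D.path s).1 = y.1 := by rw [e, plane_path]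
        refine ⟨y, Or.inl hy, D.path s, Or.inr ⟨s, hs, rfl⟩, ?_, e, e'.trans e⟩
        intro e2
        rcases hOver y hy (D.path s) ⟨s, hs, rfl⟩ e' with e1 | e1 | e1
        · exact (hM _ hxM).2.2.1 (by rw [← e, e1.1, hp1])
        · exact (hM _ hxM).2.2.2 (by rw [← e, e1.1, hq1])
        · exact e1.2.ne (by rw [e2])
  have hreg : K'.IsRegular := by
    refine ⟨?_, ?_, ?_⟩
    · rw [hcr]
      exact (D.regular.finite.subset h.restCrossings_subset).union hM'fin
    · have hOO : ∀ z ∈ O, ∀ z' ∈ O, z.1 = z'.1 → z = z' := fun z hz z' hz' e => hOinj hz hz' e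
      have hRRO : ∀ z ∈ R, ∀ z' ∈ R, ∀ y ∈ O, z.1 = z'.1 → z'.1 = y.1 → z = z' := by
        intro z hz z' hz' y hy e1 e2
        by_contra hne
        have hc := h.restCrossings_subset (hRR z hz z' hz' hne e1)
        rw [e1] at hc
        rcases hOver y hy z' hz' e2 with e3 | e3 | e3
        · rw [e3.2, hp1] at hc; exact h.right_notMem hc
        · rw [e3.2, hq1] at hc; exact h.left_notMem hc
        · exact (hM _ e3.1).1 (e2 ▸ hc)
      intro s t u e1 e2
      have hmem : ∀ s, K'.path s ∈ O ∪ R := fun s => hK'c ▸ ⟨s, rfl⟩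
      rcases hmem s with hs | hs <;> rcases hmem t with ht | ht <;> rcases hmem u with hu | hu
      · exact Or.inl (hOO _ hs _ ht e1)
      · exact Or.inl (hOO _ hs _ ht e1)
      · exact Or.inr (Or.inr (hOO _ hs _ hu (e1.trans e2)))
      · exact Or.inr (Or.inl (hRRO _ ht _ hu _ hs e2 (e1.trans e2).symm))
      · exact Or.inr (Or.inl (hOO _ ht _ hu e2))
      · exact Or.inr (Or.inr (hRRO _ hs _ hu _ ht (e1.trans e2) e2.symm))
      · exact Or.inl (hRRO _ hs _ ht _ hu e1 e2)
      · obtain ⟨s', -, es⟩ := hs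
        obtain ⟨t', -, et⟩ := ht
        obtain ⟨u', -, eu⟩ := hu
        rw [← es, ← et] at e1 ⊢
        rw [← et, ← eu] at e2
        rw [← eu]
        exact D.regular.double s' t' u' e1 e2
    · have hpM' : p ∉ D.restCrossings a b ∪ M' := by
        rintro (hx | hx)
        · exact h.right_notMem (h.restCrossings_subset hx)
        · exact (hM _ hx.1).2.2.1 rfl
      have hqM' : q ∉ D.restCrossings a b ∪ M' := by
        rintro (hx | hx)
        · exact h.left_notMem (h.restCrossings_subset hx)
        · exact (hM _ hx.1).2.2.2 rfl
      intro i
      rw [hcr]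
      have hsub : D.restCrossings a b ∪ M' ⊆ D.rest a b := by
        rintro x (⟨s, hs, -, -, -, rfl, -⟩ | hx)
        · exact ⟨s, hs, rfl⟩
        · exact hx.2.2
      have hmem := hPv i
      rw [List.cons_append, List.append_assoc, List.singleton_append, List.mem_cons,
        List.mem_append, List.mem_cons] at hmem
      rcases hmem with e | e | e | e
      · change (P.vertex i).1 ∉ _
        rw [e, hp1]; exact hpM'
      · rw [hB, List.mem_reverse, List.mem_map] at e
        obtain ⟨v, hv, e⟩ := e
        change (P.vertex i).1 ∉ _
        rw [← e, show (σ v).1 = v from rfl]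
        intro hx
        rcases hV v (by rw [hN]; simp [hv]) (hsub hx) with rfl | rfl
        · exact hpM' hx
        · exact hqM' hx
      · change (P.vertex i).1 ∉ _
        rw [e, hq1]; exact hqM'
      · change (P.vertex i).1 ∉ _
        rcases hR3 _ e with e | e | ⟨j, e⟩
        · rw [e, hq1]; exact hqM'
        · rw [e, hp1]; exact hpM'
        · rw [← e]
          rintro (hx | hx)
          · exact D.regular.vertex_not_mem j (h.restCrossings_subset hx)
          · exact (hM _ hx.1).2.1 ⟨j, rfl⟩
  have hdisj : Disjoint (D.restCrossings a b) M' := by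
    rw [Set.disjoint_left]
    intro x hx hx'
    exact (hM x hx'.1).1 (h.restCrossings_subset hx)
  refine ⟨⟨K', hreg⟩, M'.ncard, ?_, ?_, ?_, ?_⟩
  · obtain ⟨N₂, hN2, hN2c⟩ := h.exists_bridge_list
    change Relation.EqvGen DeltaMove D.carrier K'.carrier
    rw [h.carrier_eq, hK'c, union_comm O R, hR, ← hN2c, ← hR2, hO]
    have hshape : ∀ N : List Space, ∃ b₁ B₁, N ++ [D.path a] = b₁ :: B₁ := by
      intro N
      cases N with
      | nil => exact ⟨_, _, rfl⟩
      | cons x N => exact ⟨_, _, rfl⟩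
    obtain ⟨b₁, B₁, e1⟩ := hshape N₂
    obtain ⟨b₂, B₂, e2⟩ := hshape B
    have l1 : (b₁ :: B₁).getLast? = some (D.path a) := by rw [← e1]; simp
    have l2 : (b₂ :: B₂).getLast? = some (D.path a) := by rw [← e2]; simp
    rw [e1] at hN2 hN2c ⊢

    rw [e2] at hOfst hO ⊢
    refine eqvGen_of_over hN2 l1 hOfst l2 hR1 (by rw [← List.cons_append, List.getLast?_concat]) ?_ ?_
    · rw [hR2, hN2c]
      rintro _ ⟨t, ht, rfl⟩ _ ⟨s, hs, rfl⟩ e hle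
      have hle' := h.notUnder s hs
      have hz : D.path t = D.path s := by
        refine Prod.ext e (le_antisymm ?_ hle)
        by_contra hlt
        exact hle' ⟨t, e, not_le.1 hlt⟩
      have hsr : D.plane.path s ∈ D.rest a b := ⟨t, ht, by rw [plane_path, plane_path, e]⟩
      rcases h.rest_inter_bridge hs hsr with rfl | rfl | hsp
      · exact Or.inr hz
      · exact Or.inl hz
      · obtain ⟨u, hu, eu, hlt⟩ := h.exists_rest_of_crossing hs (h.mem_passes_iff.1 hsp).2
        have := h.existsUnique_rest hsp ht (Ioo_subset_Icc_self hu)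
          (by rw [plane_path, plane_path, e]) eu
        rw [← this, hz] at hlt
        exact absurd hlt (lt_irrefl _)
    · rw [hR2, ← hO]
      intro z hz y hy e hle
      rcases hOver y hy z hz e with e3 | e3 | e3
      · exact Or.inl e3.2
      · exact Or.inr e3.2
      · exact absurd hle (not_le.2 e3.2)
  · have hPO : ∀ s ∈ Icc (0 : ℝ) (B ++ [D.path a]).length, P.path s ∈ O := fun s hs =>
      hP1.subset ⟨s, hs, rfl⟩
    have hlt : ((B ++ [D.path a]).length : ℝ) < P.n := by
      rw [hPn]
      exact_mod_cast (by simp : (B ++ [D.path a]).length <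
        (D.path b :: (B ++ [D.path a]) ++ N₁).length)
    refine ⟨0, (B ++ [D.path a]).length, by positivity, by rw [zero_add]; exact hlt, Or.inl ⟨?_, ?_⟩⟩
    · rintro s hs ⟨t, e, hlt'⟩
      have hy := hPO s hs
      change (P.path t).1 = (P.path s).1 at e
      change (P.path s).2 < (P.path t).2 at hlt'
      rcases hPc.subset ⟨t, rfl⟩ with ht | ht
      · rw [hOinj ht hy e] at hlt'; exact lt_irrefl _ hlt'
      · rcases hOver _ hy _ ht e with e3 | e3 | e3
        · rw [e3.1, e3.2] at hlt'; exact lt_irrefl _ hlt'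
        · rw [e3.1, e3.2] at hlt'; exact lt_irrefl _ hlt'
        · exact lt_asymm hlt' e3.2
    · rw [hM'fin.cast_ncard_eq]
      have hinj : InjOn (fun s => (P.path s).1) (Icc (0 : ℝ) (B ++ [D.path a]).length) := by
        intro s hs t ht e
        exact hPs ⟨hs.1, hs.2.trans_lt hlt⟩ ⟨ht.1, ht.2.trans_lt hlt⟩
          (hOinj (hPO s hs) (hPO t ht) e)
      rw [← (hinj.mono (fun s hs => hs.1)).encard_image (s := {s | s ∈ Icc (0 : ℝ)
        (B ++ [D.path a]).length ∧ KnotDiagram.IsOverpass ⟨K', hreg⟩ s})]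
      congr 1
      ext x
      constructor
      · rintro ⟨s, ⟨hs, t, e, hlt'⟩, rfl⟩
        change (P.path t).1 = (P.path s).1 at e
        change (P.path t).2 < (P.path s).2 at hlt'
        have hy := hPO s hs
        rcases hPc.subset ⟨t, rfl⟩ with ht | ht
        · rw [hOinj ht hy e] at hlt'; exact absurd hlt' (lt_irrefl _)
        · rcases hOver _ hy _ ht e with e3 | e3 | e3
          · rw [e3.1, e3.2] at hlt'; exact absurd hlt' (lt_irrefl _)
          · rw [e3.1, e3.2] at hlt'; exact absurd hlt' (lt_irrefl _)
          · have hr := h.path_fst_mem_rest ht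
            rw [e] at hr
            exact ⟨e3.1, hOimg.subset ⟨_, hy, rfl⟩, hr⟩
      · rintro ⟨hxM, hxL, hxr⟩
        obtain ⟨y, hy, e⟩ := hOimg.superset hxL
        obtain ⟨s, hs, es⟩ := hP1.superset hy
        obtain ⟨u, hu, eu⟩ := hxr
        obtain ⟨t, et⟩ := hPc.superset (Or.inr ⟨u, hu, rfl⟩)
        have ht : (P.path t).1 = (P.path s).1 := by rw [et, es, e, ← eu, plane_path]
        refine ⟨s, ⟨hs, t, ht, ?_⟩, by change (P.path s).1 = x; rw [es, e]⟩
        change (P.path t).2 < (P.path s).2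
        rcases hOver _ (hPO s hs) (P.path t) (by rw [et]; exact ⟨u, hu, rfl⟩) ht with e3 | e3 | e3
        · exact absurd (by rw [← e, ← es, e3.1, hp1]) (hM _ hxM).2.2.1
        · exact absurd (by rw [← e, ← es, e3.1, hq1]) (hM _ hxM).2.2.2
        · exact e3.2
  · change K'.crossings.ncard = _
    rw [hcr, ncard_union_eq hdisj (D.regular.finite.subset h.restCrossings_subset) hM'fin]
  · rw [← Set.ncard_coe_finset]
    exact ncard_le_ncard (fun x hx => hx.1) M.finite_toSet

/-- The points which a new bridge must not run through. -/
def _root_.KnotDiagram.forbidden (D : KnotDiagram) (a b : ℝ) : Set Plane :=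
  D.crossings ∪ range D.plane.vertex ∪ {D.plane.path a, D.plane.path b}

theorem finite_forbidden : (D.forbidden a b).Finite :=
  (D.regular.finite.union D.finite_range_plane_vertex).union (Set.toFinite _)

/-- Access to the right end of the bridge from a point near its left end gives a new bridge. -/
theorem exists_reroute_of_reach {i : ℕ} {x : Plane}
    (hx : Reach (D.rest a b) (D.plane.path b) (D.forbidden a b) i x)
    (hseg : segment ℝ x (D.plane.path a) ∩ D.rest a b ⊆ {D.plane.path a}) :
    ∃ (D' : KnotDiagram) (l' : ℕ), Relation.EqvGen DeltaMove D.carrier D'.carrier ∧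
      D'.HasBridge l' ∧ D'.crossingNumber = (D.restCrossings a b).ncard + l' ∧ l' ≤ i := by
  obtain ⟨M, hMi, hM, L, h1, h2, h3, h4⟩ := hx
  set p := D.plane.path b
  set q := D.plane.path a
  have hMF : ∀ m ∈ M, m ∉ D.crossings ∧ m ∉ range D.plane.vertex ∧ m ≠ p ∧ m ≠ q := by
    intro m hm
    have := (hM m hm).2
    simp only [forbidden, mem_union, mem_insert_iff, mem_singleton_iff, not_or] at this
    tauto
  have hqc : q ∉ chain (x :: L) := by
    intro hq
    rcases h3 hq with (hq | hq) | hq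
    · exact hq h.left_mem_rest
    · exact h.path_left_ne_right hq
    · exact (hMF q hq).2.2.2 rfl
  obtain ⟨L', g1, g2, g3, g4, -⟩ := h1.erase_loop h2 q
  obtain ⟨D', l', e1, e2, e3, e4⟩ := h.exists_reroute g1 g2 (M := M) (by
    intro z hz hzr
    rcases g3 hz with hz | hz
    · rcases h3 hz with (hz | hz) | hz
      · exact absurd hzr hz
      · exact Or.inl hz
      · exact Or.inr (Or.inr hz)
    · exact Or.inr (Or.inl (hseg ⟨hz, hzr⟩))) hMF (by
    intro v hv hvr
    rcases g4 v hv with hv | hv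
    · exact Or.inl ((h4 v hv).resolve_left (fun hn => hn hvr))
    · exact Or.inr (hseg ⟨hv.2, hvr⟩))
  exact ⟨D', l', e1, e2, e3, e4.trans hMi⟩

end KnotDiagram.IsOverBridge

end Reroute

/-! ### Closed polygons through a given point -/

section Through

open Set Topology Filter

namespace ClosedPolygon

theorem vertex_add_mul {E : Type} (P : ClosedPolygon E) (i k : ℤ) :
    P.vertex (i + k * P.n) = P.vertex i := by
  have hp : Function.Periodic P.vertex (P.n : ℤ) := P.periodic
  have := hp.int_mul k i
  simpa using this

theorem dirR_add_mul (P : ClosedPolygon Plane) (s : ℝ) (k : ℤ) :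
    P.dirR (s + k * P.n) = P.dirR s := by
  have e : ⌊s + (k : ℝ) * P.n⌋ = ⌊s⌋ + k * P.n := by
    have := Int.floor_add_intCast s (k * P.n)
    push_cast at this
    exact this
  rw [dirR, e, add_right_comm, P.vertex_add_mul, P.vertex_add_mul, dirR]

/-- The winding number changes by one across a point which is not a vertex and through which the
polygon runs only once. -/
theorem wind_jump_at (P : ClosedPolygon Plane) {s : ℝ} (hf : Int.fract s ≠ 0) (hd : P.dirR s ≠ 0)
    (huniq : ∀ s', P.path s' = P.path s → ∃ k : ℤ, s' = s + k * P.n) :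
    ∃ r > 0, ∀ y ∈ Metric.ball (P.path s) r, ∀ y' ∈ Metric.ball (P.path s) r,
      0 < cross (P.dirR s) (y - P.path s) → cross (P.dirR s) (y' - P.path s) < 0 →
      y ∉ P.carrier ∧ y' ∉ P.carrier ∧ P.wind y = P.wind y' + 1 := by
  obtain ⟨k, hk⟩ := P.exists_mem_Ico s 0
  set t := s + k * P.n with ht
  have et : P.path t = P.path s := P.path_add_mul s k
  have ed : P.dirR t = P.dirR s := P.dirR_add_mul s k
  have hft : Int.fract t ≠ 0 := by
    have := Int.fract_add_intCast s (k * P.n)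
    push_cast at this
    rwa [ht, this]
  rw [zero_add] at hk
  have hi0 : 0 ≤ ⌊t⌋ := Int.floor_nonneg.2 hk.1
  obtain ⟨i, hi⟩ := Int.eq_ofNat_of_zero_le hi0
  have hiR : (i : ℝ) = ⌊t⌋ := by rw [hi]; simp
  have hfl := Int.floor_le t
  have hfl2 := Int.lt_floor_add_one t
  have hfr : t - i = Int.fract t := by rw [hiR]; rfl
  have hin : i < P.n := by
    have : (i : ℝ) < P.n := by rw [hiR]; exact hfl.trans_lt hk.2
    exact_mod_cast this
  have hpos : 0 < Int.fract t := lt_of_le_of_ne (Int.fract_nonneg t) hft.symm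
  have hm : P.path t = AffineMap.lineMap (P.vertex i) (P.vertex (i + 1)) (t - i) :=
    P.path_of_mem i ⟨by rw [Int.cast_natCast, hiR]; exact hfl,
      by rw [Int.cast_natCast, hiR]; exact hfl2.le⟩
  have hdir : P.dirR t = P.vertex (i + 1) - P.vertex i := by rw [dirR, hi]
  rw [← et, ← ed, hdir]
  refine P.wind_jump hin ?_ ?_ ?_
  · rw [openSegment_eq_image_lineMap]
    exact ⟨t - i, ⟨by rw [hfr]; exact hpos, by rw [hfr]; exact Int.fract_lt_one t⟩, hm.symm⟩
  · intro e
    exact hd (by rw [← ed, hdir, e, sub_self])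
  · intro j hj hji hmem
    have := P.path_image_Icc j
    push_cast at this
    rw [← this] at hmem
    obtain ⟨t', ht', e⟩ := hmem
    obtain ⟨k', hk'⟩ := huniq t' (e.trans et)
    have hjn : (j : ℝ) + 1 ≤ P.n := by exact_mod_cast hj
    have hj0 : (0 : ℝ) ≤ j := by positivity
    have ht0 : 0 < t := by
      have : (0 : ℝ) ≤ i := by positivity
      linarith
    have hn := P.n_pos'
    have hkk : t' = t + ((k' - k : ℤ) : ℝ) * P.n := by rw [hk', ht]; push_cast; ring
    have hzero : k' - k = 0 := by
      have h1 : ((k' - k : ℤ) : ℝ) * P.n < 1 * P.n := by linarith [ht'.2]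
      have h2 : (-1 : ℝ) * P.n < ((k' - k : ℤ) : ℝ) * P.n := by linarith [ht'.1, hk.2]
      have h1' := lt_of_mul_lt_mul_right h1 hn.le
      have h2' := lt_of_mul_lt_mul_right h2 hn.le
      have h3 : k' - k < 1 := by exact_mod_cast h1'
      have h4 : -1 < k' - k := by exact_mod_cast h2'
      omega
    rw [hzero] at hkk
    simp only [Int.cast_zero, zero_mul, add_zero] at hkk
    subst hkk
    apply hji
    have h1 : (j : ℝ) < i + 1 := by linarith [ht'.1]
    have h2 : (i : ℝ) < j + 1 := by linarith [ht'.2]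
    have h1' : j < i + 1 := by exact_mod_cast h1
    have h2' : i < j + 1 := by exact_mod_cast h2
    omega

end ClosedPolygon

theorem add_smul_injective {v w : Plane} (hw : w ≠ 0) {c c' : ℝ} (h : v + c • w = v + c' • w) :
    c = c' := smul_left_injective ℝ hw (add_left_cancel h)

theorem exists_pos_of_mem_segment {v w y : Plane} {c : ℝ} (hc : 0 ≤ c)
    (hy : y ∈ segment ℝ (v + c • w) v) (hyv : y ≠ v) : ∃ c₁ : ℝ, 0 < c₁ ∧ c₁ ≤ c ∧ y = v + c₁ • w := by
  rw [segment_symm, segment_eq_image_lineMap] at hy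
  obtain ⟨t, ht, rfl⟩ := hy
  have e : AffineMap.lineMap v (v + c • w) t = v + (t * c) • w := by
    rw [AffineMap.lineMap_apply_module']
    module
  refine ⟨t * c, lt_of_le_of_ne (mul_nonneg ht.1 hc) ?_, mul_le_of_le_one_left hc ht.2, e⟩
  intro h0
  rw [e, ← h0, zero_smul, add_zero] at hyv
  exact hyv rfl

/-- An arc between two points on opposite sides of `v` on a line gives a simple closed polygon that
runs straight through `v` along this line and consists otherwise of points of the arc. -/
theorem exists_polygon_through {v w y y' : Plane} {L : List Plane} (hw : w ≠ 0)
    (hL : IsArc (y :: L)) (hlast : (y :: L).getLast? = some y') (hv : v ∉ chain (y :: L))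
    {c c' : ℝ} (hc : 0 < c) (hc' : 0 < c') (hy : y = v + c • w) (hy' : y' = v + c' • (-w)) :
    ∃ (P : ClosedPolygon Plane) (A : Set Plane) (y₀ y₁ : Plane), P.IsSimple ∧ IsPreconnected A ∧
      A ⊆ chain (y :: L) ∧ y₁ ∈ A ∧ y₁ ∈ segment ℝ y v ∧ y₀ ∈ A ∧ y₀ ∈ segment ℝ y' v ∧
      P.carrier = A ∪ segment ℝ y₀ y₁ ∧ v ∈ segment ℝ y₀ y₁ ∧
      ∃ r > 0, ∀ x ∈ Metric.ball v r, ∀ x' ∈ Metric.ball v r, 0 < cross w (x - v) →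
        cross w (x' - v) < 0 → x ∉ P.carrier ∧ x' ∉ P.carrier ∧ P.wind x ≠ P.wind x' := by
  have hw' : -w ≠ 0 := neg_ne_zero.2 hw
  obtain ⟨L', g1, g2, -, -, g5⟩ := hL.erase_loop hlast v
  obtain ⟨y₁, L₁, rfl, hy₁, hsub₁⟩ := g5 hv
  have hlast₁ : (y₁ :: L₁).getLast? = some y' := by simpa using g2
  -- turn the arc around and attach `v` at the other end
  obtain ⟨R, hR⟩ : ∃ R, (y₁ :: L₁).reverse = y' :: R := by
    have : (y₁ :: L₁).reverse.head? = some y' := by rw [List.head?_reverse, hlast₁]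
    cases hrev : (y₁ :: L₁).reverse with
    | nil => simp at hrev
    | cons z R =>
      rw [hrev] at this
      simp only [List.head?_cons, Option.some.injEq] at this
      exact ⟨R, by rw [this]⟩
  have hRarc : IsArc (y' :: R) := hR ▸ g1.2.2.reverse
  have hRchain : chain (y' :: R) = chain (y₁ :: L₁) := by rw [← hR, chain_reverse]
  have hRlast : (y' :: R).getLast? = some y₁ := by rw [← hR]; simp
  have hvR : v ∉ chain (y' :: R) := fun hm => hv (hsub₁ (hRchain ▸ hm))
  obtain ⟨L'', k1, k2, -, -, k5⟩ := hRarc.erase_loop hRlast v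
  obtain ⟨y₀, L₃, rfl, hy₀, hsub₀⟩ := k5 hvR
  rw [hRchain] at hsub₀
  have hlast₀ : (y₀ :: L₃).getLast? = some y₁ := by simpa using k2
  have hy₀A : y₀ ∈ chain (y₀ :: L₃) := head_mem_chain _ _
  have hy₁A : y₁ ∈ chain (y₀ :: L₃) := mem_chain_of_getLast? hlast₀
  have hAsub : chain (y₀ :: L₃) ⊆ chain (y :: L) := hsub₀.trans hsub₁
  have hvA : v ∉ chain (y₀ :: L₃) := fun hm => hv (hAsub hm)
  obtain ⟨c₁, hc₁, -, e₁⟩ := exists_pos_of_mem_segment hc.le (hy ▸ hy₁) (by rintro rfl; exact hvA hy₁A)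
  obtain ⟨c₀, hc₀, -, e₀⟩ := exists_pos_of_mem_segment hc'.le (hy' ▸ hy₀) (by rintro rfl; exact hvA hy₀A)
  have hsum : 0 < c₁ + c₀ := by linarith
  -- the closing edge, from `y₁` to `y₀`
  have hline : AffineMap.lineMap y₁ y₀ (c₁ / (c₁ + c₀)) = v := by
    rw [AffineMap.lineMap_apply_module', e₁, e₀]
    match_scalars
    · ring
    · field_simp
      ring
  have hτ : c₁ / (c₁ + c₀) ∈ Ioo (0 : ℝ) 1 :=
    ⟨div_pos hc₁ hsum, (div_lt_one hsum).2 (by linarith)⟩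
  have hvseg : v ∈ segment ℝ y₀ y₁ := by
    rw [segment_symm, segment_eq_image_lineMap]
    exact ⟨_, Ioo_subset_Icc_self hτ, hline⟩
  have hsegsub : segment ℝ y₀ y₁ ⊆ segment ℝ v y₀ ∪ segment ℝ v y₁ := by
    rw [segment_symm, segment_eq_image_lineMap]
    rintro _ ⟨t, ht, rfl⟩
    have e : AffineMap.lineMap y₁ y₀ t = v + (c₁ - t * (c₁ + c₀)) • w := by
      rw [AffineMap.lineMap_apply_module', e₁, e₀]
      module
    rw [e]
    rcases le_total 0 (c₁ - t * (c₁ + c₀)) with h0 | h0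
    · right
      rw [segment_eq_image_lineMap]
      refine ⟨(c₁ - t * (c₁ + c₀)) / c₁, ⟨div_nonneg h0 hc₁.le, (div_le_one hc₁).2 ?_⟩, ?_⟩
      · nlinarith [ht.1]
      · rw [AffineMap.lineMap_apply_module', e₁, add_sub_cancel_left, smul_smul,
          div_mul_cancel₀ _ hc₁.ne', add_comm]
    · left
      rw [segment_eq_image_lineMap]
      refine ⟨-(c₁ - t * (c₁ + c₀)) / c₀, ⟨div_nonneg (by linarith) hc₀.le,
        (div_le_one hc₀).2 ?_⟩, ?_⟩
      · nlinarith [ht.2]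
      · rw [AffineMap.lineMap_apply_module', e₀, add_sub_cancel_left, smul_smul,
          div_mul_cancel₀ _ hc₀.ne', add_comm, smul_neg, neg_smul, neg_neg]
  have hne : y₁ ≠ y₀ := by
    intro e
    rw [e₁, e₀, smul_neg, ← neg_smul] at e
    linarith [add_smul_injective hw e]
  obtain ⟨P, hPs, hPc, -, hPn, hPv, -, -⟩ := exists_polygon (h := y₀) (t := y₁) (K := L₃) (M := [])
    k1.2.2 hlast₀ ⟨hne, by simp [chain], trivial⟩ (by
      rintro z ⟨hz, hz'⟩
      have hz2 : z ∈ segment ℝ y₀ y₁ := by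
        rcases hz' with hz' | hz'
        · rwa [segment_symm]
        · rw [show z = y₀ from hz']; exact left_mem_segment ℝ _ _
      rcases hsegsub hz2 with h1 | h1
      · exact Or.inl (k1.2.1 ⟨h1, hz⟩)
      · exact Or.inr (g1.2.1 ⟨h1, hsub₀ hz⟩))
  have hcar : P.carrier = chain (y₀ :: L₃) ∪ segment ℝ y₀ y₁ := by
    rw [hPc, segment_symm ℝ y₀ y₁]
    have : chain [y₁, y₀] = segment ℝ y₁ y₀ := by
      simp only [chain]
      exact union_eq_self_of_subset_right (by simpa using right_mem_segment ℝ y₁ y₀)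
    rw [List.nil_append, this]
  refine ⟨P, chain (y₀ :: L₃), y₀, y₁, hPs, isPreconnected_chain _, hAsub, hy₁A, hy₁, hy₀A, hy₀,
    hcar, hvseg, ?_⟩
  -- the position of `v` on the polygon
  set N := L₃.length with hN
  have hPnN : P.n = N + 1 := by rw [hPn]; simp [hN]
  have hvN : P.vertex N = y₁ := by
    rw [hPv N (by simp [hN])]
    rw [List.getLast?_eq_getElem?] at hlast₀
    simpa [hN] using hlast₀
  have hvN1 : P.vertex (N + 1) = y₀ := by
    have h1 := P.periodic 0
    have h2 := hPv 0 (by simp)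
    rw [zero_add, hPnN] at h1
    push_cast at h1
    rw [h1]
    simpa using h2
  set s : ℝ := N + c₁ / (c₁ + c₀) with hs
  have hfloor : ⌊s⌋ = N := by
    rw [Int.floor_eq_iff]
    push_cast
    exact ⟨by linarith [hτ.1], by linarith [hτ.2]⟩
  have hfr : Int.fract s = c₁ / (c₁ + c₀) := by rw [Int.fract, hfloor]; push_cast; ring
  have hps : P.path s = v := by
    rw [ClosedPolygon.path, hfloor, hfr, hvN, hvN1, hline]
  have hdir : P.dirR s = (-(c₁ + c₀)) • w := by
    rw [ClosedPolygon.dirR, hfloor, hvN, hvN1, e₁, e₀]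
    module
  obtain ⟨r, hr, hjump⟩ := P.wind_jump_at (s := s) (by rw [hfr]; exact hτ.1.ne')
    (by rw [hdir]; exact smul_ne_zero (by linarith) hw)
    (fun s' e => by
      obtain ⟨k, hk⟩ := hPs.eq_add e
      exact ⟨k, hk⟩)
  rw [hps, hdir] at hjump
  refine ⟨r, hr, fun x hx x' hx' h1 h2 => ?_⟩
  obtain ⟨j1, j2, j3⟩ := hjump x' hx' x hx (by rw [cross_smul_left]; nlinarith)
    (by rw [cross_smul_left]; nlinarith)
  exact ⟨j2, j1, by omega⟩

end Through

section DiagramWind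

open Set Topology Filter

namespace KnotDiagram

variable {D : KnotDiagram}

/-- The winding number of the shadow of a diagram changes by one across a point which is neither a
vertex nor a crossing. -/
theorem wind_jump {s : ℝ} (hf : Int.fract s ≠ 0) (hc : D.plane.path s ∉ D.crossings) :
    ∃ r > 0, ∀ y ∈ Metric.ball (D.plane.path s) r, ∀ y' ∈ Metric.ball (D.plane.path s) r,
      0 < cross (D.plane.dirR s) (y - D.plane.path s) →
      cross (D.plane.dirR s) (y' - D.plane.path s) < 0 →
      y ∉ D.shadow ∧ y' ∉ D.shadow ∧ D.plane.wind y = D.plane.wind y' + 1 := by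
  rw [← plane_carrier]
  refine D.plane.wind_jump_at hf (D.plane.dirR_ne_zero D.plane_vertex_ne s) ?_
  intro s' e
  have : D.path s' = D.path s := by
    by_contra hne
    exact hc ⟨s', s, hne, by rw [← plane_path, e], (D.plane_path s).symm⟩
  exact D.simple.eq_add this

theorem wind_eq {V : Set Plane} (hV : IsPreconnected V) (hd : ∀ x ∈ V, x ∉ D.shadow) {x y : Plane}
    (hx : x ∈ V) (hy : y ∈ V) : D.plane.wind x = D.plane.wind y :=
  ClosedPolygon.wind_eq_of_isPreconnected hV (by rwa [plane_carrier]) hx hy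

end KnotDiagram

end DiagramWind

/-! ### Levels of the complement of the rest of the diagram -/

section Levels

open Set Topology Filter

namespace KnotDiagram

/-- The points with access to the right end of the bridge at the cost of `i` intersections. -/
def Access (D : KnotDiagram) (a b : ℝ) (i : ℕ) (x : Plane) : Prop :=
  Reach (D.rest a b) (D.plane.path b) (D.forbidden a b) i x

/-- The points off the rest of the diagram for which the cost of access is exactly `j`. -/
def level (D : KnotDiagram) (a b : ℝ) (j : ℕ) : Set Plane :=
  {x | x ∉ D.rest a b ∧ D.Access a b j x ∧ ∀ i < j, ¬ D.Access a b i x}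

/-- The number of crossings on the bridge to the right of a given parameter. -/
noncomputable def depth (D : KnotDiagram) (a b s : ℝ) : ℕ := (D.passes a b ∩ Icc s b).ncard

/-- The bridge cannot be shortened: every arc that leads from near its left end to its right end
meets the rest of the diagram at least `l` times. -/
def IsShortest (D : KnotDiagram) (a b : ℝ) (l : ℕ) : Prop :=
  ∀ i x, D.Access a b i x →
    segment ℝ x (D.plane.path a) ∩ D.rest a b ⊆ {D.plane.path a} → l ≤ i

namespace IsOverBridge

variable {D : KnotDiagram} {a b : ℝ} {l : ℕ} (h : D.IsOverBridge a b l)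

include h

theorem access_congr {V : Set Plane} (hV : IsPreconnected V) (hVr : V ⊆ (D.rest a b)ᶜ)
    {x y : Plane} (hx : x ∈ V) (hy : y ∈ V) {i : ℕ} (hi : D.Access a b i x) : D.Access a b i y :=
  Reach.congr h.isCompact_rest.isClosed hV hVr hx hy hi

theorem level_congr {V : Set Plane} (hV : IsPreconnected V) (hVr : V ⊆ (D.rest a b)ᶜ)
    {x y : Plane} (hx : x ∈ V) (hy : y ∈ V) {j : ℕ} (hj : x ∈ D.level a b j) :
    y ∈ D.level a b j :=
  ⟨hVr hy, h.access_congr hV hVr hx hy hj.2.1,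
    fun i hi hy' => hj.2.2 i hi (h.access_congr hV hVr hy hx hy')⟩

theorem level_unique {x : Plane} {i j : ℕ} (hi : x ∈ D.level a b i) (hj : x ∈ D.level a b j) :
    i = j := by
  rcases lt_trichotomy i j with hij | hij | hij
  · exact absurd hi.2.1 (hj.2.2 i hij)
  · exact hij
  · exact absurd hj.2.1 (hi.2.2 j hij)

theorem exists_ball_compl_rest {x : Plane} (hx : x ∉ D.rest a b) :
    ∃ r > 0, Metric.ball x r ⊆ (D.rest a b)ᶜ :=
  Metric.isOpen_iff.1 h.isOpen_compl_rest x hx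

theorem isOpen_level (j : ℕ) : IsOpen (D.level a b j) := by
  rw [Metric.isOpen_iff]
  intro x hx
  obtain ⟨r, hr, hb⟩ := h.exists_ball_compl_rest hx.1
  exact ⟨r, hr, fun y hy => h.level_congr (convex_ball x r).isPreconnected hb
    (Metric.mem_ball_self hr) hy hx⟩

theorem access_depth {s : ℝ} (hs : s ∈ Ioo a b) (hp : s ∉ D.passes a b) :
    D.Access a b (D.depth a b s) (D.plane.path s) := by
  obtain ⟨s₀, hs₀, h1⟩ := h.reach_right (D.forbidden a b)
  obtain ⟨s', hs'⟩ := exists_between (max_lt hs.2 hs₀.2)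
  have hss' := (le_max_left s s₀).trans_lt hs'.1
  obtain ⟨h2, h3⟩ := h1 s' ⟨(le_max_right _ _).trans_lt hs'.1, hs'.2⟩
  refine (h.reach_left h.finite_forbidden hs.1 hss'.le hs'.2 hp h2 h3).mono ?_
  rw [zero_add]
  exact ncard_le_ncard (inter_subset_inter_right _ (Icc_subset_Icc_right hs'.2.le))
    (h.finite_passes.inter_of_left _)

theorem depth_add {s₁ s : ℝ} (hp : s ∉ D.passes a b) :
    (D.passes a b ∩ Icc s₁ s).ncard + D.depth a b s ≤ l := by
  have hd : Disjoint (D.passes a b ∩ Icc s₁ s) (D.passes a b ∩ Icc s b) := by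
    rw [Set.disjoint_left]
    rintro u ⟨hu, hu1⟩ ⟨-, hu2⟩
    have : u = s := le_antisymm hu1.2 hu2.1
    exact hp (this ▸ hu)
  rw [depth, ← ncard_union_eq hd (h.finite_passes.inter_of_left _)
    (h.finite_passes.inter_of_left _), ← h.ncard_passes]
  exact ncard_le_ncard (union_subset inter_subset_left inter_subset_left) h.finite_passes

theorem depth_le_of_access (hmin : D.IsShortest a b l) {s : ℝ} (hs : s ∈ Ioo a b)
    (hp : s ∉ D.passes a b) {i : ℕ} (hi : D.Access a b i (D.plane.path s)) :
    D.depth a b s ≤ i := by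
  obtain ⟨s₀, hs₀, h1⟩ := h.segment_left
  obtain ⟨s₁, hs₁⟩ := exists_between (lt_min hs.1 hs₀.1)
  obtain ⟨h2, h3⟩ := h1 s₁ ⟨hs₁.1, hs₁.2.trans_le (min_le_right _ _)⟩
  have := hmin _ _ (h.reach_left h.finite_forbidden hs₁.1 (hs₁.2.trans_le (min_le_left _ _)).le
    hs.2 h2 hp hi) h3
  have := h.depth_add (s₁ := s₁) hp
  omega

theorem mem_level_depth (hmin : D.IsShortest a b l) {s : ℝ} (hs : s ∈ Ioo a b)
    (hp : s ∉ D.passes a b) : D.plane.path s ∈ D.level a b (D.depth a b s) :=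
  ⟨h.bridge_notMem_rest hs hp, h.access_depth hs hp, fun _ hi hi' =>
    absurd (h.depth_le_of_access hmin hs hp hi') (not_le.2 hi)⟩

theorem mem_level_iff (hmin : D.IsShortest a b l) {s : ℝ} (hs : s ∈ Icc a b) {j : ℕ} :
    D.plane.path s ∈ D.level a b j ↔
      s ∈ Ioo a b ∧ s ∉ D.passes a b ∧ D.depth a b s = j := by
  constructor
  · intro hj
    have hsI : s ∈ Ioo a b := by
      refine ⟨lt_of_le_of_ne hs.1 ?_, lt_of_le_of_ne hs.2 ?_⟩
      · rintro rfl; exact hj.1 h.left_mem_rest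
      · rintro rfl; exact hj.1 h.right_mem_rest
    have hp : s ∉ D.passes a b := fun hp => hj.1 hp.2
    exact ⟨hsI, hp, h.level_unique (h.mem_level_depth hmin hsI hp) hj⟩
  · rintro ⟨hsI, hp, rfl⟩
    exact h.mem_level_depth hmin hsI hp

/-- The interval between two consecutive crossings of the bridge, counted from the right. -/
theorem exists_gap {j : ℕ} (h1 : 1 ≤ j) (hj : j < l) : ∃ τ₁ ∈ D.passes a b, ∃ τ₂ ∈ D.passes a b,
    τ₁ < τ₂ ∧ (∀ s ∈ Ioo τ₁ τ₂, s ∉ D.passes a b) ∧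
      ∀ s ∈ Icc a b, s ∉ D.passes a b → (D.depth a b s = j ↔ s ∈ Ioo τ₁ τ₂) := by
  classical
  set S := h.finite_passes.toFinset with hS
  have hcard : S.card = l := by rw [hS, ← ncard_eq_toFinset_card _ h.finite_passes, h.ncard_passes]
  set e := S.orderEmbOfFin hcard with he
  have hrange : range e = D.passes a b := by
    rw [he, Finset.range_orderEmbOfFin, hS, Finite.coe_toFinset]
  have hmem : ∀ i, e i ∈ D.passes a b := fun i => hrange ▸ mem_range_self i
  set i₁ : Fin l := ⟨l - j - 1, by omega⟩ with hi₁
  set i₂ : Fin l := ⟨l - j, by omega⟩ with hi₂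
  have hd2 : D.depth a b (e i₂) = j := by
    have : D.passes a b ∩ Icc (e i₂) b = e '' (Finset.Ici i₂ : Finset (Fin l)) := by
      ext u
      constructor
      · rintro ⟨hu, hu2⟩
        rw [← hrange] at hu
        obtain ⟨i, rfl⟩ := hu
        exact ⟨i, by simpa using e.le_iff_le.1 hu2.1, rfl⟩
      · rintro ⟨i, hi, rfl⟩
        have hi' : i₂ ≤ i := by simpa using hi
        exact ⟨hmem i, e.le_iff_le.2 hi', (hmem i).1.2.le⟩
    rw [depth, this, e.injective.injOn.ncard_image, Set.ncard_coe_finset, Fin.card_Ici]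
    simp only [hi₂]
    omega
  have hanti : ∀ {s s' : ℝ}, s ≤ s' → D.depth a b s' ≤ D.depth a b s := fun hss =>
    ncard_le_ncard (inter_subset_inter_right _ (Icc_subset_Icc_left hss))
      (h.finite_passes.inter_of_left _)
  refine ⟨e i₁, hmem i₁, e i₂, hmem i₂, e.lt_iff_lt.2 (by
    rw [Fin.lt_def]; simp only [hi₁, hi₂]; omega), fun s hs hp => ?_, fun s hs hp => ?_⟩
  · rw [← hrange] at hp
    obtain ⟨i, rfl⟩ := hp
    have h1 := e.lt_iff_lt.1 hs.1
    have h2 := e.lt_iff_lt.1 hs.2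
    rw [Fin.lt_def] at h1 h2
    simp only [hi₁, hi₂] at h1 h2
    omega
  have hstrict : ∀ {s s' : ℝ}, s ∈ D.passes a b → s < s' → D.depth a b s' < D.depth a b s := by
    intro s s' hs hss
    refine ncard_lt_ncard ⟨inter_subset_inter_right _ (Icc_subset_Icc_left hss.le), fun hsub => ?_⟩
      (h.finite_passes.inter_of_left _)
    have := hsub ⟨hs, le_rfl, hs.1.2.le⟩
    linarith [this.2.1]
  constructor
  · intro hd
    have hs2 : s < e i₂ := by
      by_contra hle
      have hlt : e i₂ < s := lt_of_le_of_ne (not_lt.1 hle) (fun e' => hp (e' ▸ hmem i₂))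
      have := hstrict (hmem i₂) hlt
      omega
    refine ⟨?_, hs2⟩
    by_contra hle
    have hlt : s < e i₁ := lt_of_le_of_ne (not_lt.1 hle) (fun e' => hp (e' ▸ hmem i₁))
    have h1 := hanti hlt.le
    have h2 := hstrict (hmem i₁) (e.lt_iff_lt.2 (show i₁ < i₂ by
      rw [Fin.lt_def]; simp only [hi₁, hi₂]; omega))
    omega
  · intro hsI
    rw [← hd2]
    refine congrArg ncard ?_
    ext u
    refine and_congr_right fun hu => ⟨fun hu2 => ⟨?_, hu2.2⟩, fun hu2 => ⟨hsI.2.le.trans hu2.1, hu2.2⟩⟩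
    rw [← hrange] at hu
    obtain ⟨i, rfl⟩ := hu
    have : i₁ < i := e.lt_iff_lt.1 (hsI.1.trans_le hu2.1)
    refine e.le_iff_le.2 ?_
    rw [Fin.lt_def] at this
    rw [Fin.le_def]
    simp only [hi₁, hi₂] at this ⊢
    omega

theorem level_nonempty (hmin : D.IsShortest a b l) {j : ℕ} (hj : j ≤ l) :
    (D.level a b j).Nonempty := by
  rcases Nat.eq_zero_or_pos j with rfl | h0
  · obtain ⟨s₀, hs₀, h1⟩ := h.reach_right (D.forbidden a b)
    obtain ⟨s, hs⟩ := exists_between hs₀.2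
    obtain ⟨h2, h3⟩ := h1 s hs
    exact ⟨_, h.bridge_notMem_rest ⟨hs₀.1.trans hs.1, hs.2⟩ h2, h3, by simp⟩
  · rcases hj.lt_or_eq with hj | rfl
    · obtain ⟨τ₁, hτ₁, τ₂, hτ₂, hlt, -, hgap⟩ := h.exists_gap h0 hj
      obtain ⟨s, hs, hsp⟩ := ((Ioo_infinite hlt).sdiff h.finite_passes).nonempty
      have hsI : s ∈ Ioo a b := ⟨hτ₁.1.1.trans hs.1, hs.2.trans hτ₂.1.2⟩
      exact ⟨_, (h.mem_level_iff hmin (Ioo_subset_Icc_self hsI)).2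
        ⟨hsI, hsp, (hgap s (Ioo_subset_Icc_self hsI) hsp).2 hs⟩⟩
    · obtain ⟨s₀, hs₀, h1⟩ := h.segment_left
      obtain ⟨s, hs⟩ := exists_between hs₀.1
      obtain ⟨h2, h3⟩ := h1 s hs
      have hsI : s ∈ Ioo a b := ⟨hs.1, hs.2.trans hs₀.2⟩
      have hd : D.depth a b s ≤ j := (Nat.le_add_left _ _).trans (h.depth_add (s₁ := a) h2)
      exact ⟨_, h.bridge_notMem_rest hsI h2, (h.access_depth hsI h2).mono hd,
        fun i hi hi' => absurd (hmin i _ hi' h3) (not_le.2 hi)⟩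

/-- Some level strictly between the two ends of the bridge is connected: otherwise the rest of the
diagram would have too many complementary components. -/
theorem exists_level_isPreconnected (hmin : D.IsShortest a b l) (hl : 4 ≤ l)
    (hk : (D.restCrossings a b).ncard ≤ l + 2) :
    ∃ j, 1 ≤ j ∧ j < l ∧ IsPreconnected (D.level a b j) := by
  classical
  by_contra hcon
  push Not at hcon
  obtain ⟨F, hF, hFV, hcov⟩ := h.compLE_compl_rest
  set G : ℕ → Finset (Set Plane) := fun j => F.filter fun V => (V ∩ D.level a b j).Nonempty with hG
  have hmemG : ∀ j, ∀ x ∈ D.level a b j, ∃ V ∈ G j, x ∈ V := by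
    intro j x hx
    obtain ⟨V, hV, hxV⟩ := mem_iUnion₂.1 (hcov hx.1)
    exact ⟨V, Finset.mem_filter.2 ⟨hV, x, hxV, hx⟩, hxV⟩
  have hsubG : ∀ j, ∀ V ∈ G j, V ⊆ D.level a b j := by
    intro j V hV y hy
    obtain ⟨hVF, x, hxV, hx⟩ := Finset.mem_filter.1 hV
    exact h.level_congr (hFV V hVF).1 (hFV V hVF).2 hxV hy hx
  have h1 : ∀ j ≤ l, 1 ≤ (G j).card := by
    intro j hj
    obtain ⟨x, hx⟩ := h.level_nonempty hmin hj
    obtain ⟨V, hV, -⟩ := hmemG j x hx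
    exact Finset.card_pos.2 ⟨V, hV⟩
  have h2 : ∀ j, 1 ≤ j → j < l → 2 ≤ (G j).card := by
    intro j hj1 hjl
    by_contra hlt
    obtain ⟨V, hV⟩ := Finset.card_eq_one.1 (show (G j).card = 1 by have := h1 j hjl.le; omega)
    refine hcon j hj1 hjl ?_
    have hVj : V ∈ G j := by rw [hV]; simp
    have : D.level a b j = V := by
      refine Subset.antisymm (fun x hx => ?_) (hsubG j V hVj)
      obtain ⟨W, hW, hxW⟩ := hmemG j x hx
      rw [hV, Finset.mem_singleton] at hW
      exact hW ▸ hxW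
    rw [this]
    exact (hFV V (Finset.mem_filter.1 hVj).1).1
  have hsum : ∑ j ∈ Finset.range (l + 1), (G j).card ≤ F.card := by
    rw [← Finset.card_biUnion]
    · exact Finset.card_le_card (Finset.biUnion_subset.2 fun j _ => Finset.filter_subset _ _)
    · intro i _ j _ hij
      rw [Function.onFun, Finset.disjoint_left]
      intro V hVi hVj
      obtain ⟨-, x, hxV, hx⟩ := Finset.mem_filter.1 hVi
      exact hij (h.level_unique hx (hsubG j V hVj hxV))
  obtain ⟨m, rfl⟩ : ∃ m, l = m + 1 := ⟨l - 1, by omega⟩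
  rw [Finset.sum_range_succ, Finset.sum_range_succ'] at hsum
  have h3 : ∑ i ∈ Finset.range m, 2 ≤ ∑ i ∈ Finset.range m, (G (i + 1)).card :=
    Finset.sum_le_sum fun i hi => h2 (i + 1) (by omega) (by
      have := Finset.mem_range.1 hi; omega)
  rw [Finset.sum_const, Finset.card_range, smul_eq_mul] at h3
  have h4 := h1 0 (by omega)
  have h5 := h1 (m + 1) le_rfl
  omega

end IsOverBridge

end KnotDiagram

end Levels

/-! ### The components of a connected level off the bridge -/

section Regions

open Set Topology Filter

namespace KnotDiagram

variable {D : KnotDiagram}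

/-- The two sides of the shadow at a point which is neither a vertex nor a crossing. -/
theorem exists_sides {t : ℝ} (hf : Int.fract t ≠ 0) (hc : D.plane.path t ∉ D.crossings)
    {U : Set Plane} (hU : U ∈ 𝓝 (D.plane.path t)) :
    ∃ ε : ℝ, 0 < ε ∧ ∀ c : ℝ, 0 < c → c ≤ ε →
      (D.plane.path t + c • rot (D.plane.dirR t) ∈ U ∧
        D.plane.path t + c • rot (D.plane.dirR t) ∉ D.shadow) ∧
      (D.plane.path t + c • -rot (D.plane.dirR t) ∈ U ∧
        D.plane.path t + c • -rot (D.plane.dirR t) ∉ D.shadow) ∧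
      D.plane.wind (D.plane.path t + c • rot (D.plane.dirR t)) =
        D.plane.wind (D.plane.path t + c • -rot (D.plane.dirR t)) + 1 := by
  obtain ⟨r, hr, hj⟩ := wind_jump hf hc
  set m := D.plane.path t with hm
  set d := D.plane.dirR t with hd
  have hd0 : d ≠ 0 := D.plane.dirR_ne_zero D.plane_vertex_ne t
  have hN : U ∩ Metric.ball m r ∈ 𝓝 m := inter_mem hU (Metric.ball_mem_nhds m hr)
  have hev : ∀ u : Plane, ∀ᶠ c in 𝓝 (0 : ℝ), m + c • u ∈ U ∩ Metric.ball m r := by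
    intro u
    have hcc : Continuous (fun c : ℝ => m + c • u) := by fun_prop
    have := hcc.tendsto 0
    rw [zero_smul, add_zero] at this
    exact this.eventually hN
  obtain ⟨ε, hε, hb⟩ := Metric.eventually_nhds_iff_ball.1 ((hev (rot d)).and (hev (-rot d)))
  refine ⟨ε / 2, by linarith, fun c hc0 hcε => ?_⟩
  obtain ⟨h1, h2⟩ := hb c (by rw [Metric.mem_ball, Real.dist_eq, sub_zero, abs_of_pos hc0]; linarith)
  have hs := sqLen_pos hd0
  obtain ⟨j1, j2, j3⟩ := hj _ h1.2 _ h2.2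
    (by rw [add_sub_cancel_left, cross_smul, cross_rot]; positivity)
    (by rw [add_sub_cancel_left, smul_neg, ← neg_smul, cross_smul, cross_rot]; nlinarith)
  exact ⟨⟨h1.1, j1⟩, ⟨h2.1, j2⟩, j3⟩

theorem isClosed_shadow (D : KnotDiagram) : IsClosed D.shadow := by
  rw [← plane_carrier]
  exact D.plane.isCompact_carrier.isClosed

/-- The part of a level, off the shadow of the diagram, where the winding number of the shadow has
a given value. -/
def region (D : KnotDiagram) (a b : ℝ) (j : ℕ) (w : ℤ) : Set Plane :=
  {x | x ∈ D.level a b j ∧ x ∉ D.shadow ∧ D.plane.wind x = w}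

namespace IsOverBridge

variable {a b : ℝ} {l : ℕ} (h : D.IsOverBridge a b l)

include h

theorem isOpen_region (j : ℕ) (w : ℤ) : IsOpen (D.region a b j w) := by
  rw [Metric.isOpen_iff]
  rintro x ⟨hx1, hx2, hx3⟩
  obtain ⟨r, hr, hb⟩ := Metric.isOpen_iff.1
    ((h.isOpen_level j).inter D.isClosed_shadow.isOpen_compl) x ⟨hx1, hx2⟩
  refine ⟨r, hr, fun y hy => ⟨(hb hy).1, (hb hy).2, ?_⟩⟩
  rw [← hx3]
  exact wind_eq (convex_ball x r).isPreconnected (fun z hz => (hb hz).2) hy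
    (Metric.mem_ball_self hr)

theorem rest_subset_shadow : D.rest a b ⊆ D.shadow := by
  rw [h.shadow_eq]; exact subset_union_left

theorem bridge_subset_shadow {s : ℝ} (hs : s ∈ Icc a b) : D.plane.path s ∈ D.shadow := by
  rw [h.shadow_eq]; exact Or.inr ⟨s, hs, rfl⟩

/-- The interval of the bridge that runs through a given level. -/
theorem exists_level_gap (hmin : D.IsShortest a b l) {j : ℕ} (h1 : 1 ≤ j) (hj : j < l) :
    ∃ τ₁ ∈ D.passes a b, ∃ τ₂ ∈ D.passes a b, τ₁ < τ₂ ∧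
      ∀ s ∈ Icc a b, D.plane.path s ∈ D.level a b j ↔ s ∈ Ioo τ₁ τ₂ := by
  obtain ⟨τ₁, hτ₁, τ₂, hτ₂, hlt, hno, hgap⟩ := h.exists_gap h1 hj
  refine ⟨τ₁, hτ₁, τ₂, hτ₂, hlt, fun s hs => ?_⟩
  rw [h.mem_level_iff hmin hs]
  constructor
  · rintro ⟨-, hp, hd⟩
    exact (hgap s hs hp).1 hd
  · intro hsI
    exact ⟨⟨hτ₁.1.1.trans hsI.1, hsI.2.trans hτ₂.1.2⟩, hno s hsI, (hgap s hs (hno s hsI)).2 hsI⟩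

/-- The bridge cuts a connected level into two connected regions, which are told apart by the
winding number. -/
theorem exists_regions {j : ℕ} (hconn : IsPreconnected (D.level a b j)) {τ₁ τ₂ : ℝ}
    (hτ₁ : τ₁ ∈ D.passes a b) (hτ₂ : τ₂ ∈ D.passes a b) (hlt : τ₁ < τ₂)
    (hgap : ∀ s ∈ Icc a b, D.plane.path s ∈ D.level a b j ↔ s ∈ Ioo τ₁ τ₂) :
    ∃ w : ℤ, (∀ x ∈ D.level a b j, x ∉ D.shadow → D.plane.wind x = w ∨ D.plane.wind x = w + 1) ∧
      IsPreconnected (D.region a b j w) ∧ IsPreconnected (D.region a b j (w + 1)) := by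
  classical
  have hsub : Icc τ₁ τ₂ ⊆ Icc a b := Icc_subset_Icc hτ₁.1.1.le hτ₂.1.2.le
  have hdiff : D.level a b j \ D.plane.path '' Icc τ₁ τ₂ = D.level a b j \ D.shadow := by
    apply Subset.antisymm
    · rintro x ⟨hx, hx'⟩
      refine ⟨hx, fun hs => ?_⟩
      rw [h.shadow_eq] at hs
      rcases hs with hs | ⟨s, hs, rfl⟩
      · exact hx.1 hs
      · exact hx' ⟨s, Ioo_subset_Icc_self ((hgap s hs).1 hx), rfl⟩
    · rintro x ⟨hx, hx'⟩
      refine ⟨hx, ?_⟩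
      rintro ⟨s, hs, rfl⟩
      exact hx' (h.bridge_subset_shadow (hsub hs))
  have hcomp : CompLE (D.level a b j \ D.plane.path '' Icc τ₁ τ₂) (0 + 1 + ({τ₂} : Set ℝ).ncard) := by
    refine CompLE.diff_path D.plane D.plane_vertex_ne (h.isOpen_level j) hlt.le
      (fun hx => hx.1 hτ₁.2) ⟨{D.level a b j}, by simp, by simpa using hconn, by simp⟩ ?_ ?_
      (injOn_singleton _ _) (finite_singleton _)
    · rintro s hs (h1 | ⟨s', hs', e⟩)
      · by_contra hne
        exact h1 ((hgap s (hsub (Ioc_subset_Icc_self hs))).2 ⟨hs.1, lt_of_le_of_ne hs.2 hne⟩)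
      · have := h.injOn (hsub ⟨hs'.1, hs'.2.le.trans hs.2⟩) (hsub (Ioc_subset_Icc_self hs)) e
        exact absurd this hs'.2.ne
    · rw [singleton_subset_iff]; exact ⟨hlt, le_rfl⟩
  rw [hdiff, ncard_singleton] at hcomp
  obtain ⟨F, hF, hFV, hcov⟩ := hcomp
  have hwF : ∀ V ∈ F, ∀ x ∈ V, ∀ y ∈ V, D.plane.wind x = D.plane.wind y := fun V hV x hx y hy =>
    wind_eq (hFV V hV).1 (fun z hz => ((hFV V hV).2 hz).2) hx hy
  -- two points on different sides of the bridge
  obtain ⟨s, hsirr, hs1, hs2⟩ := exists_irrational_btwn hlt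
  have hsI : s ∈ Icc a b := hsub ⟨hs1.le, hs2.le⟩
  have hsf := (hgap s hsI).2 ⟨hs1, hs2⟩
  have hfr : Int.fract s ≠ 0 := by
    intro e
    rw [Int.fract, sub_eq_zero] at e
    exact hsirr ⟨⌊s⌋, by rw [e]; simp⟩
  have hcr : D.plane.path s ∉ D.crossings := fun hc =>
    hsf.1 (h.mem_passes_iff.2 ⟨hsI, hc⟩).2
  obtain ⟨ε, hε, hside⟩ := exists_sides hfr hcr ((h.isOpen_level j).mem_nhds hsf)
  obtain ⟨g1, g2, g3⟩ := hside ε hε le_rfl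
  set x₁ := D.plane.path s + ε • rot (D.plane.dirR s)
  set x₀ := D.plane.path s + ε • -rot (D.plane.dirR s)
  obtain ⟨V₁, hV₁, hx₁⟩ := mem_iUnion₂.1 (hcov g1)
  obtain ⟨V₀, hV₀, hx₀⟩ := mem_iUnion₂.1 (hcov g2)
  have hne : V₀ ≠ V₁ := by
    rintro rfl
    have := hwF V₀ hV₀ x₀ hx₀ x₁ hx₁
    omega
  have hFeq : F = {V₀, V₁} := by
    symm
    refine Finset.eq_of_subset_of_card_le ?_ ?_
    · intro V hV
      rcases Finset.mem_insert.1 hV with rfl | hV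
      · exact hV₀
      · rw [Finset.mem_singleton] at hV
        rwa [hV]
    · rw [Finset.card_pair hne]; omega
  have hcases : ∀ x ∈ D.level a b j, x ∉ D.shadow → (x ∈ V₀ ∧ D.plane.wind x = D.plane.wind x₀) ∨
      (x ∈ V₁ ∧ D.plane.wind x = D.plane.wind x₀ + 1) := by
    intro x hx hxs
    obtain ⟨V, hV, hxV⟩ := mem_iUnion₂.1 (hcov ⟨hx, hxs⟩)
    rw [hFeq] at hV
    rcases Finset.mem_insert.1 hV with rfl | hV
    · exact Or.inl ⟨hxV, hwF V hV₀ x hxV x₀ hx₀⟩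
    · rw [Finset.mem_singleton] at hV
      subst hV
      exact Or.inr ⟨hxV, by rw [← g3]; exact hwF V hV₁ x hxV x₁ hx₁⟩
  have e0 : D.region a b j (D.plane.wind x₀) = V₀ := by
    apply Subset.antisymm
    · rintro x ⟨hx, hxs, hxw⟩
      rcases hcases x hx hxs with h1 | h1
      · exact h1.1
      · omega
    · intro x hx
      obtain ⟨h1, h2⟩ := (hFV V₀ hV₀).2 hx
      exact ⟨h1, h2, hwF V₀ hV₀ x hx x₀ hx₀⟩
  have e1 : D.region a b j (D.plane.wind x₀ + 1) = V₁ := by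
    apply Subset.antisymm
    · rintro x ⟨hx, hxs, hxw⟩
      rcases hcases x hx hxs with h1 | h1
      · omega
      · exact h1.1
    · intro x hx
      obtain ⟨h1, h2⟩ := (hFV V₁ hV₁).2 hx
      exact ⟨h1, h2, by rw [← g3]; exact hwF V₁ hV₁ x hx x₁ hx₁⟩
  refine ⟨D.plane.wind x₀, fun x hx hxs => (hcases x hx hxs).imp And.right And.right, ?_, ?_⟩
  · rw [e0]; exact (hFV V₀ hV₀).1
  · rw [e1]; exact (hFV V₁ hV₁).1

end IsOverBridge

end KnotDiagram

end Regions

/-! ### The last contact of the diagram with the cheaper levels -/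

section LastContact

open Set Topology Filter

theorem ray_subset_closure {v d : Plane} (hd : d ≠ 0) {r : ℝ} {s : ℝ}
    (hs : v + s • d ∈ Metric.ball v r) : v + s • d ∈ closure (Metric.ball v r \ ray v d) := by
  have ht : Tendsto (fun ε : ℝ => v + s • d + ε • rot d) (𝓝[>] 0) (𝓝 (v + s • d)) := by
    have hc : Continuous (fun ε : ℝ => v + s • d + ε • rot d) := by fun_prop
    have := hc.tendsto 0
    simp only [zero_smul, add_zero] at this
    exact this.mono_left nhdsWithin_le_nhds
  refine mem_closure_of_tendsto ht ?_
  filter_upwards [ht.eventually (Metric.isOpen_ball.mem_nhds hs), self_mem_nhdsWithin] with ε h1 h2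
  refine ⟨h1, ?_⟩
  rintro ⟨c, -, e⟩
  have h3 : (0 : ℝ) < ε := h2
  have := congrArg (fun y => cross d (y - v)) e
  simp only [add_sub_cancel_left, add_assoc, cross_add, cross_smul, cross_same, cross_rot, mul_zero,
    zero_add] at this
  have hs := sqLen_pos hd
  have : 0 < ε * sqLen d := by positivity
  linarith

namespace KnotDiagram

/-- The points off the rest of the diagram with access at the cost of at most `i` intersections. -/
def reachable (D : KnotDiagram) (a b : ℝ) (i : ℕ) : Set Plane :=
  {x | x ∉ D.rest a b ∧ D.Access a b i x}

namespace IsOverBridge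

variable {D : KnotDiagram} {a b : ℝ} {l : ℕ} (h : D.IsOverBridge a b l)

include h

theorem reachable_of_isPreconnected {V : Set Plane} (hV : IsPreconnected V)
    (hVr : V ⊆ (D.rest a b)ᶜ) {x : Plane} (hx : x ∈ V) {i : ℕ} (hxi : x ∈ D.reachable a b i) :
    V ⊆ D.reachable a b i :=
  fun _ hy => ⟨hVr hy, h.access_congr hV hVr hx hy hxi.2⟩

theorem right_mem_closure_reachable (i : ℕ) :
    D.plane.path b ∈ closure (D.reachable a b i) := by
  obtain ⟨s₀, hs₀, h1⟩ := h.reach_right (D.forbidden a b)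
  have hb : b ∈ closure (Ioo s₀ b) := by
    rw [closure_Ioo hs₀.2.ne]
    exact ⟨hs₀.2.le, le_rfl⟩
  refine map_mem_closure D.plane.continuous_path hb fun s hs => ?_
  obtain ⟨h2, h3⟩ := h1 s hs
  exact ⟨h.bridge_notMem_rest ⟨hs₀.1.trans hs.1, hs.2⟩ h2, h3.mono (Nat.zero_le i)⟩

theorem left_notMem_closure_reachable (hmin : D.IsShortest a b l) {i : ℕ} (hi : i < l) :
    D.plane.path a ∉ closure (D.reachable a b i) := by
  intro hcl
  obtain ⟨r, hr, hb⟩ := h.exists_ball_left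
  have hd : D.plane.dirL a ≠ 0 := D.plane.dirL_ne_zero D.plane_vertex_ne a
  have hVc : IsPreconnected (Metric.ball (D.plane.path a) r \
      ray (D.plane.path a) (D.plane.dirL a)) := isPreconnected_ball_diff_ray hd hr
  set V := Metric.ball (D.plane.path a) r \ ray (D.plane.path a) (D.plane.dirL a) with hV
  have hVr : V ⊆ (D.rest a b)ᶜ := fun y hy hyr => hy.2 ((hb y hy.1).1 hyr)
  obtain ⟨y, hyb, hyi⟩ := mem_closure_iff.1 hcl _ Metric.isOpen_ball (Metric.mem_ball_self hr)
  have hyV : y ∈ V := ⟨hyb, fun hm => hyi.1 ((hb y hyb).2 hm)⟩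
  obtain ⟨s₀, hs₀, h1⟩ := h.segment_left
  have hev : ∀ᶠ s in 𝓝[>] a, s < s₀ ∧ a < s ∧
      D.plane.path s ∈ Metric.ball (D.plane.path a) r := by
    filter_upwards [mem_nhdsWithin_of_mem_nhds (Iio_mem_nhds hs₀.1), self_mem_nhdsWithin,
      mem_nhdsWithin_of_mem_nhds (D.plane.continuous_path.continuousAt.preimage_mem_nhds
        (Metric.ball_mem_nhds (D.plane.path a) hr))] with s g1 g2 g3
    exact ⟨g1, g2, g3⟩
  obtain ⟨s, g1, g2, g3⟩ := hev.exists
  obtain ⟨h2, h3⟩ := h1 s ⟨g2, g1⟩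
  have hsV : D.plane.path s ∈ V :=
    ⟨g3, fun hm => h.bridge_notMem_rest ⟨g2, g1.trans hs₀.2⟩ h2 ((hb _ g3).2 hm)⟩
  exact absurd (hmin i _ (h.access_congr hVc hVr hyV hsV hyi.2) h3) (not_le.2 hi)

/-- Past its last contact with the reachable points, the diagram runs through a crossing with an
earlier strand. -/
theorem exists_last_crossing (hmin : D.IsShortest a b l) {i : ℕ} (hi : i < l) :
    ∃ t₀ u₀, b < u₀ ∧ u₀ < t₀ ∧ t₀ < a + D.n ∧ D.plane.path u₀ = D.plane.path t₀ ∧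
      D.plane.path t₀ ∈ closure (D.reachable a b i) ∧
      ∀ t ∈ Ioc t₀ (a + D.n), D.plane.path t ∉ closure (D.reachable a b i) := by
  have hcomp : IsCompact (Icc b (a + D.n) ∩
      D.plane.path ⁻¹' closure (D.reachable a b i)) :=
    isCompact_Icc.inter_right (isClosed_closure.preimage D.plane.continuous_path)
  obtain ⟨t₀, ⟨ht₀, hcl⟩, hmax⟩ := hcomp.exists_isGreatest
    ⟨b, ⟨le_rfl, h.lt_add.le⟩, h.right_mem_closure_reachable i⟩
  have hafter : ∀ t ∈ Ioc t₀ (a + D.n), D.plane.path t ∉ closure (D.reachable a b i) :=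
    fun t ht hm => absurd (hmax ⟨⟨ht₀.1.trans ht.1.le, ht.2⟩, hm⟩) (not_le.2 ht.1)
  have hlt : t₀ < a + D.n := by
    refine lt_of_le_of_ne ht₀.2 ?_
    rintro rfl
    rw [mem_preimage, h.path_add_n] at hcl
    exact h.left_notMem_closure_reachable hmin hi hcl
  -- the ray along which the diagram leaves does not lie in the closure
  have hray : ∀ r > 0, ¬ ∀ s : ℝ, 0 < s →
      D.plane.path t₀ + s • D.plane.dirR t₀ ∈ Metric.ball (D.plane.path t₀) r →
      D.plane.path t₀ + s • D.plane.dirR t₀ ∈ closure (D.reachable a b i) := by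
    intro r hr hall
    have hcc : Continuous (fun s : ℝ => D.plane.path t₀ + s • D.plane.dirR t₀) := by fun_prop
    have ht := hcc.tendsto 0
    rw [zero_smul, add_zero] at ht
    have hev : ∀ᶠ s in 𝓝[>] (0 : ℝ), 0 < s ∧ s < ⌊t₀⌋ + 1 - t₀ ∧ s < a + D.n - t₀ ∧
        D.plane.path t₀ + s • D.plane.dirR t₀ ∈ Metric.ball (D.plane.path t₀) r := by
      filter_upwards [self_mem_nhdsWithin,
        mem_nhdsWithin_of_mem_nhds (Iio_mem_nhds
          (show (0 : ℝ) < ⌊t₀⌋ + 1 - t₀ by linarith [Int.lt_floor_add_one t₀])),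
        mem_nhdsWithin_of_mem_nhds (Iio_mem_nhds (show (0 : ℝ) < a + D.n - t₀ by linarith)),
        (ht.mono_left nhdsWithin_le_nhds).eventually (Metric.ball_mem_nhds _ hr)] with s g1 g2 g3 g4
      exact ⟨g1, g2, g3, g4⟩
    obtain ⟨s, g1, g2, g3, g4⟩ := hev.exists
    have := hall s g1 g4
    rw [← D.plane.path_add_right g1.le g2.le] at this
    exact hafter (t₀ + s) ⟨by linarith, by linarith⟩ this
  have hex : ∃ u ∈ Icc b (a + D.n), D.plane.path u = D.plane.path t₀ ∧ u ≠ t₀ := by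
    by_contra hcon
    push Not at hcon
    obtain ⟨r, hr, hb⟩ := h.exists_ball_of_unique ht₀ hcon
    obtain ⟨y, hyb, hyi⟩ := mem_closure_iff.1 hcl _ Metric.isOpen_ball (Metric.mem_ball_self hr)
    have hdR := D.plane.dirR_ne_zero D.plane_vertex_ne t₀
    rcases ht₀.1.lt_or_eq with hbt | hbt
    · have hX : ∀ y ∈ Metric.ball (D.plane.path t₀) r, y ∈ D.rest a b ↔
          y ∈ ray (D.plane.path t₀) (D.plane.dirL t₀) ∨
            y ∈ ray (D.plane.path t₀) (D.plane.dirR t₀) := by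
        intro y hy
        rw [hb y hy]
        simp [hlt, hbt, or_comm]
      obtain ⟨V, hV, hVr, hyV, hVcl⟩ := exists_preconnected_of_two_rays hr
        (D.plane.dirL_ne_zero D.plane_vertex_ne t₀) hdR
        (fun c hc => D.dirL_ne_smul_dirR t₀ hc) hX hyb hyi.1
      have hsub := h.reachable_of_isPreconnected hV (fun z hz => (hVr hz).2) hyV hyi
      exact hray r hr fun s hs hsb => closure_mono hsub (hVcl s hs hsb)
    · have hX : ∀ y ∈ Metric.ball (D.plane.path t₀) r, y ∈ D.rest a b ↔
          y ∈ ray (D.plane.path t₀) (D.plane.dirR t₀) := by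
        intro y hy
        rw [hb y hy]
        simp [hlt, hbt]
      have hV : IsPreconnected (Metric.ball (D.plane.path t₀) r \
          ray (D.plane.path t₀) (D.plane.dirR t₀)) := isPreconnected_ball_diff_ray hdR hr
      have hsub := h.reachable_of_isPreconnected hV
        (fun z hz hzr => hz.2 ((hX z hz.1).1 hzr))
        (x := y) ⟨hyb, fun hm => hyi.1 ((hX y hyb).2 hm)⟩ hyi
      exact hray r hr fun s _ hsb => closure_mono hsub (ray_subset_closure hdR hsb)
  obtain ⟨u₀, hu₀, e, hne⟩ := hex
  refine ⟨t₀, u₀, (h.mem_Ioo_of_eq hu₀ ht₀ hne e).1, ?_, hlt, e, hcl, hafter⟩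
  rcases hne.lt_or_gt with h1 | h1
  · exact h1
  · exact absurd (e ▸ hcl) (hafter u₀ ⟨h1, hu₀.2⟩)

theorem crossing_notMem_bridge {t u : ℝ} (ht : t ∈ Icc b (a + D.n)) (hu : u ∈ Icc b (a + D.n))
    (htu : t ≠ u) (e : D.plane.path t = D.plane.path u) :
    D.plane.path t ∉ D.plane.path '' Icc a b := by
  rintro ⟨s, hs, es⟩
  have hc := mem_crossings htu (h.abs_sub_lt ht hu) e
  have hp := h.mem_passes_iff.2 ⟨hs, es ▸ hc⟩
  exact htu (h.existsUnique_rest hp ht hu es.symm (e.symm.trans es.symm))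

/-- The rest of the diagram near a crossing, in affine coordinates `cross A (y - v)` and
`cross B (y - v)` at the crossing `v` along the two strands: the strands are the coordinate axes,
the diagram leaves along the positive half of the first axis. Of the four quadrants, the second one
is reachable at the cost of `i`, the first one has cost `i + 1`, and so has one of the two other
ones. -/
theorem exists_corner (hmin : D.IsShortest a b l) {i : ℕ} (hi : i < l) :
    ∃ (t₀ u₀ : ℝ) (e A B : Plane) (c₁ c₂ r : ℝ), b < u₀ ∧ u₀ < t₀ ∧ t₀ < a + D.n ∧
      D.plane.path u₀ = D.plane.path t₀ ∧
      (e = D.plane.dirR u₀ ∨ e = -D.plane.dirR u₀) ∧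
      cross A (D.plane.dirR t₀) = 1 ∧ cross A e = 0 ∧ cross B (D.plane.dirR t₀) = 0 ∧
      cross B e = 1 ∧ c₁ ≠ 0 ∧ A = c₁ • D.plane.dirR u₀ ∧ c₂ ≠ 0 ∧ B = c₂ • D.plane.dirR t₀ ∧
      0 < r ∧ (∀ y ∈ Metric.ball (D.plane.path t₀) r, y ∉ D.plane.path '' Icc a b ∧
        (y ∈ D.rest a b ↔ cross A (y - D.plane.path t₀) = 0 ∨
          cross B (y - D.plane.path t₀) = 0)) ∧
      (∀ y ∈ Metric.ball (D.plane.path t₀) r, cross A (y - D.plane.path t₀) < 0 →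
        0 < cross B (y - D.plane.path t₀) → y ∈ D.reachable a b i) ∧
      (∀ y ∈ Metric.ball (D.plane.path t₀) r, 0 < cross A (y - D.plane.path t₀) →
        0 < cross B (y - D.plane.path t₀) → y ∈ D.level a b (i + 1)) ∧
      ((∀ y ∈ Metric.ball (D.plane.path t₀) r, 0 < cross A (y - D.plane.path t₀) →
        cross B (y - D.plane.path t₀) < 0 → y ∈ D.level a b (i + 1)) ∨
      (∀ y ∈ Metric.ball (D.plane.path t₀) r, cross A (y - D.plane.path t₀) < 0 →
        cross B (y - D.plane.path t₀) < 0 → y ∈ D.level a b (i + 1))) := by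
  obtain ⟨t₀, u₀, hbu, hut, hta, eut, hcl, hafter⟩ := h.exists_last_crossing hmin hi
  have ht₀ : t₀ ∈ Icc b (a + D.n) := ⟨(hbu.trans hut).le, hta.le⟩
  have hu₀ : u₀ ∈ Icc b (a + D.n) := ⟨hbu.le, (hut.trans hta).le⟩
  obtain ⟨hcross, r₁, hr₁, hb₁⟩ := h.exists_ball_of_crossing ht₀ hu₀ hut.ne' eut.symm
  set v := D.plane.path t₀ with hv
  set d := D.plane.dirR t₀ with hd
  set e₀ := D.plane.dirR u₀ with he₀
  -- a disc that stays away from the bridge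
  have hclosed : IsClosed (D.plane.path '' Icc a b) :=
    (isCompact_Icc.image D.plane.continuous_path).isClosed
  have hvb := h.crossing_notMem_bridge ht₀ hu₀ hut.ne' eut.symm
  obtain ⟨r₂, hr₂, hb₂⟩ := Metric.isOpen_iff.1 hclosed.isOpen_compl v hvb
  set r := min r₁ r₂ with hr
  have hr0 : 0 < r := lt_min hr₁ hr₂
  have hbX : ∀ y ∈ Metric.ball v r, y ∈ D.rest a b ↔ cross d (y - v) = 0 ∨ cross e₀ (y - v) = 0 :=
    fun y hy => hb₁ y (Metric.ball_subset_ball (min_le_left _ _) hy)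
  -- a reachable point near the crossing determines the direction of the second axis
  obtain ⟨y₀, hy₀b, hy₀⟩ := mem_closure_iff.1 hcl _ Metric.isOpen_ball (Metric.mem_ball_self hr0)
  have hy₀X := (hbX y₀ hy₀b).not.1 hy₀.1
  push Not at hy₀X
  obtain ⟨σ, hσ, hσpos⟩ : ∃ σ : ℝ, (σ = 1 ∨ σ = -1) ∧
      0 < σ * (cross d (y₀ - v) * cross d e₀) := by
    rcases (mul_ne_zero hy₀X.1 hcross).lt_or_gt with h1 | h1
    · exact ⟨-1, Or.inr rfl, by linarith⟩
    · exact ⟨1, Or.inl rfl, by linarith⟩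
  have hσ0 : σ ≠ 0 := by rcases hσ with rfl | rfl <;> norm_num
  set κ := cross d (σ • e₀) with hκ
  have hκe : κ = σ * cross d e₀ := cross_smul d σ e₀
  have hκ0 : κ ≠ 0 := by rw [hκe]; exact mul_ne_zero hσ0 hcross
  set A : Plane := (-(κ⁻¹ * σ)) • e₀ with hA
  set B : Plane := κ⁻¹ • d with hB
  have hAd : cross A d = 1 := by
    rw [hA, cross_smul_left, cross_comm e₀ d, neg_mul_neg]
    rw [mul_assoc, ← hκe, inv_mul_cancel₀ hκ0]
  have hAe : cross A (σ • e₀) = 0 := by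
    rw [hA, cross_smul_left, cross_smul, cross_same, mul_zero, mul_zero]
  have hBd : cross B d = 0 := by rw [hB, cross_smul_left, cross_same, mul_zero]
  have hBe : cross B (σ • e₀) = 1 := by rw [hB, cross_smul_left, ← hκ, inv_mul_cancel₀ hκ0]
  have hc₁ : -(κ⁻¹ * σ) ≠ 0 := neg_ne_zero.2 (mul_ne_zero (inv_ne_zero hκ0) hσ0)
  have hA0 : A ≠ 0 := by
    intro h0
    rw [h0] at hAd
    simp [cross] at hAd
  have hB0 : B ≠ 0 := by
    intro h0
    rw [h0] at hBe
    simp [cross] at hBe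
  have hX : ∀ y ∈ Metric.ball v r, y ∈ D.rest a b ↔ cross A (y - v) = 0 ∨ cross B (y - v) = 0 := by
    intro y hy
    rw [hbX y hy, hA, hB, cross_smul_left, cross_smul_left, mul_eq_zero, mul_eq_zero, or_comm]
    simp [hc₁, hκ0]
  -- the quadrants
  set Q : ℝ → ℝ → Set Plane := fun σ τ =>
    Metric.ball v r ∩ {y | 0 < cross (σ • A) (y - v)} ∩ {y | 0 < cross (τ • B) (y - v)} with hQ
  have hQc : ∀ σ τ, IsPreconnected (Q σ τ) := fun σ τ =>
    (((convex_ball v r).inter (convex_cross_pos _ v)).inter (convex_cross_pos _ v)).isPreconnected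
  have hmemQ : ∀ σ τ y, y ∈ Q σ τ ↔ y ∈ Metric.ball v r ∧ 0 < σ * cross A (y - v) ∧
      0 < τ * cross B (y - v) := by
    intro σ τ y
    simp only [hQ, mem_inter_iff, Set.mem_ofPred_eq, cross_smul_left, and_assoc]
  have hQX : ∀ σ τ, Q σ τ ⊆ (D.rest a b)ᶜ := by
    intro σ τ y hy hyX
    rw [hmemQ] at hy
    rcases (hX y hy.1).1 hyX with h1 | h1
    · rw [h1, mul_zero] at hy; exact lt_irrefl _ hy.2.1
    · rw [h1, mul_zero] at hy; exact lt_irrefl _ hy.2.2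
  set e := σ • e₀ with he
  -- coordinates
  have hcA : ∀ α β : ℝ, cross A (v + (α • d + β • e) - v) = α := by
    intro α β
    rw [add_sub_cancel_left, cross_add, cross_smul, cross_smul, hAd, hAe]; ring
  have hcB : ∀ α β : ℝ, cross B (v + (α • d + β • e) - v) = β := by
    intro α β
    rw [add_sub_cancel_left, cross_add, cross_smul, cross_smul, hBd, hBe]; ring
  have hsmall : ∃ δ > (0 : ℝ), ∀ α β : ℝ, |α| ≤ δ → |β| ≤ δ →
      v + (α • d + β • e) ∈ Metric.ball v r := by
    have hcc : Continuous (fun p : ℝ × ℝ => v + (p.1 • d + p.2 • e)) := by fun_prop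
    have ht := hcc.tendsto (0, 0)
    simp only [zero_smul, add_zero] at ht
    obtain ⟨δ, hδ, hball⟩ := Metric.eventually_nhds_iff_ball.1
      (ht.eventually (Metric.ball_mem_nhds v hr0))
    refine ⟨δ / 2, by linarith, fun α β hα hβ => hball (α, β) ?_⟩
    rw [Metric.mem_ball, Prod.dist_eq, Real.dist_eq, Real.dist_eq]
    simp only [sub_zero]
    exact max_lt (by linarith) (by linarith)
  obtain ⟨δ, hδ, hδb⟩ := hsmall
  -- the first and the fourth quadrant are not reachable
  have hnot : ∀ τ, (τ = 1 ∨ τ = -1) → ∀ y ∈ Q 1 τ, y ∉ D.reachable a b i := by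
    intro τ hτ y hy hyi
    have hsub := h.reachable_of_isPreconnected (hQc 1 τ) (hQX 1 τ) hy hyi
    have hev : ∀ᶠ s in 𝓝[>] (0 : ℝ), 0 < s ∧ s < ⌊t₀⌋ + 1 - t₀ ∧ s < a + D.n - t₀ ∧ s < δ := by
      filter_upwards [self_mem_nhdsWithin,
        mem_nhdsWithin_of_mem_nhds (Iio_mem_nhds
          (show (0 : ℝ) < ⌊t₀⌋ + 1 - t₀ by linarith [Int.lt_floor_add_one t₀])),
        mem_nhdsWithin_of_mem_nhds (Iio_mem_nhds (show (0 : ℝ) < a + D.n - t₀ by linarith)),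
        mem_nhdsWithin_of_mem_nhds (Iio_mem_nhds hδ)] with s g1 g2 g3 g4
      exact ⟨g1, g2, g3, g4⟩
    obtain ⟨s, g1, g2, g3, g4⟩ := hev.exists
    refine hafter (t₀ + s) ⟨by linarith, by linarith⟩ (closure_mono hsub ?_)
    rw [D.plane.path_add_right g1.le g2.le]
    have ht : Tendsto (fun ε : ℝ => v + (s • d + (ε * τ) • e)) (𝓝[>] 0) (𝓝 (v + s • d)) := by
      have hcc : Continuous (fun ε : ℝ => v + (s • d + (ε * τ) • e)) := by fun_prop
      have := hcc.tendsto 0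
      simp only [zero_mul, zero_smul, add_zero] at this
      exact this.mono_left nhdsWithin_le_nhds
    refine mem_closure_of_tendsto ht ?_
    filter_upwards [self_mem_nhdsWithin, mem_nhdsWithin_of_mem_nhds (Iio_mem_nhds hδ)] with ε k1 k2
    have k1' : (0 : ℝ) < ε := k1
    have k2' : ε < δ := k2
    have hττ : |ε * τ| = ε ∧ τ * (ε * τ) = ε := by
      rcases hτ with rfl | rfl
      · simp [abs_of_pos k1']
      · simp [abs_of_pos k1']
    rw [hmemQ, hcA, hcB]
    refine ⟨hδb _ _ (by rw [abs_of_pos g1]; exact g4.le) (by rw [hττ.1]; exact k2'.le), by linarith,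
      by rw [hττ.2]; exact k1'⟩
  -- crossing one of the axes
  have hδ2 : |δ / 2| ≤ δ := by rw [abs_of_pos (by linarith)]; linarith
  have hstep : ∀ m ∈ Metric.ball v r, ∀ C ≠ (0 : Plane), (C = A ∧ cross A (m - v) = 0 ∧
      cross B (m - v) ≠ 0 ∨ C = B ∧ cross B (m - v) = 0 ∧ cross A (m - v) ≠ 0) →
      ∃ ρ, LocLine (D.rest a b) m C ρ := by
    intro m hm C hC hcase
    have hball := Metric.isOpen_ball.mem_nhds hm
    have hne : ∀ E : Plane, cross E (m - v) ≠ 0 → ∀ᶠ y in 𝓝 m, cross E (y - v) ≠ 0 := by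
      intro E hE
      have hcc : Continuous (fun y => cross E (y - v)) :=
        (continuous_cross E).comp (continuous_id.sub continuous_const)
      exact hcc.continuousAt.eventually_ne hE
    have hsub : ∀ E y : Plane, cross E (m - v) = 0 → cross E (y - v) = cross E (y - m) := by
      intro E y h0
      rw [← sub_add_sub_cancel y m v, cross_add, h0, add_zero]
    rcases hcase with ⟨rfl, h0, h1⟩ | ⟨rfl, h0, h1⟩
    · obtain ⟨ρ, hρ, hall⟩ := Metric.eventually_nhds_iff_ball.1 ((hne B h1).and hball)
      refine ⟨ρ, hC, hρ, fun y hy => ?_⟩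
      obtain ⟨g1, g2⟩ := hall y hy
      rw [hX y g2, hsub _ _ h0]
      simp [g1]
    · obtain ⟨ρ, hρ, hall⟩ := Metric.eventually_nhds_iff_ball.1 ((hne A h1).and hball)
      refine ⟨ρ, hC, hρ, fun y hy => ?_⟩
      obtain ⟨g1, g2⟩ := hall y hy
      rw [hX y g2, hsub _ _ h0]
      simp [g1]
  have hnear : ∀ m : Plane, ∀ α β : ℝ, ∀ ρ > 0, ∃ ε > (0 : ℝ), ε < δ ∧
      m + (ε * α) • d + (ε * β) • e ∈ Metric.ball m ρ ∧
      m + (-(ε * α)) • d + (-(ε * β)) • e ∈ Metric.ball m ρ := by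
    intro m α β ρ hρ
    have key : ∀ α β : ℝ, ∀ᶠ ε in 𝓝[>] (0 : ℝ),
        m + (ε * α) • d + (ε * β) • e ∈ Metric.ball m ρ := by
      intro α β
      have hcc : Continuous (fun ε : ℝ => m + (ε * α) • d + (ε * β) • e) := by fun_prop
      have := hcc.tendsto 0
      simp only [zero_mul, zero_smul, add_zero] at this
      exact (this.mono_left nhdsWithin_le_nhds).eventually (Metric.ball_mem_nhds m hρ)
    have hev : ∀ᶠ ε in 𝓝[>] (0 : ℝ), 0 < ε ∧ ε < δ ∧
      m + (ε * α) • d + (ε * β) • e ∈ Metric.ball m ρ ∧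
      m + (-(ε * α)) • d + (-(ε * β)) • e ∈ Metric.ball m ρ := by
      filter_upwards [self_mem_nhdsWithin, mem_nhdsWithin_of_mem_nhds (Iio_mem_nhds hδ), key α β,
        key (-α) (-β)] with ε g1 g2 g3 g4
      exact ⟨g1, g2, g3, by rwa [← mul_neg, ← mul_neg]⟩
    obtain ⟨ε, g⟩ := hev.exists
    exact ⟨ε, g⟩
  have hcost : ∀ σ₁ τ₁ σ₂ τ₂ : ℝ, ∀ y₁ ∈ Q σ₁ τ₁, y₁ ∈ D.reachable a b i → ∀ x₁ ∈ Q σ₁ τ₁,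
      ∀ x₂ ∈ Q σ₂ τ₂, ∀ m C ρ, LocLine (D.rest a b) m C ρ → x₁ ∈ Metric.ball m ρ →
      x₂ ∈ Metric.ball m ρ → ∀ y₂ ∈ Q σ₂ τ₂, D.Access a b (i + 1) y₂ := by
    intro σ₁ τ₁ σ₂ τ₂ y₁ hy₁ hy₁i x₁ hx₁ x₂ hx₂ m C ρ hl hxm₁ hxm₂ y₂ hy₂
    have h1 := h.access_congr (hQc σ₁ τ₁) (hQX σ₁ τ₁) hy₁ hx₁ hy₁i.2
    have h2 : D.Access a b (i + 1) x₂ := Reach.cross_line h.isCompact_rest.isClosed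
      h.finite_forbidden hl hxm₁ (hQX _ _ hx₁) hxm₂ (hQX _ _ hx₂) h1
    exact h.access_congr (hQc σ₂ τ₂) (hQX σ₂ τ₂) hx₂ hy₂ h2
  have hlevel : ∀ y, y ∉ D.rest a b → D.Access a b (i + 1) y → y ∉ D.reachable a b i →
      y ∈ D.level a b (i + 1) := fun y h1 h2 h3 =>
    ⟨h1, h2, fun i' hi' hy' => h3 ⟨h1, hy'.mono (Nat.lt_succ_iff.1 hi')⟩⟩
  -- the rules for two quadrants that are separated by the second, or by the first, axis
  have hruleA : ∀ σ₁ τ₁ : ℝ, (σ₁ = 1 ∨ σ₁ = -1) → (τ₁ = 1 ∨ τ₁ = -1) → ∀ y₁ ∈ Q σ₁ τ₁,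
      y₁ ∈ D.reachable a b i → ∀ y₂ ∈ Q (-σ₁) τ₁, D.Access a b (i + 1) y₂ := by
    intro σ₁ τ₁ hσ₁ hτ₁ y₁ hy₁ hy₁i y₂ hy₂
    have hτ2 : τ₁ * τ₁ = 1 := by rcases hτ₁ with rfl | rfl <;> norm_num
    have hσ2 : σ₁ * σ₁ = 1 := by rcases hσ₁ with rfl | rfl <;> norm_num
    have habs : |δ / 2 * τ₁| ≤ δ := by
      rcases hτ₁ with rfl | rfl
      · simpa using hδ2
      · rw [mul_neg, mul_one, abs_neg]; exact hδ2
    set m := v + ((0 : ℝ) • d + (δ / 2 * τ₁) • e) with hm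
    have hmb : m ∈ Metric.ball v r := hδb _ _ (by simpa using hδ.le) habs
    obtain ⟨ρ, hl⟩ := hstep m hmb A hA0 (Or.inl ⟨rfl, hcA _ _, by
      rw [hcB]; intro h0; rcases hτ₁ with rfl | rfl <;> linarith⟩)
    obtain ⟨ε, hε, hεδ, hb1, hb2⟩ := hnear m σ₁ 0 ρ hl.2.1
    have habs' : |ε * σ₁| ≤ δ := by
      rcases hσ₁ with rfl | rfl
      · rw [mul_one, abs_of_pos hε]; exact hεδ.le
      · rw [mul_neg, mul_one, abs_neg, abs_of_pos hε]; exact hεδ.le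
    have e1 : m + (ε * σ₁) • d + (ε * 0) • e = v + ((ε * σ₁) • d + (δ / 2 * τ₁) • e) := by
      rw [hm]; module
    have e2 : m + (-(ε * σ₁)) • d + (-(ε * 0)) • e = v + ((-(ε * σ₁)) • d + (δ / 2 * τ₁) • e) := by
      rw [hm]; module
    rw [e1] at hb1
    rw [e2] at hb2
    refine hcost σ₁ τ₁ (-σ₁) τ₁ y₁ hy₁ hy₁i _ ?_ _ ?_ m A ρ hl hb1 hb2 y₂ hy₂
    · rw [hmemQ, hcA, hcB]
      exact ⟨hδb _ _ habs' habs, by nlinarith, by nlinarith⟩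
    · rw [hmemQ, hcA, hcB]
      exact ⟨hδb _ _ (by rwa [abs_neg]) habs, by nlinarith, by nlinarith⟩
  have hruleB : ∀ σ₁ τ₁ : ℝ, (σ₁ = 1 ∨ σ₁ = -1) → (τ₁ = 1 ∨ τ₁ = -1) → ∀ y₁ ∈ Q σ₁ τ₁,
      y₁ ∈ D.reachable a b i → ∀ y₂ ∈ Q σ₁ (-τ₁), D.Access a b (i + 1) y₂ := by
    intro σ₁ τ₁ hσ₁ hτ₁ y₁ hy₁ hy₁i y₂ hy₂
    have hτ2 : τ₁ * τ₁ = 1 := by rcases hτ₁ with rfl | rfl <;> norm_num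
    have hσ2 : σ₁ * σ₁ = 1 := by rcases hσ₁ with rfl | rfl <;> norm_num
    have habs : |δ / 2 * σ₁| ≤ δ := by
      rcases hσ₁ with rfl | rfl
      · simpa using hδ2
      · rw [mul_neg, mul_one, abs_neg]; exact hδ2
    set m := v + ((δ / 2 * σ₁) • d + (0 : ℝ) • e) with hm
    have hmb : m ∈ Metric.ball v r := hδb _ _ habs (by simpa using hδ.le)
    obtain ⟨ρ, hl⟩ := hstep m hmb B hB0 (Or.inr ⟨rfl, hcB _ _, by
      rw [hcA]; intro h0; rcases hσ₁ with rfl | rfl <;> linarith⟩)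
    obtain ⟨ε, hε, hεδ, hb1, hb2⟩ := hnear m 0 τ₁ ρ hl.2.1
    have habs' : |ε * τ₁| ≤ δ := by
      rcases hτ₁ with rfl | rfl
      · rw [mul_one, abs_of_pos hε]; exact hεδ.le
      · rw [mul_neg, mul_one, abs_neg, abs_of_pos hε]; exact hεδ.le
    have e1 : m + (ε * 0) • d + (ε * τ₁) • e = v + ((δ / 2 * σ₁) • d + (ε * τ₁) • e) := by
      rw [hm]; module
    have e2 : m + (-(ε * 0)) • d + (-(ε * τ₁)) • e = v + ((δ / 2 * σ₁) • d + (-(ε * τ₁)) • e) := by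
      rw [hm]; module
    rw [e1] at hb1
    rw [e2] at hb2
    refine hcost σ₁ τ₁ σ₁ (-τ₁) y₁ hy₁ hy₁i _ ?_ _ ?_ m B ρ hl hb1 hb2 y₂ hy₂
    · rw [hmemQ, hcA, hcB]
      exact ⟨hδb _ _ habs habs', by nlinarith, by nlinarith⟩
    · rw [hmemQ, hcA, hcB]
      exact ⟨hδb _ _ habs (by rwa [abs_neg]), by nlinarith, by nlinarith⟩
  -- the reachable point lies in the second quadrant
  have hy₀B : 0 < cross B (y₀ - v) := by
    rw [hB, cross_smul_left, hκe, mul_inv]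
    have hσi : σ⁻¹ = σ := by rcases hσ with rfl | rfl <;> norm_num
    rw [hσi]
    have hsq : 0 < (cross d e₀)⁻¹ * (cross d e₀)⁻¹ :=
      mul_self_pos.2 (inv_ne_zero hcross)
    have := mul_pos hσpos hsq
    have e1 : σ * (cross d (y₀ - v) * cross d e₀) * ((cross d e₀)⁻¹ * (cross d e₀)⁻¹) =
        σ * (cross d e₀)⁻¹ * cross d (y₀ - v) := by field_simp
    rwa [e1] at this
  have hy₀A : cross A (y₀ - v) < 0 := by
    have hne : cross A (y₀ - v) ≠ 0 := by
      intro h0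
      exact hy₀.1 ((hX y₀ hy₀b).2 (Or.inl h0))
    refine lt_of_le_of_ne (le_of_not_gt fun hpos => ?_) hne
    exact hnot 1 (Or.inl rfl) y₀ ((hmemQ _ _ _).2 ⟨hy₀b, by linarith, by linarith⟩) hy₀
  have hy₀Q : y₀ ∈ Q (-1) 1 := (hmemQ _ _ _).2 ⟨hy₀b, by linarith, by linarith⟩
  refine ⟨t₀, u₀, e, A, B, -(κ⁻¹ * σ), κ⁻¹, r, hbu, hut, hta, eut, ?_, hAd, hAe, hBd, hBe, hc₁, hA,
    inv_ne_zero hκ0, hB, hr0, fun y hy => ⟨hb₂ (Metric.ball_subset_ball (min_le_right _ _) hy),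
      hX y hy⟩, ?_, ?_, ?_⟩
  · rcases hσ with rfl | rfl
    · exact Or.inl (one_smul _ _)
    · exact Or.inr (by rw [he, neg_smul, one_smul])
  · intro y hy h1 h2
    exact h.reachable_of_isPreconnected (hQc (-1) 1) (hQX _ _) hy₀Q hy₀
      ((hmemQ _ _ _).2 ⟨hy, by linarith, by linarith⟩)
  · intro y hy h1 h2
    have hyQ : y ∈ Q 1 1 := (hmemQ _ _ _).2 ⟨hy, by linarith, by linarith⟩
    refine hlevel y (hQX _ _ hyQ) ?_ (hnot 1 (Or.inl rfl) y hyQ)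
    exact hruleA (-1) 1 (Or.inr rfl) (Or.inl rfl) y₀ hy₀Q hy₀ y (by rwa [neg_neg])
  · by_cases hcase : ∃ y ∈ Q (-1) (-1), y ∈ D.reachable a b i
    · left
      obtain ⟨y₁, hy₁Q, hy₁⟩ := hcase
      intro y hy h1 h2
      have hyQ : y ∈ Q 1 (-1) := (hmemQ _ _ _).2 ⟨hy, by linarith, by linarith⟩
      refine hlevel y (hQX _ _ hyQ) ?_ (hnot (-1) (Or.inr rfl) y hyQ)
      exact hruleA (-1) (-1) (Or.inr rfl) (Or.inr rfl) y₁ hy₁Q hy₁ y (by rwa [neg_neg])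
    · right
      push Not at hcase
      intro y hy h1 h2
      have hyQ : y ∈ Q (-1) (-1) := (hmemQ _ _ _).2 ⟨hy, by linarith, by linarith⟩
      exact hlevel y (hQX _ _ hyQ)
        (hruleB (-1) 1 (Or.inr rfl) (Or.inl rfl) y₀ hy₀Q hy₀ y hyQ) (hcase y hyQ)

end IsOverBridge

end KnotDiagram

end LastContact

/-! ### A second place where the connected level crosses the diagram -/

section Exit

open Set Topology Filter

namespace KnotDiagram

variable {D : KnotDiagram}

/-- At a parameter that is not an integer the diagram runs straight, and the nearby points are no
crossings. -/
theorem eventually_regular {t : ℝ} (hf : Int.fract t ≠ 0) : ∀ᶠ s in 𝓝[≠] (0 : ℝ),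
    D.plane.path (t + s) = D.plane.path t + s • D.plane.dirR t ∧ Int.fract (t + s) ≠ 0 ∧
      D.plane.dirR (t + s) = D.plane.dirR t ∧ D.plane.path (t + s) ∉ D.crossings := by
  have hd := D.plane.dirR_ne_zero D.plane_vertex_ne t
  have hpos : 0 < Int.fract t := lt_of_le_of_ne (Int.fract_nonneg t) hf.symm
  have hfl : (⌊t⌋ : ℝ) < t := by rw [Int.fract] at hpos; linarith
  have hfl1 := Int.lt_floor_add_one t
  have hcont : Continuous (fun s : ℝ => t + s) := by fun_prop
  have ht := hcont.tendsto 0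
  rw [add_zero] at ht
  have hcont2 : Continuous (fun s : ℝ => D.plane.path t + s • D.plane.dirR t) := by fun_prop
  have ht2 := hcont2.tendsto 0
  rw [zero_smul, add_zero] at ht2
  have hcl : (D.crossings \ {D.plane.path t})ᶜ ∈ 𝓝 (D.plane.path t) :=
    (D.regular.finite.subset sdiff_subset).isClosed.isOpen_compl.mem_nhds (by simp)
  filter_upwards [self_mem_nhdsWithin, mem_nhdsWithin_of_mem_nhds (ht.eventually
    (Ioo_mem_nhds hfl hfl1)), mem_nhdsWithin_of_mem_nhds (ht2.eventually hcl)] with s h0 h1 h2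
  have hfloor : ⌊t + s⌋ = ⌊t⌋ := Int.floor_eq_iff.2 ⟨h1.1.le, h1.2⟩
  have hpath : D.plane.path (t + s) = D.plane.path t + s • D.plane.dirR t := by
    rw [D.plane.path_of_mem ⌊t⌋ ⟨h1.1.le, h1.2.le⟩, D.plane.path_of_mem ⌊t⌋ ⟨hfl.le, hfl1.le⟩]
    simp only [AffineMap.lineMap_apply_module', ClosedPolygon.dirR]
    module
  refine ⟨hpath, ?_, by rw [ClosedPolygon.dirR, hfloor, ClosedPolygon.dirR], fun hc => ?_⟩
  · rw [Int.fract, hfloor]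
    have := h1.1
    intro e
    linarith
  · rw [hpath] at hc
    refine h2 ⟨hc, fun e => h0 ?_⟩
    rw [mem_singleton_iff, add_eq_left, smul_eq_zero] at e
    exact e.resolve_right hd

/-- The two sides of the shadow, told apart by a linear form. -/
theorem exists_sides_of_form {t : ℝ} (hf : Int.fract t ≠ 0) (hc : D.plane.path t ∉ D.crossings)
    {U : Set Plane} (hU : U ∈ 𝓝 (D.plane.path t)) {C : Plane} {c : ℝ} (hc0 : c ≠ 0)
    (hC : C = c • D.plane.dirR t) :
    ∃ y ∈ U, ∃ y' ∈ U, 0 < cross C (y - D.plane.path t) ∧ cross C (y' - D.plane.path t) < 0 ∧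
      (D.plane.wind y = D.plane.wind y' + 1 ∨ D.plane.wind y' = D.plane.wind y + 1) := by
  obtain ⟨ε, hε, hs⟩ := exists_sides hf hc hU
  obtain ⟨⟨g1, -⟩, ⟨g2, -⟩, g3⟩ := hs ε hε le_rfl
  have hsq := sqLen_pos (D.plane.dirR_ne_zero D.plane_vertex_ne t)
  have e1 : cross C (D.plane.path t + ε • rot (D.plane.dirR t) - D.plane.path t) =
      c * (ε * sqLen (D.plane.dirR t)) := by
    rw [add_sub_cancel_left, hC, cross_smul_left, cross_smul, cross_rot]
  have e2 : cross C (D.plane.path t + ε • -rot (D.plane.dirR t) - D.plane.path t) =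
      -(c * (ε * sqLen (D.plane.dirR t))) := by
    rw [add_sub_cancel_left, hC, cross_smul_left, smul_neg, ← neg_smul, cross_smul, cross_rot]
    ring
  have hpos : 0 < ε * sqLen (D.plane.dirR t) := mul_pos hε hsq
  rcases hc0.lt_or_gt with h0 | h0
  · have := mul_neg_of_neg_of_pos h0 hpos
    exact ⟨_, g2, _, g1, by rw [e2]; linarith, by rw [e1]; linarith, Or.inr g3⟩
  · have := mul_pos h0 hpos
    exact ⟨_, g1, _, g2, by rw [e1]; linarith, by rw [e2]; linarith, Or.inl g3⟩

namespace IsOverBridge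

variable {a b : ℝ} {l : ℕ} (h : D.IsOverBridge a b l)

include h

/-- A connected level crosses the diagram at some place off the bridge. If it did not, the last
contact of the diagram with the cheaper points would be a crossing, two opposite quadrants at which
belong to the same region of the level. A closed polygon in this region through the crossing would
separate the cheaper points from the part of the diagram past the crossing, though these are joined
by an arc of access, the bridge, and the diagram itself. -/
theorem exists_exit (hmin : D.IsShortest a b l) {i : ℕ} (hi : i < l) {w : ℤ}
    (hw : ∀ x ∈ D.level a b (i + 1), x ∉ D.shadow → D.plane.wind x = w ∨ D.plane.wind x = w + 1)
    (hw₀ : IsPreconnected (D.region a b (i + 1) w))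
    (hw₁ : IsPreconnected (D.region a b (i + 1) (w + 1))) :
    ∃ t ∈ Ioo b (a + D.n), Int.fract t ≠ 0 ∧ D.plane.path t ∉ D.crossings ∧
      ∃ U ∈ 𝓝 (D.plane.path t), ∀ y ∈ U, y ∉ D.rest a b → y ∈ D.level a b (i + 1) := by
  obtain ⟨t₀, u₀, e, A, B, c₁, c₂, r, hbu, hut, hta, eut, heu, hAd, hAe, hBd, hBe, hc₁, hA, hc₂,
    hB, hr, hX, hq2, hq1, hq34⟩ := h.exists_corner hmin hi
  have ht₀ : t₀ ∈ Icc b (a + D.n) := ⟨(hbu.trans hut).le, hta.le⟩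
  have hu₀ : u₀ ∈ Icc b (a + D.n) := ⟨hbu.le, (hut.trans hta).le⟩
  have hcr := mem_crossings hut.ne' (h.abs_sub_lt ht₀ hu₀) eut.symm
  have hft := fract_ne_zero hcr
  have hfu : Int.fract u₀ ≠ 0 := fract_ne_zero (eut ▸ hcr)
  set v := D.plane.path t₀ with hv
  set d := D.plane.dirR t₀ with hd
  have hopen : ∀ E : Plane, IsOpen {y : Plane | 0 < cross E (y - v)} := fun E =>
    isOpen_lt continuous_const ((continuous_cross E).comp (continuous_id.sub continuous_const))
  -- a regular point of the first strand just past the crossing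
  have hvball : v ∈ Metric.ball v r := Metric.mem_ball_self hr
  have hlim : ∀ u : Plane, Tendsto (fun s : ℝ => v + s • u) (𝓝 0) (𝓝 v) := by
    intro u
    have hcc : Continuous (fun s : ℝ => v + s • u) := by fun_prop
    simpa using hcc.tendsto 0
  have hpast : ∀ ρ > 0, ∃ s > 0, s < a + D.n - t₀ ∧ D.plane.path (t₀ + s) = v + s • d ∧
      Int.fract (t₀ + s) ≠ 0 ∧ D.plane.dirR (t₀ + s) = d ∧ D.plane.path (t₀ + s) ∉ D.crossings ∧
      v + s • d ∈ Metric.ball v ρ := by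
    intro ρ hρ
    have hev : ∀ᶠ s in 𝓝[>] (0 : ℝ), 0 < s ∧ s < a + D.n - t₀ ∧
        D.plane.path (t₀ + s) = v + s • d ∧ Int.fract (t₀ + s) ≠ 0 ∧ D.plane.dirR (t₀ + s) = d ∧
        D.plane.path (t₀ + s) ∉ D.crossings ∧ v + s • d ∈ Metric.ball v ρ := by
      filter_upwards [self_mem_nhdsWithin,
        mem_nhdsWithin_of_mem_nhds (Iio_mem_nhds (show (0 : ℝ) < a + D.n - t₀ by linarith)),
        (eventually_regular hft).filter_mono (nhdsWithin_mono (s := Ioi (0 : ℝ)) _ fun x hx => ne_of_gt hx),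
        mem_nhdsWithin_of_mem_nhds ((hlim d).eventually (Metric.ball_mem_nhds v hρ))]
        with s g1 g2 g3 g4
      exact ⟨g1, g2, g3.1, g3.2.1, g3.2.2.1, g3.2.2.2, g4⟩
    exact hev.exists
  rcases hq34 with hq4 | hq3
  · obtain ⟨s, hs0, hsn, e1, e2, e3, e4, e5⟩ := hpast r hr
    refine ⟨t₀ + s, ⟨by linarith, by linarith⟩, e2, e4,
      Metric.ball v r ∩ {y | 0 < cross A (y - v)}, ?_, ?_⟩
    · rw [e1]
      refine (Metric.isOpen_ball.inter (hopen A)).mem_nhds ⟨e5, ?_⟩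
      rw [Set.mem_ofPred_eq, add_sub_cancel_left, cross_smul, hAd, mul_one]
      exact hs0
    · rintro y ⟨hyb, hyA⟩ hyX
      have hne : cross B (y - v) ≠ 0 := fun h0 => hyX ((hX y hyb).2.2 (Or.inr h0))
      rcases hne.lt_or_gt with h1 | h1
      · exact hq4 y hyb hyA h1
      · exact hq1 y hyb hyA h1
  exfalso
  have hnsh : ∀ y ∈ Metric.ball v r, cross A (y - v) ≠ 0 → cross B (y - v) ≠ 0 →
      y ∉ D.shadow := by
    intro y hy h1 h2 hys
    rw [h.shadow_eq] at hys
    rcases hys with hys | hys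
    · rcases (hX y hy).2.1 hys with h3 | h3
      · exact h1 h3
      · exact h2 h3
    · exact (hX y hy).1 hys
  -- the winding number is constant on each quadrant
  have hquad : ∀ α β : ℝ, ∀ y ∈ Metric.ball v r, ∀ y' ∈ Metric.ball v r,
      0 < α * cross A (y - v) → 0 < β * cross B (y - v) → 0 < α * cross A (y' - v) →
      0 < β * cross B (y' - v) → D.plane.wind y = D.plane.wind y' := by
    intro α β y hy y' hy' h1 h2 h3 h4
    refine wind_eq (V := Metric.ball v r ∩ {y | 0 < cross (α • A) (y - v)} ∩
      {y | 0 < cross (β • B) (y - v)}) (((convex_ball v r).inter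
        (convex_cross_pos _ v)).inter (convex_cross_pos _ v)).isPreconnected ?_ ?_ ?_
    · rintro z ⟨⟨hz, hz1⟩, hz2⟩
      rw [Set.mem_ofPred_eq, cross_smul_left] at hz1 hz2
      exact hnsh z hz (fun h0 => by rw [h0, mul_zero] at hz1; exact lt_irrefl _ hz1)
        (fun h0 => by rw [h0, mul_zero] at hz2; exact lt_irrefl _ hz2)
    · exact ⟨⟨hy, by rwa [Set.mem_ofPred_eq, cross_smul_left]⟩,
        by rwa [Set.mem_ofPred_eq, cross_smul_left]⟩
    · exact ⟨⟨hy', by rwa [Set.mem_ofPred_eq, cross_smul_left]⟩,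
        by rwa [Set.mem_ofPred_eq, cross_smul_left]⟩
  -- from the first to the fourth quadrant
  obtain ⟨y₁, hy₁b, hy₁A, hy₁B, y₂, hy₂b, hy₂A, hy₂B, hw12⟩ : ∃ y ∈ Metric.ball v r,
      0 < cross A (y - v) ∧ 0 < cross B (y - v) ∧ ∃ y' ∈ Metric.ball v r,
      0 < cross A (y' - v) ∧ cross B (y' - v) < 0 ∧
      (D.plane.wind y = D.plane.wind y' + 1 ∨ D.plane.wind y' = D.plane.wind y + 1) := by
    obtain ⟨s, hs0, hsn, e1, e2, e3, e4, e5⟩ := hpast r hr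
    have hU : Metric.ball v r ∩ {y | 0 < cross A (y - v)} ∈ 𝓝 (D.plane.path (t₀ + s)) := by
      rw [e1]
      refine (Metric.isOpen_ball.inter (hopen A)).mem_nhds ⟨e5, ?_⟩
      rw [Set.mem_ofPred_eq, add_sub_cancel_left, cross_smul, hAd, mul_one]
      exact hs0
    obtain ⟨y, hy, y', hy', k1, k2, k3⟩ := exists_sides_of_form e2 e4 hU hc₂ (hB.trans (by rw [e3]))
    have hsub : ∀ y, cross B (y - v) = cross B (y - D.plane.path (t₀ + s)) := by
      intro y
      rw [e1, show y - v = (y - (v + s • d)) + s • d by abel, cross_add, cross_smul, hBd, mul_zero,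
        add_zero]
    exact ⟨y, hy.1, hy.2, by rwa [hsub], y', hy'.1, hy'.2, by rwa [hsub], k3⟩
  -- from the fourth to the third quadrant
  obtain ⟨y₃, hy₃b, hy₃A, hy₃B, y₄, hy₄b, hy₄A, hy₄B, hw34⟩ : ∃ y ∈ Metric.ball v r,
      0 < cross A (y - v) ∧ cross B (y - v) < 0 ∧ ∃ y' ∈ Metric.ball v r,
      cross A (y' - v) < 0 ∧ cross B (y' - v) < 0 ∧
      (D.plane.wind y = D.plane.wind y' + 1 ∨ D.plane.wind y' = D.plane.wind y + 1) := by
    set d' := D.plane.dirR u₀ with hd'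
    have hAd' : cross A d' = 0 := by
      rcases heu with rfl | rfl
      · exact hAe
      · rw [← neg_neg d', ← neg_one_smul ℝ (-d'), cross_smul, hAe, mul_zero]
    have hex : ∃ s : ℝ, cross B (s • d') < 0 ∧ D.plane.path (u₀ + s) = v + s • d' ∧
        Int.fract (u₀ + s) ≠ 0 ∧ D.plane.dirR (u₀ + s) = d' ∧
        D.plane.path (u₀ + s) ∉ D.crossings ∧ v + s • d' ∈ Metric.ball v r := by
      have hreg := eventually_regular (D := D) hfu
      rw [eut] at hreg
      have hball : ∀ᶠ s in 𝓝[≠] (0 : ℝ), v + s • d' ∈ Metric.ball v r :=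
        ((hlim d').eventually (Metric.ball_mem_nhds v hr)).filter_mono nhdsWithin_le_nhds
      have hboth := hreg.and hball
      rcases heu with rfl | rfl
      · obtain ⟨s, ⟨⟨g1, g2, g3, g4⟩, g5⟩, g6⟩ := ((hboth.filter_mono
          (nhdsWithin_mono (s := Iio (0 : ℝ)) _ fun x hx => ne_of_lt hx)).and self_mem_nhdsWithin :
            ∀ᶠ s in 𝓝[<] (0 : ℝ), _ ∧ s ∈ Iio (0 : ℝ)).exists
        have g6' : s < 0 := g6
        exact ⟨s, by rw [cross_smul, hBe, mul_one]; exact g6', g1, g2, g3, g4, g5⟩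
      · obtain ⟨s, ⟨⟨g1, g2, g3, g4⟩, g5⟩, g6⟩ := ((hboth.filter_mono
          (nhdsWithin_mono (s := Ioi (0 : ℝ)) _ fun x hx => ne_of_gt hx)).and self_mem_nhdsWithin :
            ∀ᶠ s in 𝓝[>] (0 : ℝ), _ ∧ s ∈ Ioi (0 : ℝ)).exists
        have g6' : 0 < s := g6
        refine ⟨s, ?_, g1, g2, g3, g4, g5⟩
        have : cross B (s • d') = -s := by
          rw [← neg_neg (s • d'), ← smul_neg, ← neg_smul, cross_smul, hBe, mul_one]
        rw [this]
        linarith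
    obtain ⟨s, hs0, e1, e2, e3, e4, e5⟩ := hex
    have hU : Metric.ball v r ∩ {y | 0 < cross (-B) (y - v)} ∈ 𝓝 (D.plane.path (u₀ + s)) := by
      rw [e1]
      refine (Metric.isOpen_ball.inter (hopen (-B))).mem_nhds ⟨e5, ?_⟩
      rw [Set.mem_ofPred_eq, add_sub_cancel_left, cross_neg_left]
      linarith
    obtain ⟨y, hy, y', hy', k1, k2, k3⟩ := exists_sides_of_form e2 e4 hU hc₁ (hA.trans (by rw [e3]))
    have hsub : ∀ y, cross A (y - v) = cross A (y - D.plane.path (u₀ + s)) := by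
      intro y
      rw [e1, show y - v = (y - (v + s • d')) + s • d' by abel, cross_add, cross_smul, hAd',
        mul_zero, add_zero]
    have hyB := hy.2
    have hyB' := hy'.2
    rw [Set.mem_ofPred_eq, cross_neg_left] at hyB hyB'
    exact ⟨y, hy.1, by rwa [hsub], by linarith, y', hy'.1, by rwa [hsub], by linarith, k3⟩
  have hw23 : D.plane.wind y₂ = D.plane.wind y₃ :=
    hquad 1 (-1) y₂ hy₂b y₃ hy₃b (by linarith) (by linarith) (by linarith) (by linarith)
  have hw1 := hw y₁ (hq1 y₁ hy₁b hy₁A hy₁B) (hnsh y₁ hy₁b hy₁A.ne' hy₁B.ne')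
  have hw4 := hw y₄ (hq3 y₄ hy₄b hy₄A hy₄B) (hnsh y₄ hy₄b hy₄A.ne hy₄B.ne)
  have hw14 : D.plane.wind y₁ = D.plane.wind y₄ := by omega
  set R := D.region a b (i + 1) (D.plane.wind y₁) with hR
  have hRc : IsPreconnected R := by
    rcases hw1 with h1 | h1
    · rw [hR, h1]; exact hw₀
    · rw [hR, h1]; exact hw₁
  -- the diagonal through the crossing
  set u := d + e with hu
  have hAu : cross A u = 1 := by rw [hu, cross_add, hAd, hAe, add_zero]
  have hBu : cross B u = 1 := by rw [hu, cross_add, hBd, hBe, zero_add]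
  have hu0 : u ≠ 0 := by
    intro h0
    rw [h0] at hAu
    simp [cross] at hAu
  obtain ⟨c, hc0, hcb, hcb'⟩ : ∃ c > (0 : ℝ), v + c • u ∈ Metric.ball v r ∧
      v + c • -u ∈ Metric.ball v r := by
    have hev : ∀ᶠ c in 𝓝[>] (0 : ℝ), 0 < c ∧ v + c • u ∈ Metric.ball v r ∧
        v + c • -u ∈ Metric.ball v r := by
      filter_upwards [self_mem_nhdsWithin,
        mem_nhdsWithin_of_mem_nhds ((hlim u).eventually (Metric.ball_mem_nhds v hr)),
        mem_nhdsWithin_of_mem_nhds ((hlim (-u)).eventually (Metric.ball_mem_nhds v hr))]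
        with c g1 g2 g3
      exact ⟨g1, g2, g3⟩
    exact hev.exists
  -- off the crossing, the diagonal runs through the region
  have hdiag : ∀ x : ℝ, v + x • u ∈ Metric.ball v r → x ≠ 0 → v + x • u ∈ R := by
    intro x hxb hx0
    have eA : cross A (v + x • u - v) = x := by rw [add_sub_cancel_left, cross_smul, hAu, mul_one]
    have eB : cross B (v + x • u - v) = x := by rw [add_sub_cancel_left, cross_smul, hBu, mul_one]
    have hns := hnsh _ hxb (by rwa [eA]) (by rwa [eB])
    rcases hx0.lt_or_gt with h1 | h1
    · refine ⟨hq3 _ hxb (by rwa [eA]) (by rwa [eB]), hns, ?_⟩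
      rw [hw14]
      exact hquad (-1) (-1) _ hxb y₄ hy₄b (by rw [eA]; linarith) (by rw [eB]; linarith)
        (by linarith) (by linarith)
    · refine ⟨hq1 _ hxb (by rwa [eA]) (by rwa [eB]), hns, ?_⟩
      exact hquad 1 1 _ hxb y₁ hy₁b (by rw [eA]; linarith) (by rw [eB]; linarith)
        (by linarith) (by linarith)
  have hyR : v + c • u ∈ R := hdiag c hcb hc0.ne'
  have ecu : v + c • -u = v + (-c) • u := by rw [smul_neg, neg_smul]
  have hyR' : v + c • -u ∈ R := by
    rw [ecu] at hcb' ⊢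
    exact hdiag (-c) hcb' (by linarith)
  have harc : ArcTo (v + c • -u) R R (v + c • u) := by
    refine ArcTo.of_isPreconnected (h.isOpen_region _ _) hRc subset_rfl subset_rfl subset_rfl
      hyR' hyR ⟨[], trivial, rfl, ?_, ?_⟩
    · simpa [chain] using hyR'
    · simpa using hyR'
  obtain ⟨L, hL, hLlast, hLR, -⟩ := harc
  have hvX : v ∈ D.rest a b := ⟨t₀, ht₀, rfl⟩
  have hvR : v ∉ R := fun hm => hm.1.1 hvX
  obtain ⟨P, S, z₀, z₁, -, -, hSL, -, hz₁, -, hz₀, hcar, -, ρ, hρ, hjump⟩ :=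
    exists_polygon_through hu0 hL hLlast (fun hm => hvR (hLR hm)) hc0 hc0 rfl rfl
  have hPR : ∀ z ∈ P.carrier, z = v ∨ z ∈ R := by
    intro z hz
    rw [hcar] at hz
    rcases hz with hz | hz
    · exact Or.inr (hLR (hSL hz))
    · have hsub : segment ℝ z₀ z₁ ⊆ segment ℝ (v + c • -u) (v + c • u) := by
        have hvm : v ∈ segment ℝ (v + c • -u) (v + c • u) := by
          rw [segment_eq_image_lineMap]
          refine ⟨1 / 2, ⟨by norm_num, by norm_num⟩, ?_⟩
          rw [AffineMap.lineMap_apply_module']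
          module
        refine (convex_segment _ _).segment_subset ?_ ?_
        · exact segment_subset_right hvm hz₀
        · rw [segment_symm] at hz₁
          exact segment_subset_left hvm hz₁
      have hzb := (convex_ball v r).segment_subset hcb' hcb (hsub hz)
      have hz' := hsub hz
      rw [segment_eq_image_lineMap] at hz'
      obtain ⟨t, -, rfl⟩ := hz'
      have et : AffineMap.lineMap (v + c • -u) (v + c • u) t = v + (c * (2 * t - 1)) • u := by
        rw [AffineMap.lineMap_apply_module']
        module
      rw [et] at hzb ⊢
      by_cases h0 : c * (2 * t - 1) = 0
      · left; rw [h0, zero_smul, add_zero]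
      · exact Or.inr (hdiag _ hzb h0)
  have hPX : ∀ z ∈ D.shadow, z ≠ v → z ∉ P.carrier := by
    intro z hz hzv hzP
    rcases hPR z hzP with h1 | h1
    · exact hzv h1
    · exact h1.2.1 hz
  -- the two points that are separated
  obtain ⟨x₁, hx₁b, hx₁ρ, c', hc', hx₁⟩ : ∃ x ∈ Metric.ball v r, x ∈ Metric.ball v ρ ∧
      ∃ c' > (0 : ℝ), x = v + c' • (e - d) := by
    have hev : ∀ᶠ c in 𝓝[>] (0 : ℝ), 0 < c ∧ v + c • (e - d) ∈ Metric.ball v r ∧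
        v + c • (e - d) ∈ Metric.ball v ρ := by
      filter_upwards [self_mem_nhdsWithin,
        mem_nhdsWithin_of_mem_nhds ((hlim (e - d)).eventually (Metric.ball_mem_nhds v hr)),
        mem_nhdsWithin_of_mem_nhds ((hlim (e - d)).eventually (Metric.ball_mem_nhds v hρ))]
        with c g1 g2 g3
      exact ⟨g1, g2, g3⟩
    obtain ⟨c', g1, g2, g3⟩ := hev.exists
    exact ⟨_, g2, g3, c', g1, rfl⟩
  have hx₁reach : x₁ ∈ D.reachable a b i := by
    refine hq2 x₁ hx₁b ?_ ?_
    · rw [hx₁, add_sub_cancel_left, cross_smul, sub_eq_add_neg, cross_add, hAe,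
        ← neg_one_smul ℝ d, cross_smul, hAd]
      linarith
    · rw [hx₁, add_sub_cancel_left, cross_smul, sub_eq_add_neg, cross_add, hBe,
        ← neg_one_smul ℝ d, cross_smul, hBd]
      linarith
  obtain ⟨s, hs0, hsn, e1, -, -, -, hx₂ρ⟩ := hpast ρ hρ
  set x₂ := v + s • d with hx₂
  have hκ : cross d e ≠ 0 := by
    intro h0
    rw [hB, cross_smul_left, h0, mul_zero] at hBe
    exact zero_ne_one hBe
  have hne : P.wind x₁ ≠ P.wind x₂ := by
    have k1 : cross u (x₁ - v) = 2 * c' * cross d e := by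
      rw [hx₁, add_sub_cancel_left, hu]
      simp [cross]; ring
    have k2 : cross u (x₂ - v) = -(s * cross d e) := by
      rw [hx₂, add_sub_cancel_left, hu]
      simp [cross]; ring
    rcases hκ.lt_or_gt with h0 | h0
    · have hs' := mul_neg_of_pos_of_neg hs0 h0
      have hc'' := mul_neg_of_pos_of_neg (show 0 < 2 * c' by linarith) h0
      exact (hjump x₂ hx₂ρ x₁ hx₁ρ (by rw [k2]; linarith) (by rw [k1]; linarith)).2.2.symm
    · have hs' := mul_pos hs0 h0
      have hc'' := mul_pos (show 0 < 2 * c' by linarith) h0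
      exact (hjump x₁ hx₁ρ x₂ hx₂ρ (by rw [k1]; linarith) (by rw [k2]; linarith)).2.2
  apply hne
  -- the first part of the connection, an arc of access
  have hvp : D.plane.path b ≠ v := fun e' => h.right_notMem (e' ▸ hcr)
  have w1 : P.wind x₁ = P.wind (D.plane.path b) := by
    obtain ⟨-, M, hMi, hM, L', k1, k2, k3, k4⟩ := hx₁reach
    refine ClosedPolygon.wind_eq_of_isPreconnected (isPreconnected_chain (x₁ :: L')) ?_
      (head_mem_chain _ _) (mem_chain_of_getLast? k2)
    intro z hz
    by_cases hzX : z ∈ D.rest a b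
    · refine hPX z (h.rest_subset_shadow hzX) ?_
      rintro rfl
      rcases k3 hz with (hz' | hz') | hz'
      · exact hz' hzX
      · exact hvp hz'.symm
      · exact (hM _ hz').2 (Or.inl (Or.inl hcr))
    · intro hzP
      rcases hPR z hzP with rfl | hzR
      · exact hzX hvX
      · exact hzR.1.2.2 i (Nat.lt_succ_self i) (Reach.of_mem_chain hMi hM k1 k2 k3 k4 hz hzX)
  -- the second part, the bridge
  have w2 : P.wind (D.plane.path b) = P.wind (D.plane.path a) := by
    refine ClosedPolygon.wind_eq_of_isPreconnected (h.isPreconnected_bridge a b) ?_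
      ⟨b, ⟨h.lt.le, le_rfl⟩, rfl⟩ ⟨a, ⟨le_rfl, h.lt.le⟩, rfl⟩
    rintro _ ⟨s', hs', rfl⟩
    refine hPX _ (h.bridge_subset_shadow hs') fun e' => ?_
    exact (hX v hvball).1 ⟨s', hs', e'⟩
  -- the third part, the diagram past the crossing
  have w3 : P.wind (D.plane.path a) = P.wind x₂ := by
    rw [← h.path_add_n a, ← e1]
    refine ClosedPolygon.wind_eq_of_isPreconnected (h.isPreconnected_bridge (t₀ + s) (a + D.n)) ?_
      ⟨a + D.n, ⟨by linarith, le_rfl⟩, rfl⟩ ⟨t₀ + s, ⟨le_rfl, by linarith⟩, rfl⟩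
    rintro _ ⟨s', hs', rfl⟩
    have hs'I : s' ∈ Icc b (a + D.n) := ⟨by linarith [hs'.1, ht₀.1], hs'.2⟩
    refine hPX _ (h.rest_subset_shadow ⟨s', hs'I, rfl⟩) fun e' => ?_
    rcases no_three (h.abs_sub_lt hs'I ht₀) (h.abs_sub_lt ht₀ hu₀) (h.abs_sub_lt hs'I hu₀) e'
      eut.symm with k | k | k
    · linarith [hs'.1]
    · linarith
    · linarith [hs'.1]
  rw [w1, w2, w3]

end IsOverBridge

end KnotDiagram

end Exit

/-! ### A closed curve that decomposes the diagram -/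

section Composite

open Set Topology Filter

theorem exists_abs_le_of_mem_segment {v w y₀ y₁ z : Plane} {c : ℝ} (hc : 0 ≤ c)
    (h₁ : y₁ ∈ segment ℝ (v + c • w) v) (h₀ : y₀ ∈ segment ℝ (v + c • -w) v)
    (hz : z ∈ segment ℝ y₀ y₁) : ∃ t : ℝ, |t| ≤ c ∧ z = v + t • w := by
  have hvm : v ∈ segment ℝ (v + c • -w) (v + c • w) := by
    rw [segment_eq_image_lineMap]
    refine ⟨1 / 2, ⟨by norm_num, by norm_num⟩, ?_⟩
    rw [AffineMap.lineMap_apply_module']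
    module
  have hz' : z ∈ segment ℝ (v + c • -w) (v + c • w) := by
    refine (convex_segment _ _).segment_subset (segment_subset_right hvm h₀) ?_ hz
    rw [segment_symm] at h₁
    exact segment_subset_left hvm h₁
  rw [segment_eq_image_lineMap] at hz'
  obtain ⟨t, ht, rfl⟩ := hz'
  refine ⟨c * (2 * t - 1), abs_le.2 ⟨by nlinarith [ht.1], by nlinarith [ht.2]⟩, ?_⟩
  rw [AffineMap.lineMap_apply_module']
  module

/-- Every point of a connected open set is joined, inside this set, to a boundary point that can be
reached along a straight line. -/
theorem exists_arc_to_boundary {R : Set Plane} (hR : IsOpen R) (hRc : IsPreconnected R)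
    {e u x : Plane} {ε : ℝ} (hε : 0 < ε) (hu : u ≠ 0) (he : ∀ c : ℝ, 0 < c → c ≤ ε → e + c • u ∈ R)
    (hx : x ∈ R) : ∃ L, IsArc (x :: L) ∧ (x :: L).getLast? = some e ∧ chain (x :: L) ⊆ R ∪ {e} := by
  have hne : e + ε • u ≠ e := by
    intro h0
    rw [add_eq_left, smul_eq_zero] at h0
    exact h0.elim hε.ne' hu
  have hbase : ArcTo e (R ∪ {e}) (R ∪ {e}) (e + ε • u) := by
    refine ⟨[e], ⟨hne, by simp [chain], trivial⟩, by simp, ?_, ?_⟩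
    · intro z hz
      by_cases hze : z = e
      · exact Or.inr hze
      · simp only [chain, mem_union, mem_singleton_iff, hze, or_false] at hz
        obtain ⟨c, hc0, hc1, rfl⟩ := exists_pos_of_mem_segment hε.le hz hze
        exact Or.inl (he c hc0 hc1)
    · intro z hz
      simp only [List.mem_cons, List.not_mem_nil, or_false] at hz
      rcases hz with rfl | rfl
      · exact Or.inl (he ε hε le_rfl)
      · exact Or.inr rfl
  obtain ⟨L, h1, h2, h3, -⟩ := hbase.of_isPreconnected hR hRc subset_rfl subset_union_left
    subset_union_left (he ε hε le_rfl) hx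
  exact ⟨L, h1, h2, h3⟩

/-- Two disjoint open connected sets which touch two points `e` and `v` from opposite sides carry
an arc that leads around from one side of `v` to the other through `e`. -/
theorem exists_arc_around {R₁ R₀ : Set Plane} (hR₁ : IsOpen R₁) (hR₀ : IsOpen R₀)
    (hc₁ : IsPreconnected R₁) (hc₀ : IsPreconnected R₀) (hdisj : Disjoint R₁ R₀)
    {e u x y : Plane} {ε : ℝ} (hε : 0 < ε) (hu : u ≠ 0)
    (he₁ : ∀ c : ℝ, 0 < c → c ≤ ε → e + c • u ∈ R₁)
    (he₀ : ∀ c : ℝ, 0 < c → c ≤ ε → e + c • -u ∈ R₀) (hx : x ∈ R₁) (hy : y ∈ R₀) :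
    ∃ L, IsArc (x :: L) ∧ (x :: L).getLast? = some y ∧ chain (x :: L) ⊆ R₁ ∪ R₀ ∪ {e} := by
  obtain ⟨L₁, a1, a2, a3⟩ := exists_arc_to_boundary hR₁ hc₁ hε hu he₁ hx
  obtain ⟨L₀, b1, b2, b3⟩ := exists_arc_to_boundary hR₀ hc₀ hε (neg_ne_zero.2 hu) he₀ hy
  obtain ⟨K, hK⟩ : ∃ K, (y :: L₀).reverse = e :: K := by
    have : (y :: L₀).reverse.head? = some e := by rw [List.head?_reverse, b2]
    cases hrev : (y :: L₀).reverse with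
    | nil => simp at hrev
    | cons z R =>
      rw [hrev] at this
      simp only [List.head?_cons, Option.some.injEq] at this
      exact ⟨R, by rw [this]⟩
  have k1 : IsArc (e :: K) := hK ▸ b1.reverse
  have k2 : (e :: K).getLast? = some y := by rw [← hK, List.getLast?_reverse]; rfl
  have k3 : chain (e :: K) ⊆ R₀ ∪ {e} := by rw [← hK, chain_reverse]; exact b3
  obtain ⟨j1, j2, j3⟩ := a1.join a2 k1 k2 (by
    rintro z ⟨hz1, hz2⟩
    rcases a3 hz1 with hz1 | hz1
    · rcases k3 hz2 with hz2 | hz2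
      · exact absurd hz2 (disjoint_left.1 hdisj hz1)
      · exact hz2
    · exact hz1)
  refine ⟨_, j1, j2, ?_⟩
  rw [j3]
  rintro z (hz | hz)
  · rcases a3 hz with hz | hz
    · exact Or.inl (Or.inl hz)
    · exact Or.inr hz
  · rcases k3 hz with hz | hz
    · exact Or.inl (Or.inr hz)
    · exact Or.inr hz

namespace KnotDiagram.IsOverBridge

variable {D : KnotDiagram} {a b : ℝ} {l : ℕ} (h : D.IsOverBridge a b l)

include h

/-- A diagram with a shortest bridge is composite if there are few crossings outside of the bridge.
The two regions of a connected level are separated by a segment of the bridge and by a segment of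
the rest of the diagram. A closed polygon that crosses the diagram in one point of each segment,
and has one half in each region, separates the two ends of the segment of the bridge. -/
theorem isComposite (hmin : D.IsShortest a b l) (hl : 4 ≤ l)
    (hk : (D.restCrossings a b).ncard ≤ l + 2) : D.IsComposite := by
  obtain ⟨j, h1, hj, hconn⟩ := h.exists_level_isPreconnected hmin hl hk
  obtain ⟨i, rfl⟩ : ∃ i, j = i + 1 := ⟨j - 1, by omega⟩
  obtain ⟨τ₁, hτ₁, τ₂, hτ₂, hlt, hgap⟩ := h.exists_level_gap hmin h1 hj
  obtain ⟨w, hw, hw₀, hw₁⟩ := h.exists_regions hconn hτ₁ hτ₂ hlt hgap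
  obtain ⟨t, ht, hft, hct, U, hU, hUl⟩ := h.exists_exit hmin (by omega) hw hw₀ hw₁
  have hsub : Icc τ₁ τ₂ ⊆ Icc a b := Icc_subset_Icc hτ₁.1.1.le hτ₂.1.2.le
  obtain ⟨s, hsirr, hs1, hs2⟩ := exists_irrational_btwn hlt
  have hsI : s ∈ Icc a b := hsub ⟨hs1.le, hs2.le⟩
  have hsl := (hgap s hsI).2 ⟨hs1, hs2⟩
  have hfs : Int.fract s ≠ 0 := by
    intro e
    rw [Int.fract, sub_eq_zero] at e
    exact hsirr ⟨⌊s⌋, by rw [e]; simp⟩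
  have hcs : D.plane.path s ∉ D.crossings := fun hc =>
    hsl.1 (h.mem_passes_iff.2 ⟨hsI, hc⟩).2
  obtain ⟨ε, hε, hside⟩ := exists_sides hfs hcs ((h.isOpen_level (i + 1)).mem_nhds hsl)
  obtain ⟨ε', hε', hside'⟩ := exists_sides hft hct hU
  have heb : ∀ s' ∈ Icc a b, D.plane.path s' ≠ D.plane.path t := by
    intro s' hs' e
    refine hct (mem_crossings (by linarith [hs'.2, ht.1] : s' < t).ne' ?_ e.symm)
    rw [abs_lt]; constructor <;> linarith [hs'.1, hs'.2, ht.1, ht.2]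
  have heS : D.plane.path t ∈ D.shadow :=
    h.rest_subset_shadow ⟨t, Ioo_subset_Icc_self ht, rfl⟩
  have hzS : D.plane.path s ∈ D.shadow := h.bridge_subset_shadow hsI
  have hez := heb s hsI
  set z := D.plane.path s with hz
  set e := D.plane.path t with he
  set d := D.plane.dirR s with hd
  set u := rot (D.plane.dirR t) with hu
  have hd0 : d ≠ 0 := D.plane.dirR_ne_zero D.plane_vertex_ne s
  have hu0 : u ≠ 0 := rot_ne_zero (D.plane.dirR_ne_zero D.plane_vertex_ne t)
  set R₁ := D.region a b (i + 1) (w + 1) with hR₁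
  set R₀ := D.region a b (i + 1) w with hR₀
  have hsplit : ∀ x y, x ∈ D.level a b (i + 1) → x ∉ D.shadow → y ∈ D.level a b (i + 1) →
      y ∉ D.shadow → D.plane.wind x = D.plane.wind y + 1 → x ∈ R₁ ∧ y ∈ R₀ := by
    intro x y hx hxs hy hys hxy
    rcases hw x hx hxs with h2 | h2 <;> rcases hw y hy hys with h3 | h3 <;>
      first
      | exact ⟨⟨hx, hxs, h2⟩, hy, hys, h3⟩
      | omega
  have hzR : ∀ c : ℝ, 0 < c → c ≤ ε → z + c • rot d ∈ R₁ ∧ z + c • -rot d ∈ R₀ := by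
    intro c hc0 hc1
    obtain ⟨g1, g2, g3⟩ := hside c hc0 hc1
    exact hsplit _ _ g1.1 g1.2 g2.1 g2.2 g3
  have heR : ∀ c : ℝ, 0 < c → c ≤ ε' → e + c • u ∈ R₁ ∧ e + c • -u ∈ R₀ := by
    intro c hc0 hc1
    obtain ⟨g1, g2, g3⟩ := hside' c hc0 hc1
    exact hsplit _ _ (hUl _ g1.1 fun hm => g1.2 (h.rest_subset_shadow hm)) g1.2
      (hUl _ g2.1 fun hm => g2.2 (h.rest_subset_shadow hm)) g2.2 g3
  obtain ⟨L, hL, hLlast, hLsub⟩ := exists_arc_around (h.isOpen_region _ _) (h.isOpen_region _ _)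
    hw₁ hw₀ (disjoint_left.2 fun x hx hx' => by have := hx.2.2; have := hx'.2.2; omega)
    hε' hu0 (fun c h2 h3 => (heR c h2 h3).1)
    (fun c h2 h3 => (heR c h2 h3).2) (hzR ε hε le_rfl).1 (hzR ε hε le_rfl).2
  have hshadow : ∀ x ∈ chain ((z + ε • rot d) :: L), x ∈ D.shadow → x = e := by
    intro x hx hxs
    rcases hLsub hx with (hx | hx) | hx
    · exact absurd hxs hx.2.1
    · exact absurd hxs hx.2.1
    · exact hx
  have hzL : z ∉ chain ((z + ε • rot d) :: L) := fun hm => hez (hshadow z hm hzS)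
  obtain ⟨P, A, y₀, y₁, hP, hA, hAL, hy₁A, hy₁, hy₀A, hy₀, hcar, hzm, r, hr, hjump⟩ :=
    exists_polygon_through (rot_ne_zero hd0) hL hLlast hzL hε hε rfl rfl
  have hcross : ∀ x ∈ P.carrier, x ∈ D.shadow → x = z ∨ x = e := by
    intro x hx hxs
    rw [hcar] at hx
    rcases hx with hx | hx
    · exact Or.inr (hshadow x (hAL hx) hxs)
    · obtain ⟨c, hc, rfl⟩ := exists_abs_le_of_mem_segment hε.le hy₁ hy₀ hx
      rcases lt_trichotomy c 0 with h2 | h2 | h2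
      · have := (hzR (-c) (by linarith) (by rw [abs_of_neg h2] at hc; exact hc)).2.2.1
        rw [smul_neg, neg_smul, neg_neg] at this
        exact absurd hxs this
      · left; rw [h2, zero_smul, add_zero]
      · exact absurd hxs (hzR c h2 (by rwa [abs_of_pos h2] at hc)).1.2.1
  -- the polygon must leave the region it starts in, and it can do so only at `e`
  have heA : e ∈ A := by
    by_contra heA
    have hwA := wind_eq (D := D) hA (fun x hx hxs => heA (hshadow x (hAL hx) hxs ▸ hx)) hy₁A hy₀A
    obtain ⟨c₁, k1, k2, rfl⟩ := exists_pos_of_mem_segment hε.le hy₁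
      (fun h0 => hzL (hAL (h0 ▸ hy₁A)))
    obtain ⟨c₀, k3, k4, rfl⟩ := exists_pos_of_mem_segment hε.le hy₀
      (fun h0 => hzL (hAL (h0 ▸ hy₀A)))
    have m1 := (hzR c₁ k1 k2).1.2.2
    have m2 := (hzR c₀ k3 k4).2.2.2
    omega
  have hPS : P.carrier ∩ D.shadow = {z, e} := by
    apply Subset.antisymm
    · rintro x ⟨hx, hxs⟩
      exact hcross x hx hxs
    · rintro x (rfl | rfl)
      · exact ⟨hcar ▸ Or.inr hzm, hzS⟩
      · exact ⟨hcar ▸ Or.inl heA, heS⟩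
  have hoff : ∀ s' ∈ Icc a b, s' ≠ s → D.plane.path s' ∉ P.carrier := by
    intro s' hs' hne hm
    rcases hcross _ hm (h.bridge_subset_shadow hs') with h2 | h2
    · exact hne (h.injOn hs' hsI h2)
    · exact heb s' hs' h2
  refine ⟨P, hP, ⟨z, e, hez, hPS, hcs, hct⟩, D.plane.path τ₁, h.crossing_of_rest hτ₁.1 hτ₁.2,
    D.plane.path τ₂, h.crossing_of_rest hτ₂.1 hτ₂.2, fun hcc => ?_⟩
  -- two points of the bridge on the two sides of `z`
  obtain ⟨δ, hδ0, hδ1, hδ2, p1, p2, p3, p4⟩ : ∃ δ : ℝ, 0 < δ ∧ δ < s - τ₁ ∧ δ < τ₂ - s ∧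
      D.plane.path (s + δ) = z + δ • d ∧ D.plane.path (s + -δ) = z + (-δ) • d ∧
      z + δ • d ∈ Metric.ball z r ∧ z + (-δ) • d ∈ Metric.ball z r := by
    have hcont : Continuous fun c : ℝ => z + c • d := by fun_prop
    have hlim := hcont.tendsto 0
    simp only [zero_smul, add_zero] at hlim
    obtain ⟨ρ, hρ, hb⟩ := Metric.eventually_nhds_iff_ball.1
      ((eventually_nhdsWithin_iff.1 (eventually_regular (D := D) hfs)).and
        (hlim.eventually (Metric.ball_mem_nhds z hr)))
    obtain ⟨δ, hδ0, hδ⟩ := exists_between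
      (lt_min hρ (lt_min (sub_pos.2 hs1) (sub_pos.2 hs2)))
    rw [lt_min_iff, lt_min_iff] at hδ
    have q1 := hb δ (by rw [Metric.mem_ball, Real.dist_eq, sub_zero, abs_of_pos hδ0]; exact hδ.1)
    have q2 := hb (-δ) (by
      rw [Metric.mem_ball, Real.dist_eq, sub_zero, abs_neg, abs_of_pos hδ0]; exact hδ.1)
    exact ⟨δ, hδ0, hδ.2.1, hδ.2.2, (q1.1 hδ0.ne').1, (q2.1 (by simpa using hδ0.ne')).1, q1.2, q2.2⟩
  have hs := sqLen_pos hd0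
  have hcr : ∀ c : ℝ, cross (rot d) (z + c • d - z) = -(c * sqLen d) := by
    intro c
    rw [add_sub_cancel_left, cross_smul, cross_comm, cross_rot]
    ring
  refine (hjump _ p4 _ p3 (by rw [hcr]; nlinarith) (by rw [hcr]; nlinarith)).2.2 ?_
  have e1 : P.wind (D.plane.path τ₁) = P.wind (D.plane.path (s + -δ)) := by
    refine ClosedPolygon.wind_eq_of_isPreconnected (h.isPreconnected_bridge τ₁ (s + -δ)) ?_
      ⟨τ₁, ⟨le_rfl, by linarith⟩, rfl⟩ ⟨s + -δ, ⟨by linarith, le_rfl⟩, rfl⟩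
    rintro _ ⟨s', hs', rfl⟩
    exact hoff s' (hsub ⟨hs'.1, by linarith [hs'.2]⟩) (by linarith [hs'.2] : s' < s).ne
  have e2 : P.wind (D.plane.path (s + δ)) = P.wind (D.plane.path τ₂) := by
    refine ClosedPolygon.wind_eq_of_isPreconnected (h.isPreconnected_bridge (s + δ) τ₂) ?_
      ⟨s + δ, ⟨le_rfl, by linarith⟩, rfl⟩ ⟨τ₂, ⟨by linarith, le_rfl⟩, rfl⟩
    rintro _ ⟨s', hs', rfl⟩
    exact hoff s' (hsub ⟨by linarith [hs'.1], hs'.2⟩) (by linarith [hs'.1] : s < s').ne'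
  have e3 : P.wind (D.plane.path τ₁) = P.wind (D.plane.path τ₂) := by
    have hmem : D.plane.path τ₁ ∈ (P.carrier)ᶜ := hoff τ₁ (hsub ⟨le_rfl, hlt.le⟩) hs1.ne
    exact ClosedPolygon.wind_eq_of_isPreconnected isPreconnected_connectedComponentIn
      (fun x hx => connectedComponentIn_subset _ _ hx) (mem_connectedComponentIn hmem) hcc
  rw [← p1, ← p2, ← e1, e2, e3]

end KnotDiagram.IsOverBridge

end Composite

/-! ### Mirror images -/

section Mirror

open Set

/-- The reflection of space in the projection plane. -/
def reflect : Space ≃ₗ[ℝ] Space := (LinearEquiv.refl ℝ Plane).prodCongr (LinearEquiv.neg ℝ)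

@[simp] theorem reflect_apply (z : Space) : reflect z = (z.1, -z.2) := rfl

theorem image_reflect_image_reflect (S : Set Space) : reflect '' (reflect '' S) = S := by
  rw [image_image]
  simp

/-- The mirror image of a polygonal knot. -/
def PolygonalKnot.mirror (K : PolygonalKnot) : PolygonalKnot where
  n := K.n
  n_pos := K.n_pos
  vertex i := reflect (K.vertex i)
  periodic i := by rw [K.periodic]
  simple := by
    intro s hs t ht e
    refine K.simple hs ht (reflect.injective ?_)
    simpa only [ClosedPolygon.path, AffineMap.lineMap_apply_module, map_add, map_smul] using e

namespace PolygonalKnot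

theorem mirror_path (K : PolygonalKnot) (s : ℝ) : K.mirror.path s = reflect (K.path s) := by
  simp only [ClosedPolygon.path, AffineMap.lineMap_apply_module, map_add, map_smul]
  rfl

theorem mirror_carrier (K : PolygonalKnot) : K.mirror.carrier = reflect '' K.carrier := by
  rw [ClosedPolygon.carrier, ClosedPolygon.carrier, ← range_comp]
  exact congrArg range (funext K.mirror_path)

theorem mirror_crossings (K : PolygonalKnot) : K.mirror.crossings = K.crossings := by
  ext x
  simp only [crossings, mirror_path, Set.mem_ofPred_eq, reflect.injective.ne_iff]
  rfl

end PolygonalKnot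

theorem DeltaMove.reflect {S S' : Set Space} (h : DeltaMove S S') :
    DeltaMove (reflect '' S) (reflect '' S') := by
  obtain ⟨⟨K, rfl⟩, ⟨K', hK'⟩, A, B, C, h1, h2, h3⟩ := h
  have hseg : ∀ x y : Space, _root_.reflect '' segment ℝ x y =
      segment ℝ (_root_.reflect x) (_root_.reflect y) := fun x y =>
    image_segment ℝ (_root_.reflect : Space →ₗ[ℝ] Space).toAffineMap x y
  refine ⟨⟨K.mirror, K.mirror_carrier⟩, ⟨K'.mirror, by rw [K'.mirror_carrier, hK']⟩,
    _root_.reflect A, _root_.reflect B, _root_.reflect C, ?_, ?_, ?_⟩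
  · have := h1.map' (_root_.reflect : Space →ₗ[ℝ] Space).toAffineMap _root_.reflect.injective
    have e : ![_root_.reflect A, _root_.reflect B, _root_.reflect C] =
        (_root_.reflect : Space →ₗ[ℝ] Space).toAffineMap ∘ ![A, B, C] := by
      funext i
      fin_cases i <;> rfl
    rwa [e]
  · have := (_root_.reflect : Space →ₗ[ℝ] Space).image_convexHull {A, B, C}
    rw [image_insert_eq, image_pair] at this
    change _root_.reflect '' _ = _ at this
    rw [← hseg, ← h2, image_inter _root_.reflect.injective, this]
    rfl
  · rw [h3, image_union, image_sdiff _root_.reflect.injective, image_union, hseg, hseg, hseg]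

theorem eqvGen_reflect {S S' : Set Space} (h : Relation.EqvGen DeltaMove S S') :
    Relation.EqvGen DeltaMove (reflect '' S) (reflect '' S') := by
  induction h with
  | rel _ _ h => exact .rel _ _ h.reflect
  | refl _ => exact .refl _
  | symm _ _ _ ih => exact .symm _ _ ih
  | trans _ _ _ _ _ ih1 ih2 => exact .trans _ _ _ ih1 ih2

namespace KnotDiagram

/-- The diagram with all its crossings changed. -/
def mirror (D : KnotDiagram) : KnotDiagram where
  toPolygonalKnot := D.toPolygonalKnot.mirror
  regular := by
    constructor
    · rw [PolygonalKnot.mirror_crossings]; exact D.regular.finite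
    · intro s t u
      simp only [PolygonalKnot.mirror_path, reflect_apply]
      intro h1 h2
      rcases D.regular.double s t u h1 h2 with h | h | h <;> simp [h]
    · intro i
      rw [PolygonalKnot.mirror_crossings]
      exact D.regular.vertex_not_mem i

variable (D : KnotDiagram)

theorem mirror_path (s : ℝ) : D.mirror.path s = reflect (D.path s) :=
  D.toPolygonalKnot.mirror_path s

theorem mirror_carrier : D.mirror.carrier = reflect '' D.carrier :=
  D.toPolygonalKnot.mirror_carrier

theorem mirror_crossings : D.mirror.crossings = D.crossings :=
  D.toPolygonalKnot.mirror_crossings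

theorem mirror_shadow : D.mirror.shadow = D.shadow := by
  rw [shadow, mirror_carrier, image_image]
  rfl

theorem mirror_isOverpass (s : ℝ) : D.mirror.IsOverpass s ↔ D.IsUnderpass s := by
  simp only [IsOverpass, IsUnderpass, mirror_path, reflect_apply, neg_lt_neg_iff]

theorem mirror_isUnderpass (s : ℝ) : D.mirror.IsUnderpass s ↔ D.IsOverpass s := by
  simp only [IsOverpass, IsUnderpass, mirror_path, reflect_apply, neg_lt_neg_iff]

variable {D}

theorem HasBridge.mirror {l : ℕ} (h : D.HasBridge l) : D.mirror.HasBridge l := by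
  obtain ⟨a, b, h1, h2, h3⟩ := h
  refine ⟨a, b, h1, h2, ?_⟩
  simp only [mirror_isOverpass, mirror_isUnderpass]
  exact h3.symm

theorem IsComposite.of_mirror (h : D.mirror.IsComposite) : D.IsComposite := by
  simpa only [IsComposite, mirror_crossings, mirror_shadow] using h

end KnotDiagram

end Mirror

/-! ### Minimal diagrams with a long bridge -/

section Minimal

open Set Topology Filter

namespace KnotDiagram

variable {D : KnotDiagram}

theorem crossing_of_isOverpass {s : ℝ} (h : D.IsOverpass s) : D.plane.path s ∈ D.crossings := by
  obtain ⟨t, e, ht⟩ := h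
  exact ⟨t, s, fun e' => by rw [e'] at ht; exact ht.false, by rw [e, plane_path],
    (D.plane_path s).symm⟩

theorem crossing_of_isUnderpass {s : ℝ} (h : D.IsUnderpass s) : D.plane.path s ∈ D.crossings := by
  obtain ⟨t, e, ht⟩ := h
  exact ⟨t, s, fun e' => by rw [e'] at ht; exact ht.false, by rw [e, plane_path],
    (D.plane_path s).symm⟩

theorem eventually_notMem_crossings (D : KnotDiagram) (t : ℝ) : ∀ᶠ s in 𝓝[≠] (0 : ℝ),
    Int.fract (t + s) ≠ 0 ∧ D.plane.path (t + s) ∉ D.crossings := by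
  by_cases hf : Int.fract t = 0
  · obtain ⟨i, rfl⟩ : ∃ i : ℤ, t = i := ⟨⌊t⌋, by rwa [Int.fract, sub_eq_zero] at hf⟩
    have hcont : Continuous fun s : ℝ => D.plane.path (i + s) :=
      D.plane.continuous_path.comp (by fun_prop)
    have hlim := hcont.tendsto 0
    rw [add_zero, D.plane.path_intCast] at hlim
    filter_upwards [self_mem_nhdsWithin, mem_nhdsWithin_of_mem_nhds (hlim.eventually
      (D.regular.finite.isClosed.isOpen_compl.mem_nhds (D.regular.vertex_not_mem i))),
      mem_nhdsWithin_of_mem_nhds (Ioo_mem_nhds (by norm_num : (-1 : ℝ) < 0) one_pos)]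
      with s h0 h1 h2
    refine ⟨fun h3 => h0 ?_, h1⟩
    rw [Int.fract_intCast_add] at h3
    rcases lt_or_ge s 0 with h4 | h4
    · have : Int.fract s = s + 1 := by
        rw [Int.fract_eq_iff]
        exact ⟨by linarith [h2.1], by linarith, -1, by push_cast; ring⟩
      linarith [h2.1]
    · rwa [Int.fract_eq_self.2 ⟨h4, h2.2⟩] at h3
  · filter_upwards [eventually_regular (D := D) hf] with s hs
    exact ⟨hs.2.1, hs.2.2.2⟩

/-- The ends of a bridge can be moved away from the vertices and the crossings. -/
theorem exists_isOverBridge {a b : ℝ} {l : ℕ} (hab : a ≤ b) (hba : b < a + D.n)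
    (hu : ∀ s ∈ Icc a b, ¬ D.IsUnderpass s)
    (hl : {s | s ∈ Icc a b ∧ D.IsOverpass s}.encard = l) :
    ∃ a' b', D.IsOverBridge a' b' l := by
  obtain ⟨ρ, hρ, hb⟩ := Metric.eventually_nhds_iff_ball.1
    ((eventually_nhdsWithin_iff.1 (D.eventually_notMem_crossings a)).and
      (eventually_nhdsWithin_iff.1 (D.eventually_notMem_crossings b)))
  obtain ⟨δ, hδ0, hδ⟩ := exists_between
    (lt_min hρ (show 0 < (a + D.n - b) / 2 by linarith))
  rw [lt_min_iff] at hδ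
  have hleft : ∀ s ∈ Ico (a - δ) a, Int.fract s ≠ 0 ∧ D.plane.path s ∉ D.crossings := by
    intro s hs
    have := (hb (s - a) (by
      rw [Metric.mem_ball, Real.dist_eq, sub_zero, abs_of_neg (by linarith [hs.2])]
      linarith [hs.1])).1 (by have := hs.2; intro e; rw [mem_singleton_iff] at e; linarith)
    rwa [add_sub_cancel] at this
  have hright : ∀ s ∈ Ioc b (b + δ), Int.fract s ≠ 0 ∧ D.plane.path s ∉ D.crossings := by
    intro s hs
    have := (hb (s - b) (by
      rw [Metric.mem_ball, Real.dist_eq, sub_zero, abs_of_pos (by linarith [hs.1])]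
      linarith [hs.2])).2 (by have := hs.1; intro e; rw [mem_singleton_iff] at e; linarith)
    rwa [add_sub_cancel] at this
  have hmem : ∀ s ∈ Icc (a - δ) (b + δ), D.plane.path s ∈ D.crossings → s ∈ Icc a b := by
    intro s hs hc
    constructor
    · by_contra h0
      exact (hleft s ⟨hs.1, not_le.1 h0⟩).2 hc
    · by_contra h0
      exact (hright s ⟨not_le.1 h0, hs.2⟩).2 hc
  have ha := hleft (a - δ) ⟨le_rfl, by linarith⟩
  have hb' := hright (b + δ) ⟨by linarith, le_rfl⟩
  refine ⟨a - δ, b + δ, by linarith, by linarith [hδ.2], ha.2, hb'.2, ha.1, hb'.1,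
    fun s hs hs' => hu s (hmem s hs (crossing_of_isUnderpass hs')) hs', ?_⟩
  rw [← hl]
  congr 1
  ext s
  refine and_congr_left fun hs => ⟨fun hs' => hmem s hs' (crossing_of_isOverpass hs), fun hs' => ?_⟩
  exact ⟨by linarith [hs'.1], by linarith [hs'.2]⟩

theorem IsOverBridge.isComposite_of_minimal {a b : ℝ} {l k : ℕ} (h : D.IsOverBridge a b l)
    (hc : D.crossingNumber = k + l)
    (hmin : ∀ (D' : KnotDiagram) (l' : ℕ), Relation.EqvGen DeltaMove D.carrier D'.carrier →
      D'.HasBridge l' → D'.crossingNumber = k + l' → D.crossingNumber ≤ D'.crossingNumber)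
    (hl : 4 ≤ l) (hk : k ≤ l + 2) : D.IsComposite := by
  have hr : (D.restCrossings a b).ncard = k := by
    have := h.crossingNumber_eq
    omega
  refine h.isComposite (fun i x hx hseg => ?_) hl (by omega)
  obtain ⟨D', l', e1, e2, e3, e4⟩ := h.exists_reroute_of_reach hx hseg
  have := hmin D' l' e1 e2 (by omega)
  omega

/-- In a diagram which is minimal in its knot type among those with the same number of crossings
outside of a bridge, a long bridge forces a decomposition. -/
theorem HasBridge.isComposite_of_minimal {l k : ℕ} (h : D.HasBridge l)
    (hc : D.crossingNumber = k + l)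
    (hmin : ∀ (D' : KnotDiagram) (l' : ℕ), Relation.EqvGen DeltaMove D.carrier D'.carrier →
      D'.HasBridge l' → D'.crossingNumber = k + l' → D.crossingNumber ≤ D'.crossingNumber)
    (hl : 4 ≤ l) (hk : k ≤ l + 2) : D.IsComposite := by
  obtain ⟨a, b, hab, hba, ⟨h1, h2⟩ | ⟨h1, h2⟩⟩ := h
  · obtain ⟨a', b', h'⟩ := exists_isOverBridge hab hba h1 h2
    exact h'.isComposite_of_minimal hc hmin hl hk
  · obtain ⟨a', b', h'⟩ := exists_isOverBridge (D := D.mirror) (l := l) hab hba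
      (by simpa only [mirror_isUnderpass] using h1) (by simpa only [mirror_isOverpass] using h2)
    have hcm : ∀ D : KnotDiagram, D.mirror.crossingNumber = D.crossingNumber := fun D => by
      rw [crossingNumber, crossingNumber, mirror_crossings]
    refine (h'.isComposite_of_minimal (k := k) (by rw [hcm, hc]) ?_ hl hk).of_mirror
    intro D' l' e1 e2 e3
    rw [hcm, ← hcm D']
    refine hmin D'.mirror l' ?_ e2.mirror (by rw [hcm, e3])
    have := eqvGen_reflect e1
    rwa [mirror_carrier, image_reflect_image_reflect, ← mirror_carrier] at this

end KnotDiagram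

end Minimal

theorem mainTheorem2 (K : PolygonalKnot) (k l : ℕ) (D : KnotDiagram)
    (hK : D.IsDiagramOf K) (hprime : D.IsPrime)
    (hbridge : D.HasBridge l) (hl : (l : ℤ) = (D.crossingNumber : ℤ) - (k : ℤ))
    (hmin : ∀ (D' : KnotDiagram) (l' : ℕ), D'.IsDiagramOf K → D'.HasBridge l' →
      (l' : ℤ) = (D'.crossingNumber : ℤ) - (k : ℤ) → D.crossingNumber ≤ D'.crossingNumber) :
    (l : ℤ) ≤ max 3 ((k : ℤ) - 3) ∧
      (D.crossingNumber : ℤ) ≤ (k : ℤ) + max 3 ((k : ℤ) - 3) := by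
  have key : ¬ (4 ≤ l ∧ k ≤ l + 2) := by
    rintro ⟨h4, hk⟩
    refine hprime (hbridge.isComposite_of_minimal (k := k) (by omega) ?_ h4 hk)
    intro D' l' h1 h2 h3
    exact hmin D' l' (.trans _ _ _ (.symm _ _ h1) hK) h2 (by omega)
  omega
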